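/- Let $C$ be a complete algebraically closed non-archimedean field of mixed characteristic $(0,p)$, with valuation ring $\mathcal O_C$ and maximal ideal $\mathfrak m$. Let $l\ge 0$, $n_1,\dots,n_l\ge 0$, let $\varpi_1,\dots,\varpi_l\in\mathcal O_C\setminus\{0\}$ with chosen compatible systems of roots $\varpi_i^{1/p^m}\in\mathcal O_C$, and put $d=\sum_i n_i$. For $m\ge 0$ let $$R_m^+=\mathcal O_C\langle t_{i,j}^{1/p^m} : 1\le i\le l,\ 0\le j\le n_i\rangle\Big/\Big(\textstyle\prod_{j=0}^{n_i}t_{i,j}^{1/p^m}-\varpi_i^{1/p^m}\Big)_{1\le i\le l},$$ let $R^+=R_0^+$ (so that $\operatorname{Spf}R^+$ is a model polystable formal $\mathcal O_C$-scheme), and let $R_\infty^+$ be the $p$-adic completion of $\operatorname{colim}_m R_m^+$. The profinite group $$\Delta=\Big\{(\varepsilon_{i,j}^{(m)}) : \varepsilon_{i,j}^{(m)}\in\mu_{p^m}(C),\ (\varepsilon_{i,j}^{(m+1)})^p=\varepsilon_{i,j}^{(m)},\ \textstyle\prod_j\varepsilon_{i,j}^{(m)}=1\Big\}\simeq\mathbf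 Z_p(1)^d$$ acts on $R_\infty^+$ by $t_{i,j}^{1/p^m}\mapsto\varepsilon_{i,j}^{(m)}t_{i,j}^{1/p^m}$, and trivially on $R^+$. Let $\mathbf R\Gamma_{cont}(\Delta,-)$ denote continuous cohomology with discrete coefficients, computed by continuous cochains. (a) There is a unique $R^+/p$-linear $\Delta$-invariant map $\mathrm{pr}\colon R_\infty^+/p\to R^+/p$ such that $\mathrm{pr}(1)=1$ and $\mathrm{pr}\big(\prod t_{i,j}^{e_{i,j}/p^m}\big)=0$ for all $m\ge 0$ and $e_{i,j}\in\mathbf Z_{\ge 0}$ such that for some $i$ the $e_{i,j}$ are not all congruent modulo $p^m$ (the projection onto the part of trivial weight). (b) $H^i_{cont}(\Delta,R^+/p)=0$ for $i>d$, and there is a map of complexes of $R^+/p$-modules from the continuous cochains $\mathbf R\Gamma_{cont}(\Delta,R^+/p)$ to $R^+/p[-d]$ that induces an isomorphism $H^d_{cont}(\Delta,R^+/p)\simeq R^+/p$. (c) For every map as in (b), let $t\colon\mathbf R\Gamma_{cont}(\Delta,R_\infty^+/p)\xrightarrow{\mathrm{pr}}\mathbf R\Gamma_{cont}(\Delta,R^+/p)\to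 R^+/p[-d]$ be the resulting trace. Then the pairing $$\mathbf R\Gamma_{cont}(\Delta,R_\infty^+/p)\otimes^L_{R^+/p}\mathbf R\Gamma_{cont}(\Delta,R_\infty^+/p)\xrightarrow{\ \cup\ }\mathbf R\Gamma_{cont}(\Delta,R_\infty^+/p)\xrightarrow{\ t\ }R^+/p[-d]$$ is almost perfect: both induced duality maps $$\mathbf R\Gamma_{cont}(\Delta,R_\infty^+/p)\to\mathbf R\mathrm{Hom}_{R^+/p}\big(\mathbf R\Gamma_{cont}(\Delta,R_\infty^+/p),R^+/p[-d]\big)$$ have, on cohomology in every degree, kernel and cokernel annihilated by $\mathfrak m$. If $d>0$, the pairing is not perfect, i.e. the duality maps are not both isomorphisms. -/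

import Mathlib

universe w u

namespace PolystableDuality

open CategoryTheory

noncomputable section

section Cochains

variable {k : Type u} [CommRing k] {G : Type u} [Group G] [TopologicalSpace G]
  {A : Type u} [CommRing A] [Algebra k A]

/-- Homogeneous continuous `n`-cochains of `G` with values in `A`, where `A` is discrete (so that
continuous means locally constant) and `G` acts on `A` through `ρ`. -/
def cochains (ρ : G →* (A →ₐ[k] A)) (n : ℕ) : Submodule k ((Fin (n + 1) → G) → A) where
  carrier := {f | IsLocallyConstant f ∧ ∀ (g : G) (x : Fin (n + 1) → G),
    f (fun s => g * x s) = ρ g (f x)}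
  add_mem' {a b} ha hb := ⟨ha.1.add hb.1, fun g x => by
    simp only [Pi.add_apply, map_add, ha.2 g x, hb.2 g x]⟩
  zero_mem' := ⟨IsLocallyConstant.const 0, fun g x => by simp⟩
  smul_mem' c f hf := ⟨hf.1.comp (fun a => c • a), fun g x => by
    simp only [Pi.smul_apply, map_smul, hf.2 g x]⟩

/-- The alternating sum over the faces, on arbitrary functions. -/
def preD (k A : Type u) (G : Type u) [CommRing k] [CommRing A] [Algebra k A] (n : ℕ) :
    ((Fin (n + 1) → G) → A) →ₗ[k] ((Fin (n + 2) → G) → A) where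
  toFun f x := ∑ i : Fin (n + 2), (-1 : A) ^ (i : ℕ) * f (fun s => x (i.succAbove s))
  map_add' f g := by
    funext x
    simp only [Pi.add_apply, mul_add, Finset.sum_add_distrib]
  map_smul' c f := by
    funext x
    simp only [Pi.smul_apply, RingHom.id_apply, Finset.smul_sum, mul_smul_comm]

lemma preD_preD {H : Type u} (n : ℕ) (f : (Fin (n + 1) → H) → A) :
    preD k A H (n + 1) (preD k A H n f) = 0 := by
  funext x
  change ∑ j : Fin (n + 3), (-1 : A) ^ (j : ℕ) * (∑ i : Fin (n + 2), (-1 : A) ^ (i : ℕ) *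
    f (fun s => x (j.succAbove (i.succAbove s)))) = 0
  simp only [Finset.mul_sum]
  rw [← Finset.sum_product']
  refine Finset.sum_involution (fun q _ => (q.1.succAbove q.2, q.2.predAbove q.1)) ?_ ?_ ?_ ?_
  · rintro ⟨j, i⟩ -
    dsimp only
    rw [← mul_assoc, ← mul_assoc, ← pow_add, ← pow_add, Fin.neg_one_pow_succAbove_add_predAbove]
    have : (fun s => x ((j.succAbove i).succAbove ((i.predAbove j).succAbove s)))
        = (fun s => x (j.succAbove (i.succAbove s))) := by
      funext s
      rw [Fin.succAbove_succAbove_succAbove_predAbove]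
    rw [this]
    ring
  · rintro ⟨j, i⟩ - - h
    exact Fin.succAbove_ne j i (congrArg Prod.fst h)
  · intros; exact Finset.mem_univ _
  · rintro ⟨j, i⟩ -
    dsimp only
    rw [Fin.succAbove_succAbove_predAbove]
    congr 1
    exact Fin.predAbove_predAbove_succAbove j i

/-- The differential of the homogeneous cochain complex. -/
def cochainD (ρ : G →* (A →ₐ[k] A)) (n : ℕ) : cochains ρ n →ₗ[k] cochains ρ (n + 1) :=
  (preD k A G n).restrict (by
    intro f hf
    refine ⟨?_, fun g x => ?_⟩
    · have : preD k A G n f = ∑ i : Fin (n + 2),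
          fun x : Fin (n + 2) → G => (-1 : A) ^ (i : ℕ) * f (fun s => x (i.succAbove s)) := by
        funext x
        rw [Finset.sum_apply]
        rfl
      rw [this]
      refine Finset.sum_induction _ IsLocallyConstant (fun _ _ ha hb => ha.add hb)
        (IsLocallyConstant.const 0) (fun i _ => ?_)
      exact (hf.1.comp_continuous (by fun_prop :
        Continuous (fun (x : Fin (n + 2) → G) s => x (i.succAbove s)))).comp _
    · change ∑ i : Fin (n + 2), _ = ρ g (∑ i : Fin (n + 2), _)
      rw [map_sum]
      refine Finset.sum_congr rfl fun i _ => ?_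
      rw [map_mul, map_pow, map_neg, map_one, ← hf.2 g])

lemma cochainD_apply (ρ : G →* (A →ₐ[k] A)) (n : ℕ) (f : cochains ρ n) (x : Fin (n + 2) → G) :
    (cochainD ρ n f).1 x = ∑ i : Fin (n + 2), (-1 : A) ^ (i : ℕ) * f.1 (fun s => x (i.succAbove s)) :=
  rfl

lemma cochainD_cochainD (ρ : G →* (A →ₐ[k] A)) (n : ℕ) (f : cochains ρ n) :
    cochainD ρ (n + 1) (cochainD ρ n f) = 0 :=
  Subtype.ext (preD_preD (k := k) n f.1)

/-- The cup product of homogeneous cochains: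
`(x ∪ y)(g₀, …, g_{a+b}) = x(g₀, …, g_a) · y(g_a, …, g_{a+b})`. -/
def cup (ρ : G →* (A →ₐ[k] A)) (a b c : ℕ) (h : a + b = c) :
    cochains ρ a →ₗ[k] cochains ρ b →ₗ[k] cochains ρ c :=
  LinearMap.mk₂ k
    (fun x y => ⟨fun g => x.1 (fun s => g ⟨s, by omega⟩) * y.1 (fun s => g ⟨a + s, by omega⟩),
      (x.2.1.comp_continuous (by fun_prop)).mul (y.2.1.comp_continuous (by fun_prop)),
      fun g z => by
        rw [map_mul, ← x.2.2 g, ← y.2.2 g]⟩)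
    (fun x x' y => Subtype.ext (funext fun g => add_mul _ _ _))
    (fun r x y => Subtype.ext (funext fun g => smul_mul_assoc _ _ _))
    (fun x y y' => Subtype.ext (funext fun g => mul_add _ _ _))
    (fun r x y => Subtype.ext (funext fun g => mul_smul_comm _ _ _))

lemma cup_apply (ρ : G →* (A →ₐ[k] A)) (a b c : ℕ) (h : a + b = c) (x : cochains ρ a)
    (y : cochains ρ b) (g : Fin (c + 1) → G) :
    (cup ρ a b c h x y).1 g =
      x.1 (fun s => g ⟨s, by omega⟩) * y.1 (fun s => g ⟨a + s, by omega⟩) := rfl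

/-- The Leibniz rule. -/
lemma cochainD_cup (ρ : G →* (A →ₐ[k] A)) (a b c : ℕ) (h : a + b = c) (x : cochains ρ a)
    (y : cochains ρ b) :
    cochainD ρ c (cup ρ a b c h x y) =
      cup ρ (a + 1) b (c + 1) (by omega) (cochainD ρ a x) y +
        (-1 : k) ^ a • cup ρ a (b + 1) (c + 1) (by omega) x (cochainD ρ b y) := by
  subst h
  refine Subtype.ext (funext fun g => ?_)
  rw [Submodule.coe_add, Submodule.coe_smul, Pi.add_apply, Pi.smul_apply]
  simp only [cochainD_apply, cup_apply]
  -- extend `g` to a sequence, and write all sums over ranges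
  obtain ⟨γ, rfl⟩ : ∃ γ : ℕ → G, g = fun s : Fin (a + b + 2) => γ s :=
    ⟨fun m => if hm : m < a + b + 2 then g ⟨m, hm⟩ else 1, by funext s; simp [s.2]⟩
  let face : ℕ → (ℕ → G) → ℕ → G := fun i γ m => if m < i then γ m else γ (m + 1)
  let X : (ℕ → G) → A := fun γ => x.1 (fun s => γ s)
  let Y : (ℕ → G) → A := fun γ => y.1 (fun s => γ s)
  have hface : ∀ (n : ℕ) (i : Fin (n + 1)) (s : Fin n) (γ : ℕ → G),
      γ (i.succAbove s : Fin (n + 1)) = face i γ s := by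
    intro n i s γ
    by_cases hs : (s : ℕ) < i
    · simp [face, hs, Fin.succAbove_of_castSucc_lt i s (by simpa [Fin.lt_def] using hs)]
    · simp [face, hs, Fin.succAbove_of_le_castSucc i s (by simpa [Fin.le_def] using hs)]
  have e1 : ∀ i : Fin (a + b + 2),
      (x.1 (fun s => γ ((i.succAbove ⟨s, by omega⟩ : Fin (a + b + 2)) : ℕ)) *
        y.1 (fun s => γ ((i.succAbove ⟨a + s, by omega⟩ : Fin (a + b + 2)) : ℕ)))
      = X (face i γ) * Y (fun m => face i γ (a + m)) := by
    intro i
    simp only [X, Y, hface]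
  have e2 : ∀ i : Fin (a + 2), x.1 (fun s => γ ((i.succAbove s : Fin (a + 2)) : ℕ))
      = X (face i γ) := by
    intro i
    simp only [X, hface]
  have e3 : ∀ i : Fin (b + 2), y.1 (fun s => γ (a + (i.succAbove s : Fin (b + 2))))
      = Y (face i (fun m => γ (a + m))) := by
    intro i
    simp only [Y]
    refine congrArg _ (funext fun s => ?_)
    exact hface (b + 1) i s (fun m => γ (a + m))
  simp only [e1, e2, e3]
  change _ = _ * Y (fun m => γ (a + 1 + m)) + (-1 : k) ^ a • (X γ * _)
  rw [Fin.sum_univ_eq_sum_range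
      (fun i => (-1 : A) ^ i * (X (face i γ) * Y (fun m => face i γ (a + m)))),
    Fin.sum_univ_eq_sum_range (fun i => (-1 : A) ^ i * X (face i γ)),
    Fin.sum_univ_eq_sum_range (fun i => (-1 : A) ^ i * Y (face i (fun m => γ (a + m))))]
  have hX : ∀ i, a + 1 ≤ i → X (face i γ) = X γ := by
    intro i hi
    simp only [X]
    refine congrArg _ (funext fun s => ?_)
    have : (s : ℕ) < i := by omega
    simp [face, this]
  have hY : ∀ i, i ≤ a → Y (fun m => face i γ (a + m)) = Y (fun m => γ (a + 1 + m)) := by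
    intro i hi
    simp only [Y]
    refine congrArg _ (funext fun s => ?_)
    have : ¬ (a + (s : ℕ) < i) := by omega
    simp only [face, this, if_false]
    congr 1
    omega
  have hY' : ∀ i, Y (fun m => face (a + i) γ (a + m)) = Y (face i (fun m => γ (a + m))) := by
    intro i
    simp only [Y, face]
    refine congrArg _ (funext fun s => ?_)
    simp only [add_lt_add_iff_left, add_assoc]
  have hY0 : Y (face 0 (fun m => γ (a + m))) = Y (fun m => γ (a + 1 + m)) := by
    rw [← hY', add_zero, hY a le_rfl]
  rw [show a + b + 2 = (a + 1) + (b + 1) by ring, Finset.sum_range_add,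
    Finset.sum_range_succ (fun i => (-1 : A) ^ i * X (face i γ)) (a + 1),
    Finset.sum_range_succ' (fun i => (-1 : A) ^ i * Y (face i (fun m => γ (a + m)))) (b + 1),
    hY0, hX (a + 1) le_rfl]
  have s1 : ∑ i ∈ Finset.range (a + 1),
      (-1 : A) ^ i * (X (face i γ) * Y (fun m => face i γ (a + m))) =
      (∑ i ∈ Finset.range (a + 1), (-1 : A) ^ i * X (face i γ)) * Y (fun m => γ (a + 1 + m)) := by
    rw [Finset.sum_mul]
    refine Finset.sum_congr rfl fun i hi => ?_
    rw [hY i (by have := Finset.mem_range.1 hi; omega), mul_assoc]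
  have s2 : ∑ i ∈ Finset.range (b + 1), (-1 : A) ^ (a + 1 + i) *
        (X (face (a + 1 + i) γ) * Y (fun m => face (a + 1 + i) γ (a + m))) =
      (-1 : A) ^ a * (X γ * ∑ i ∈ Finset.range (b + 1),
        (-1 : A) ^ (i + 1) * Y (face (i + 1) (fun m => γ (a + m)))) := by
    rw [Finset.mul_sum, Finset.mul_sum]
    refine Finset.sum_congr rfl fun i _ => ?_
    rw [hX _ (by omega), show a + 1 + i = a + (i + 1) by ring, hY' (i + 1), pow_add]
    ring
  rw [s1, s2, Algebra.smul_def, map_pow, map_neg, map_one]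
  ring


/-- The continuous cochains in degree `n : ℤ` (zero in negative degrees). -/
def cochainObj (ρ : G →* (A →ₐ[k] A)) : ℤ → ModuleCat.{u} k
  | .ofNat n => ModuleCat.of k (cochains ρ n)
  | .negSucc _ => ModuleCat.of k PUnit.{u + 1}

/-- The differential in all integral degrees. -/
def cochainObjD (ρ : G →* (A →ₐ[k] A)) : ∀ n : ℤ, cochainObj ρ n ⟶ cochainObj ρ (n + 1)
  | .ofNat n => ModuleCat.ofHom (cochainD ρ n)
  | .negSucc _ => 0

/-- The complex of homogeneous continuous cochains of `G` with values in the discrete `G`-module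
`A`, as a complex of `k`-modules; it represents `RΓ_cont(G, A)`. -/
def contComplex (ρ : G →* (A →ₐ[k] A)) : CochainComplex (ModuleCat.{u} k) ℤ :=
  CochainComplex.of (cochainObj ρ) (cochainObjD ρ) (by
    rintro (n | n)
    · exact ModuleCat.hom_ext (LinearMap.ext fun f => cochainD_cochainD ρ n f)
    · exact Limits.zero_comp)

lemma contComplex_d (ρ : G →* (A →ₐ[k] A)) (n : ℤ) :
    (contComplex ρ).d n (n + 1) = cochainObjD ρ n :=
  CochainComplex.of_d _ _ n

/-- The map on cochains induced by an equivariant linear map of coefficients. -/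
def cochainsMap {B : Type u} [CommRing B] [Algebra k B] (ρ : G →* (A →ₐ[k] A))
    (σ : G →* (B →ₐ[k] B)) (φ : A →ₗ[k] B) (hφ : ∀ g a, φ (ρ g a) = σ g (φ a)) (n : ℕ) :
    cochains ρ n →ₗ[k] cochains σ n where
  toFun f := ⟨fun x => φ (f.1 x), f.2.1.comp φ, fun g x => by
    change φ (f.1 _) = _
    rw [f.2.2 g x, hφ]⟩
  map_add' f g := Subtype.ext (funext fun x => map_add φ _ _)
  map_smul' c f := Subtype.ext (funext fun x => map_smul φ _ _)

/-- The map on cochains in all integral degrees. -/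
def cochainObjMap {B : Type u} [CommRing B] [Algebra k B] (ρ : G →* (A →ₐ[k] A))
    (σ : G →* (B →ₐ[k] B)) (φ : A →ₗ[k] B) (hφ : ∀ g a, φ (ρ g a) = σ g (φ a)) :
    ∀ n : ℤ, cochainObj ρ n ⟶ cochainObj σ n
  | .ofNat n => ModuleCat.ofHom (cochainsMap ρ σ φ hφ n)
  | .negSucc _ => 0

/-- The morphism of cochain complexes induced by an equivariant linear map of coefficients. -/
def contComplexMap {B : Type u} [CommRing B] [Algebra k B] (ρ : G →* (A →ₐ[k] A))
    (σ : G →* (B →ₐ[k] B)) (φ : A →ₗ[k] B) (hφ : ∀ g a, φ (ρ g a) = σ g (φ a)) :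
    contComplex ρ ⟶ contComplex σ where
  f := cochainObjMap ρ σ φ hφ
  comm' := by
    rintro i _ rfl
    rw [contComplex_d, contComplex_d]
    rcases i with n | n
    · refine ModuleCat.hom_ext (LinearMap.ext fun f => Subtype.ext (funext fun x => ?_))
      change ∑ i : Fin (n + 2), (-1 : B) ^ (i : ℕ) * φ (f.1 fun s => x (i.succAbove s)) =
        φ (∑ i : Fin (n + 2), (-1 : A) ^ (i : ℕ) * f.1 fun s => x (i.succAbove s))
      rw [map_sum]
      refine Finset.sum_congr rfl fun i _ => ?_
      rcases Nat.even_or_odd (i : ℕ) with h | h <;> simp [h.neg_one_pow]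
    · exact Limits.zero_comp.trans Limits.zero_comp.symm

/-- The cup product in all integral degrees. -/
def cupZ (ρ : G →* (A →ₐ[k] A)) : ∀ i j n : ℤ, i + j = n →
    cochainObj ρ i →ₗ[k] cochainObj ρ j →ₗ[k] cochainObj ρ n
  | .ofNat a, .ofNat b, .ofNat c, h => cup ρ a b c (Int.ofNat.inj h)
  | _, _, _, _ => 0

lemma cochainObj_neg_eq_zero (ρ : G →* (A →ₐ[k] A)) (m : ℕ) (x : cochainObj ρ (.negSucc m)) :
    x = 0 := rfl

lemma cochainObjD_cupZ (ρ : G →* (A →ₐ[k] A)) (i j n : ℤ) (h : i + j = n)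
    (x : cochainObj ρ i) (y : cochainObj ρ j) :
    cochainObjD ρ n (cupZ ρ i j n h x y) =
      cupZ ρ (i + 1) j (n + 1) (by omega) (cochainObjD ρ i x) y +
        i.negOnePow • cupZ ρ i (j + 1) (n + 1) (by omega) x (cochainObjD ρ j y) := by
  rcases i with a | a
  · rcases j with b | b
    · obtain rfl : n = Int.ofNat (a + b) := h.symm
      have key := cochainD_cup ρ a b (a + b) rfl x y
      have hs : ∀ z : cochainObj ρ (Int.ofNat (a + b) + 1),
          (Int.ofNat a).negOnePow • z = (-1 : k) ^ a • z := by
        intro z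
        rcases Nat.even_or_odd a with ha | ha
        · rw [ha.neg_one_pow, one_smul, Int.negOnePow_even _ (by simpa using ha), one_smul]
        · rw [ha.neg_one_pow, neg_smul, one_smul, Int.negOnePow_odd _ (by simpa using ha),
            Units.neg_smul, one_smul]
      rw [hs]
      exact key
    · rw [cochainObj_neg_eq_zero ρ b y]
      simp only [map_zero, smul_zero, add_zero]
  · rw [cochainObj_neg_eq_zero ρ a x]
    simp only [map_zero, LinearMap.zero_apply, smul_zero, add_zero]

end Cochains

section Pairings

variable {k : Type u} [CommRing k]

/-- The cocycles of degree `i`. -/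
def cocycles (K : CochainComplex (ModuleCat.{u} k) ℤ) (i : ℤ) :
    Submodule k (K.X i) := LinearMap.ker (K.d i (i + 1)).hom

/-- The `i`-th cohomology module: cocycles modulo coboundaries. -/
abbrev cohomology (K : CochainComplex (ModuleCat.{u} k) ℤ) (i : ℤ) :
    Type u :=
  cocycles K i ⧸ (LinearMap.range (K.d (i - 1) i).hom).comap (cocycles K i).subtype

/-- A pairing `K ⊗ L → N[-d]` of complexes of `k`-modules, given in components. -/
structure ChainPairing (K L : CochainComplex (ModuleCat.{u} k) ℤ) (N : ModuleCat.{u} k)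
    (d : ℤ) where
  /-- The component on `Kⁱ ⊗ Lʲ`. -/
  comp : ∀ i j : ℤ, i + j = d → K.X i →ₗ[k] L.X j →ₗ[k] N
  /-- Compatibility with differentials: the pairing vanishes on
  `∂(x ⊗ y) = ∂x ⊗ y + (-1)ⁱ x ⊗ ∂y`. -/
  comp_d : ∀ (i j : ℤ) (h : i + 1 + j = d) (x : K.X i) (y : L.X j),
    comp (i + 1) j h (K.d i (i + 1) x) y +
      i.negOnePow • comp i (j + 1) (by omega) x (L.d j (j + 1) y) = 0

namespace ChainPairing

variable {K L : CochainComplex (ModuleCat.{u} k) ℤ} {N : ModuleCat.{u} k} {d : ℤ}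

/-- Interchanging the two variables, with the usual sign `(-1)^{ij}`. -/
def flip (β : ChainPairing K L N d) : ChainPairing L K N d where
  comp j i h := (i * j).negOnePow • (β.comp i j (by omega)).flip
  comp_d j i h y x := by
    have := β.comp_d i j (by omega) x y
    simp only [LinearMap.smul_apply, LinearMap.flip_apply]
    rw [smul_smul, ← Int.negOnePow_add]
    rw [eq_neg_of_add_eq_zero_left this, smul_neg, smul_smul, ← Int.negOnePow_add,
      show j + (i + 1) * j + i = i * (j + 1) + 2 * j by ring, Int.negOnePow_add _ (2 * j),
      Int.negOnePow_two_mul, mul_one]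
    exact add_neg_cancel _

/-- A cocycle `z` of degree `i` gives the morphism of complexes `⟨z, -⟩ : L ⟶ N[-j]`,
where `i + j = d`. -/
def toSingle (β : ChainPairing K L N d) (i j : ℤ) (h : i + j = d) (z : cocycles K i) :
    L ⟶ (HomologicalComplex.single (ModuleCat.{u} k) (ComplexShape.up ℤ) j).obj N :=
  HomologicalComplex.mkHomToSingle (ModuleCat.ofHom (β.comp i j h z.1)) (by
    rintro j' hj
    obtain rfl : j' + 1 = j := hj
    refine ModuleCat.hom_ext (LinearMap.ext fun y => ?_)
    have := β.comp_d i j' (by omega) z.1 y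
    have hz : (K.d i (i + 1)) z.1 = 0 := z.2
    rw [hz, map_zero, LinearMap.zero_apply, zero_add] at this
    exact (smul_eq_zero_iff_eq _).1 this)

lemma toSingle_f (β : ChainPairing K L N d) (i j : ℤ) (h : i + j = d) (z : cocycles K i) :
    (β.toSingle i j h z).f j = ModuleCat.ofHom (β.comp i j h z.1) ≫
      (HomologicalComplex.singleObjXSelf (ComplexShape.up ℤ) j N).inv :=
  HomologicalComplex.mkHomToSingle_f _ _

variable [HasDerivedCategory.{w} (ModuleCat.{u} k)]

/-- The map from cocycles to morphisms in the derived category. -/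
def cocycleDuality (β : ChainPairing K L N d) (i j : ℤ) (h : i + j = d) :
    cocycles K i →ₗ[k] (DerivedCategory.Q.obj L ⟶ DerivedCategory.Q.obj
      ((HomologicalComplex.single (ModuleCat.{u} k) (ComplexShape.up ℤ) j).obj N)) where
  toFun z := DerivedCategory.Q.map (β.toSingle i j h z)
  map_add' z z' := by
    rw [← Functor.map_add]
    congr 1
    refine HomologicalComplex.to_single_hom_ext ?_
    simp only [HomologicalComplex.add_f_apply, toSingle_f, Submodule.coe_add, map_add,
      ModuleCat.ofHom_add, Preadditive.add_comp]
  map_smul' c z := by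
    rw [RingHom.id_apply, ← Functor.map_smul]
    congr 1
    refine HomologicalComplex.to_single_hom_ext ?_
    rw [HomologicalComplex.smul_f_apply, toSingle_f, toSingle_f, Submodule.coe_smul, map_smul,
      ← Linear.smul_comp]
    rfl

lemma cocycleDuality_d (β : ChainPairing K L N d) (i j : ℤ) (h : i + j = d) (z : cocycles K i)
    (hz : z ∈ (LinearMap.range (K.d (i - 1) i).hom).comap (cocycles K i).subtype) :
    β.cocycleDuality i j h z = 0 := by
  obtain ⟨i, rfl⟩ : ∃ i', i = i' + 1 := ⟨i - 1, by omega⟩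
  obtain ⟨w, hw⟩ : ∃ w : K.X i, (K.d i (i + 1)).hom w = z.1 := by
    obtain ⟨w, hw⟩ := hz
    have aux : ∀ i₀, i₀ = i → ∀ w : K.X i₀, (K.d i₀ (i + 1)).hom w = z.1 →
        ∃ w : K.X i, (K.d i (i + 1)).hom w = z.1 := by
      rintro _ rfl w hw
      exact ⟨w, hw⟩
    exact aux _ (by omega) w hw
  have hi : i + (j + 1) = d := by omega
  let H : Homotopy (β.toSingle (i + 1) j h z) 0 :=
    (Homotopy.ofEq (HomologicalComplex.to_single_hom_ext (by
      rw [Homotopy.nullHomotopicMap'_f (show (ComplexShape.up ℤ).Rel (j - 1) j by simp)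
        (show (ComplexShape.up ℤ).Rel j (j + 1) by simp), HomologicalComplex.single_obj_d,
        Limits.comp_zero, add_zero, dif_pos rfl, toSingle_f]
      simp only [← Category.assoc]
      refine congrArg (· ≫ _) ?_
      refine ModuleCat.hom_ext (LinearMap.ext fun y => ?_)
      have := β.comp_d i j h w y
      change β.comp (i + 1) j h z.1 y = -(i.negOnePow • β.comp i (j + 1) hi w
        ((L.d j (j + 1)).hom y))
      rw [← hw]
      exact eq_neg_of_add_eq_zero_left this))).trans
    (Homotopy.nullHomotopy' (fun a b (hab : (ComplexShape.up ℤ).Rel b a) =>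
      if hb : b = j then
        (HomologicalComplex.XIsoOfEq L (show a = j + 1 from hb ▸ hab.symm)).hom ≫
          ModuleCat.ofHom (-(i.negOnePow • β.comp i (j + 1) hi w)) ≫
          (HomologicalComplex.singleObjXIsoOfEq (ComplexShape.up ℤ) j N b hb).inv
      else 0))
  change DerivedCategory.Q.map (β.toSingle (i + 1) j h z) = 0
  rw [DerivedCategory.Q_map_eq_of_homotopy _ H, Functor.map_zero]

/-- The duality map on cohomology in degree `i`, induced by the pairing: the source is `Hⁱ(K)`,
and the target, the morphisms `L ⟶ N[-j] = N[-d][i]` in the derived category, is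
`Hⁱ(RHom(L, N[-d]))`. -/
def duality (β : ChainPairing K L N d) (i j : ℤ) (h : i + j = d) :
    cohomology K i →ₗ[k] (DerivedCategory.Q.obj L ⟶ DerivedCategory.Q.obj
      ((HomologicalComplex.single (ModuleCat.{u} k) (ComplexShape.up ℤ) j).obj N)) :=
  Submodule.liftQ _ (β.cocycleDuality i j h) (fun z hz => β.cocycleDuality_d i j h z hz)

end ChainPairing

/-- A linear map whose kernel and cokernel are annihilated by the ideal `I`. -/
def IsAlmostIso (I : Ideal k) {M M' : Type*} [AddCommGroup M] [Module k M] [AddCommGroup M']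
    [Module k M'] (φ : M →ₗ[k] M') : Prop :=
  (∀ a ∈ I, ∀ x, φ x = 0 → a • x = 0) ∧ (∀ a ∈ I, ∀ y, ∃ x, φ x = a • y)

section

variable {K L : CochainComplex (ModuleCat.{u} k) ℤ} {N : ModuleCat.{u} k} {d : ℤ}
  [HasDerivedCategory.{w} (ModuleCat.{u} k)]

/-- The pairing is almost perfect with respect to `I`: both duality maps
`K → RHom(L, N[-d])` and `L → RHom(K, N[-d])` are almost isomorphisms, i.e. they induce
almost isomorphisms on cohomology in every degree. -/
def ChainPairing.IsAlmostPerfect (I : Ideal k) (β : ChainPairing K L N d) : Prop :=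
  ∀ (i j : ℤ) (h : i + j = d),
    IsAlmostIso I (β.duality i j h) ∧ IsAlmostIso I (β.flip.duality i j h)

/-- The pairing is perfect: both duality maps
`K → RHom(L, N[-d])` and `L → RHom(K, N[-d])` are isomorphisms in the derived category. -/
def ChainPairing.IsPerfect (β : ChainPairing K L N d) : Prop :=
  ∀ (i j : ℤ) (h : i + j = d),
    Function.Bijective (β.duality i j h) ∧ Function.Bijective (β.flip.duality i j h)

end

variable {G : Type u} [Group G] [TopologicalSpace G] {A : Type u} [CommRing A] [Algebra k A]
  {N : ModuleCat.{u} k} {d : ℤ}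

/-- The cup product on `RΓ_cont(G, A)` followed by a morphism `T : RΓ_cont(G, A) → N[-d]`. -/
def cupPairing (ρ : G →* (A →ₐ[k] A)) (T : contComplex ρ ⟶
    (HomologicalComplex.single (ModuleCat.{u} k) (ComplexShape.up ℤ) d).obj N) :
    ChainPairing (contComplex ρ) (contComplex ρ) N d where
  comp i j h := (cupZ ρ i j d h).compr₂
    (T.f d ≫ (HomologicalComplex.singleObjXSelf (ComplexShape.up ℤ) d N).hom).hom
  comp_d i j h x y := by
    obtain ⟨n, rfl⟩ : ∃ n, d = n + 1 := ⟨i + j, by omega⟩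
    have h1 := cochainObjD_cupZ ρ i j n (by omega) x y
    have h2 : (contComplex ρ).d n (n + 1) ≫ T.f (n + 1) = 0 := by
      rw [← T.comm, HomologicalComplex.single_obj_d, Limits.comp_zero]
    rw [contComplex_d] at h2
    have h3 : (T.f (n + 1)) (cochainObjD ρ n (cupZ ρ i j n (by omega) x y)) = 0 :=
      congrArg (fun f => f.hom (cupZ ρ i j n (by omega) x y)) h2
    rw [contComplex_d, contComplex_d]
    let F : cochainObj ρ (n + 1) →ₗ[k] N :=
      (T.f (n + 1) ≫ (HomologicalComplex.singleObjXSelf (ComplexShape.up ℤ) (n + 1) N).hom).hom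
    have h4 : F (cochainObjD ρ n (cupZ ρ i j n (by omega) x y)) = 0 :=
      (congrArg (HomologicalComplex.singleObjXSelf (ComplexShape.up ℤ) (n + 1) N).hom h3).trans
        (map_zero _)
    rw [h1, map_add, Units.smul_def, map_zsmul, ← Units.smul_def] at h4
    exact h4

end Pairings

section Model

/-! ### The perfectoid cover of a model polystable formal scheme -/

variable (p : ℕ)

/-- The `p`-adic completion of a ring. -/
abbrev PCompletion (A : Type u) [CommRing A] : Type u :=
  AdicCompletion (Ideal.span {(p : A)}) A

lemma span_pow_le_comap {A B : Type u} [CommRing A] [CommRing B] (φ : A →+* B) (m : ℕ) :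
    Ideal.span {(p : A)} ^ m ≤ (Ideal.span {(p : B)} ^ m).comap φ := by
  rw [← Ideal.map_le_iff_le_comap, Ideal.map_pow, Ideal.map_span, Set.image_singleton,
    map_natCast]

/-- The ring map from the `p`-adic completion of `A` to `B / p^m` induced by a ring map. -/
def pCompletionLevel {A B : Type u} [CommRing A] [CommRing B] (φ : A →+* B) (m : ℕ) :
    PCompletion p A →+* B ⧸ Ideal.span {(p : B)} ^ m :=
  (Ideal.quotientMap _ φ (span_pow_le_comap p φ m)).comp
    (AdicCompletion.evalₐ (Ideal.span {(p : A)}) m : _ →+* _)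

lemma factorPow_pCompletionLevel {A B : Type u} [CommRing A] [CommRing B] (φ : A →+* B)
    {m m' : ℕ} (hle : m ≤ m') :
    (Ideal.Quotient.factorPow (Ideal.span {(p : B)}) hle).comp (pCompletionLevel p φ m') =
      pCompletionLevel p φ m := by
  refine RingHom.ext fun x => ?_
  obtain ⟨y, rfl⟩ := AdicCompletion.mk_surjective _ _ x
  simp only [pCompletionLevel, RingHom.comp_apply, RingHom.coe_coe, AdicCompletion.evalₐ_mk]
  rw [← AdicCompletion.Ideal.mk_eq_mk _ hle y]
  rfl

/-- The ring map on `p`-adic completions induced by a ring map. -/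
def pCompletionMap {A B : Type u} [CommRing A] [CommRing B] (φ : A →+* B) :
    PCompletion p A →+* PCompletion p B :=
  AdicCompletion.liftRingHom _ (pCompletionLevel p φ) (factorPow_pCompletionLevel p φ)

lemma evalₐ_pCompletionMap {A B : Type u} [CommRing A] [CommRing B] (φ : A →+* B) (m : ℕ)
    (x : PCompletion p A) :
    AdicCompletion.evalₐ (Ideal.span {(p : B)}) m (pCompletionMap p φ x) =
      Ideal.quotientMap _ φ (span_pow_le_comap p φ m)
        (AdicCompletion.evalₐ (Ideal.span {(p : A)}) m x) :=
  AdicCompletion.evalₐ_liftRingHom _ (pCompletionLevel p φ) (factorPow_pCompletionLevel p φ) m x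

lemma pCompletionMap_algebraMap {A B : Type u} [CommRing A] [CommRing B] (φ : A →+* B) (a : A) :
    pCompletionMap p φ (algebraMap A (PCompletion p A) a) = algebraMap B (PCompletion p B) (φ a) := by
  refine AdicCompletion.ext_evalₐ fun m => ?_
  rw [evalₐ_pCompletionMap p φ]
  simp [AdicCompletion.algebraMap_apply]

lemma pCompletionMap_comp {A B D : Type u} [CommRing A] [CommRing B] [CommRing D]
    (φ : A →+* B) (ψ : B →+* D) :
    (pCompletionMap p ψ).comp (pCompletionMap p φ) = pCompletionMap p (ψ.comp φ) := by
  refine RingHom.ext fun x => AdicCompletion.ext_evalₐ fun m => ?_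
  rw [RingHom.comp_apply, evalₐ_pCompletionMap p ψ,
    evalₐ_pCompletionMap p φ,
    evalₐ_pCompletionMap p _]
  obtain ⟨y, hy⟩ := Ideal.Quotient.mk_surjective (AdicCompletion.evalₐ (Ideal.span {(p : A)}) m x)
  rw [← hy]
  simp

lemma pCompletionMap_id (A : Type u) [CommRing A] :
    pCompletionMap p (RingHom.id A) = RingHom.id _ := by
  refine RingHom.ext fun x => AdicCompletion.ext_evalₐ fun m => ?_
  rw [evalₐ_pCompletionMap p _]
  obtain ⟨y, hy⟩ := Ideal.Quotient.mk_surjective (AdicCompletion.evalₐ (Ideal.span {(p : A)}) m x)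
  rw [RingHom.id_apply, ← hy]
  simp

variable (C : Type u) [NormedField C] [IsUltrametricDist C]

/-- The valuation ring `O_C = {x : ‖x‖ ≤ 1}`. -/
abbrev OC : ValuationSubring C := (NormedField.valuation (K := C)).valuationSubring

/-- The data defining a model polystable formal `O_C`-scheme
`Spf O_C⟨t_{i,j}⟩ / (t_{i,0} ⋯ t_{i,n_i} - ϖ_i)`, together with compatible systems
`ϖ_i^{1/p^m}` of `p`-power roots of the non-zero elements `ϖ_i`. -/
structure ModelData where
  /-- The number of blocks of variables. -/
  l : ℕ
  /-- The block `i` consists of the variables `t_{i,0}, …, t_{i,n i}`. -/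
  n : Fin l → ℕ
  /-- `root i m` is `ϖ_i^{1/p^m}`. -/
  root : Fin l → ℕ → OC C
  root_pow : ∀ i m, root i (m + 1) ^ p = root i m
  root_zero_ne : ∀ i, root i 0 ≠ 0

namespace ModelData

variable {p C} (D : ModelData p C)

lemma root_pow_pow (i : Fin D.l) (m r : ℕ) : D.root i (m + r) ^ p ^ r = D.root i m := by
  induction r with
  | zero => simp
  | succ r ih => rw [pow_succ', pow_mul, ← add_assoc, D.root_pow, ih]

/-- The relative dimension `d = ∑ n_i`. -/
def dim : ℕ := ∑ i, D.n i

/-- The index set of the variables. -/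
abbrev Idx : Type := Σ i : Fin D.l, Fin (D.n i + 1)

/-- The polynomial ring `O_C[t_{i,j}^{1/p^m}]`; the variable `X (i,j)` stands for
`t_{i,j}^{1/p^m}`. -/
abbrev Poly : Type u := MvPolynomial D.Idx (OC C)

/-- The ring `O_C⟨t_{i,j}^{1/p^m}⟩` of convergent power series: the `p`-adic completion of
the polynomial ring. -/
abbrev Tate : Type u := PCompletion p D.Poly

/-- The relation `t_{i,0}^{1/p^m} ⋯ t_{i,n_i}^{1/p^m} - ϖ_i^{1/p^m}`. -/
def rel (m : ℕ) (i : Fin D.l) : D.Poly :=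
  ∏ j, MvPolynomial.X ⟨i, j⟩ - MvPolynomial.C (D.root i m)

/-- The ideal generated by the relations. -/
def relIdeal (m : ℕ) : Ideal D.Tate :=
  Ideal.span (Set.range fun i => algebraMap D.Poly D.Tate (D.rel m i))

/-- The ring `R_m^+ = O_C⟨t_{i,j}^{1/p^m}⟩ / (∏_j t_{i,j}^{1/p^m} - ϖ_i^{1/p^m})`; in particular
`R_0^+ = R^+`. -/
def R (m : ℕ) : Type u := D.Tate ⧸ D.relIdeal m

instance (m : ℕ) : CommRing (D.R m) := inferInstanceAs (CommRing (D.Tate ⧸ D.relIdeal m))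

instance (m : ℕ) : Algebra (OC C) (D.R m) :=
  inferInstanceAs (Algebra (OC C) (D.Tate ⧸ D.relIdeal m))

/-- The class in `R_m^+` of a polynomial in the `t_{i,j}^{1/p^m}`. -/
def ofPoly (m : ℕ) : D.Poly →+* D.R m :=
  (Ideal.Quotient.mk (D.relIdeal m)).comp (algebraMap D.Poly D.Tate)

/-- A substitution of polynomials that respects the relations induces a map `R_m^+ → R_{m'}^+`. -/
def mapR {m m' : ℕ} (φ : D.Poly →+* D.Poly) (h : ∀ i, D.rel m' i ∣ φ (D.rel m i)) :
    D.R m →+* D.R m' :=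
  Ideal.quotientMap (D.relIdeal m') (pCompletionMap p φ) (by
    rw [relIdeal, Ideal.span_le]
    rintro _ ⟨i, rfl⟩
    rw [SetLike.mem_coe, Ideal.mem_comap, pCompletionMap_algebraMap]
    obtain ⟨c, hc⟩ := h i
    rw [hc, map_mul]
    exact Ideal.mul_mem_right _ _ (Ideal.subset_span ⟨i, rfl⟩))

lemma mapR_comp {m m' m'' : ℕ} (φ ψ : D.Poly →+* D.Poly) (h : ∀ i, D.rel m' i ∣ φ (D.rel m i))
    (h' : ∀ i, D.rel m'' i ∣ ψ (D.rel m' i)) (h'' : ∀ i, D.rel m'' i ∣ (ψ.comp φ) (D.rel m i)) :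
    (D.mapR ψ h').comp (D.mapR φ h) = D.mapR (ψ.comp φ) h'' := by
  refine Ideal.Quotient.ringHom_ext (RingHom.ext fun x => ?_)
  exact congrArg (Ideal.Quotient.mk (D.relIdeal m''))
    (RingHom.congr_fun (pCompletionMap_comp p φ ψ) x)

lemma mapR_id {m : ℕ} (h : ∀ i, D.rel m i ∣ (RingHom.id D.Poly) (D.rel m i)) :
    D.mapR (RingHom.id D.Poly) h = RingHom.id (D.R m) := by
  refine Ideal.Quotient.ringHom_ext (RingHom.ext fun x => ?_)
  exact congrArg (Ideal.Quotient.mk (D.relIdeal m))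
    (RingHom.congr_fun (pCompletionMap_id p D.Poly) x)

lemma mapR_congr {m m' : ℕ} {φ ψ : D.Poly →+* D.Poly} (h : ∀ i, D.rel m' i ∣ φ (D.rel m i))
    (h' : ∀ i, D.rel m' i ∣ ψ (D.rel m i)) (e : φ = ψ) : D.mapR φ h = D.mapR ψ h' := by
  subst e; rfl

lemma rel_dvd_expand {m m' : ℕ} (h : m ≤ m') (i : Fin D.l) :
    D.rel m' i ∣ (MvPolynomial.expand (p ^ (m' - m)) : D.Poly →ₐ[OC C] D.Poly) (D.rel m i) := by
  have : (MvPolynomial.expand (p ^ (m' - m)) : D.Poly →ₐ[OC C] D.Poly) (D.rel m i) =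
      (∏ j, MvPolynomial.X ⟨i, j⟩) ^ p ^ (m' - m) -
        (MvPolynomial.C (D.root i m')) ^ p ^ (m' - m) := by
    have hr := D.root_pow_pow i m (m' - m)
    rw [Nat.add_sub_cancel' h] at hr
    rw [rel, map_sub, map_prod, ← Finset.prod_pow, ← map_pow, hr]
    simp
  rw [this]
  exact sub_dvd_pow_sub_pow _ _ _

/-- The transition map `R_m^+ → R_{m'}^+`, sending
`t_{i,j}^{1/p^m}` to `(t_{i,j}^{1/p^{m'}})^{p^{m'-m}}`. -/
def trans (m m' : ℕ) (h : m ≤ m') : D.R m →+* D.R m' :=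
  D.mapR (MvPolynomial.expand (p ^ (m' - m)) : D.Poly →ₐ[OC C] D.Poly).toRingHom
    (D.rel_dvd_expand h)

/-- The ring `colim_m R_m^+`. -/
abbrev RColim : Type u := Ring.DirectLimit D.R (fun m m' h => D.trans m m' h)

/-- The ring `R_∞^+`, the `p`-adic completion of `colim_m R_m^+`. -/
abbrev RInf : Type u := PCompletion p D.RColim

/-- The ring `R^+/p`. -/
def RModP : Type u := D.R 0 ⧸ Ideal.span {(p : D.R 0)}

instance : CommRing D.RModP := inferInstanceAs (CommRing (D.R 0 ⧸ Ideal.span {(p : D.R 0)}))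

instance : Algebra (OC C) D.RModP :=
  inferInstanceAs (Algebra (OC C) (D.R 0 ⧸ Ideal.span {(p : D.R 0)}))

/-- The ring `R_∞^+/p`. -/
def RInfModP : Type u := D.RInf ⧸ Ideal.span {(p : D.RInf)}

instance : CommRing D.RInfModP := inferInstanceAs (CommRing (D.RInf ⧸ Ideal.span {(p : D.RInf)}))

/-- The map `R_m^+ → R_∞^+`. -/
def toRInf (m : ℕ) : D.R m →+* D.RInf :=
  (algebraMap D.RColim D.RInf).comp (Ring.DirectLimit.of D.R (fun m m' h => D.trans m m' h) m)

/-- The map `R_m^+ → R_∞^+/p`. -/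
def toRInfModP (m : ℕ) : D.R m →+* D.RInfModP := (Ideal.Quotient.mk _).comp (D.toRInf m)

/-- The structure of `R^+/p`-algebra on `R_∞^+/p`. -/
instance : Algebra D.RModP D.RInfModP :=
  (Ideal.quotientMap (Ideal.span {(p : D.RInf)}) (D.toRInf 0) (by
    rw [← Ideal.map_le_iff_le_comap, Ideal.map_span, Set.image_singleton, map_natCast])
    ).toAlgebra

/-- The monomial `∏ (t_{i,j}^{1/p^m})^{e_{i,j}}` in `R_∞^+/p`. -/
def monomial (m : ℕ) (e : D.Idx → ℕ) : D.RInfModP :=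
  D.toRInfModP m (D.ofPoly m (∏ s, MvPolynomial.X s ^ e s))

/-- The ideal of `R^+/p` generated by the maximal ideal of `O_C`. -/
def almostIdeal : Ideal D.RModP :=
  (IsLocalRing.maximalIdeal (OC C)).map (algebraMap (OC C) D.RModP)

/-- The group `Δ = lim_m Δ_m`, as a group of families `ε_{i,j}^{(m)}` with
`ε_{i,j}^{(m)} ∈ μ_{p^m}`, compatible under `p`-th powers, and with `∏_j ε_{i,j}^{(m)} = 1`. -/
def deltaSubgroup : Subgroup (ℕ → D.Idx → (OC C)ˣ) where
  carrier := {ε | (∀ m s, ε m s ^ p ^ m = 1) ∧ (∀ m s, ε (m + 1) s ^ p = ε m s) ∧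
    ∀ m i, ∏ j, ε m ⟨i, j⟩ = 1}
  mul_mem' {a b} ha hb := by
    refine ⟨fun m s => ?_, fun m s => ?_, fun m i => ?_⟩
    · simp [mul_pow, ha.1 m s, hb.1 m s]
    · simp [mul_pow, ha.2.1 m s, hb.2.1 m s]
    · simp [Finset.prod_mul_distrib, ha.2.2 m i, hb.2.2 m i]
  one_mem' := by simp
  inv_mem' {a} ha := by
    refine ⟨fun m s => ?_, fun m s => ?_, fun m i => ?_⟩
    · simp [ha.1 m s]
    · simp [ha.2.1 m s]
    · simp [ha.2.2 m i]

/-- The group `Δ`, isomorphic to `ℤ_p(1)^d`. -/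
def Delta : Type u := D.deltaSubgroup

instance : Group D.Delta := inferInstanceAs (Group D.deltaSubgroup)

/-- The component of an element of `Δ` at level `m`. -/
def Delta.level {D : ModelData p C} (ε : D.Delta) (m : ℕ) : D.Idx → (OC C)ˣ := ε.1 m

/-- The profinite topology: the inverse limit of the discrete topologies on the finite levels. -/
instance : TopologicalSpace D.Delta :=
  ⨅ m : ℕ, TopologicalSpace.induced (fun ε : D.Delta => ε.level m) ⊥

/-- The substitution `t_{i,j}^{1/p^m} ↦ ε_{i,j}^{(m)} t_{i,j}^{1/p^m}`. -/
def actPoly (ε : D.Delta) (m : ℕ) : D.Poly →+* D.Poly :=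
  (MvPolynomial.aeval (R := OC C) fun s =>
    MvPolynomial.C ((ε.level m s : (OC C)ˣ) : OC C) * MvPolynomial.X s).toRingHom

lemma actPoly_C (ε : D.Delta) (m : ℕ) (a : OC C) :
    D.actPoly ε m (MvPolynomial.C a) = MvPolynomial.C a := by
  simp [actPoly]

lemma actPoly_X (ε : D.Delta) (m : ℕ) (s : D.Idx) :
    D.actPoly ε m (MvPolynomial.X s) =
      MvPolynomial.C ((ε.level m s : (OC C)ˣ) : OC C) * MvPolynomial.X s := by
  simp [actPoly]

lemma actPoly_rel (ε : D.Delta) (m : ℕ) (i : Fin D.l) :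
    D.actPoly ε m (D.rel m i) = D.rel m i := by
  rw [rel, map_sub, map_prod, actPoly_C]
  simp only [actPoly_X]
  rw [Finset.prod_mul_distrib, ← map_prod, ← Units.coe_prod]
  have : ∏ j, ε.level m ⟨i, j⟩ = 1 := ε.2.2.2 m i
  rw [this]
  simp

lemma actPoly_zero (ε : D.Delta) : D.actPoly ε 0 = RingHom.id _ := by
  refine MvPolynomial.ringHom_ext (fun a => by simp [actPoly_C]) (fun s => ?_)
  have : ε.level 0 s = 1 := by
    have h := ε.2.1 0 s
    rwa [pow_zero, pow_one] at h
  simp [actPoly_X, this]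

lemma actPoly_one (m : ℕ) : D.actPoly 1 m = RingHom.id _ := by
  refine MvPolynomial.ringHom_ext (fun a => by simp [actPoly_C]) (fun s => ?_)
  have : (1 : D.Delta).level m s = 1 := rfl
  simp [actPoly_X, this]

lemma actPoly_mul (ε δ : D.Delta) (m : ℕ) :
    D.actPoly (ε * δ) m = (D.actPoly ε m).comp (D.actPoly δ m) := by
  refine MvPolynomial.ringHom_ext (fun a => by simp [actPoly_C]) (fun s => ?_)
  have : (ε * δ).level m s = ε.level m s * δ.level m s := rfl
  simp [actPoly_X, actPoly_C, this]
  ring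

lemma level_pow (ε : D.Delta) (m r : ℕ) (s : D.Idx) :
    ε.level (m + r) s ^ p ^ r = ε.level m s := by
  induction r with
  | zero => simp
  | succ r ih =>
    have : ε.level (m + r + 1) s ^ p = ε.level (m + r) s := ε.2.2.1 (m + r) s
    rw [pow_succ', pow_mul, ← add_assoc, this, ih]

lemma actPoly_expand (ε : D.Delta) {m m' : ℕ} (h : m ≤ m') :
    (D.actPoly ε m').comp
        (MvPolynomial.expand (p ^ (m' - m)) : D.Poly →ₐ[OC C] D.Poly).toRingHom =
      (MvPolynomial.expand (p ^ (m' - m)) : D.Poly →ₐ[OC C] D.Poly).toRingHom.comp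
        (D.actPoly ε m) := by
  refine MvPolynomial.ringHom_ext (fun a => by simp [actPoly_C]) (fun s => ?_)
  have := D.level_pow ε m (m' - m) s
  rw [Nat.add_sub_cancel' h] at this
  change D.actPoly ε m' (MvPolynomial.expand (p ^ (m' - m)) (MvPolynomial.X s)) =
    MvPolynomial.expand (p ^ (m' - m)) (D.actPoly ε m (MvPolynomial.X s))
  rw [MvPolynomial.expand_X, map_pow, actPoly_X, actPoly_X, map_mul, MvPolynomial.expand_X,
    MvPolynomial.expand_C, mul_pow, ← map_pow, ← Units.val_pow_eq_pow_val, this]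

/-- The action of `Δ` on `R_m^+`. -/
def actR (ε : D.Delta) (m : ℕ) : D.R m →+* D.R m :=
  D.mapR (D.actPoly ε m) (fun i => by rw [actPoly_rel])

lemma actR_comp_trans (ε : D.Delta) (m m' : ℕ) (h : m ≤ m') :
    (D.actR ε m').comp (D.trans m m' h) = (D.trans m m' h).comp (D.actR ε m) := by
  have h1 : ∀ i, D.rel m' i ∣ ((D.actPoly ε m').comp
      (MvPolynomial.expand (p ^ (m' - m)) : D.Poly →ₐ[OC C] D.Poly).toRingHom) (D.rel m i) := by
    intro i
    have := map_dvd (D.actPoly ε m') (D.rel_dvd_expand h i)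
    rw [actPoly_rel] at this
    exact this
  have h2 : ∀ i, D.rel m' i ∣ ((MvPolynomial.expand (p ^ (m' - m)) :
      D.Poly →ₐ[OC C] D.Poly).toRingHom.comp (D.actPoly ε m)) (D.rel m i) := by
    intro i
    rw [RingHom.comp_apply, actPoly_rel]
    exact D.rel_dvd_expand h i
  rw [actR, actR, trans, mapR_comp _ _ _ _ _ h1, mapR_comp _ _ _ _ _ h2]
  exact D.mapR_congr _ _ (D.actPoly_expand ε h)

/-- The action of `Δ` on `colim_m R_m^+`. -/
def actColim (ε : D.Delta) : D.RColim →+* D.RColim :=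
  Ring.DirectLimit.map (fun m => D.actR ε m) (D.actR_comp_trans ε)

/-- The action of `Δ` on `R_∞^+`. -/
def actRInf (ε : D.Delta) : D.RInf →+* D.RInf := pCompletionMap p (D.actColim ε)

/-- The action of `Δ` on `R_∞^+/p` by ring maps. -/
def actRInfModP (ε : D.Delta) : D.RInfModP →+* D.RInfModP :=
  Ideal.quotientMap _ (D.actRInf ε) (by
    rw [← Ideal.map_le_iff_le_comap, Ideal.map_span, Set.image_singleton, map_natCast])

lemma actR_one (m : ℕ) : D.actR 1 m = RingHom.id _ := by
  have h : ∀ i, D.rel m i ∣ (RingHom.id D.Poly) (D.rel m i) := fun i => by rw [RingHom.id_apply]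
  rw [actR, D.mapR_congr _ h (D.actPoly_one m), mapR_id]

lemma actR_zero (ε : D.Delta) : D.actR ε 0 = RingHom.id _ := by
  have h : ∀ i, D.rel 0 i ∣ (RingHom.id D.Poly) (D.rel 0 i) := fun i => by rw [RingHom.id_apply]
  rw [actR, D.mapR_congr _ h (D.actPoly_zero ε), mapR_id]

lemma actR_mul (ε δ : D.Delta) (m : ℕ) : D.actR (ε * δ) m = (D.actR ε m).comp (D.actR δ m) := by
  rw [actR, actR, actR, mapR_comp _ _ _ _ _ (fun i => by
    rw [RingHom.comp_apply, actPoly_rel, actPoly_rel])]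
  exact D.mapR_congr _ _ (D.actPoly_mul ε δ m)

lemma actColim_one : D.actColim 1 = RingHom.id _ := by
  refine Ring.DirectLimit.hom_ext _ fun m => RingHom.ext fun x => ?_
  rw [RingHom.comp_apply, RingHom.comp_apply, actColim, Ring.DirectLimit.map_apply_of, actR_one,
    RingHom.id_apply, RingHom.id_apply]

lemma actColim_mul (ε δ : D.Delta) :
    D.actColim (ε * δ) = (D.actColim ε).comp (D.actColim δ) := by
  refine Ring.DirectLimit.hom_ext _ fun m => RingHom.ext fun x => ?_
  rw [RingHom.comp_apply, RingHom.comp_apply, RingHom.comp_apply, actColim, actColim, actColim,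
    Ring.DirectLimit.map_apply_of, Ring.DirectLimit.map_apply_of, Ring.DirectLimit.map_apply_of,
    actR_mul, RingHom.comp_apply]

/-- The action of `Δ` on `R_∞^+/p` by automorphisms of the `R^+/p`-algebra `R_∞^+/p`. -/
def rho : D.Delta →* (D.RInfModP →ₐ[D.RModP] D.RInfModP) where
  toFun ε :=
    { D.actRInfModP ε with
      commutes' := fun r => by
        obtain ⟨r, rfl⟩ := Ideal.Quotient.mk_surjective r
        change Ideal.Quotient.mk _ (D.actRInf ε (D.toRInf 0 r)) =
          Ideal.Quotient.mk _ (D.toRInf 0 r)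
        congr 1
        rw [actRInf, toRInf, RingHom.comp_apply, pCompletionMap_algebraMap, actColim, Ring.DirectLimit.map_apply_of,
          actR_zero, RingHom.id_apply] }
  map_one' := by
    refine AlgHom.ext fun x => ?_
    obtain ⟨x, rfl⟩ := Ideal.Quotient.mk_surjective x
    change Ideal.Quotient.mk _ (D.actRInf 1 x) = Ideal.Quotient.mk _ x
    rw [actRInf, actColim_one, pCompletionMap_id, RingHom.id_apply]
  map_mul' ε δ := by
    refine AlgHom.ext fun x => ?_
    obtain ⟨x, rfl⟩ := Ideal.Quotient.mk_surjective x
    change Ideal.Quotient.mk _ (D.actRInf (ε * δ) x) =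
      Ideal.Quotient.mk _ (D.actRInf ε (D.actRInf δ x))
    rw [actRInf, actColim_mul, ← pCompletionMap_comp]
    rfl

/-- The projection `R_∞^+/p → R^+/p` onto the summand of trivial weight in the decomposition of
`R_∞^+/p` into the pieces indexed by `X(T)[1/p]/X(T)`: it is the identity on `R^+/p`, and
it kills the monomial `∏ t_{i,j}^{e_{i,j}/p^m}` whenever its class in `X(T)[1/p]/X(T)` is
non-trivial, i.e. unless, for every `i`, all `e_{i,j}` are congruent modulo `p^m`. It is
invariant under `Δ`. -/
structure IsWeightProjection (pr : D.RInfModP →ₗ[D.RModP] D.RModP) : Prop where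
  map_one : pr 1 = 1
  map_monomial : ∀ (m : ℕ) (e : D.Idx → ℕ),
    (¬ ∀ i j j', e ⟨i, j⟩ ≡ e ⟨i, j'⟩ [MOD p ^ m]) → pr (D.monomial m e) = 0
  map_rho : ∀ (ε : D.Delta) x, pr (D.rho ε x) = pr x

/-- The complex `RΓ_cont(Δ, R_∞^+/p)`. -/
abbrev cohRInf : CochainComplex (ModuleCat.{u} D.RModP) ℤ := contComplex D.rho

/-- The complex `RΓ_cont(Δ, R^+/p)`, where `Δ` acts trivially on `R^+/p`. -/
abbrev cohR : CochainComplex (ModuleCat.{u} D.RModP) ℤ :=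
  contComplex (1 : D.Delta →* (D.RModP →ₐ[D.RModP] D.RModP))

/-- The complex `R^+/p[-d]`. -/
abbrev shiftedRModP : CochainComplex (ModuleCat.{u} D.RModP) ℤ :=
  (HomologicalComplex.single (ModuleCat.{u} D.RModP) (ComplexShape.up ℤ) (D.dim : ℤ)).obj
    (ModuleCat.of D.RModP D.RModP)

/-- The trace `RΓ_cont(Δ, R_∞^+/p) → R^+/p[-d]` obtained from the projection
`pr : R_∞^+/p → R^+/p` and a morphism `t : RΓ_cont(Δ, R^+/p) → R^+/p[-d]`. -/
def trace (pr : D.RInfModP →ₗ[D.RModP] D.RModP) (hpr : D.IsWeightProjection pr)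
    (t : D.cohR ⟶ D.shiftedRModP) : D.cohRInf ⟶ D.shiftedRModP :=
  contComplexMap D.rho 1 pr hpr.map_rho ≫ t

/-- The pairing `RΓ_cont(Δ, R_∞^+/p) ⊗ RΓ_cont(Δ, R_∞^+/p) → R^+/p[-d]`, the cup product
followed by the trace. -/
def pairing (pr : D.RInfModP →ₗ[D.RModP] D.RModP) (hpr : D.IsWeightProjection pr)
    (t : D.cohR ⟶ D.shiftedRModP) :
    ChainPairing D.cohRInf D.cohRInf (ModuleCat.of D.RModP D.RModP) (D.dim : ℤ) :=
  cupPairing D.rho (D.trace pr hpr t)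

end ModelData

end Model

end

end PolystableDuality

/-! Write k = R^+/p and A = R_∞^+/p. The group Δ is a power of Z_p with topological generators γ,
and p = 0 in k, so the continuous cohomology of a smooth k-module is computed by the Koszul complex
on the operators γ - 1 (`toKos_bijective`, by dimension shifting along coinduced modules). The
comparison map is built from prism operators, the standard homotopies between the identity and γ on
homogeneous cochains. They are twisted derivations for the cup product, so cup product followed by a
form on the coefficients becomes an explicit pairing of Koszul complexes (`kos_comp_toKos`), which
is perfect in every degree as soon as the form is (`IsTermPerfect.kos`). For trivial coefficients
the Koszul differentials vanish; this gives (b) and shows that every admissible trace is, in the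
derived category, a unit times the projection to the top Koszul term (`exists_trace_eq`).

At a finite level m the ring B = R_m^+/p need not be projective over k, but it is a Frobenius
algebra over k whose higher Ext groups into k vanish. Adjoining p^m-th roots of the variables gives
a free algebra with a perfect form, the top coefficient. From it B arises by killing, one block at a
time, the element ∏ t^{1/p^m} - ϖ^{1/p^m}. This element and its cofactor in the difference of p^m-th
powers are exact zero divisors, and both the perfect form and the vanishing of Ext pass to the
quotient (`IsPerfectForm.quotient`, `IsAcyclicFor.quotient`,
`frobForm_isPerfectForm_and_isAcyclicFor`). Because of the vanishing of Ext, morphisms in the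
derived category from the Koszul complex of B to k[-j] are chain maps up to homotopy, so the
degreewise perfect pairing gives honest duality for B.

The form on B is pr of the product, and pr is given on monomials by an explicit contraction
(`contract`) compatible with the change of level; this also proves (a) and the injectivity of B → A.
To pass from B to A, decompose A by weights. For a in the maximal ideal there is an m such that ζ -
1 divides a for all p-power roots of unity ζ of order larger than p^m, because |ζ - 1| tends to 1.
Dividing a by w - 1 on the weights w outside level m writes a(1 - e_m) as a sum of operators (γ -
1)U_γ, where e_m projects A to level m (`exists_homotopy_operators`). Such operators are
null-homotopic on cochains, so up to a the cohomology of A is a retract of that of B, and duality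
holds up to a (`cupPairing_duality_upTo`).

The pairing is not perfect for d > 0 because a cochain on a compact group takes finitely many
values. If duality were surjective in the top degree, every functional on A would be determined on
invariants by finitely many forms y ↦ pr(xy). But the elements p/(ζ - 1) · t^{1/p^r}, with ζ of
order p^r, are invariants of unbounded level, and a suitable infinite sum of forms detects all of
them (`exists_functional`). -/

namespace PolystableDuality

open CategoryTheory

noncomputable section

/-! ### Koszul complexes of commuting automorphisms and their pairings -/

section GComplexes

/-- A cochain complex of `k`-modules in non-negative degrees, with commuting automorphisms indexed
by the elements of a group. -/
structure GComplex (k : Type u) [CommRing k] (G : Type u) [Group G] where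
  /-- The terms. -/
  X : ℕ → Type u
  [grp : ∀ n, AddCommGroup (X n)]
  [mod : ∀ n, Module k (X n)]
  /-- The differential. -/
  d : ∀ n, X n →ₗ[k] X (n + 1)
  d_d : ∀ n x, d (n + 1) (d n x) = 0
  /-- The automorphisms. -/
  act : G → ∀ n, X n →ₗ[k] X n
  act_d : ∀ g n x, act g (n + 1) (d n x) = d n (act g n x)
  act_comm : ∀ g h n x, act g n (act h n x) = act h n (act g n x)
  act_inv : ∀ g n x, act g n (act g⁻¹ n x) = x

attribute [instance] GComplex.grp GComplex.mod

variable {k : Type u} [CommRing k] {G : Type u} [Group G]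

/-- Equivariant morphisms of complexes. -/
structure GHom (K L : GComplex k G) where
  /-- The components. -/
  f : ∀ n, K.X n →ₗ[k] L.X n
  comm : ∀ n x, f (n + 1) (K.d n x) = L.d n (f n x)
  comm_act : ∀ g n x, f n (K.act g n x) = L.act g n (f n x)

namespace GComplex

variable (K L : GComplex k G)

lemma act_inv' (g : G) (n : ℕ) (x : K.X n) : K.act g⁻¹ n (K.act g n x) = x := by
  rw [K.act_comm, K.act_inv]

lemma act_bijective (g : G) (n : ℕ) : Function.Bijective (K.act g n) :=
  Function.bijective_iff_has_inverse.2 ⟨K.act g⁻¹ n, K.act_inv' g n, K.act_inv g n⟩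

/-- Exactness in degree `n + 1`. -/
def ExactSucc (n : ℕ) : Prop := ∀ x : K.X (n + 1), K.d (n + 1) x = 0 → ∃ y, K.d n y = x

/-- The terms of the fibre of `γ - 1`. -/
def fibX : ℕ → Type u
  | 0 => K.X 0
  | n + 1 => K.X (n + 1) × K.X n

instance fibXGrp : ∀ n, AddCommGroup (K.fibX n)
  | 0 => inferInstanceAs (AddCommGroup (K.X 0))
  | n + 1 => inferInstanceAs (AddCommGroup (K.X (n + 1) × K.X n))

instance fibXMod : ∀ n, Module k (K.fibX n)
  | 0 => inferInstanceAs (Module k (K.X 0))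
  | n + 1 => inferInstanceAs (Module k (K.X (n + 1) × K.X n))

/-- The differential of the fibre of `γ - 1`. -/
def fibD (γ : G) : ∀ n, K.fibX n →ₗ[k] K.fibX (n + 1)
  | 0 => LinearMap.prod (K.d 0) (K.act γ 0 - LinearMap.id)
  | n + 1 => LinearMap.prod ((K.d (n + 1)).comp (LinearMap.fst k _ _))
      ((K.act γ (n + 1) - LinearMap.id).comp (LinearMap.fst k _ _) -
        (K.d n).comp (LinearMap.snd k _ _))

/-- The action on the fibre of `γ - 1`. -/
def fibAct (g : G) : ∀ n, K.fibX n →ₗ[k] K.fibX n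
  | 0 => K.act g 0
  | n + 1 => LinearMap.prodMap (K.act g (n + 1)) (K.act g n)

/-- The fibre of `γ - 1`. -/
def fib (γ : G) : GComplex k G where
  X := K.fibX
  d := K.fibD γ
  d_d
    | 0, (x : K.X 0) => Prod.ext (K.d_d 0 x) (by
      change K.act γ 1 (K.d 0 x) - K.d 0 x - K.d 0 (K.act γ 0 x - x) = 0
      rw [map_sub, K.act_d, sub_self])
    | n + 1, (x, x') => Prod.ext (K.d_d (n + 1) x) (by
      change K.act γ (n + 2) (K.d (n + 1) x) - K.d (n + 1) x -
        K.d (n + 1) (K.act γ (n + 1) x - x - K.d n x') = 0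
      rw [map_sub, map_sub, K.d_d, K.act_d, sub_zero, sub_self])
  act := K.fibAct
  act_d
    | g, 0, (x : K.X 0) => Prod.ext (K.act_d g 0 x) (by
      change K.act g 0 (K.act γ 0 x - x) = K.act γ 0 (K.act g 0 x) - K.act g 0 x
      rw [map_sub, K.act_comm])
    | g, n + 1, (x, x') => Prod.ext (K.act_d g (n + 1) x) (by
      change K.act g (n + 1) (K.act γ (n + 1) x - x - K.d n x') =
        K.act γ (n + 1) (K.act g (n + 1) x) - K.act g (n + 1) x - K.d n (K.act g n x')
      rw [map_sub, map_sub, K.act_comm, K.act_d])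
  act_comm
    | g, h, 0, x => K.act_comm g h 0 x
    | g, h, n + 1, (x, x') => Prod.ext (K.act_comm g h (n + 1) x) (K.act_comm g h n x')
  act_inv
    | g, 0, x => K.act_inv g 0 x
    | g, n + 1, (x, x') => Prod.ext (K.act_inv g (n + 1) x) (K.act_inv g n x')

/-- The Koszul complex of a list of group elements. -/
def kos : List G → GComplex k G
  | [] => K
  | γ :: Γ => (kos Γ).fib γ

/-- The terms of a module in degree zero. -/
def degZeroX (M : Type u) : ℕ → Type u
  | 0 => M
  | _ + 1 => PUnit

variable {M : Type u} [AddCommGroup M] [Module k M]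

instance degZeroXGrp : ∀ n, AddCommGroup (degZeroX M n)
  | 0 => inferInstanceAs (AddCommGroup M)
  | _ + 1 => inferInstanceAs (AddCommGroup PUnit)

instance degZeroXMod : ∀ n, Module k (degZeroX M n)
  | 0 => inferInstanceAs (Module k M)
  | _ + 1 =>
    { smul := fun _ x => x
      one_smul := fun _ => rfl
      mul_smul := fun _ _ _ => rfl
      smul_zero := fun _ => rfl
      smul_add := fun _ _ _ => rfl
      add_smul := fun _ _ _ => rfl
      zero_smul := fun _ => rfl }

/-- The map between modules in degree zero induced by a linear map. -/
def degZeroMap {M' : Type u} [AddCommGroup M'] [Module k M'] (f : M →ₗ[k] M') :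
    ∀ n, degZeroX M n →ₗ[k] degZeroX M' n
  | 0 => f
  | _ + 1 => 0

/-- A representation of a commutative group, as a complex in degree zero. -/
def degZero (hG : ∀ a b : G, a * b = b * a) (ρ : G →* Module.End k M) : GComplex k G where
  X := degZeroX M
  d _ := 0
  d_d _ _ := rfl
  act g := degZeroMap (ρ g)
  act_d _ _ _ := (map_zero _)
  act_comm
    | g, h, 0, x => by
      change (ρ g * ρ h) x = (ρ h * ρ g) x
      rw [← map_mul, hG, map_mul]
    | _, _, _ + 1, _ => rfl
  act_inv
    | g, 0, x => by
      change (ρ g * ρ g⁻¹) x = x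
      rw [← map_mul, mul_inv_cancel, map_one]; rfl
    | _, _ + 1, _ => rfl

end GComplex

namespace GHom

variable {K L : GComplex k G}

/-- The map on fibres induced by an equivariant morphism. -/
def fib (φ : GHom K L) (γ : G) : GHom (K.fib γ) (L.fib γ) where
  f
    | 0 => φ.f 0
    | n + 1 => LinearMap.prodMap (φ.f (n + 1)) (φ.f n)
  comm
    | 0, (x : K.X 0) => Prod.ext (φ.comm 0 x) (by
      change φ.f 0 (K.act γ 0 x - x) = L.act γ 0 (φ.f 0 x) - φ.f 0 x
      rw [map_sub, φ.comm_act])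
    | n + 1, (x, x') => Prod.ext (φ.comm (n + 1) x) (by
      change φ.f (n + 1) (K.act γ (n + 1) x - x - K.d n x') =
        L.act γ (n + 1) (φ.f (n + 1) x) - φ.f (n + 1) x - L.d n (φ.f n x')
      rw [map_sub, map_sub, φ.comm_act, φ.comm])
  comm_act
    | g, 0, x => φ.comm_act g 0 x
    | g, n + 1, (x, x') => Prod.ext (φ.comm_act g (n + 1) x) (φ.comm_act g n x')

/-- The map on Koszul complexes induced by an equivariant morphism. -/
def kos (φ : GHom K L) : ∀ Γ : List G, GHom (K.kos Γ) (L.kos Γ)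
  | [] => φ
  | γ :: Γ => (kos φ Γ).fib γ

/-- The map between complexes in degree zero induced by an equivariant map. -/
def degZero {M M' : Type u} [AddCommGroup M] [Module k M] [AddCommGroup M'] [Module k M']
    (hG : ∀ a b : G, a * b = b * a) {ρ : G →* Module.End k M} {σ : G →* Module.End k M'}
    (f : M →ₗ[k] M') (hf : ∀ g m, f (ρ g m) = σ g (f m)) :
    GHom (GComplex.degZero hG ρ) (GComplex.degZero hG σ) where
  f := GComplex.degZeroMap f
  comm n x := by
    change GComplex.degZeroMap f (n + 1) 0 = 0
    exact map_zero _
  comm_act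
    | g, 0, x => hf g x
    | _, _ + 1, _ => rfl

end GHom

/-- A homotopy from the identity to the action of `γ`. -/
structure ActHomotopy (K : GComplex k G) (γ : G) where
  /-- The components. -/
  h : ∀ n, K.X (n + 1) →ₗ[k] K.X n
  h_d_zero : ∀ x, h 0 (K.d 0 x) = K.act γ 0 x - x
  h_d_succ : ∀ n x, K.d n (h n x) + h (n + 1) (K.d (n + 1) x) = K.act γ (n + 1) x - x
  h_act : ∀ g n x, h n (K.act g (n + 1) x) = K.act g n (h n x)

/-- A homotopy from the identity to `γ` lifts morphisms to the fibre of `γ - 1`. -/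
def GHom.fibLift {K L : GComplex k G} (φ : GHom K L) {γ : G} (H : ActHomotopy K γ) :
    GHom K (L.fib γ) where
  f
    | 0 => φ.f 0
    | n + 1 => LinearMap.prod (φ.f (n + 1)) ((φ.f n).comp (H.h n))
  comm
    | 0, (x : K.X 0) => Prod.ext (φ.comm 0 x) (by
      change φ.f 0 (H.h 0 (K.d 0 x)) = L.act γ 0 (φ.f 0 x) - φ.f 0 x
      rw [H.h_d_zero, map_sub, φ.comm_act])
    | n + 1, x => Prod.ext (φ.comm (n + 1) x) (by
      change φ.f (n + 1) (H.h (n + 1) (K.d (n + 1) x)) =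
        L.act γ (n + 1) (φ.f (n + 1) x) - φ.f (n + 1) x - L.d n (φ.f n (H.h n x))
      rw [← φ.comm, ← φ.comm_act, ← map_sub, ← map_sub, ← H.h_d_succ, add_sub_cancel_left])
  comm_act
    | g, 0, x => φ.comm_act g 0 x
    | g, n + 1, x => Prod.ext (φ.comm_act g (n + 1) x) (by
      change φ.f n (H.h n (K.act g (n + 1) x)) = L.act g n (φ.f n (H.h n x))
      rw [H.h_act, φ.comm_act])

/-- Homotopies for all `γ` lift morphisms to the Koszul complex. -/
def GHom.kosLift {K L : GComplex k G} (φ : GHom K L) (H : ∀ γ, ActHomotopy K γ) :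
    ∀ Γ : List G, GHom K (L.kos Γ)
  | [] => φ
  | γ :: Γ => (kosLift φ H Γ).fibLift (H γ)

/-- An invariant pairing `K ⊗ L → N[-d]`; only the components of total degree `d` matter. -/
structure GPairing (K L : GComplex k G) (N : Type u) [AddCommGroup N] [Module k N] (d : ℕ) where
  /-- The components. -/
  comp : ∀ i j, K.X i →ₗ[k] L.X j →ₗ[k] N
  comp_d : ∀ i j x y, i + 1 + j = d →
    comp (i + 1) j (K.d i x) y + (-1 : k) ^ i • comp i (j + 1) x (L.d j y) = 0
  comp_act : ∀ g i j x y, i + j = d → comp i j (K.act g i x) (L.act g j y) = comp i j x y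

namespace GPairing

variable {K L : GComplex k G} {N : Type u} [AddCommGroup N] [Module k N] {d : ℕ}

/-- The components of the pairing of fibres. -/
def fibComp (β : GPairing K L N d) (γ : G) : ∀ i j, K.fibX i →ₗ[k] L.fibX j →ₗ[k] N
  -- The total degree on fibres is d + 1, so this bidegree never occurs.
  | 0, 0 => 0
  | 0, j + 1 => (β.comp 0 j).compl₂ (LinearMap.snd k (L.X (j + 1)) (L.X j))
  -- The twist by γ in the second argument is forced by the identity β((γ - 1)x, γy) + β(x, (γ -
  -- 1)y) = 0, which follows from invariance and provides the cancellation in the Leibniz rule.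
  | i + 1, 0 => ((β.comp i 0).compl₂ (L.act γ 0)).comp (LinearMap.snd k (K.X (i + 1)) (K.X i))
  | i + 1, j + 1 =>
    ((β.comp i (j + 1)).compl₂ ((L.act γ (j + 1)).comp
      (LinearMap.fst k (L.X (j + 1)) (L.X j)))).comp (LinearMap.snd k (K.X (i + 1)) (K.X i)) +
    (-1 : k) ^ (i + 1) • ((β.comp (i + 1) j).compl₂
      (LinearMap.snd k (L.X (j + 1)) (L.X j))).comp (LinearMap.fst k (K.X (i + 1)) (K.X i))

lemma fibComp_succ_succ (β : GPairing K L N d) (γ : G) (i j : ℕ) (x : K.X (i + 1)) (x' : K.X i)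
    (y : L.X (j + 1)) (y' : L.X j) : β.fibComp γ (i + 1) (j + 1) (x, x') (y, y') =
      β.comp i (j + 1) x' (L.act γ (j + 1) y) + (-1 : k) ^ (i + 1) • β.comp (i + 1) j x y' := rfl

/-- The pairing of fibres. -/
def fib (β : GPairing K L N d) (γ : G) : GPairing (K.fib γ) (L.fib γ) N (d + 1) where
  comp := β.fibComp γ
  comp_d
    | 0, 0, (x : K.X 0), (y : L.X 0), h => by
      have e := β.comp_act γ 0 0 x y (by omega)
      change β.comp 0 0 (K.act γ 0 x - x) (L.act γ 0 y) +
        (-1 : k) ^ 0 • β.comp 0 0 x (L.act γ 0 y - y) = 0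
      simp only [map_sub, LinearMap.sub_apply, e, pow_zero, one_smul]
      abel
    | 0, j + 1, (x : K.X 0), (y, y'), h => by
      have e := β.comp_act γ 0 (j + 1) x y (by omega)
      have e' := β.comp_d 0 j x y' (by omega)
      change β.comp 0 (j + 1) (K.act γ 0 x - x) (L.act γ (j + 1) y) +
        (-1 : k) ^ (0 + 1) • β.comp (0 + 1) j (K.d 0 x) y' +
        (-1 : k) ^ 0 • β.comp 0 (j + 1) x (L.act γ (j + 1) y - y - L.d j y') = 0
      simp only [map_sub, LinearMap.sub_apply, e, pow_zero, one_smul, zero_add, pow_one,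
        neg_smul] at e' ⊢
      rw [eq_neg_of_add_eq_zero_left e']
      abel
    | i + 1, 0, (x, x'), (y : L.X 0), h => by
      have e := β.comp_act γ (i + 1) 0 x y (by omega)
      have e' : _ + (-1 : k) ^ i • β.comp i 1 x' (L.d 0 (L.act γ 0 y)) = 0 :=
        β.comp_d i 0 x' (L.act γ 0 y) (by omega)
      rw [← L.act_d] at e'
      change β.comp (i + 1) 0 (K.act γ (i + 1) x - x - K.d i x') (L.act γ 0 y) +
        (-1 : k) ^ (i + 1) • (β.comp i 1 x' (L.act γ 1 (L.d 0 y)) +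
          (-1 : k) ^ (i + 1) • β.comp (i + 1) 0 x (L.act γ 0 y - y)) = 0
      simp only [map_sub, LinearMap.sub_apply, e, smul_add, smul_smul, ← pow_add,
        Even.neg_one_pow ⟨i + 1, rfl⟩, one_smul]
      rw [eq_neg_of_add_eq_zero_left e', pow_succ, mul_neg_one, neg_smul]
      abel
    | i + 1, j + 1, (x, x'), (y, y'), h => by
      have e := β.comp_act γ (i + 1) (j + 1) x y (by omega)
      have e' := β.comp_d i (j + 1) x' (L.act γ (j + 1) y) (by omega)
      have e'' := β.comp_d (i + 1) j x y' (by omega)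
      rw [← L.act_d] at e'
      change β.comp (i + 1) (j + 1) (K.act γ (i + 1) x - x - K.d i x') (L.act γ (j + 1) y) +
        (-1 : k) ^ (i + 1 + 1) • β.comp (i + 1 + 1) j (K.d (i + 1) x) y' +
        (-1 : k) ^ (i + 1) • (β.comp i (j + 1 + 1) x' (L.act γ (j + 1 + 1) (L.d (j + 1) y)) +
          (-1 : k) ^ (i + 1) • β.comp (i + 1) (j + 1) x (L.act γ (j + 1) y - y - L.d j y')) = 0
      simp only [map_sub, LinearMap.sub_apply, e, smul_add, smul_smul, ← pow_add,
        Even.neg_one_pow ⟨i + 1, rfl⟩, one_smul]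
      have e3 : (-1 : k) ^ (i + 1 + 1) • β.comp (i + 1 + 1) j (K.d (i + 1) x) y' =
          β.comp (i + 1) (j + 1) x (L.d j y') := by
        rw [eq_neg_of_add_eq_zero_left e'', smul_neg, smul_smul, ← pow_add,
          Odd.neg_one_pow ⟨i + 1, by ring⟩, neg_smul, one_smul, neg_neg]
      rw [eq_neg_of_add_eq_zero_left e', e3, pow_succ, mul_neg_one, neg_smul]
      abel
  comp_act
    | g, 0, 0, _, _, _ => rfl
    | g, 0, j + 1, x, (y, y'), h => β.comp_act g 0 j x y' (by omega)
    | g, i + 1, 0, (x, x'), (y : L.X 0), h => by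
      change β.comp i 0 (K.act g i x') (L.act γ 0 (L.act g 0 y)) = β.comp i 0 x' (L.act γ 0 y)
      rw [L.act_comm, β.comp_act _ _ _ _ _ (by omega)]
    | g, i + 1, j + 1, (x, x'), (y, y'), h => by
      change β.comp i (j + 1) (K.act g i x') (L.act γ (j + 1) (L.act g (j + 1) y)) +
        (-1 : k) ^ (i + 1) • β.comp (i + 1) j (K.act g (i + 1) x) (L.act g j y') = _
      rw [L.act_comm, β.comp_act _ _ _ _ _ (by omega), β.comp_act _ _ _ _ _ (by omega)]
      rfl

/-- The pairing of Koszul complexes. -/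
def kos (β : GPairing K L N d) : ∀ Γ : List G, GPairing (K.kos Γ) (L.kos Γ) N (d + Γ.length)
  | [] => β
  | γ :: Γ => (kos β Γ).fib γ

/-- Perfectness in every degree. -/
structure IsTermPerfect (β : GPairing K L N d) : Prop where
  left : ∀ i j, i + j = d → Function.Bijective (β.comp i j)
  right : ∀ i j, i + j = d → Function.Bijective (β.comp i j).flip
  boundedL : ∀ i, d < i → Subsingleton (K.X i)
  boundedR : ∀ i, d < i → Subsingleton (L.X i)

end GPairing

end GComplexes

end

end PolystableDuality

namespace PolystableDuality

open CategoryTheory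

noncomputable section

/-! ### Perfectness, exactness and long exact sequences for Koszul complexes -/

section GComplexes

variable {k : Type u} [CommRing k] {G : Type u} [Group G]

namespace GPairing

variable {K L : GComplex k G} {N : Type u} [AddCommGroup N] [Module k N] {d : ℕ}

/-- The fibre pairing matches the first component on one side with the second on the other: one
block is β twisted by the automorphism γ, the other is β up to sign, so perfectness reduces to that
of β. In the extreme bidegrees one of the components lies above degree `d`, which is why the bounds
are carried along. -/
lemma IsTermPerfect.fib {β : GPairing K L N d} (h : β.IsTermPerfect) (γ : G) :
    (β.fib γ).IsTermPerfect where
  left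
    | 0, 0, e => by omega
    | 0, j + 1, e => by
      obtain rfl : j = d := by omega
      have hs := h.boundedR (j + 1) (by omega)
      refine ⟨(injective_iff_map_eq_zero _).2 fun (x : K.X 0) hx => ?_, fun f => ?_⟩
      · exact (injective_iff_map_eq_zero _).1 (h.left 0 j (by omega)).1 x
          (LinearMap.ext fun y' => LinearMap.congr_fun hx ((0 : L.X (j + 1)), y'))
      · obtain ⟨x, hx⟩ := (h.left 0 j (by omega)).2 (f.comp (LinearMap.inr k (L.X (j + 1)) (L.X j)))
        refine ⟨x, LinearMap.ext fun (y, y') => ?_⟩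
        rw [Subsingleton.elim y 0]
        exact LinearMap.congr_fun hx y'
    | i + 1, 0, e => by
      obtain rfl : i = d := by omega
      have hs := h.boundedL (i + 1) (by omega)
      refine ⟨(injective_iff_map_eq_zero _).2 fun (x, x') hx => ?_, fun f => ?_⟩
      · refine Prod.ext (Subsingleton.elim _ _) ?_
        refine (injective_iff_map_eq_zero _).1 (h.left i 0 (by omega)).1 x'
          (LinearMap.ext fun y => ?_)
        obtain ⟨y, rfl⟩ := (L.act_bijective γ 0).2 y
        exact LinearMap.congr_fun hx y
      · obtain ⟨x', hx⟩ := (h.left i 0 (by omega)).2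
          ((show L.X 0 →ₗ[k] N from f).comp (L.act γ⁻¹ 0))
        refine ⟨((0 : K.X (i + 1)), x'), LinearMap.ext fun (y : L.X 0) => ?_⟩
        refine (LinearMap.congr_fun hx (L.act γ 0 y)).trans ?_
        exact congrArg f (L.act_inv' γ 0 y)
    | i + 1, j + 1, e => by
      refine ⟨(injective_iff_map_eq_zero _).2 fun (x, x') hx => ?_, fun f => ?_⟩
      · have h1 : x' = 0 := by
          refine (injective_iff_map_eq_zero _).1 (h.left i (j + 1) (by omega)).1 x'
            (LinearMap.ext fun y => ?_)
          obtain ⟨y, rfl⟩ := (L.act_bijective γ (j + 1)).2 y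
          have : β.fibComp γ (i + 1) (j + 1) (x, x') (y, (0 : L.X j)) = 0 :=
            LinearMap.congr_fun hx (y, (0 : L.X j))
          simpa using (β.fibComp_succ_succ γ i j x x' y 0).symm.trans this
        have h2 : x = 0 := by
          refine (injective_iff_map_eq_zero _).1 (h.left (i + 1) j (by omega)).1 x
            (LinearMap.ext fun y' => ?_)
          have : β.fibComp γ (i + 1) (j + 1) (x, x') ((0 : L.X (j + 1)), y') = 0 :=
            LinearMap.congr_fun hx ((0 : L.X (j + 1)), y')
          rw [β.fibComp_succ_succ] at this
          simp only [map_zero, zero_add] at this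
          rcases neg_one_pow_eq_or k (i + 1) with hh | hh <;> simpa [hh] using this
        rw [h1, h2]; rfl
      · obtain ⟨x', hx'⟩ := (h.left i (j + 1) (by omega)).2
          ((f.comp (LinearMap.inl k (L.X (j + 1)) (L.X j))).comp (L.act γ⁻¹ (j + 1)))
        obtain ⟨x, hx⟩ := (h.left (i + 1) j (by omega)).2
          ((-1 : k) ^ (i + 1) • f.comp (LinearMap.inr k (L.X (j + 1)) (L.X j)))
        refine ⟨(x, x'), LinearMap.ext fun (y, y') => ?_⟩
        refine (β.fibComp_succ_succ γ i j x x' y y').trans ?_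
        rw [hx, hx', LinearMap.smul_apply, smul_smul, ← pow_add, Even.neg_one_pow ⟨i + 1, rfl⟩,
          one_smul]
        simp only [LinearMap.comp_apply, L.act_inv']
        exact (map_add (show L.X (j + 1) × L.X j →ₗ[k] N from f) (y, 0) (0, y')).symm.trans
          (congrArg f (Prod.ext (add_zero _) (zero_add _)))
  right
    | 0, 0, e => by omega
    | 0, j + 1, e => by
      obtain rfl : j = d := by omega
      have hs := h.boundedR (j + 1) (by omega)
      refine ⟨(injective_iff_map_eq_zero _).2 fun (y, y') hx => ?_, fun f => ?_⟩
      · refine Prod.ext (Subsingleton.elim _ _) ?_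
        exact (injective_iff_map_eq_zero _).1 (h.right 0 j (by omega)).1 y'
          (LinearMap.ext fun x => LinearMap.congr_fun hx x)
      · obtain ⟨y', hx⟩ := (h.right 0 j (by omega)).2 f
        exact ⟨((0 : L.X (j + 1)), y'), LinearMap.ext fun x => LinearMap.congr_fun hx x⟩
    | i + 1, 0, e => by
      obtain rfl : i = d := by omega
      have hs := h.boundedL (i + 1) (by omega)
      refine ⟨(injective_iff_map_eq_zero _).2 fun (y : L.X 0) hx => ?_, fun f => ?_⟩
      · refine (injective_iff_map_eq_zero _).1 (L.act_bijective γ 0).1 y ?_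
        exact (injective_iff_map_eq_zero _).1 (h.right i 0 (by omega)).1 _
          (LinearMap.ext fun x' => LinearMap.congr_fun hx ((0 : K.X (i + 1)), x'))
      · obtain ⟨y, hx⟩ := (h.right i 0 (by omega)).2 (f.comp (LinearMap.inr k (K.X (i + 1)) (K.X
          i)))
        obtain ⟨y, rfl⟩ := (L.act_bijective γ 0).2 y
        refine ⟨y, LinearMap.ext fun (x, x') => ?_⟩
        rw [Subsingleton.elim x 0]
        exact LinearMap.congr_fun hx x'
    | i + 1, j + 1, e => by
      refine ⟨(injective_iff_map_eq_zero _).2 fun (y, y') hx => ?_, fun f => ?_⟩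
      · have h1 : y = 0 := by
          refine (injective_iff_map_eq_zero _).1 (L.act_bijective γ (j + 1)).1 y ?_
          refine (injective_iff_map_eq_zero _).1 (h.right i (j + 1) (by omega)).1 _
            (LinearMap.ext fun x' => ?_)
          have : β.fibComp γ (i + 1) (j + 1) ((0 : K.X (i + 1)), x') (y, y') = 0 :=
            LinearMap.congr_fun hx ((0 : K.X (i + 1)), x')
          simpa using (β.fibComp_succ_succ γ i j 0 x' y y').symm.trans this
        have h2 : y' = 0 := by
          refine (injective_iff_map_eq_zero _).1 (h.right (i + 1) j (by omega)).1 y'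
            (LinearMap.ext fun x => ?_)
          have : β.fibComp γ (i + 1) (j + 1) (x, (0 : K.X i)) (y, y') = 0 :=
            LinearMap.congr_fun hx (x, (0 : K.X i))
          rw [β.fibComp_succ_succ] at this
          simp only [map_zero, zero_add, LinearMap.zero_apply] at this
          rcases neg_one_pow_eq_or k (i + 1) with hh | hh <;> simpa [hh] using this
        rw [h1, h2]; rfl
      · obtain ⟨y, hx'⟩ := (h.right i (j + 1) (by omega)).2
          (f.comp (LinearMap.inr k (K.X (i + 1)) (K.X i)))
        obtain ⟨y, rfl⟩ := (L.act_bijective γ (j + 1)).2 y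
        obtain ⟨y', hx⟩ := (h.right (i + 1) j (by omega)).2
          ((-1 : k) ^ (i + 1) • f.comp (LinearMap.inl k (K.X (i + 1)) (K.X i)))
        refine ⟨(y, y'), LinearMap.ext fun (x, x') => ?_⟩
        refine (β.fibComp_succ_succ γ i j x x' y y').trans ?_
        have e1 := LinearMap.congr_fun hx x
        have e2 := LinearMap.congr_fun hx' x'
        rw [LinearMap.flip_apply] at e1 e2
        rw [e1, e2, LinearMap.smul_apply, smul_smul, ← pow_add, Even.neg_one_pow ⟨i + 1, rfl⟩,
          one_smul]
        exact (map_add (show K.X (i + 1) × K.X i →ₗ[k] N from f) (0, x') (x, 0)).symm.trans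
          (congrArg f (Prod.ext (zero_add _) (add_zero _)))
  boundedL
    | 0, e => by omega
    | i + 1, e => by
      have := h.boundedL (i + 1) (by omega)
      have := h.boundedL i (by omega)
      exact inferInstanceAs (Subsingleton (K.X (i + 1) × K.X i))
  boundedR
    | 0, e => by omega
    | i + 1, e => by
      have := h.boundedR (i + 1) (by omega)
      have := h.boundedR i (by omega)
      exact inferInstanceAs (Subsingleton (L.X (i + 1) × L.X i))

lemma IsTermPerfect.kos {β : GPairing K L N d} (h : β.IsTermPerfect) :
    ∀ Γ : List G, (β.kos Γ).IsTermPerfect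
  | [] => h
  | γ :: Γ => (kos h Γ).fib γ

section DegZero

variable {M M' : Type u} [AddCommGroup M] [Module k M] [AddCommGroup M'] [Module k M']
  (hG : ∀ a b : G, a * b = b * a) {ρ : G →* Module.End k M} {σ : G →* Module.End k M'}

/-- The components of the pairing of complexes in degree zero. -/
def degZeroComp (b : M →ₗ[k] M' →ₗ[k] N) : ∀ i j,
    (GComplex.degZero hG ρ).X i →ₗ[k] (GComplex.degZero hG σ).X j →ₗ[k] N
  | 0, 0 => b
  | _, _ => 0

/-- An invariant bilinear map, as a pairing of complexes in degree zero. -/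
def degZero (b : M →ₗ[k] M' →ₗ[k] N) (hb : ∀ g x y, b (ρ g x) (σ g y) = b x y) :
    GPairing (GComplex.degZero hG ρ) (GComplex.degZero hG σ) N 0 where
  comp := degZeroComp hG b
  comp_d _ _ _ _ h := by omega
  comp_act
    | g, 0, 0, x, y, _ => hb g x y
    | _, 0, _ + 1, _, _, h => by omega
    | _, _ + 1, _, _, _, h => by omega

lemma degZero_isTermPerfect (b : M →ₗ[k] M' →ₗ[k] N) (hb : ∀ g x y, b (ρ g x) (σ g y) = b x y)
    (h1 : Function.Bijective b) (h2 : Function.Bijective b.flip) :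
    (degZero hG b hb).IsTermPerfect where
  left
    | 0, 0, _ => h1
    | 0, _ + 1, h => by omega
    | _ + 1, _, h => by omega
  right
    | 0, 0, _ => h2
    | 0, _ + 1, h => by omega
    | _ + 1, _, h => by omega
  boundedL
    | 0, h => by omega
    | _ + 1, _ => inferInstanceAs (Subsingleton PUnit)
  boundedR
    | 0, h => by omega
    | _ + 1, _ => inferInstanceAs (Subsingleton PUnit)

end DegZero

end GPairing

namespace GComplex

variable (K : GComplex k G)

/-- The terms of the Koszul complex in degree zero. -/
def kosZero : ∀ Γ : List G, (K.kos Γ).X 0 ≃ₗ[k] K.X 0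
  | [] => LinearEquiv.refl k _
  | _ :: Γ => kosZero Γ

lemma kosZero_act (g : G) : ∀ (Γ : List G) (x : (K.kos Γ).X 0),
    K.kosZero Γ ((K.kos Γ).act g 0 x) = K.act g 0 (K.kosZero Γ x)
  | [], _ => rfl
  | _ :: Γ, x => kosZero_act g Γ x

lemma kosZero_cons_d (γ : G) (Γ : List G) (x : (K.kos Γ).X 0) :
    (K.kos (γ :: Γ)).d 0 x = ((K.kos Γ).d 0 x, (K.kos Γ).act γ 0 x - x) := rfl

/-- Each further generator adds the equation γx = x, so the cocycles of degree zero are the common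
invariants. -/
lemma kos_d_zero_iff (hK : ∀ x : K.X 0, K.d 0 x = 0) : ∀ (Γ : List G) (x : (K.kos Γ).X 0),
    (K.kos Γ).d 0 x = 0 ↔ ∀ γ ∈ Γ, K.act γ 0 (K.kosZero Γ x) = K.kosZero Γ x
  | [], x => ⟨fun _ γ h => by simp at h, fun _ => hK x⟩
  | γ :: Γ, (x : (K.kos Γ).X 0) => by
    have ih := kos_d_zero_iff hK Γ x
    refine (Prod.ext_iff (y := ((0 : (K.kos Γ).X 1), (0 : (K.kos Γ).X 0)))).trans ?_
    rw [kosZero_cons_d]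
    dsimp only
    rw [ih, List.forall_mem_cons, and_comm, sub_eq_zero, ← (K.kosZero Γ).injective.eq_iff,
      kosZero_act]
    rfl

/-- In the long exact sequence of the fibre, if K has no cohomology in positive degrees then the
only possible positive cohomology of the fibre is the cokernel of γ - 1 on H^0(K), and `h0` says
that it vanishes. -/
lemma fib_exactSucc (γ : G) (h : ∀ n, K.ExactSucc n)
    (h0 : ∀ x : K.X 0, K.d 0 x = 0 → ∃ y, K.d 0 y = 0 ∧ K.act γ 0 y - y = x) :
    ∀ n, (K.fib γ).ExactSucc n
  | 0 => fun (x, x') hx => by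
    obtain ⟨hx1, hx2⟩ := Prod.ext_iff.1 hx
    change K.d 1 x = 0 at hx1
    change K.act γ 1 x - x - K.d 0 x' = 0 at hx2
    obtain ⟨w, rfl⟩ := h 0 x hx1
    obtain ⟨s, hs, hs'⟩ := h0 (x' - (K.act γ 0 w - w)) (by
      rw [map_sub, map_sub, ← K.act_d, ← neg_eq_zero, ← hx2]; abel)
    refine ⟨(w + s : K.X 0), Prod.ext ?_ ?_⟩
    · change K.d 0 (w + s) = _
      rw [map_add, hs, add_zero]
    · change K.act γ 0 (w + s) - (w + s) = x'
      rw [map_add, eq_add_of_sub_eq hs']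
      abel
  | n + 1 => fun (x, x') hx => by
    obtain ⟨hx1, hx2⟩ := Prod.ext_iff.1 hx
    change K.d (n + 2) x = 0 at hx1
    change K.act γ (n + 2) x - x - K.d (n + 1) x' = 0 at hx2
    obtain ⟨w, rfl⟩ := h (n + 1) x hx1
    obtain ⟨v, hv⟩ := h n (x' - (K.act γ (n + 1) w - w)) (by
      rw [map_sub, map_sub, ← K.act_d, ← neg_eq_zero, ← hx2]; abel)
    refine ⟨((w, -v) : K.X (n + 1) × K.X n), Prod.ext rfl ?_⟩
    change K.act γ (n + 1) w - w - K.d n (-v) = x'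
    rw [map_neg, hv]
    abel

/-- The head of the list is the last generator to be applied, so the condition concerns γ - 1 on the
elements fixed by the generators behind it; hence the quantification over suffixes. -/
lemma kos_exactSucc (hK : ∀ x : K.X 0, K.d 0 x = 0) (hK' : ∀ n, Subsingleton (K.X (n + 1))) :
    ∀ Γ : List G, (∀ γ Γ', γ :: Γ' <:+ Γ → ∀ x : K.X 0, (∀ γ' ∈ Γ', K.act γ' 0 x = x) →
      ∃ y, (∀ γ' ∈ Γ', K.act γ' 0 y = y) ∧ K.act γ 0 y - y = x) → ∀ n, (K.kos Γ).ExactSucc n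
  | [], _ => fun n x _ => ⟨0, (hK' n).elim _ _⟩
  | γ :: Γ, h => by
    refine (K.kos Γ).fib_exactSucc γ
      (kos_exactSucc hK hK' Γ fun γ' Γ' hs => h γ' Γ' (hs.trans (List.suffix_cons γ Γ))) ?_
    intro x hx
    obtain ⟨y, hy, hy'⟩ := h γ Γ (List.suffix_refl _) _ ((K.kos_d_zero_iff hK Γ x).1 hx)
    obtain ⟨y, rfl⟩ := (K.kosZero Γ).surjective y
    refine ⟨y, (K.kos_d_zero_iff hK Γ y).2 hy, (K.kosZero Γ).injective ?_⟩
    rw [map_sub, kosZero_act, hy']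

/-- Coboundaries. -/
def IsBdry : ∀ n, K.X n → Prop
  | 0, x => x = 0
  | n + 1, x => ∃ y, K.d n y = x

variable {K}

lemma IsBdry.d_eq_zero : ∀ {n} {x : K.X n}, K.IsBdry n x → K.d n x = 0
  | 0, _, h => by rw [show _ = _ from h, map_zero]
  | _ + 1, _, ⟨y, h⟩ => by rw [← h, K.d_d]

lemma IsBdry.map {L : GComplex k G} (φ : GHom K L) :
    ∀ {n} {x : K.X n}, K.IsBdry n x → L.IsBdry n (φ.f n x)
  | 0, _, h => by rw [show _ = _ from h, map_zero]; rfl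
  | _ + 1, _, ⟨y, h⟩ => ⟨φ.f _ y, by rw [← φ.comm, h]⟩

lemma IsBdry.lift {L : GComplex k G} (φ : GHom K L) (hφ : ∀ n, Function.Surjective (φ.f n)) :
    ∀ {n} {x : L.X n}, L.IsBdry n x → ∃ y, K.IsBdry n y ∧ φ.f n y = x
  | 0, _, h => ⟨0, rfl, by rw [show _ = _ from h, map_zero]⟩
  | n + 1, _, ⟨y, h⟩ => by
    obtain ⟨z, rfl⟩ := hφ n y
    exact ⟨K.d n z, ⟨z, rfl⟩, by rw [φ.comm, h]⟩

end GComplex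

namespace GHom

/-- Injectivity on cohomology in degree `n`. -/
def InjAt {K L : GComplex k G} (φ : GHom K L) (n : ℕ) : Prop :=
  ∀ x, K.d n x = 0 → L.IsBdry n (φ.f n x) → K.IsBdry n x

/-- Surjectivity on cohomology in degree `n`. -/
def SurjAt {K L : GComplex k G} (φ : GHom K L) (n : ℕ) : Prop :=
  ∀ z, L.d n z = 0 → ∃ x, K.d n x = 0 ∧ L.IsBdry n (z - φ.f n x)

/-- Two composable morphisms which form a short exact sequence in every degree. -/
structure IsShortExact {K₁ K₂ K₃ : GComplex k G} (i : GHom K₁ K₂) (p : GHom K₂ K₃) : Prop where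
  inj : ∀ n, Function.Injective (i.f n)
  exact : ∀ n, Function.Exact (i.f n) (p.f n)
  surj : ∀ n, Function.Surjective (p.f n)

lemma IsShortExact.fib {K₁ K₂ K₃ : GComplex k G} {i : GHom K₁ K₂} {p : GHom K₂ K₃}
    (h : IsShortExact i p) (γ : G) : IsShortExact (i.fib γ) (p.fib γ) where
  inj
    | 0 => h.inj 0
    | n + 1 => Function.Injective.prodMap (h.inj (n + 1)) (h.inj n)
  exact
    | 0 => h.exact 0
    | n + 1 => fun (x, x') => by
      constructor
      · intro e
        obtain ⟨e1, e2⟩ := Prod.ext_iff.1 e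
        obtain ⟨y, hy⟩ := (h.exact (n + 1) x).1 e1
        obtain ⟨y', hy'⟩ := (h.exact n x').1 e2
        exact ⟨(y, y'), Prod.ext hy hy'⟩
      · rintro ⟨⟨y, y'⟩, e⟩
        obtain ⟨e1, e2⟩ := Prod.ext_iff.1 e
        exact Prod.ext ((h.exact (n + 1) x).2 ⟨y, e1⟩) ((h.exact n x').2 ⟨y', e2⟩)
  surj
    | 0 => h.surj 0
    | n + 1 => Function.Surjective.prodMap (h.surj (n + 1)) (h.surj n)

lemma IsShortExact.kos {K₁ K₂ K₃ : GComplex k G} {i : GHom K₁ K₂} {p : GHom K₂ K₃}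
    (h : IsShortExact i p) : ∀ Γ : List G, IsShortExact (i.kos Γ) (p.kos Γ)
  | [] => h
  | γ :: Γ => (kos h Γ).fib γ

variable {K₁ K₂ K₃ L₁ L₂ L₃ : GComplex k G} {i : GHom K₁ K₂} {p : GHom K₂ K₃}
  {j : GHom L₁ L₂} {q : GHom L₂ L₃} {φ₁ : GHom K₁ L₁} {φ₂ : GHom K₂ L₂} {φ₃ : GHom K₃ L₃}

/-- Dimension shifting, as in the four lemma: a class in degree n + 1 of the sub-object becomes a
boundary in the middle term, hence comes from degree n of the quotient, where injectivity is known,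
up to classes from the middle term, where surjectivity is known. -/
lemma injAt_succ (hK : IsShortExact i p) (hL : IsShortExact j q)
    (hi : ∀ n x, φ₂.f n (i.f n x) = j.f n (φ₁.f n x))
    (hp : ∀ n x, φ₃.f n (p.f n x) = q.f n (φ₂.f n x)) (n : ℕ)
    (h2 : K₂.ExactSucc n) (h2' : φ₂.SurjAt n) (h3 : φ₃.InjAt n) : φ₁.InjAt (n + 1) := by
  rintro f hf ⟨w, hw⟩
  obtain ⟨e, he⟩ := h2 (i.f _ f) (by rw [← i.comm, hf, map_zero])
  -- The primitives of f chosen in K₂ and in L₁ differ by a cocycle of L₂; correcting e by a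
  -- preimage c of its class makes p(e - c) a cocycle whose image in L₃ is a boundary.
  obtain ⟨c, hc, hc'⟩ := h2' (φ₂.f n e - j.f n w) (by
    rw [map_sub, ← φ₂.comm, ← j.comm, he, hw, hi, sub_self])
  have hb : K₃.IsBdry n (p.f n (e - c)) := by
    refine h3 _ ?_ ?_
    · rw [← p.comm, map_sub, hc, sub_zero, he]
      exact (hK.exact _ _).2 ⟨f, rfl⟩
    · have := GComplex.IsBdry.map q hc'
      have e0 : q.f n (j.f n w) = 0 := (hL.exact _ _).2 ⟨w, rfl⟩
      rwa [map_sub, map_sub, e0, sub_zero, ← map_sub, ← map_sub, ← hp] at this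
  obtain ⟨b, hb, hb'⟩ := GComplex.IsBdry.lift p hK.surj hb
  obtain ⟨v, hv⟩ := (hK.exact n (e - c - b)).1 (by rw [map_sub, hb', sub_self])
  refine ⟨v, hK.inj _ ?_⟩
  rw [i.comm, hv, map_sub, map_sub, hc, hb.d_eq_zero, he, sub_zero, sub_zero]

/-- The other half of the shift: push z into the acyclic middle term, take a primitive, lift its
class in the quotient by surjectivity in degree n, and go back by the connecting map. -/
lemma surjAt_succ (hK : IsShortExact i p) (hL : IsShortExact j q)
    (hi : ∀ n x, φ₂.f n (i.f n x) = j.f n (φ₁.f n x))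
    (hp : ∀ n x, φ₃.f n (p.f n x) = q.f n (φ₂.f n x)) (n : ℕ)
    (h2 : L₂.ExactSucc n) (h3 : φ₃.SurjAt n) : φ₁.SurjAt (n + 1) := by
  intro z hz
  obtain ⟨w, hw⟩ := h2 (j.f _ z) (by rw [← j.comm, hz, map_zero])
  obtain ⟨e', he', hb⟩ := h3 (q.f n w) (by
    rw [← q.comm, hw]; exact (hL.exact _ _).2 ⟨z, rfl⟩)
  obtain ⟨e, rfl⟩ := hK.surj n e'
  obtain ⟨b, hb, hb'⟩ := GComplex.IsBdry.lift q hL.surj hb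
  obtain ⟨v, hv⟩ := (hL.exact n (w - φ₂.f n e - b)).1 (by
    rw [map_sub, map_sub, hb', ← hp, sub_self])
  obtain ⟨f, hf⟩ := (hK.exact (n + 1) (K₂.d n e)).1 (by rw [p.comm, he'])
  refine ⟨f, hK.inj _ ?_, v, hL.inj _ ?_⟩
  · rw [i.comm, hf, K₂.d_d, map_zero]
  · rw [j.comm, hv, map_sub, map_sub, map_sub, hb.d_eq_zero, hw, ← hi, hf, φ₂.comm, sub_zero]

end GHom

end GComplexes

end

end PolystableDuality

namespace PolystableDuality

open CategoryTheory

noncomputable section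

/-! ### Faces, prism operators and cup products of homogeneous cochains -/

section ModuleCochains

set_option linter.unusedSectionVars false

variable {k : Type u} [CommRing k] {G : Type u} [Group G]
  {M : Type u} [AddCommGroup M] [Module k M] {M' : Type u} [AddCommGroup M'] [Module k M']
  {N : Type u} [AddCommGroup N] [Module k N]

variable (k G M) in
/-- The alternating sum over the faces, on arbitrary functions with values in a module. -/
def faceD (n : ℕ) : ((Fin n → G) → M) →ₗ[k] ((Fin (n + 1) → G) → M) where
  toFun f x := ∑ i : Fin (n + 1), (-1 : k) ^ (i : ℕ) • f (fun s => x (i.succAbove s))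
  map_add' f g := by
    funext x
    simp only [Pi.add_apply, smul_add, Finset.sum_add_distrib]
  map_smul' c f := by
    funext x
    simp only [Pi.smul_apply, RingHom.id_apply, Finset.smul_sum, smul_comm c]

lemma faceD_apply (n : ℕ) (f : (Fin n → G) → M) (x : Fin (n + 1) → G) :
    faceD k G M n f x =
      ∑ i : Fin (n + 1), (-1 : k) ^ (i : ℕ) • f (fun s => x (i.succAbove s)) := rfl

lemma faceD_zero (f : (Fin 0 → G) → M) (x : Fin 1 → G) (y : Fin 0 → G) :
    faceD k G M 0 f x = f y := by
  rw [faceD_apply, Fin.sum_univ_succ, Finset.univ_eq_empty, Finset.sum_empty, add_zero]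
  simp only [Fin.val_zero, pow_zero, one_smul]
  exact congrArg f (Subsingleton.elim _ _)

/-- Fixing the first argument. -/
def fixHead {n : ℕ} (F : (Fin (n + 1) → G) → M) (a : G) : (Fin n → G) → M :=
  fun y => F (Fin.cons a y)

/-- Splitting off the face that drops the first argument gives the recursion on which all the later
inductions run; signs then never have to be handled globally. -/
lemma faceD_cons (n : ℕ) (f : (Fin (n + 1) → G) → M) (a : G) (y : Fin (n + 1) → G) :
    faceD k G M (n + 1) f (Fin.cons a y) = f y - faceD k G M n (fixHead f a) y := by
  rw [faceD_apply, Fin.sum_univ_succ, faceD_apply]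
  simp only [Fin.val_zero, pow_zero, one_smul, Fin.val_succ, pow_succ, mul_neg_one, neg_smul,
    Finset.sum_neg_distrib, Fin.zero_succAbove, Fin.cons_succ]
  rw [sub_eq_add_neg]
  congr 2
  refine Finset.sum_congr rfl fun i _ => congrArg _ (congrArg f (funext fun s => ?_))
  refine Fin.cases ?_ (fun s => ?_) s
  · simp
  · simp

lemma faceD_translate (n : ℕ) (f : (Fin n → G) → M) (g : G) (x : Fin (n + 1) → G) :
    faceD k G M n f (fun s => g * x s) = faceD k G M n (fun y => f (fun s => g * y s)) x := rfl

lemma faceD_map (n : ℕ) (f : (Fin n → G) → M) (φ : M →ₗ[k] M') (x : Fin (n + 1) → G) :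
    faceD k G M' n (fun y => φ (f y)) x = φ (faceD k G M n f x) := by
  simp only [faceD_apply, map_sum, map_smul]

lemma faceD_faceD : ∀ (n : ℕ) (f : (Fin n → G) → M),
    faceD k G M (n + 1) (faceD k G M n f) = 0
  | 0, f => by
    funext x
    obtain ⟨a, y, rfl⟩ : ∃ a y, x = Fin.cons a y := ⟨x 0, Fin.tail x, (Fin.cons_self_tail x).symm⟩
    rw [faceD_cons, faceD_zero _ _ Fin.elim0, faceD_zero _ _ Fin.elim0, fixHead,
      faceD_zero _ _ Fin.elim0, sub_self]
    rfl
  | n + 1, f => by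
    funext x
    obtain ⟨a, y, rfl⟩ : ∃ a y, x = Fin.cons a y := ⟨x 0, Fin.tail x, (Fin.cons_self_tail x).symm⟩
    have : fixHead (faceD k G M (n + 1) f) a = f - faceD k G M n (fixHead f a) :=
      funext fun y => faceD_cons n f a y
    rw [faceD_cons, this, map_sub, faceD_faceD n, sub_zero, sub_self]
    rfl

variable (k M) in
/-- The prism operator for the translation by `γ`. -/
def prism (γ : G) : ∀ n : ℕ, ((Fin (n + 1) → G) → M) →ₗ[k] ((Fin n → G) → M)
  | 0 => 0
  | n + 1 =>
    -- Unfolded, this is Σ (-1)^i F(x_0, …, x_i, γx_i, …, γx_n), the usual triangulation of the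
    -- prism between x and γx.
    { toFun := fun F x => F (Fin.cons (x 0) (fun s => γ * x s)) -
        prism γ n (fixHead F (x 0)) (Fin.tail x)
      map_add' := fun F F' => by
        funext x
        have : fixHead (F + F') (x 0) = fixHead F (x 0) + fixHead F' (x 0) := rfl
        rw [this, map_add]
        simp only [Pi.add_apply]
        abel
      map_smul' := fun c F => by
        funext x
        have : fixHead (c • F) (x 0) = c • fixHead F (x 0) := rfl
        rw [this, map_smul]
        simp only [Pi.smul_apply, smul_sub, RingHom.id_apply] }

lemma prism_cons (γ : G) (n : ℕ) (F : (Fin (n + 2) → G) → M) (a : G) (y : Fin n → G) :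
    prism k M γ (n + 1) F (Fin.cons a y) =
      F (Fin.cons a (Fin.cons (γ * a) (fun s => γ * y s))) -
        prism k M γ n (fixHead F a) y := by
  have : (fun s => γ * (Fin.cons a y : Fin (n + 1) → G) s) =
      Fin.cons (γ * a) (fun s => γ * y s) := by
    funext s
    refine Fin.cases ?_ (fun s => ?_) s <;> simp
  rw [← this]
  rfl

lemma mul_cons (γ a : G) {n : ℕ} (y : Fin n → G) :
    (fun s => γ * (Fin.cons a y : Fin (n + 1) → G) s) = Fin.cons (γ * a) (fun s => γ * y s) := by
  funext s
  refine Fin.cases ?_ (fun s => ?_) s <;> simp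

/-- This is the homotopy between the identity and translation by γ. After splitting off the first
argument on both sides, the terms in which it stays fixed are governed by the same formula one
degree lower, and the others cancel in pairs. -/
lemma faceD_prism : ∀ (n : ℕ) (γ : G) (F : (Fin (n + 1) → G) → M) (x : Fin (n + 1) → G),
    faceD k G M n (prism k M γ n F) x + prism k M γ (n + 1) (faceD k G M (n + 1) F) x =
      F (fun s => γ * x s) - F x
  | 0, γ, F, x => by
    obtain ⟨a, y, rfl⟩ : ∃ a y, x = Fin.cons a y := ⟨x 0, Fin.tail x, (Fin.cons_self_tail x).symm⟩
    rw [prism_cons, faceD_cons, mul_cons]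
    change faceD k G M 0 (0 : (Fin 0 → G) → M) _ + (_ - _ - 0) = _
    rw [map_zero, faceD_zero _ _ y, Pi.zero_apply, zero_add, sub_zero]
    rfl
  | n + 1, γ, F, x => by
    obtain ⟨a, y, rfl⟩ : ∃ a y, x = Fin.cons a y := ⟨x 0, Fin.tail x, (Fin.cons_self_tail x).symm⟩
    have e1 : fixHead (faceD k G M (n + 2) F) a = F - faceD k G M (n + 1) (fixHead F a) :=
      funext fun y => faceD_cons (n + 1) F a y
    have e2 : fixHead (prism k M γ (n + 1) F) a =
        (fun z => fixHead (fixHead F a) (γ * a) (fun s => γ * z s)) -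
          prism k M γ n (fixHead F a) :=
      funext fun y => prism_cons γ n F a y
    have ih := faceD_prism n γ (fixHead F a) y
    rw [prism_cons, faceD_cons, faceD_cons, e1, e2, map_sub, map_sub, mul_cons, faceD_cons,
      Pi.sub_apply, Pi.sub_apply, faceD_translate, eq_sub_of_add_eq ih]
    change _ - (_ - (F (Fin.cons a _) - F (Fin.cons a _) - _)) +
      (_ - (F (Fin.cons a _) - _) - _) = _
    abel

lemma prism_map (γ : G) (φ : M →ₗ[k] M') : ∀ (n : ℕ) (F : (Fin (n + 1) → G) → M) (x : Fin n → G),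
    prism k M' γ n (fun y => φ (F y)) x = φ (prism k M γ n F x)
  | 0, _, _ => (map_zero φ).symm
  | n + 1, F, x => by
    change φ _ - prism k M' γ n (fun y => φ (fixHead F (x 0) y)) _ = φ (_ - _)
    rw [prism_map γ φ n, map_sub]

/-- Both g and γ act by left multiplication, so they have to commute; this is where the
commutativity of the group enters. -/
lemma prism_translate (hG : ∀ a b : G, a * b = b * a) (γ g : G) :
    ∀ (n : ℕ) (F : (Fin (n + 1) → G) → M) (x : Fin n → G),
    prism k M γ n F (fun s => g * x s) = prism k M γ n (fun y => F (fun s => g * y s)) x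
  | 0, _, _ => rfl
  | n + 1, F, x => by
    obtain ⟨a, y, rfl⟩ : ∃ a y, x = Fin.cons a y := ⟨x 0, Fin.tail x, (Fin.cons_self_tail x).symm⟩
    have e : fixHead (fun z => F (fun s => g * z s)) a =
        fun z => fixHead F (g * a) (fun s => g * z s) :=
      funext fun z => congrArg F (mul_cons g a z)
    rw [mul_cons, prism_cons, prism_cons, e, ← prism_translate hG γ g n, mul_cons, mul_cons]
    simp only [← mul_assoc, hG γ g]

/-- The recursion turns the first argument into a parameter, so the induction runs over families
indexed by a space `Y`, which absorbs one factor of the group at each step. -/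
lemma prism_isLocallyConstant [TopologicalSpace G] [ContinuousMul G] (γ : G) :
    ∀ (n : ℕ) {Y : Type u} [TopologicalSpace Y] (F : Y → (Fin (n + 1) → G) → M),
    IsLocallyConstant (fun q : Y × (Fin (n + 1) → G) => F q.1 q.2) →
    IsLocallyConstant (fun q : Y × (Fin n → G) => prism k M γ n (F q.1) q.2)
  | 0, _, _, _, _ => IsLocallyConstant.const 0
  | n + 1, Y, _, F, h => by
    have h1 : IsLocallyConstant (fun q : Y × (Fin (n + 1) → G) =>
        F q.1 (Fin.cons (q.2 0) (fun s => γ * q.2 s))) :=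
      h.comp_continuous (f := fun q : Y × (Fin (n + 1) → G) =>
        ((q.1, Fin.cons (q.2 0) (fun s => γ * q.2 s)) : Y × (Fin (n + 2) → G))) (by
          refine continuous_fst.prodMk (continuous_pi fun s => ?_)
          refine Fin.cases ?_ (fun s => ?_) s
          · simp only [Fin.cons_zero]; fun_prop
          · simp only [Fin.cons_succ]; fun_prop)
    have h2 := prism_isLocallyConstant γ n (Y := Y × G) (fun q => fixHead (F q.1) q.2)
      (h.comp_continuous (f := fun q : (Y × G) × (Fin (n + 1) → G) =>
        ((q.1.1, Fin.cons q.1.2 q.2) : Y × (Fin (n + 2) → G))) (by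
          refine (by fun_prop : Continuous _).prodMk (continuous_pi fun s => ?_)
          refine Fin.cases ?_ (fun s => ?_) s
          · simp only [Fin.cons_zero]; fun_prop
          · simp only [Fin.cons_succ]; fun_prop))
    exact h1.sub (h2.comp_continuous (f := fun q : Y × (Fin (n + 1) → G) =>
      (((q.1, q.2 0), Fin.tail q.2) : (Y × G) × (Fin n → G))) (by
        refine (by fun_prop : Continuous _).prodMk (continuous_pi fun s => ?_)
        simp only [Fin.tail]; fun_prop))

/-- The cup product of arbitrary functions, with respect to a bilinear map. -/
def rawCup (b : M →ₗ[k] M' →ₗ[k] N) (i j n : ℕ) (h : i + j = n) (f : (Fin (i + 1) → G) → M)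
    (g : (Fin (j + 1) → G) → M') : (Fin (n + 1) → G) → N :=
  fun x => b (f (fun s => x ⟨s, by omega⟩)) (g (fun s => x ⟨i + s, by omega⟩))

lemma rawCup_cons (b : M →ₗ[k] M' →ₗ[k] N) (i j n : ℕ) (h : i + j = n)
    (f : (Fin (i + 2) → G) → M) (g : (Fin (j + 1) → G) → M') (a : G) :
    fixHead (rawCup b (i + 1) j (n + 1) (by omega) f g) a = rawCup b i j n h (fixHead f a) g := by
  funext y
  have e1 : (fun s : Fin (i + 2) => (Fin.cons a y : Fin (n + 2) → G) ⟨s, by omega⟩) =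
      Fin.cons a (fun s : Fin (i + 1) => y ⟨s, by omega⟩) := by
    funext s
    refine Fin.cases ?_ (fun s => ?_) s
    · rfl
    · rfl
  have e2 : (fun s : Fin (j + 1) => (Fin.cons a y : Fin (n + 2) → G) ⟨i + 1 + s, by omega⟩) =
      (fun s : Fin (j + 1) => y ⟨i + s, by omega⟩) := by
    funext s
    have : (⟨i + 1 + s, by omega⟩ : Fin (n + 2)) = Fin.succ ⟨i + s, by omega⟩ :=
      Fin.ext (by simp; omega)
    rw [this, Fin.cons_succ]
  change b _ _ = b _ _
  rw [e1, e2]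
  rfl

lemma rawCup_succ_cons (b : M →ₗ[k] M' →ₗ[k] N) (i j n : ℕ) (h : i + 1 + j = n + 1)
    (f : (Fin (i + 2) → G) → M) (g : (Fin (j + 1) → G) → M') (a : G) (y : Fin (n + 1) → G) :
    rawCup b (i + 1) j (n + 1) h f g (Fin.cons a y) =
      rawCup b i j n (by omega) (fixHead f a) g y :=
  congrFun (rawCup_cons b i j n (by omega) f g a) y

lemma rawCup_zero_cons (b : M →ₗ[k] M' →ₗ[k] N) (j : ℕ)
    (f : (Fin 1 → G) → M) (g : (Fin (j + 1) → G) → M') (a : G) (y : Fin j → G) :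
    rawCup b 0 j j (zero_add j) f g (Fin.cons a y) = b (f (fun _ => a)) (g (Fin.cons a y)) := by
  have e1 : (fun s : Fin 1 => (Fin.cons a y : Fin (j + 1) → G) ⟨s, by omega⟩) = fun _ => a := by
    funext s
    rw [Subsingleton.elim s 0]; rfl
  have e2 : (fun s : Fin (j + 1) => (Fin.cons a y : Fin (j + 1) → G) ⟨0 + s, by omega⟩) =
      Fin.cons a y := by
    funext s
    congr 1
    exact Fin.ext (zero_add _)
  change b _ _ = b _ _
  rw [e1, e2]

/-- The prism never moves the first argument of its function, so a factor of degree zero on the left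
goes through unchanged. -/
lemma prism_rawCup_zero (b : M →ₗ[k] M' →ₗ[k] N) (γ : G) (j : ℕ)
    (f : (Fin 1 → G) → M) (g : (Fin (j + 2) → G) → M') :
    prism k N γ (j + 1) (rawCup b 0 (j + 1) (j + 1) (zero_add _) f g) =
      rawCup b 0 j j (zero_add _) f (prism k M' γ (j + 1) g) := by
  funext x
  obtain ⟨a, y, rfl⟩ : ∃ a y, x = Fin.cons a y := ⟨x 0, Fin.tail x, (Fin.cons_self_tail x).symm⟩
  have e : fixHead (rawCup b 0 (j + 1) (j + 1) (zero_add _) f g) a =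
      fun z => b (f (fun _ => a)) (fixHead g a z) := funext fun z => rawCup_zero_cons b _ f g a z
  rw [prism_cons, rawCup_zero_cons, rawCup_zero_cons, prism_cons, e,
    prism_map γ (b (f (fun _ => a))), map_sub]

lemma prism_one_cons (γ : G) (f : (Fin 2 → G) → M) (a : G) :
    prism k M γ 1 f (fun _ => a) = f (Fin.cons a (fun _ => γ * a)) := by
  have e' : (fun _ => a : Fin 1 → G) = Fin.cons a (Fin.elim0 : Fin 0 → G) := by
    funext s; rw [Fin.fin_one_eq_zero s]; rfl
  have e1 : (Fin.cons (γ * a) fun s : Fin 0 => γ * (Fin.elim0 s : G) : Fin 1 → G) =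
      fun _ => γ * a := by
    funext s; rw [Fin.fin_one_eq_zero s]; rfl
  rw [e', prism_cons, e1]
  exact sub_zero _

/-- In every term of the prism the last argument has been multiplied by γ, so a factor of degree
zero on the right is evaluated on translated arguments. -/
lemma prism_rawCup_succ_zero (b : M →ₗ[k] M' →ₗ[k] N) (γ : G) : ∀ (i : ℕ)
    (f : (Fin (i + 2) → G) → M) (g : (Fin 1 → G) → M'),
    prism k N γ (i + 1) (rawCup b (i + 1) 0 (i + 1) (add_zero _) f g) =
      rawCup b i 0 i (add_zero _) (prism k M γ (i + 1) f) (fun x => g (fun s => γ * x s))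
  | 0, f, g => by
    funext x
    obtain ⟨a, y, rfl⟩ : ∃ a y, x = Fin.cons a y := ⟨x 0, Fin.tail x, (Fin.cons_self_tail x).symm⟩
    rw [prism_cons, rawCup_zero_cons, rawCup_succ_cons b 0 0 0 rfl, rawCup_zero_cons,
      prism_one_cons, mul_cons]
    exact sub_zero _
  | i + 1, f, g => by
    funext x
    obtain ⟨a, y, rfl⟩ : ∃ a y, x = Fin.cons a y := ⟨x 0, Fin.tail x, (Fin.cons_self_tail x).symm⟩
    have e2 : fixHead (prism k M γ (i + 2) f) a =
        (fun z => fixHead (fixHead f a) (γ * a) (fun s => γ * z s)) -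
          prism k M γ (i + 1) (fixHead f a) :=
      funext fun y => prism_cons γ (i + 1) f a y
    rw [prism_cons, rawCup_cons b (i + 1) 0 (i + 1) (add_zero _), prism_rawCup_succ_zero b γ i,
      rawCup_succ_cons b (i + 1) 0 (i + 1), rawCup_succ_cons b i 0 i, rawCup_succ_cons b i 0 i, e2]
    simp only [rawCup, Pi.sub_apply, map_sub, LinearMap.sub_apply]

/-- The doubled vertex of the prism falls either in the first factor, and then all the arguments of
the second are translated by γ, or in the second factor, and then the first is untouched. The
resulting twisted derivation rule has the shape of the pairing of fibres. -/
lemma prism_rawCup_succ_succ (b : M →ₗ[k] M' →ₗ[k] N) (γ : G) (j : ℕ) : ∀ (i n : ℕ)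
    (h : i + (j + 1) = n)
    (f : (Fin (i + 2) → G) → M) (g : (Fin (j + 2) → G) → M'),
    prism k N γ (n + 1) (rawCup b (i + 1) (j + 1) (n + 1) (by omega) f g) =
      rawCup b i (j + 1) n h (prism k M γ (i + 1) f) (fun x => g (fun s => γ * x s)) +
        (-1 : k) ^ (i + 1) • rawCup b (i + 1) j n (by omega) f (prism k M' γ (j + 1) g)
  | 0, n, h, f, g => by
    obtain rfl : n = j + 1 := by omega
    funext x
    obtain ⟨a, y, rfl⟩ : ∃ a y, x = Fin.cons a y := ⟨x 0, Fin.tail x, (Fin.cons_self_tail x).symm⟩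
    have e1 : (-1 : k) ^ (0 + 1) = -1 := by rw [zero_add, pow_one]
    rw [prism_cons, rawCup_cons b 0 (j + 1) (j + 1) (zero_add _), prism_rawCup_zero, Pi.add_apply,
      Pi.smul_apply, rawCup_zero_cons, prism_one_cons, rawCup_succ_cons b 0 (j + 1) (j + 1),
      rawCup_succ_cons b 0 j j, rawCup_zero_cons, e1, neg_smul, one_smul, ← sub_eq_add_neg,
      mul_cons]
    rfl
  | i + 1, n, h, f, g => by
    obtain ⟨n, rfl⟩ : ∃ m, n = m + 1 := ⟨n - 1, by omega⟩
    funext x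
    obtain ⟨a, y, rfl⟩ : ∃ a y, x = Fin.cons a y := ⟨x 0, Fin.tail x, (Fin.cons_self_tail x).symm⟩
    have e2 : fixHead (prism k M γ (i + 2) f) a =
        (fun z => fixHead (fixHead f a) (γ * a) (fun s => γ * z s)) -
          prism k M γ (i + 1) (fixHead f a) :=
      funext fun y => prism_cons γ (i + 1) f a y
    rw [prism_cons, rawCup_cons b (i + 1) (j + 1) (n + 1) (by omega),
      prism_rawCup_succ_succ b γ j i n (by omega), Pi.add_apply, Pi.add_apply, Pi.smul_apply,
      Pi.smul_apply, rawCup_succ_cons b (i + 1) (j + 1) (n + 1),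
      rawCup_succ_cons b i (j + 1) n (by omega), rawCup_succ_cons b i (j + 1) n (by omega),
      rawCup_succ_cons b (i + 1) j n (by omega), e2]
    simp only [rawCup, Pi.sub_apply, map_sub, LinearMap.sub_apply]
    rw [pow_succ _ (i + 1), mul_neg_one, neg_smul]
    abel

end ModuleCochains

end

end PolystableDuality

namespace PolystableDuality

open CategoryTheory

noncomputable section

/-! ### The multiplicative map from continuous cochains to the Koszul complex -/

section ModuleComplex

set_option linter.unusedSectionVars false
set_option linter.unusedVariables false

variable {k : Type u} [CommRing k] {G : Type u} [Group G] [TopologicalSpace G]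
  {M : Type u} [AddCommGroup M] [Module k M] {M' : Type u} [AddCommGroup M'] [Module k M']
  {N : Type u} [AddCommGroup N] [Module k N]

/-- Homogeneous continuous cochains with values in a discrete module. -/
def modCochains (ρ : G →* Module.End k M) (n : ℕ) : Submodule k ((Fin (n + 1) → G) → M) where
  carrier := {f | IsLocallyConstant f ∧ ∀ (g : G) (x : Fin (n + 1) → G),
    f (fun s => g * x s) = ρ g (f x)}
  add_mem' {a b} ha hb := ⟨ha.1.add hb.1, fun g x => by
    simp only [Pi.add_apply, map_add, ha.2 g x, hb.2 g x]⟩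
  zero_mem' := ⟨IsLocallyConstant.const 0, fun g x => by simp⟩
  smul_mem' c f hf := ⟨hf.1.comp (fun a => c • a), fun g x => by
    simp only [Pi.smul_apply, map_smul, hf.2 g x]⟩

lemma faceD_mem (ρ : G →* Module.End k M) (n : ℕ) {f : (Fin (n + 1) → G) → M}
    (hf : f ∈ modCochains ρ n) : faceD k G M (n + 1) f ∈ modCochains ρ (n + 1) := by
  refine ⟨?_, fun g x => ?_⟩
  · have : faceD k G M (n + 1) f = ∑ i : Fin (n + 2),
        fun x : Fin (n + 2) → G => (-1 : k) ^ (i : ℕ) • f (fun s => x (i.succAbove s)) := by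
      funext x
      rw [Finset.sum_apply]
      rfl
    rw [this]
    refine Finset.sum_induction _ IsLocallyConstant (fun _ _ ha hb => ha.add hb)
      (IsLocallyConstant.const 0) (fun i _ => ?_)
    exact (hf.1.comp_continuous (by fun_prop :
      Continuous (fun (x : Fin (n + 2) → G) s => x (i.succAbove s)))).comp _
  · rw [faceD_translate, ← faceD_map]
    exact congrArg (fun F => faceD k G M (n + 1) F x) (funext fun y => hf.2 g y)

lemma map_mem_modCochains {ρ : G →* Module.End k M} {σ : G →* Module.End k M'} (φ : M →ₗ[k] M')
    (hφ : ∀ g m, φ (ρ g m) = σ g (φ m)) (n : ℕ) {f : (Fin (n + 1) → G) → M}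
    (hf : f ∈ modCochains ρ n) : (fun x => φ (f x)) ∈ modCochains σ n :=
  ⟨hf.1.comp φ, fun g x => (congrArg φ (hf.2 g x)).trans (hφ g _)⟩

/-- The map on cochains induced by an equivariant linear map. -/
def modCochainsMap {ρ : G →* Module.End k M} {σ : G →* Module.End k M'} (φ : M →ₗ[k] M')
    (hφ : ∀ g m, φ (ρ g m) = σ g (φ m)) (n : ℕ) : modCochains ρ n →ₗ[k] modCochains σ n where
  toFun f := ⟨fun x => φ (f.1 x), map_mem_modCochains φ hφ n f.2⟩
  map_add' f g := Subtype.ext (funext fun x => map_add φ _ _)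
  map_smul' c f := Subtype.ext (funext fun x => map_smul φ _ _)

lemma rho_comm (hG : ∀ a b : G, a * b = b * a) (ρ : G →* Module.End k M) (g h : G) (m : M) :
    ρ g (ρ h m) = ρ h (ρ g m) := by
  change (ρ g * ρ h) m = (ρ h * ρ g) m
  rw [← map_mul, hG, map_mul]

/-- The complex of homogeneous continuous cochains with values in a discrete module. -/
def modComplex (hG : ∀ a b : G, a * b = b * a) (ρ : G →* Module.End k M) : GComplex k G where
  X n := modCochains ρ n
  d n := (faceD k G M (n + 1)).restrict (fun _ hf => faceD_mem ρ n hf)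
  d_d n f := Subtype.ext (faceD_faceD (n + 1) f.1)
  act g n := modCochainsMap (ρ g) (fun h m => rho_comm hG ρ g h m) n
  act_d g n f := Subtype.ext (funext fun x => (faceD_map (n + 1) f.1 (ρ g) x).symm)
  act_comm g h n f := Subtype.ext (funext fun x => rho_comm hG ρ g h _)
  act_inv g n f := Subtype.ext (funext fun x => by
    change (ρ g * ρ g⁻¹) (f.1 x) = f.1 x
    rw [← map_mul, mul_inv_cancel, map_one]; rfl)

variable (hG : ∀ a b : G, a * b = b * a)

lemma modComplex_d (ρ : G →* Module.End k M) (n : ℕ) (f : modCochains ρ n) :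
    ((modComplex hG ρ).d n f : modCochains ρ (n + 1)).1 = faceD k G M (n + 1) f.1 := rfl

/-- The morphism of complexes induced by an equivariant map. -/
def modComplexMap {ρ : G →* Module.End k M} {σ : G →* Module.End k M'} (φ : M →ₗ[k] M')
    (hφ : ∀ g m, φ (ρ g m) = σ g (φ m)) : GHom (modComplex hG ρ) (modComplex hG σ) where
  f n := modCochainsMap φ hφ n
  comm n f := Subtype.ext (funext fun x => (faceD_map (n + 1) f.1 φ x).symm)
  comm_act g n f := Subtype.ext (funext fun x => hφ g (f.1 x))

lemma prism_mem [ContinuousMul G] (hG : ∀ a b : G, a * b = b * a) (ρ : G →* Module.End k M)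
    (γ : G) (n : ℕ) {f : (Fin (n + 2) → G) → M} (hf : f ∈ modCochains ρ (n + 1)) :
    prism k M γ (n + 1) f ∈ modCochains ρ n := by
  refine ⟨?_, fun g x => ?_⟩
  · exact (prism_isLocallyConstant γ (n + 1) (Y := PUnit) (fun _ => f)
      (hf.1.comp_continuous continuous_snd)).comp_continuous
      (f := fun x => ((PUnit.unit, x) : PUnit × (Fin (n + 1) → G))) (by fun_prop)
  · rw [prism_translate hG, ← prism_map]
    exact congrArg (fun F => prism k M γ (n + 1) F x) (funext fun y => hf.2 g y)

/-- The prism homotopy on continuous cochains. -/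
def modHomotopy [ContinuousMul G] (ρ : G →* Module.End k M) (γ : G) :
    ActHomotopy (modComplex hG ρ) γ where
  h n := (prism k M γ (n + 1)).restrict (fun _ hf => prism_mem hG ρ γ n hf)
  h_d_zero f := Subtype.ext (funext fun x => by
    have := faceD_prism (k := k) 0 γ f.1 x
    -- By equivariance, translating the arguments by γ is the same as acting by γ on the
    -- coefficients.
    rw [f.2.2] at this
    rw [show prism k M γ 0 f.1 = 0 from rfl, map_zero, Pi.zero_apply, zero_add] at this
    exact this)
  h_d_succ n f := Subtype.ext (funext fun x => by
    have := faceD_prism (k := k) (n + 1) γ f.1 x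
    rw [f.2.2] at this
    exact this)
  h_act g n f := Subtype.ext (funext fun x => prism_map γ (ρ g) (n + 1) f.1 x)

/-- The components of the evaluation at the neutral element. -/
def evalOneF (ρ : G →* Module.End k M) : ∀ n,
    (modComplex hG ρ).X n →ₗ[k] (GComplex.degZero hG ρ).X n
  | 0 => (LinearMap.proj (fun _ => 1)).comp (modCochains ρ 0).subtype
  | _ + 1 => 0

/-- Evaluation of cochains of degree zero at the neutral element. -/
def evalOne (ρ : G →* Module.End k M) : GHom (modComplex hG ρ) (GComplex.degZero hG ρ) where
  f := evalOneF hG ρ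
  comm _ _ := rfl
  comm_act
    | _, 0, _ => rfl
    | _, _ + 1, _ => rfl

/-- The comparison between continuous cochains and the Koszul complex. -/
def toKos [ContinuousMul G] (ρ : G →* Module.End k M) (Γ : List G) :
    GHom (modComplex hG ρ) ((GComplex.degZero hG ρ).kos Γ) :=
  (evalOne hG ρ).kosLift (modHomotopy hG ρ) Γ

lemma GHom.kosLift_naturality {K K' L L' : GComplex k G} (α : GHom K K') (β : GHom L L')
    (φ : GHom K L) (φ' : GHom K' L') (H : ∀ γ, ActHomotopy K γ) (H' : ∀ γ, ActHomotopy K' γ)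
    (hH : ∀ γ n x, (H' γ).h n (α.f (n + 1) x) = α.f n ((H γ).h n x))
    (h : ∀ n x, β.f n (φ.f n x) = φ'.f n (α.f n x)) :
    ∀ (Γ : List G) n x,
      (β.kos Γ).f n ((φ.kosLift H Γ).f n x) = (φ'.kosLift H' Γ).f n (α.f n x)
  | [], n, x => h n x
  | γ :: Γ, 0, x => kosLift_naturality α β φ φ' H H' hH h Γ 0 x
  | γ :: Γ, n + 1, x => Prod.ext (kosLift_naturality α β φ φ' H H' hH h Γ (n + 1) x) (by
      change (β.kos Γ).f n ((φ.kosLift H Γ).f n _) = (φ'.kosLift H' Γ).f n _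
      rw [kosLift_naturality α β φ φ' H H' hH h Γ n, hH])

lemma GHom.kosLift_zero {K L : GComplex k G} (φ : GHom K L) (H : ∀ γ, ActHomotopy K γ) :
    ∀ (Γ : List G) x, L.kosZero Γ ((φ.kosLift H Γ).f 0 x) = φ.f 0 x
  | [], _ => rfl
  | _ :: Γ, x => kosLift_zero φ H Γ x

lemma toKos_naturality [ContinuousMul G] {ρ : G →* Module.End k M} {σ : G →* Module.End k M'}
    (φ : M →ₗ[k] M') (hφ : ∀ g m, φ (ρ g m) = σ g (φ m)) (Γ : List G) (n : ℕ)
    (x : (modComplex hG ρ).X n) :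
    ((GHom.degZero hG φ hφ).kos Γ).f n ((toKos hG ρ Γ).f n x) =
      (toKos hG σ Γ).f n ((modComplexMap hG φ hφ).f n x) := by
  refine GHom.kosLift_naturality (modComplexMap hG φ hφ) (GHom.degZero hG φ hφ) _ _ _ _ ?_ ?_ Γ n x
  · exact fun γ n f => Subtype.ext (funext fun x => prism_map γ φ (n + 1) f.1 x)
  · rintro (_ | n) f
    · rfl
    · rfl

/-- The iterated prism operators, from the top degree to degree zero. -/
def topEval (k N : Type u) [CommRing k] [AddCommGroup N] [Module k N] :
    ∀ Γ : List G, ((Fin (Γ.length + 1) → G) → N) →ₗ[k] N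
  | [] => LinearMap.proj (fun _ => 1)
  | γ :: Γ => (topEval k N Γ).comp (prism k N γ (Γ.length + 1))

/-- The comparison with the Koszul complex is multiplicative. -/
lemma kos_comp_toKos [ContinuousMul G] {ρ : G →* Module.End k M} {σ : G →* Module.End k M'}
    (b : M →ₗ[k] M' →ₗ[k] N) (hb : ∀ g x y, b (ρ g x) (σ g y) = b x y) :
    ∀ (Γ : List G) (i j : ℕ) (h : i + j = Γ.length) (f : (modComplex hG ρ).X i)
      (g : (modComplex hG σ).X j),
    ((GPairing.degZero hG b hb).kos Γ).comp i j ((toKos hG ρ Γ).f i f) ((toKos hG σ Γ).f j g) =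
      topEval k N Γ (rawCup b i j Γ.length h f.1 g.1)
  | [], 0, 0, h, f, g => rfl
  | [], 0, _ + 1, h, _, _ => by simp at h
  | [], _ + 1, _, h, _, _ => by simp at h
  | γ :: Γ, 0, 0, h, f, g => by simp at h
  -- The remaining cases mirror the clauses of the fibre pairing; each of them is one of the product
  -- formulas for `prism`.
  | γ :: Γ, 0, j + 1, h, f, g => by
    have h' : j = Γ.length := by simpa using h
    subst h'
    have ih := kos_comp_toKos b hb Γ 0 Γ.length (zero_add _) f
      ((modHomotopy hG σ γ).h Γ.length g)
    refine ih.trans ?_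
    exact congrArg (topEval k N Γ) (prism_rawCup_zero b γ Γ.length f.1 g.1).symm
  | γ :: Γ, i + 1, 0, h, f, g => by
    have h' : i = Γ.length := by simpa using h
    subst h'
    have ih := kos_comp_toKos b hb Γ Γ.length 0 (add_zero _)
      ((modHomotopy hG ρ γ).h Γ.length f) ((modComplex hG σ).act γ 0 g)
    refine Eq.trans ?_ (ih.trans ?_)
    · rw [GHom.comm_act]
      rfl
    · refine congrArg (topEval k N Γ) (Eq.trans ?_
        (prism_rawCup_succ_zero b γ Γ.length f.1 g.1).symm)
      congr 1
      exact funext fun x => (g.2.2 γ x).symm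
  | γ :: Γ, i + 1, j + 1, h, f, g => by
    have h' : i + (j + 1) = Γ.length := by simp at h; omega
    have ih1 := kos_comp_toKos b hb Γ i (j + 1) h'
      ((modHomotopy hG ρ γ).h i f) ((modComplex hG σ).act γ (j + 1) g)
    have ih2 := kos_comp_toKos b hb Γ (i + 1) j (by omega) f ((modHomotopy hG σ γ).h j g)
    rw [GHom.comm_act] at ih1
    refine (congrArg₂ (fun a b => a + (-1 : k) ^ (i + 1) • b) ih1 ih2).trans ?_
    rw [← map_smul, ← map_add]
    refine congrArg (topEval k N Γ) (Eq.trans ?_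
        (prism_rawCup_succ_succ b γ j i Γ.length h' f.1 g.1).symm)
    congr 1
    congr 1
    exact funext fun x => (g.2.2 γ x).symm

end ModuleComplex

end

end PolystableDuality

namespace PolystableDuality

open CategoryTheory Topology

noncomputable section

/-! ### Continuous cohomology of powers of Z_p by dimension shifting -/

section DimensionShifting

set_option linter.unusedSectionVars false
set_option linter.unusedVariables false

variable {k : Type u} [CommRing k] {G : Type u} [Group G] [TopologicalSpace G]
  {M : Type u} [AddCommGroup M] [Module k M] {M' : Type u} [AddCommGroup M'] [Module k M']
  (hG : ∀ a b : G, a * b = b * a)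

/-- By the tube lemma: compactness of `X` gives one neighbourhood of y that works for all x
simultaneously. -/
lemma isLocallyConstant_curry {X Y Z : Type*} [TopologicalSpace X] [TopologicalSpace Y]
    [CompactSpace X] {F : X × Y → Z} (hF : IsLocallyConstant F) :
    IsLocallyConstant (fun (y : Y) (x : X) => F (x, y)) := by
  rw [IsLocallyConstant.iff_eventually_eq]
  intro y
  have := isCompact_univ.eventually_forall_of_forall_eventually (x₀ := y) (K := Set.univ (α := X))
    (P := fun y' x => F (x, y') = F (x, y)) (fun x _ => by
      have h1 := (IsLocallyConstant.iff_eventually_eq F).1 hF (x, y)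
      have h2 : ∀ᶠ z in 𝓝 (y, x), F (z.2, z.1) = F (x, y) :=
        (continuous_swap.tendsto (y, x)).eventually h1
      have h3 : ∀ᶠ z in 𝓝 (y, x), F (z.2, y) = F (x, y) :=
        ((by fun_prop : Continuous fun z : Y × X => (z.2, y)).tendsto (y, x)).eventually h1
      filter_upwards [h2, h3] with z hz hz'
      rw [hz, hz'])
  filter_upwards [this] with y' hy'
  exact funext fun x => hy' x trivial

lemma isLocallyConstant_comp_prod {X Y Z : Type*} [TopologicalSpace X] {c : X → Y}
    (hc : IsLocallyConstant c) {F : Y → X → Z} (hF : ∀ y, IsLocallyConstant (F y)) :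
    IsLocallyConstant (fun x => F (c x) x) := by
  rw [IsLocallyConstant.iff_eventually_eq]
  intro x
  filter_upwards [(IsLocallyConstant.iff_eventually_eq c).1 hc x,
    (IsLocallyConstant.iff_eventually_eq _).1 (hF (c x)) x] with x' h1 h2
  rw [h1, h2]

variable [IsTopologicalGroup G]

/-- Right translation on locally constant functions. -/
def coindRep (k G M : Type u) [CommRing k] [Group G] [TopologicalSpace G] [IsTopologicalGroup G]
    [AddCommGroup M] [Module k M] : G →* Module.End k (LocallyConstant G M) where
  toFun g :=
    { toFun := fun F => ⟨fun x => F (x * g), F.isLocallyConstant.comp_continuous (by fun_prop)⟩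
      map_add' := fun F F' => rfl
      map_smul' := fun c F => rfl }
  map_one' := LinearMap.ext fun F => LocallyConstant.ext fun x => congrArg F (mul_one x)
  map_mul' g h := LinearMap.ext fun F => LocallyConstant.ext fun x =>
    congrArg F (mul_assoc x g h).symm

lemma coindRep_apply (g : G) (F : LocallyConstant G M) (x : G) :
    coindRep k G M g F x = F (x * g) := rfl

/-- The orbit maps of a representation are locally constant. -/
def IsSmooth (ρ : G →* Module.End k M) : Prop := ∀ m, IsLocallyConstant (fun g => ρ g m)

lemma coindRep_isSmooth [CompactSpace G] : IsSmooth (coindRep k G M) := fun F => by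
  have := isLocallyConstant_curry (F := fun q : G × G => F (q.1 * q.2))
    (F.isLocallyConstant.comp_continuous (by fun_prop))
  rw [IsLocallyConstant.iff_eventually_eq] at this ⊢
  intro g
  filter_upwards [this g] with g' hg'
  exact LocallyConstant.ext fun x => congrFun hg' x

/-- The embedding of a module in the coinduced one. -/
def toCoind {ρ : G →* Module.End k M} (hρ : IsSmooth ρ) : M →ₗ[k] LocallyConstant G M where
  toFun m := ⟨fun g => ρ g m, hρ m⟩
  map_add' m m' := LocallyConstant.ext fun g => map_add (ρ g) m m'
  map_smul' c m := LocallyConstant.ext fun g => map_smul (ρ g) c m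

lemma toCoind_rho {ρ : G →* Module.End k M} (hρ : IsSmooth ρ) (g : G) (m : M) :
    toCoind hρ (ρ g m) = coindRep k G M g (toCoind hρ m) :=
  LocallyConstant.ext fun x => by
    change ρ x (ρ g m) = ρ (x * g) m
    rw [map_mul]; rfl

lemma toCoind_injective {ρ : G →* Module.End k M} (hρ : IsSmooth ρ) :
    Function.Injective (toCoind hρ) := fun m m' h => by
  have := congrArg (fun F : LocallyConstant G M => F 1) h
  change ρ 1 m = ρ 1 m' at this
  rwa [map_one] at this

/-- The quotient of the coinduced module. -/
abbrev CoindQuot {ρ : G →* Module.End k M} (hρ : IsSmooth ρ) : Type u :=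
  LocallyConstant G M ⧸ LinearMap.range (toCoind hρ)

/-- The action on the quotient of the coinduced module. -/
def coindQuotRep {ρ : G →* Module.End k M} (hρ : IsSmooth ρ) :
    G →* Module.End k (CoindQuot hρ) where
  toFun g := Submodule.mapQ _ _ (coindRep k G M g) (by
    rintro _ ⟨m, rfl⟩
    exact ⟨ρ g m, toCoind_rho hρ g m⟩)
  map_one' := LinearMap.ext fun x => by
    obtain ⟨x, rfl⟩ := Submodule.mkQ_surjective _ x
    simp
  map_mul' g h := LinearMap.ext fun x => by
    obtain ⟨x, rfl⟩ := Submodule.mkQ_surjective _ x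
    simp

lemma coindQuotRep_mk {ρ : G →* Module.End k M} (hρ : IsSmooth ρ) (g : G)
    (F : LocallyConstant G M) :
    (LinearMap.range (toCoind hρ)).mkQ (coindRep k G M g F) =
      coindQuotRep hρ g ((LinearMap.range (toCoind hρ)).mkQ F) := rfl

lemma coindQuotRep_isSmooth [CompactSpace G] {ρ : G →* Module.End k M} (hρ : IsSmooth ρ) :
    IsSmooth (coindQuotRep hρ) := fun x => by
  obtain ⟨x, rfl⟩ := Submodule.mkQ_surjective _ x
  exact (coindRep_isSmooth x).comp _

/-- An equivariant cochain is determined by its inhomogeneous values f(x_0⁻¹x_i). Lift these by a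
set-theoretic section and spread them out by the action; smoothness keeps the result locally
constant. -/
lemma modComplexMap_surjective {ρ : G →* Module.End k M} {σ : G →* Module.End k M'}
    (hρ : IsSmooth ρ) (φ : M →ₗ[k] M')
    (hφ : ∀ g m, φ (ρ g m) = σ g (φ m)) (hφ' : Function.Surjective φ) (n : ℕ) :
    Function.Surjective ((modComplexMap hG φ hφ).f n) := by
  rintro ⟨f, hf, hf'⟩
  obtain ⟨s, hs⟩ := hφ'.hasRightInverse
  refine ⟨⟨fun x => ρ (x 0) (s (f (fun i => (x 0)⁻¹ * x i))), ?_, fun g x => ?_⟩,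
    Subtype.ext (funext fun x => ?_)⟩
  · refine isLocallyConstant_comp_prod (c := fun x : Fin (n + 1) → G =>
      f (fun i => (x 0)⁻¹ * x i)) (F := fun m x => ρ (x 0) (s m)) ?_ (fun m => ?_)
    · exact hf.comp_continuous (by fun_prop)
    · exact (hρ (s m)).comp_continuous (by fun_prop)
  · have : (fun i => (g * x 0)⁻¹ * (g * x i)) = (fun i => (x 0)⁻¹ * x i) := by
      funext i; group
    change ρ (g * x 0) (s (f (fun i => (g * x 0)⁻¹ * (g * x i)))) = _
    rw [this, map_mul]
    rfl
  · change φ (ρ (x 0) (s (f (fun i => (x 0)⁻¹ * x i)))) = f x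
    rw [hφ, hs, hf']
    change (σ (x 0) * σ (x 0)⁻¹) (f x) = f x
    rw [← map_mul, mul_inv_cancel, map_one]
    rfl

lemma modComplex_isShortExact {ρ : G →* Module.End k M} (hρ : IsSmooth ρ) [CompactSpace G] :
    GHom.IsShortExact (modComplexMap hG (toCoind hρ) (toCoind_rho hρ))
      (modComplexMap hG _ (coindQuotRep_mk hρ)) where
  inj n f f' h := Subtype.ext (funext fun x =>
    toCoind_injective hρ (congrFun (congrArg Subtype.val h) x))
  exact n f := by
    constructor
    · intro h
      have h' : ∀ x, ∃ m, toCoind hρ m = f.1 x := fun x =>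
        (Submodule.Quotient.mk_eq_zero (LinearMap.range (toCoind hρ))).1
          (congrFun (congrArg Subtype.val h) x)
      choose e he using h'
      refine ⟨⟨e, ?_, fun g x => ?_⟩, Subtype.ext (funext he)⟩
      · have := f.2.1
        rw [IsLocallyConstant.iff_eventually_eq] at this ⊢
        intro x
        filter_upwards [this x] with y hy
        exact toCoind_injective hρ (by rw [he, he, hy])
      · refine toCoind_injective hρ ?_
        rw [he, toCoind_rho, he, f.2.2]
    · rintro ⟨e, rfl⟩
      exact Subtype.ext (funext fun x =>
        (Submodule.Quotient.mk_eq_zero (LinearMap.range (toCoind hρ))).2 ⟨_, rfl⟩)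
  surj n := modComplexMap_surjective hG coindRep_isSmooth _ _ (Submodule.mkQ_surjective _) n

lemma degZero_isShortExact {ρ : G →* Module.End k M} (hρ : IsSmooth ρ) :
    GHom.IsShortExact (GHom.degZero hG (toCoind hρ) (toCoind_rho hρ))
      (GHom.degZero hG _ (coindQuotRep_mk hρ)) where
  inj
    | 0 => toCoind_injective hρ
    | _ + 1 => fun _ _ _ => rfl
  exact
    | 0 => LinearMap.exact_map_mkQ_range (toCoind hρ)
    | _ + 1 => fun _ => ⟨fun _ => ⟨PUnit.unit, rfl⟩, fun _ => rfl⟩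
  surj
    | 0 => Submodule.mkQ_surjective _
    | _ + 1 => fun _ => ⟨PUnit.unit, rfl⟩

/-- The coinduced module has the contracting homotopy e(x)(g) = f(1, gx)(1). Compactness is needed
for e(x), as a function of g, to depend on x in a locally constant way. -/
lemma modComplex_coind_exactSucc [CompactSpace G] (n : ℕ) :
    (modComplex hG (coindRep k G M)).ExactSucc n := by
  rintro ⟨f, hf, hf'⟩ h0
  have h0' : faceD k G (LocallyConstant G M) (n + 2) f = 0 := congrArg Subtype.val h0
  have hLC : IsLocallyConstant (fun q : G × (Fin (n + 1) → G) =>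
      f (Fin.cons 1 (fun i => q.1 * q.2 i)) 1) := by
    refine (hf.comp_continuous (f := fun q : G × (Fin (n + 1) → G) =>
      (Fin.cons 1 (fun i => q.1 * q.2 i) : Fin (n + 2) → G)) ?_).comp
        (fun F : LocallyConstant G M => F 1)
    refine continuous_pi fun s => ?_
    refine Fin.cases ?_ (fun s => ?_) s
    · simp only [Fin.cons_zero]; fun_prop
    · simp only [Fin.cons_succ]; fun_prop
  let e : (Fin (n + 1) → G) → LocallyConstant G M := fun x =>
    ⟨fun g => f (Fin.cons 1 (fun i => g * x i)) 1, hLC.comp_continuous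
      (f := fun g : G => (g, x)) (by fun_prop)⟩
  refine ⟨⟨e, ?_, fun g x => LocallyConstant.ext fun y => ?_⟩, Subtype.ext (funext fun x =>
    LocallyConstant.ext fun g => ?_)⟩
  · have := isLocallyConstant_curry hLC
    rw [IsLocallyConstant.iff_eventually_eq] at this ⊢
    intro g
    filter_upwards [this g] with g' hg'
    exact LocallyConstant.ext fun x => congrFun hg' x
  · change f (Fin.cons 1 (fun i => y * (g * x i))) 1 = f (Fin.cons 1 (fun i => y * g * x i)) 1
    simp only [mul_assoc]
  · have e1 := congrArg (fun F : LocallyConstant G M => F 1)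
      (congrFun h0' (Fin.cons 1 (fun i => g * x i)))
    simp only [faceD_cons, Pi.zero_apply] at e1
    have e2 : f (fun i => g * x i) 1 = f x g := by
      rw [hf', coindRep_apply, one_mul]
    change f (fun i => g * x i) 1 - (faceD k G (LocallyConstant G M) (n + 1) (fixHead f 1)
      (fun i => g * x i)) 1 = 0 at e1
    rw [e2, sub_eq_zero] at e1
    rw [modComplex_d, e1]
    have key : ∀ z : Fin (n + 2) → G,
        (faceD k G (LocallyConstant G M) (n + 1) (fixHead f 1) z) 1 =
          faceD k G M (n + 1) (fun z => fixHead f 1 z 1) z := fun z =>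
      (faceD_map (n + 1) (fixHead f 1) (LocallyConstant.evalₗ k 1) z).symm
    have key2 : (faceD k G (LocallyConstant G M) (n + 1) e x) g =
        faceD k G M (n + 1) (fun z => e z g) x :=
      (faceD_map (n + 1) e (LocallyConstant.evalₗ k g) x).symm
    rw [key]
    exact key2

/-- A list of topological generators `γ` of a group isomorphic to a power of `ℤ_p`: it comes with
coordinates modulo all powers of `p`. -/
structure IsPadicBasis (p : ℕ) (Γ : List G) : Prop where
  dense : ∀ U : Subgroup G, IsOpen (U : Set G) → (∀ γ ∈ Γ, γ ∈ U) → U = ⊤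
  coord : ∀ γ Γ', γ :: Γ' <:+ Γ → ∀ N : ℕ, ∃ c : G → ZMod (p ^ N), IsLocallyConstant c ∧
    (∀ x, c (x * γ) = c x + 1) ∧ ∀ γ' ∈ Γ', ∀ x, c (x * γ') = c x
  tendsto : ∀ γ ∈ Γ, ∀ U ∈ 𝓝 (1 : G), ∃ N : ℕ, γ ^ p ^ N ∈ U

/-- A sum over p full periods is p times the sum over one period. -/
lemma sum_range_mul_eq_zero {p : ℕ} (hp : (p : k) = 0) (T : ℕ) (f : ℕ → M)
    (hf : ∀ j, f (j + T) = f j) : ∑ j ∈ Finset.range (T * p), f j = 0 := by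
  have h1 : ∀ m j, f (T * m + j) = f j := by
    intro m
    induction m with
    | zero => simp
    | succ m ih => intro j; rw [mul_add, mul_one, add_right_comm, hf, ih]
  have h2 : ∀ m, ∑ j ∈ Finset.range (T * m), f j = (m : k) • ∑ j ∈ Finset.range T, f j := by
    intro m
    induction m with
    | zero => simp
    | succ m ih =>
      rw [mul_add, mul_one, Finset.sum_range_add, ih, Nat.cast_succ, add_smul, one_smul]
      simp only [h1]
  rw [h2, hp, zero_smul]

/-- To invert γ - 1, sum F along the γ-orbit of x, from the point of the orbit where the coordinate
c is zero up to, but excluding, x itself. The coordinate is only defined modulo a power of p, and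
the sum over a full turn vanishes since p = 0 in k. The generators in Γ' fix F and preserve c, hence
fix the sum. -/
lemma coind_surjective (hG : ∀ a b : G,
    a * b = b * a) [CompactSpace G] {p : ℕ} [Fact p.Prime] (hp : (p : k) = 0) {Γ : List G}
    (hΓ : IsPadicBasis p Γ) (γ : G) (Γ' : List G) (hs : γ :: Γ' <:+ Γ) (F : LocallyConstant G M)
    (hF : ∀ γ' ∈ Γ', coindRep k G M γ' F = F) :
    ∃ F', (∀ γ' ∈ Γ', coindRep k G M γ' F' = F') ∧ coindRep k G M γ F' - F' = F := by
  obtain ⟨N, hN⟩ : ∃ N : ℕ, coindRep k G M (γ ^ p ^ N) F = F := by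
    refine hΓ.tendsto γ (hs.subset List.mem_cons_self) {g | coindRep k G M g F = F} ?_
    have := (IsLocallyConstant.iff_eventually_eq _).1 (coindRep_isSmooth (k := k) F) 1
    filter_upwards [this] with g hg
    rw [hg, map_one]
    rfl
  have hN' : ∀ x, F (x * γ ^ p ^ N) = F x :=
      fun x => congrArg (fun F : LocallyConstant G M => F x) hN
  -- F has period p^N along γ; with a coordinate modulo p^(N + 1), one full turn consists of exactly
  -- p periods.
  obtain ⟨c, hc, hc1, hc2⟩ := hΓ.coord γ Γ' hs (N + 1)
  let E : ℕ → G → M := fun a x => ∑ j ∈ Finset.range a, F (x * (γ ^ a)⁻¹ * γ ^ j)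
  have hE : ∀ a, IsLocallyConstant (E a) := by
    intro a
    have : E a = ∑ j ∈ Finset.range a, fun x => F (x * (γ ^ a)⁻¹ * γ ^ j) := by
      funext x; rw [Finset.sum_apply]
    rw [this]
    exact Finset.sum_induction _ IsLocallyConstant (fun _ _ ha hb => ha.add hb)
      (IsLocallyConstant.const 0)
      (fun i _ => F.isLocallyConstant.comp_continuous (by fun_prop))
  refine ⟨⟨fun x => E (c x).val x, isLocallyConstant_comp_prod hc
    (F := fun a x => E a.val x) (fun a => hE _)⟩, fun γ' hγ' => LocallyConstant.ext fun x => ?_,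
    LocallyConstant.ext fun x => ?_⟩
  · change E (c (x * γ')).val (x * γ') = E (c x).val x
    rw [hc2 γ' hγ']
    refine Finset.sum_congr rfl fun j _ => ?_
    have : x * γ' * (γ ^ (c x).val)⁻¹ * γ ^ j = x * (γ ^ (c x).val)⁻¹ * γ ^ j * γ' := by
      rw [mul_assoc x, hG γ', ← mul_assoc, mul_assoc, hG γ', ← mul_assoc]
    rw [this]
    exact congrArg (fun F : LocallyConstant G M => F _) (hF γ' hγ')
  · change E (c (x * γ)).val (x * γ) - E (c x).val x = F x
    rw [hc1]
    have hlt := ZMod.val_lt (c x)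
    rcases (Nat.succ_le_of_lt hlt).lt_or_eq with h | h
    · have e0 : (c x + 1).val = (c x).val + 1 := by
        have : c x + 1 = (((c x).val + 1 : ℕ) : ZMod (p ^ (N + 1))) := by
          rw [Nat.cast_add, ZMod.natCast_zmod_val, Nat.cast_one]
        rw [this, ZMod.val_natCast_of_lt h]
      rw [e0]
      have e1 : ∀ j, x * γ * (γ ^ ((c x).val + 1))⁻¹ * γ ^ j = x * (γ ^ (c x).val)⁻¹ * γ ^ j := by
        intro j
        congr 1
        rw [pow_succ']
        group
      simp only [E, e1, Finset.sum_range_succ]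
      rw [add_sub_cancel_left, inv_mul_cancel_right]
    -- At the wrap-around the new sum is empty, and the old sum together with F x runs over p
    -- periods, hence is zero.
    · have e0 : c x + 1 = 0 := by
        have : ((c x).val + 1 : ℕ) = (0 : ZMod (p ^ (N + 1))) := by
          rw [show (c x).val + 1 = p ^ (N + 1) from h, ZMod.natCast_self]
        rwa [Nat.cast_add, ZMod.natCast_zmod_val, Nat.cast_one] at this
      have e1 : ∑ j ∈ Finset.range ((c x).val + 1), F (x * (γ ^ (c x).val)⁻¹ * γ ^ j) = 0 := by
        rw [show (c x).val + 1 = p ^ N * p from h.trans (pow_succ _ _)]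
        refine sum_range_mul_eq_zero hp _ _ fun j => ?_
        rw [pow_add γ j, ← mul_assoc, hN']
      rw [Finset.sum_range_succ, inv_mul_cancel_right] at e1
      rw [e0, ZMod.val_zero]
      simp only [E, Finset.range_zero, Finset.sum_empty, zero_sub]
      exact (eq_neg_of_add_eq_zero_right e1).symm

lemma mul_one_eq (x : Fin 1 → G) : x = fun s => x 0 * (fun _ => 1 : Fin 1 → G) s := by
  funext s
  rw [Fin.fin_one_eq_zero s, mul_one]

/-- Continuous cochains compute the same cohomology as the Koszul complex. -/
theorem toKos_bijective [CompactSpace G] {p : ℕ} [Fact p.Prime] (hp : (p : k) = 0) {Γ : List G}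
    (hΓ : IsPadicBasis p Γ) : ∀ (n : ℕ) {M : Type u} [AddCommGroup M] [Module k M]
    {ρ : G →* Module.End k M} (hρ : IsSmooth ρ),
    (toKos hG ρ Γ).InjAt n ∧ (toKos hG ρ Γ).SurjAt n
  | 0, M, _, _, ρ, hρ => by
    constructor
    · intro f _ hf
      have h1 : f.1 (fun _ => 1) = 0 := by
        have := GHom.kosLift_zero (evalOne hG ρ) (modHomotopy hG ρ) Γ f
        rw [show (GHom.kosLift (evalOne hG ρ) (modHomotopy hG ρ) Γ).f 0 f = 0 from hf,
          map_zero] at this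
        exact this.symm
      refine Subtype.ext (funext fun x => ?_)
      rw [mul_one_eq x, f.2.2, h1, map_zero]
      rfl
    · intro z hz
      have hz' := (GComplex.kos_d_zero_iff (GComplex.degZero hG ρ) (fun _ => rfl) Γ z).1 hz
      obtain ⟨m, hm⟩ : ∃ m : M, (GComplex.degZero hG ρ).kosZero Γ z = m := ⟨_, rfl⟩
      rw [hm] at hz'
      -- The stabiliser of m is open by smoothness and contains the generators, so by density it is
      -- the whole group.
      let U : Subgroup G :=
        { carrier := {g | ρ g m = m}
          mul_mem' := fun {a b} ha hb => by
            change ρ (a * b) m = m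
            rw [map_mul]
            change ρ a (ρ b m) = m
            rw [show ρ b m = m from hb, show ρ a m = m from ha]
          one_mem' := by change ρ 1 m = m; rw [map_one]; rfl
          inv_mem' := fun {a} ha => by
            change ρ a⁻¹ m = m
            conv_lhs => rw [← show ρ a m = m from ha]
            change (ρ a⁻¹ * ρ a) m = m
            rw [← map_mul, inv_mul_cancel, map_one]
            rfl }
      have hU : U = ⊤ := hΓ.dense U ((hρ m).isOpen_fiber m) hz'
      have hU' : ∀ g, ρ g m = m := fun g => by
        have : g ∈ U := hU ▸ Subgroup.mem_top g
        exact this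
      refine ⟨⟨fun _ => m, IsLocallyConstant.const m, fun g x => (hU' g).symm⟩,
        Subtype.ext (funext fun x => ?_), ?_⟩
      · rw [modComplex_d, faceD_apply]
        change ∑ i : Fin 2, (-1 : k) ^ (i : ℕ) • m = 0
        simp [Fin.sum_univ_two]
      · refine sub_eq_zero.2 (((GComplex.degZero hG ρ).kosZero Γ).injective ?_)
        exact hm.trans (GHom.kosLift_zero (evalOne hG ρ) (modHomotopy hG ρ) Γ
          (⟨fun _ => m, IsLocallyConstant.const m, fun g x => (hU' g).symm⟩ :
            modCochains ρ 0)).symm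
  | n + 1, M, _, _, ρ, hρ => by
    -- Embed the module into the coinduced one, which is acyclic in positive degrees for cochains
    -- and for the Koszul complex alike; degree n + 1 then follows from degree n for the coinduced
    -- module and for the quotient.
    have hI := toKos_bijective hp hΓ n (coindRep_isSmooth (k := k) (G := G) (M := M))
    have hQ := toKos_bijective hp hΓ n (coindQuotRep_isSmooth hρ)
    have hex : ∀ n, ((GComplex.degZero hG (coindRep k G M)).kos Γ).ExactSucc n := by
      refine GComplex.kos_exactSucc _ (fun _ => rfl)
        (fun n => inferInstanceAs (Subsingleton PUnit)) Γ ?_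
      intro γ Γ' hs F hF
      exact coind_surjective hG hp hΓ γ Γ' hs F hF
    constructor
    · exact GHom.injAt_succ (modComplex_isShortExact hG hρ) ((degZero_isShortExact hG hρ).kos Γ)
        (fun n x => (toKos_naturality hG _ _ Γ n x).symm)
        (fun n x => (toKos_naturality hG _ _ Γ n x).symm) n (modComplex_coind_exactSucc hG n)
        hI.2 hQ.1
    · exact GHom.surjAt_succ (modComplex_isShortExact hG hρ) ((degZero_isShortExact hG hρ).kos Γ)
        (fun n x => (toKos_naturality hG _ _ Γ n x).symm)
        (fun n x => (toKos_naturality hG _ _ Γ n x).symm) n (hex n) hQ.2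

end DimensionShifting

end

end PolystableDuality

namespace PolystableDuality

open CategoryTheory

noncomputable section

/-! ### Derived morphisms from complexes with acyclic terms to a shifted module -/

section DerivedHoms

open CochainComplex.HomComplex

variable {𝒞 : Type*} [Category* 𝒞] [Abelian 𝒞]

/-- A cochain whose differential vanishes in degrees `≥ n₁` is homotopic to one which vanishes
there, if the target is exact in the relevant degrees as seen by the terms of the source. -/
lemma exists_cochain_sub_δ_eq_zero {K E : CochainComplex 𝒞 ℤ} {b j c n₁ : ℤ} (z : Cochain K E c)
    (hK : ∀ q, b < q → Limits.IsZero (K.X q))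
    (hE : ∀ q m, j ≤ m → ∀ f : K.X q ⟶ E.X (m + 1), f ≫ E.d (m + 1) (m + 2) = 0 →
      ∃ g : K.X q ⟶ E.X m, g ≫ E.d m (m + 1) = f)
    (h₁ : j < n₁ + c) (hz : ∀ q r (h : q + (c + 1) = r), n₁ ≤ q → (δ c (c + 1) z).v q r h = 0) :
    ∃ h : Cochain K E (c - 1), ∀ q r (hqr : q + c = r), n₁ ≤ q →
      (z - δ (c - 1) c h).v q r hqr = 0 := by
  -- Work downwards from the top degree b: after s corrections the components in degrees above b - s
  -- are gone.
  suffices H : ∀ s : ℕ, ∃ h : Cochain K E (c - 1), ∀ q r (hqr : q + c = r), b - s < q → n₁ ≤ q →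
      (z - δ (c - 1) c h).v q r hqr = 0 by
    obtain ⟨h, hh⟩ := H (b - n₁ + 1).toNat
    exact ⟨h, fun q r hqr hq => hh q r hqr (by omega) hq⟩
  intro s
  induction s with
  | zero => exact ⟨0, fun q r hqr hq _ => (hK q (by simpa using hq)).eq_of_src _ _⟩
  | succ s ih =>
    obtain ⟨h, hh⟩ := ih
    by_cases hs : b - s < n₁
    · exact ⟨h, fun q r hqr _ hq => hh q r hqr (by omega) hq⟩
    obtain ⟨q₀, hq₀⟩ : ∃ q₀, q₀ = b - s := ⟨_, rfl⟩
    obtain ⟨m, hm⟩ : ∃ m, m = q₀ + c - 1 := ⟨_, rfl⟩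
    -- The component in degree q₀ + 1 has already been removed, so the vanishing of the differential
    -- says that the component in degree q₀ takes values in cocycles of E, and it lifts through the
    -- differential.
    have h1 : (δ c (c + 1) (z - δ (c - 1) c h)).v q₀ (m + 2) (by omega) = 0 := by
      rw [δ_sub, δ_δ, sub_zero]
      exact hz _ _ _ (by omega)
    rw [δ_v c (c + 1) rfl _ q₀ (m + 2) (by omega) (m + 1) (q₀ + 1) (by omega) rfl,
      hh (q₀ + 1) (m + 2) (by omega) (by omega) (by omega), Limits.comp_zero, smul_zero,
      add_zero] at h1
    obtain ⟨g, hg⟩ := hE q₀ m (by omega) _ h1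
    refine ⟨h + Cochain.single g (c - 1), fun q r hqr hq hq' => ?_⟩
    rw [δ_add, ← sub_sub, Cochain.sub_v,
      δ_v (c - 1) c (by omega) (Cochain.single g (c - 1)) q r hqr (r - 1) (q + 1) rfl rfl,
      Cochain.single_v_eq_zero g (c - 1) (q + 1) r (by omega) (by omega), Limits.comp_zero,
      smul_zero, add_zero]
    by_cases hq'' : q = q₀
    · subst hq''
      obtain rfl : r = m + 1 := by omega
      obtain ⟨m', hm'⟩ : ∃ m', m' = m + 1 - 1 := ⟨_, rfl⟩
      have : ∀ m', m' = m → ∀ hh', (Cochain.single g (c - 1)).v q m' hh' ≫ E.d m' (m + 1) =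
          (z - δ (c - 1) c h).v q (m + 1) hqr := by
        rintro _ rfl _
        rw [Cochain.single_v, hg]
      rw [this _ (by omega), sub_self]
    · rw [Cochain.single_v_eq_zero g (c - 1) q (r - 1) (by omega) hq'', Limits.zero_comp,
        sub_zero]
      exact hh q r hqr (by push_cast at hq; omega) hq'

/-- The objects on which an injective resolution is exact in positive degrees. -/
def IsAcyclicFor {N : 𝒞} (R : InjectiveResolution N) (M : 𝒞) : Prop :=
  ∀ (n : ℕ) (f : M ⟶ R.cocomplex.X (n + 1)), f ≫ R.cocomplex.d (n + 1) (n + 2) = 0 →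
    ∃ g : M ⟶ R.cocomplex.X n, g ≫ R.cocomplex.d n (n + 1) = f

variable {N : 𝒞} (R : InjectiveResolution N) (j : ℤ)

/-- The injective resolution placed in degrees `≥ j`. -/
abbrev resolutionFrom : CochainComplex 𝒞 ℤ :=
  R.cocomplex.extend (ComplexShape.embeddingUpIntGE j)

/-- The augmentation of an injective resolution. -/
def resolutionι : (HomologicalComplex.single 𝒞 (ComplexShape.up ℕ) 0).obj N ⟶ R.cocomplex := R.ι

instance : QuasiIso (resolutionι R) := R.quasiIso

instance (n : ℕ) : Mono ((resolutionι R).f n) := inferInstanceAs (Mono (R.ι.f n))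

/-- The resolution map of `N[-j]`. -/
def toResolutionFrom :
    (HomologicalComplex.single 𝒞 (ComplexShape.up ℤ) j).obj N ⟶ resolutionFrom R j :=
  (HomologicalComplex.extendSingleIso (ComplexShape.embeddingUpIntGE j) N 0 j
    (by simp)).inv ≫ HomologicalComplex.extendMap (resolutionι R) (ComplexShape.embeddingUpIntGE j)

instance : QuasiIso (toResolutionFrom R j) := by
  have : QuasiIso (HomologicalComplex.extendMap (resolutionι R) (ComplexShape.embeddingUpIntGE
      j)) := by
    rw [HomologicalComplex.quasiIso_extendMap_iff]
    infer_instance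
  unfold toResolutionFrom
  infer_instance

instance (n : ℤ) : Injective ((resolutionFrom R j).X n) := by
  unfold resolutionFrom
  infer_instance

lemma isZero_resolutionFrom (n : ℤ) (hn : n < j) : Limits.IsZero ((resolutionFrom R j).X n) :=
  HomologicalComplex.isZero_extend_X _ _ _ (fun i => by simp; omega)

instance : (resolutionFrom R j).IsStrictlyGE j := by
  rw [CochainComplex.isStrictlyGE_iff]
  exact fun i hi => isZero_resolutionFrom R j i hi

instance : (resolutionFrom R j).IsKInjective :=
  CochainComplex.isKInjective_of_injective _ j

variable {R j}

lemma IsAcyclicFor.exists_lift {M : 𝒞} (hM : IsAcyclicFor R M) (m : ℤ) (hm : j ≤ m)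
    (f : M ⟶ (resolutionFrom R j).X (m + 1)) (hf : f ≫ (resolutionFrom R j).d (m + 1) (m + 2) = 0) :
    ∃ g : M ⟶ (resolutionFrom R j).X m, g ≫ (resolutionFrom R j).d m (m + 1) = f := by
  obtain ⟨n, rfl⟩ : ∃ n : ℕ, m = j + n := ⟨(m - j).toNat, by omega⟩
  have e0 : (ComplexShape.embeddingUpIntGE j).f n = j + n := rfl
  have e1 : (ComplexShape.embeddingUpIntGE j).f (n + 1) = j + n + 1 := by
    simp [add_assoc]
  have e2 : (ComplexShape.embeddingUpIntGE j).f (n + 2) = j + n + 2 := by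
    simp [add_assoc]
  unfold resolutionFrom at f hf ⊢
  rw [HomologicalComplex.extend_d_eq _ _ e1 e2, ← Category.assoc, ← Category.assoc,
    Preadditive.IsIso.comp_right_eq_zero] at hf
  obtain ⟨g, hg⟩ := hM n _ hf
  refine ⟨g ≫ (R.cocomplex.extendXIso _ e0).inv, ?_⟩
  rw [HomologicalComplex.extend_d_eq _ _ e0 e1]
  simp only [Category.assoc, Iso.inv_hom_id_assoc]
  rw [← Category.assoc, hg]
  simp

/-- The resolution map in degree `j`, as a morphism from `N`. -/
def resolutionUnit (R : InjectiveResolution N) (j : ℤ) : N ⟶ (resolutionFrom R j).X j :=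
  (HomologicalComplex.singleObjXSelf (ComplexShape.up ℤ) j N).inv ≫ (toResolutionFrom R j).f j

lemma resolutionUnit_eq : resolutionUnit R j =
    (HomologicalComplex.singleObjXSelf (ComplexShape.up ℕ) 0 N).inv ≫ (resolutionι R).f 0 ≫
      (R.cocomplex.extendXIso (ComplexShape.embeddingUpIntGE j) (i := 0) (by simp)).inv := by
  unfold resolutionUnit toResolutionFrom
  rw [HomologicalComplex.comp_f, HomologicalComplex.extendSingleIso_inv_f,
    HomologicalComplex.extendMap_f (resolutionι R) (ComplexShape.embeddingUpIntGE j) (i :=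
      0) (i' := j) (by simp)]
  simp only [Category.assoc, Iso.inv_hom_id_assoc]

instance : Mono (resolutionUnit R j) := by
  rw [resolutionUnit_eq]
  infer_instance

lemma exists_comp_resolutionUnit {M : 𝒞} (f : M ⟶ (resolutionFrom R j).X j)
    (hf : f ≫ (resolutionFrom R j).d j (j + 1) = 0) : ∃ g : M ⟶ N, g ≫ resolutionUnit R j = f := by
  have e0 : (ComplexShape.embeddingUpIntGE j).f 0 = j := by simp
  have e1 : (ComplexShape.embeddingUpIntGE j).f 1 = j + 1 := rfl
  unfold resolutionFrom at f hf ⊢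
  rw [HomologicalComplex.extend_d_eq _ _ e0 e1, ← Category.assoc, ← Category.assoc,
    Preadditive.IsIso.comp_right_eq_zero] at hf
  obtain ⟨g, hg'⟩ : ∃ g : M ⟶ ((HomologicalComplex.single 𝒞 (ComplexShape.up ℕ) 0).obj N).X 0,
      g ≫ (resolutionι R).f 0 = f ≫ (R.cocomplex.extendXIso _ e0).hom :=
    ⟨_, (Limits.KernelFork.IsLimit.lift' R.isLimitKernelFork _ hf).2⟩
  refine ⟨g ≫ (HomologicalComplex.singleObjXSelf (ComplexShape.up ℕ) 0 N).hom, ?_⟩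
  rw [resolutionUnit_eq]
  simp only [Category.assoc, Iso.hom_inv_id_assoc]
  rw [← Category.assoc, hg']
  simp

variable [HasDerivedCategory.{w} 𝒞] {K : CochainComplex 𝒞 ℤ} {b : ℤ}

/-- For a K-injective target, localisation does not change the morphisms of the homotopy category.
-/
lemma Q_map_eq_iff_of_isKInjective {E : CochainComplex 𝒞 ℤ} [E.IsKInjective] (f g : K ⟶ E) :
    DerivedCategory.Q.map f = DerivedCategory.Q.map g ↔ Nonempty (Homotopy f g) := by
  refine ⟨fun h => ⟨HomotopyCategory.homotopyOfEq _ _ ?_⟩,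
    fun ⟨h⟩ => DerivedCategory.Q_map_eq_of_homotopy _ h⟩
  refine (CochainComplex.IsKInjective.Qh_map_bijective _ _).injective ?_
  have h1 := (DerivedCategory.quotientCompQhIso 𝒞).hom.naturality f
  have h2 := (DerivedCategory.quotientCompQhIso 𝒞).hom.naturality g
  rw [h, ← h2] at h1
  exact (cancel_mono _).1 h1

lemma exists_Q_map_eq_of_isKInjective {E : CochainComplex 𝒞 ℤ} [E.IsKInjective]
    (ψ : DerivedCategory.Q.obj K ⟶ DerivedCategory.Q.obj E) :
    ∃ f : K ⟶ E, DerivedCategory.Q.map f = ψ := by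
  obtain ⟨g, hg⟩ := (CochainComplex.IsKInjective.Qh_map_bijective
    ((HomotopyCategory.quotient _ _).obj K) E).surjective
    ((DerivedCategory.quotientCompQhIso 𝒞).hom.app K ≫ ψ ≫
      (DerivedCategory.quotientCompQhIso 𝒞).inv.app E)
  obtain ⟨f, rfl⟩ := (HomotopyCategory.quotient _ _).map_surjective g
  refine ⟨f, ?_⟩
  have h1 := (DerivedCategory.quotientCompQhIso 𝒞).hom.naturality f
  have h2 : ((HomotopyCategory.quotient 𝒞 (ComplexShape.up ℤ)) ⋙ DerivedCategory.Qh).map f = _ := hg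
  rw [h2] at h1
  simp only [Category.assoc, Iso.inv_hom_id_app, Category.comp_id] at h1
  exact ((cancel_epi _).1 h1).symm

/-- Morphisms from a bounded above complex with acyclic terms to `N[-j]` in the derived category
are represented by morphisms of complexes. -/
lemma exists_Q_map_eq (R : InjectiveResolution N) (j : ℤ)
    (hK : ∀ q, b < q → Limits.IsZero (K.X q)) (hR : ∀ q, IsAcyclicFor R (K.X q))
    (ψ : DerivedCategory.Q.obj K ⟶ DerivedCategory.Q.obj
      ((HomologicalComplex.single 𝒞 (ComplexShape.up ℤ) j).obj N)) :
    ∃ g, DerivedCategory.Q.map g = ψ := by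
  obtain ⟨f, hf⟩ := exists_Q_map_eq_of_isKInjective
    (ψ ≫ DerivedCategory.Q.map (toResolutionFrom R j))
  -- The resolution vanishes below degree j, and the components above degree j are removed here, so
  -- only the component in degree j survives.
  obtain ⟨h, hh⟩ := exists_cochain_sub_δ_eq_zero (j := j) (n₁ := j + 1) (Cochain.ofHom f) hK
    (fun q m hm => (hR q).exists_lift m hm) (by omega) (fun q r _ _ => by
      simp)
  set z := Cochain.ofHom f - δ (0 - 1) 0 h with hzdef
  have hz : δ 0 1 z = 0 := by rw [hzdef, δ_sub, δ_δ, δ_ofHom, sub_zero]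
  have hzj : z.v j j (by omega) ≫ (resolutionFrom R j).d j (j + 1) = 0 := by
    have := Cochain.congr_v hz j (j + 1) rfl
    rw [δ_v 0 1 rfl z j (j + 1) rfl j (j + 1) (by omega) rfl,
      hh (j + 1) (j + 1) (by omega) le_rfl, Limits.comp_zero, smul_zero, add_zero] at this
    exact this
  -- The surviving component takes values in the cocycles of the bottom term of the resolution, that
  -- is, in N.
  obtain ⟨g₀, hg₀⟩ := exists_comp_resolutionUnit _ hzj
  have hd : ∀ i, (ComplexShape.up ℤ).Rel i j → K.d i j ≫ g₀ = 0 := by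
    rintro i hi
    obtain rfl : i + 1 = j := hi
    rw [← cancel_mono (resolutionUnit R (i + 1)), Category.assoc, hg₀, Limits.zero_comp]
    have := Cochain.congr_v hz i (i + 1) rfl
    rw [δ_v 0 1 rfl z i (i + 1) rfl i (i + 1) (by omega) rfl,
      (isZero_resolutionFrom R (i + 1) i (by omega)).eq_of_tgt (z.v i i _) 0, Limits.zero_comp,
      zero_add] at this
    exact (smul_eq_zero_iff_eq _).1 this
  refine ⟨HomologicalComplex.mkHomToSingle g₀ hd, ?_⟩
  rw [← cancel_mono (DerivedCategory.Q.map (toResolutionFrom R j)), ← hf, ← Functor.map_comp]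
  refine (Q_map_eq_iff_of_isKInjective _ _).2 ⟨((Cochain.equivHomotopy _ _).symm ⟨h, ?_⟩).symm⟩
  rw [← sub_eq_iff_eq_add']
  refine Cochain.ext _ _ fun q r hqr => ?_
  obtain rfl : q = r := by omega
  change z.v q q hqr = _
  rw [Cochain.ofHom_v, HomologicalComplex.comp_f]
  rcases lt_trichotomy q j with hq | rfl | hq
  · exact (isZero_resolutionFrom R j q hq).eq_of_tgt _ _
  · rw [HomologicalComplex.mkHomToSingle_f, Category.assoc, ← hg₀]
    rfl
  · rw [hh q q hqr (by omega), (HomologicalComplex.isZero_single_obj_X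
      (ComplexShape.up ℤ) j N q (by omega)).eq_of_tgt (HomologicalComplex.Hom.f _ q) 0,
      Limits.zero_comp]

/-- A morphism from a bounded above complex with acyclic terms to `N[-j]` which vanishes in the
derived category is null-homotopic. -/
lemma exists_factorization_of_Q_map_eq_zero (R : InjectiveResolution N) (j : ℤ)
    (hK : ∀ q, b < q → Limits.IsZero (K.X q)) (hR : ∀ q, IsAcyclicFor R (K.X q))
    (g : K ⟶ (HomologicalComplex.single 𝒞 (ComplexShape.up ℤ) j).obj N)
    (hg : DerivedCategory.Q.map g = 0) :
    ∃ s : K.X (j + 1) ⟶ N, g.f j = K.d j (j + 1) ≫ s ≫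
      (HomologicalComplex.singleObjXSelf (ComplexShape.up ℤ) j N).inv := by
  have h0 : DerivedCategory.Q.map (g ≫ toResolutionFrom R j) = DerivedCategory.Q.map 0 := by
    rw [Functor.map_comp, hg, Limits.zero_comp, Functor.map_zero]
  obtain ⟨H⟩ := (Q_map_eq_iff_of_isKInjective _ _).1 h0
  obtain ⟨z, hz⟩ : ∃ z : Cochain K (resolutionFrom R j) (-1),
      Cochain.ofHom (g ≫ toResolutionFrom R j) = δ (-1) 0 z :=
    ⟨(Cochain.equivHomotopy _ _ H).1, (Cochain.equivHomotopy _ _ H).2.trans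
      ((congrArg (_ + ·) (Cochain.ofHom_zero _ _)).trans (add_zero _))⟩
  have hv : ∀ q, j < q → (g ≫ toResolutionFrom R j).f q = 0 := by
    intro q hq
    rw [HomologicalComplex.comp_f, (HomologicalComplex.isZero_single_obj_X
      (ComplexShape.up ℤ) j N q (by omega)).eq_of_tgt (g.f q) 0, Limits.zero_comp]
  -- A null-homotopy lowers the degree by one, so the component to keep starts in degree j + 1;
  -- those starting in degrees at least j + 2 are removed, and what remains takes values in N.
  obtain ⟨h, hh⟩ := exists_cochain_sub_δ_eq_zero (c := -1) (j := j) (n₁ := j + 2) z hK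
    (fun q m hm => (hR q).exists_lift m hm) (by omega) (fun q r hqr hq => by
      obtain rfl : q = r := by omega
      change (δ (-1) 0 z).v q q _ = 0
      rw [← hz, Cochain.ofHom_v, hv q (by omega)])
  set z' := z - δ (-1 - 1) (-1) h with hz'def
  have hz' : δ (-1) 0 z' = Cochain.ofHom (g ≫ toResolutionFrom R j) := by
    rw [hz'def, δ_sub, δ_δ, sub_zero, hz]
  have h1 : z'.v (j + 1) j (by omega) ≫ (resolutionFrom R j).d j (j + 1) = 0 := by
    have := Cochain.congr_v hz' (j + 1) (j + 1) (by omega)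
    rwa [δ_v (-1) 0 rfl z' (j + 1) (j + 1) (by omega) j (j + 2) (by omega) (by omega),
      hh (j + 2) (j + 1) (by omega) le_rfl, Limits.comp_zero, smul_zero, add_zero,
      Cochain.ofHom_v, hv _ (by omega)] at this
  obtain ⟨s, hs⟩ := exists_comp_resolutionUnit _ h1
  refine ⟨s, ?_⟩
  have h2 := Cochain.congr_v hz' j j (by omega)
  rw [δ_v (-1) 0 rfl z' j j (by omega) (j - 1) (j + 1) rfl rfl,
    (isZero_resolutionFrom R j (j - 1) (by omega)).eq_of_tgt (z'.v j (j - 1) _) 0,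
    Limits.zero_comp, zero_add, Cochain.ofHom_v, ← hs, Int.negOnePow_zero, one_smul] at h2
  have h3 : (toResolutionFrom R j).f j =
      (HomologicalComplex.singleObjXSelf (ComplexShape.up ℤ) j N).hom ≫ resolutionUnit R j := by
    simp [resolutionUnit]
  rw [HomologicalComplex.comp_f, h3, ← Category.assoc, ← Category.assoc, cancel_mono] at h2
  rw [← cancel_mono (HomologicalComplex.singleObjXSelf (ComplexShape.up ℤ) j N).hom, ← h2]
  simp

end DerivedHoms

end

end PolystableDuality

namespace PolystableDuality

open CategoryTheory

noncomputable section

/-! ### Criteria for duality up to an element of the base ring -/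

section DualityCriteria

variable {k : Type u} [CommRing k] {K L K' L' : CochainComplex (ModuleCat.{u} k) ℤ}
  {N : ModuleCat.{u} k} {d : ℤ}

/-- The coboundaries of degree `i`. -/
def IsCobdry (K : CochainComplex (ModuleCat.{u} k) ℤ) (i : ℤ) (x : K.X i) : Prop :=
  ∃ (i' : ℤ) (w : K.X i'), (K.d i' i).hom w = x

lemma isCobdry_iff (i : ℤ) (x : K.X (i + 1)) :
    IsCobdry K (i + 1) x ↔ ∃ w, (K.d i (i + 1)).hom w = x := by
  refine ⟨fun ⟨i', w, hw⟩ => ?_, fun ⟨w, hw⟩ => ⟨i, w, hw⟩⟩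
  by_cases hi : i' = i
  · subst hi
    exact ⟨w, hw⟩
  · rw [K.shape i' (i + 1) (by simpa using hi)] at hw
    exact ⟨0, by rw [map_zero, ← hw]; rfl⟩

lemma isCobdry_iff' (i : ℤ) (x : K.X i) :
    IsCobdry K i x ↔ ∃ w, (K.d (i - 1) i).hom w = x := by
  obtain ⟨i, rfl⟩ : ∃ i', i = i' + 1 := ⟨i - 1, by omega⟩
  rw [isCobdry_iff]
  have : ∀ i₀, i₀ = i → ((∃ w, (K.d i (i + 1)).hom w = x) ↔
      ∃ w, (K.d i₀ (i + 1)).hom w = x) := by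
    rintro _ rfl
    rfl
  exact this _ (by omega)

lemma IsCobdry.map {i : ℤ} {x : K.X i} (h : IsCobdry K i x) (f : K ⟶ L) :
    IsCobdry L i ((f.f i).hom x) := by
  obtain ⟨i', w, rfl⟩ := h
  exact ⟨i', (f.f i').hom w, congrArg (fun g => g.hom w) (f.comm i' i)⟩

lemma IsCobdry.add {i : ℤ} {x y : K.X i} (h : IsCobdry K i x) (h' : IsCobdry K i y) :
    IsCobdry K i (x + y) := by
  rw [isCobdry_iff'] at *
  obtain ⟨w, rfl⟩ := h
  obtain ⟨w', rfl⟩ := h'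
  exact ⟨w + w', map_add _ _ _⟩

lemma IsCobdry.smul {i : ℤ} {x : K.X i} (h : IsCobdry K i x) (c : k) : IsCobdry K i (c • x) := by
  obtain ⟨i', w, rfl⟩ := h
  exact ⟨i', c • w, map_smul _ _ _⟩

/-- Injectivity on cohomology. -/
def CohInj (f : K ⟶ L) (i : ℤ) : Prop :=
  ∀ x : K.X i, (K.d i (i + 1)).hom x = 0 → IsCobdry L i ((f.f i).hom x) → IsCobdry K i x

/-- Surjectivity on cohomology. -/
def CohSurj (f : K ⟶ L) (i : ℤ) : Prop :=
  ∀ z : L.X i, (L.d i (i + 1)).hom z = 0 →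
    ∃ x, (K.d i (i + 1)).hom x = 0 ∧ IsCobdry L i (z - (f.f i).hom x)

lemma quasiIsoAt_of_cohInj_cohSurj (f : K ⟶ L) (i : ℤ) (h1 : CohInj f i) (h2 : CohSurj f i) :
    QuasiIsoAt f i := by
  rw [quasiIsoAt_iff_isIso_homologyMap]
  have hm : Mono (HomologicalComplex.homologyMap f i) := by
    rw [HomologicalComplex.mono_homologyMap_iff_up_to_refinements f (i - 1) i (i + 1) (by simp)
      (by simp)]
    intro A x hx y hy
    -- The refinement of A consists of all points together with a primitive of their value under x;
    -- it covers A because a primitive exists pointwise.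
    let S : Submodule k (A × K.X (i - 1)) := LinearMap.ker
      (x.hom.comp (LinearMap.fst k _ _) - (K.d (i - 1) i).hom.comp (LinearMap.snd k _ _))
    have hS : ∀ s : S, x.hom s.1.1 = (K.d (i - 1) i).hom s.1.2 := fun s => sub_eq_zero.1 s.2
    refine ⟨ModuleCat.of k S, ModuleCat.ofHom ((LinearMap.fst k _ _).comp S.subtype), ?_,
      ModuleCat.ofHom ((LinearMap.snd k _ _).comp S.subtype), ?_⟩
    · rw [ModuleCat.epi_iff_surjective]
      intro a
      obtain ⟨w, hw⟩ := (isCobdry_iff' _ _).1 (h1 (x.hom a) (congrArg (fun g => g.hom a) hx)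
        ⟨_, y.hom a, (congrArg (fun g => g.hom a) hy).symm⟩)
      exact ⟨⟨(a, w), sub_eq_zero.2 hw.symm⟩, rfl⟩
    · exact ModuleCat.hom_ext (LinearMap.ext hS)
  have he : Epi (HomologicalComplex.homologyMap f i) := by
    rw [HomologicalComplex.epi_homologyMap_iff_up_to_refinements f (i - 1) i (i + 1) (by simp)
      (by simp)]
    intro A y hy
    let S : Submodule k (A × K.X i × L.X (i - 1)) := LinearMap.ker
      (LinearMap.prod
      (y.hom.comp (LinearMap.fst k _ _) - ((f.f i).hom.comp ((LinearMap.fst k _ _).comp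
        (LinearMap.snd k _ _)) + (L.d (i - 1) i).hom.comp ((LinearMap.snd k _ _).comp
        (LinearMap.snd k _ _))))
      ((K.d i (i + 1)).hom.comp ((LinearMap.fst k _ _).comp (LinearMap.snd k _ _))))
    have hS : ∀ s : S, y.hom s.1.1 = (f.f i).hom s.1.2.1 + (L.d (i - 1) i).hom s.1.2.2 :=
      fun s => sub_eq_zero.1 (Prod.ext_iff.1 s.2).1
    have hS' : ∀ s : S, (K.d i (i + 1)).hom s.1.2.1 = 0 := fun s => (Prod.ext_iff.1 s.2).2
    refine ⟨ModuleCat.of k S, ModuleCat.ofHom ((LinearMap.fst k _ _).comp S.subtype), ?_,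
      ModuleCat.ofHom (((LinearMap.fst k _ _).comp (LinearMap.snd k _ _)).comp S.subtype), ?_,
      ModuleCat.ofHom (((LinearMap.snd k _ _).comp (LinearMap.snd k _ _)).comp S.subtype), ?_⟩
    · rw [ModuleCat.epi_iff_surjective]
      intro a
      obtain ⟨x, hx, hw⟩ := h2 (y.hom a) (congrArg (fun g => g.hom a) hy)
      obtain ⟨w, hw⟩ := (isCobdry_iff' _ _).1 hw
      exact ⟨⟨(a, x, w), Prod.ext (sub_eq_zero.2 (by
        change y.hom a = (f.f i).hom x + (L.d (i - 1) i).hom w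
        rw [hw, add_sub_cancel])) hx⟩, rfl⟩
    · exact ModuleCat.hom_ext (LinearMap.ext hS')
    · exact ModuleCat.hom_ext (LinearMap.ext hS)
  exact isIso_of_mono_of_epi _

namespace ChainPairing

lemma comp_d' (β : ChainPairing K L N d) (i j : ℤ) (h : i + 1 + j = d) (x : K.X i) (y : L.X j) :
    β.comp (i + 1) j h ((K.d i (i + 1)).hom x) y =
      -(i.negOnePow • β.comp i (j + 1) (by omega) x ((L.d j (j + 1)).hom y)) :=
  eq_neg_of_add_eq_zero_left (β.comp_d i j h x y)

lemma flip_comp (β : ChainPairing K L N d) (i j : ℤ) (h : i + j = d) (x : K.X j) (y : L.X i) :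
    β.flip.comp i j h y x = (j * i).negOnePow • β.comp j i (by omega) x y := rfl

lemma flip_comp_bijective (β : ChainPairing K L N d) (i j : ℤ) (h : i + j = d)
    (hβ : Function.Bijective (β.comp j i (by omega)).flip) :
    Function.Bijective (β.flip.comp i j h) := by
  refine ⟨fun y y' hy => hβ.1 ?_, fun φ => ?_⟩
  · have : (j * i).negOnePow • (β.comp j i (by omega)).flip y =
      (j * i).negOnePow • (β.comp j i (by omega)).flip y' := hy
    exact (smul_left_cancel_iff _).1 this
  · obtain ⟨y, hy⟩ := hβ.2 ((j * i).negOnePow • φ)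
    refine ⟨y, ?_⟩
    change (j * i).negOnePow • (β.comp j i (by omega)).flip y = φ
    rw [hy, smul_smul, Int.units_mul_self, one_smul]

/-- The restriction of a pairing along morphisms of complexes. -/
def comap (β : ChainPairing K' L' N d) (f : K ⟶ K') (g : L ⟶ L') : ChainPairing K L N d where
  comp i j h := (β.comp i j h).compl₁₂ (f.f i).hom (g.f j).hom
  comp_d i j h x y := by
    have := β.comp_d i j h ((f.f i).hom x) ((g.f j).hom y)
    have e1 : (K'.d i (i + 1)).hom ((f.f i).hom x) = (f.f (i + 1)).hom ((K.d i (i + 1)).hom x) :=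
      congrArg (fun g => g.hom x) (f.comm i (i + 1))
    have e2 : (L'.d j (j + 1)).hom ((g.f j).hom y) = (g.f (j + 1)).hom ((L.d j (j + 1)).hom y) :=
      congrArg (fun g => g.hom y) (g.comm j (j + 1))
    change β.comp (i + 1) j h ((K'.d i (i + 1)).hom ((f.f i).hom x)) ((g.f j).hom y) +
      i.negOnePow • β.comp i (j + 1) _ ((f.f i).hom x) ((L'.d j (j + 1)).hom ((g.f j).hom y)) = 0
      at this
    rw [e1, e2] at this
    exact this

variable [HasDerivedCategory.{w} (ModuleCat.{u} k)]

/-- Up to `a`, a class which pairs to zero with everything vanishes. -/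
def DualityInjUpTo (β : ChainPairing K L N d) (a : k) (i j : ℤ) (h : i + j = d) : Prop :=
  ∀ z : cocycles K i, β.cocycleDuality i j h z = 0 → IsCobdry K i (a • z.1)

/-- Up to `a`, every morphism to `N[-j]` is represented by a class. -/
def DualitySurjUpTo (β : ChainPairing K L N d) (a : k) (i j : ℤ) (h : i + j = d) : Prop :=
  ∀ ψ, ∃ z : cocycles K i, β.cocycleDuality i j h z = a • ψ

lemma isAlmostIso_duality (I : Ideal k) (β : ChainPairing K L N d) (i j : ℤ) (h : i + j = d)
    (h1 : ∀ a ∈ I, β.DualityInjUpTo a i j h) (h2 : ∀ a ∈ I, β.DualitySurjUpTo a i j h) :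
    IsAlmostIso I (β.duality i j h) := by
  refine ⟨fun a ha x hx => ?_, fun a ha ψ => ?_⟩
  · obtain ⟨z, rfl⟩ := Submodule.Quotient.mk_surjective _ x
    rw [← Submodule.Quotient.mk_smul, Submodule.Quotient.mk_eq_zero]
    exact (isCobdry_iff' _ _).1 (h1 a ha z hx)
  · obtain ⟨z, hz⟩ := h2 a ha ψ
    exact ⟨Submodule.Quotient.mk z, hz⟩

/-- An adjunction formula on cochains becomes a factorisation in the derived category. It serves
both to restrict along quasi-isomorphisms and to treat retracts. -/
lemma cocycleDuality_eq_comp (β : ChainPairing K L N d) (β' : ChainPairing K' L' N d) (i j : ℤ)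
    (h : i + j = d) (g : L ⟶ L') (z : cocycles K i) (z' : cocycles K' i)
    (hz : ∀ y, β.comp i j h z.1 y = β'.comp i j h z'.1 ((g.f j).hom y)) :
    β.cocycleDuality i j h z = DerivedCategory.Q.map g ≫ β'.cocycleDuality i j h z' := by
  change DerivedCategory.Q.map _ = _ ≫ DerivedCategory.Q.map _
  rw [← Functor.map_comp]
  congr 1
  refine HomologicalComplex.to_single_hom_ext ?_
  rw [HomologicalComplex.comp_f, toSingle_f, toSingle_f, ← Category.assoc]
  congr 1
  exact ModuleCat.hom_ext (LinearMap.ext hz)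

lemma cocycleDuality_of_isCobdry (β : ChainPairing K L N d) (i j : ℤ) (h : i + j = d)
    (z : cocycles K i) (hz : IsCobdry K i z.1) : β.cocycleDuality i j h z = 0 :=
  β.cocycleDuality_d i j h z ((isCobdry_iff' _ _).1 hz)

/-- The image of a cocycle. -/
def mapCocycle (f : K ⟶ K') {i : ℤ} (z : cocycles K i) : cocycles K' i :=
  ⟨(f.f i).hom z.1, by
    have : (K'.d i (i + 1)).hom ((f.f i).hom z.1) = (f.f (i + 1)).hom ((K.d i (i + 1)).hom z.1) :=
      congrArg (fun g => g.hom z.1) (f.comm i (i + 1))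
    have hz : (K.d i (i + 1)).hom z.1 = 0 := z.2
    exact this.trans (by rw [hz, map_zero])⟩

section Comap

variable (β : ChainPairing K' L' N d) (f : K ⟶ K') (g : L ⟶ L') {i j : ℤ} (h : i + j = d)

lemma comap_cocycleDuality (z : cocycles K i) : (β.comap f g).cocycleDuality i j h z =
    DerivedCategory.Q.map g ≫ β.cocycleDuality i j h (mapCocycle f z) :=
  cocycleDuality_eq_comp _ _ i j h g z _ (fun _ => rfl)

lemma DualityInjUpTo.comap [QuasiIso g] (hf : CohInj f i) (hβ : β.DualityInjUpTo 1 i j h) :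
    (β.comap f g).DualityInjUpTo 1 i j h := by
  intro z hz
  rw [comap_cocycleDuality, Preadditive.IsIso.comp_left_eq_zero] at hz
  have := hβ _ hz
  rw [one_smul] at this ⊢
  exact hf _ z.2 this

lemma DualitySurjUpTo.comap [QuasiIso g] (hf : CohSurj f i) (hβ : β.DualitySurjUpTo 1 i j h) :
    (β.comap f g).DualitySurjUpTo 1 i j h := by
  intro ψ
  obtain ⟨z', hz'⟩ := hβ (inv (DerivedCategory.Q.map g) ≫ ψ)
  obtain ⟨x, hx, hx'⟩ := hf z'.1 z'.2
  refine ⟨⟨x, hx⟩, ?_⟩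
  rw [comap_cocycleDuality]
  have : β.cocycleDuality i j h (mapCocycle f ⟨x, hx⟩) = β.cocycleDuality i j h z' := by
    rw [← sub_eq_zero, ← neg_eq_zero, neg_sub, ← map_sub]
    exact cocycleDuality_of_isCobdry _ _ _ _ _ hx'
  rw [this, hz', one_smul, one_smul, IsIso.hom_inv_id_assoc]

end Comap

section Termwise

variable (β : ChainPairing K L N d) {b : ℤ} (hL : ∀ q, b < q → Limits.IsZero (L.X q))
  (R : InjectiveResolution N) (hR : ∀ q, IsAcyclicFor R (L.X q))
  (hβ : ∀ i j h, Function.Bijective (β.comp i j h))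

include hL hR hβ

/-- The terms of L are acyclic, so a derived morphism is a chain map, that is, a functional on L^j.
Perfectness turns it into an element z; as the functional kills coboundaries, perfectness one degree
further gives dz = 0. -/
lemma dualitySurjUpTo_of_bijective (i j : ℤ) (h : i + j = d) : β.DualitySurjUpTo 1 i j h := by
  intro ψ
  obtain ⟨g, rfl⟩ := exists_Q_map_eq R j hL hR ψ
  obtain ⟨z, hz⟩ := (hβ i j h).2
    (g.f j ≫ (HomologicalComplex.singleObjXSelf (ComplexShape.up ℤ) j N).hom).hom
  have hz0 : (K.d i (i + 1)).hom z = 0 := by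
    obtain ⟨j, rfl⟩ : ∃ j', j = j' + 1 := ⟨j - 1, by omega⟩
    refine (hβ (i + 1) j (by omega)).1 (LinearMap.ext fun y => ?_)
    rw [comp_d' β i j, hz, map_zero]
    have : L.d j (j + 1) ≫ g.f (j + 1) = 0 := by
      rw [← g.comm, HomologicalComplex.single_obj_d, Limits.comp_zero]
    have h0 : (g.f (j + 1)).hom ((L.d j (j + 1)).hom y) = 0 := congrArg (fun g => g.hom y) this
    have h1 : (g.f (j + 1) ≫ (HomologicalComplex.singleObjXSelf (ComplexShape.up ℤ) (j + 1)
        N).hom).hom ((L.d j (j + 1)).hom y) = 0 := by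
      rw [ModuleCat.hom_comp, LinearMap.comp_apply, h0, map_zero]
    rw [h1, smul_zero, neg_zero]
    rfl
  refine ⟨⟨z, hz0⟩, ?_⟩
  rw [one_smul]
  change DerivedCategory.Q.map _ = _
  congr 1
  refine HomologicalComplex.to_single_hom_ext ?_
  rw [toSingle_f]
  change ModuleCat.ofHom (β.comp i j h z) ≫ _ = _
  rw [hz, ModuleCat.ofHom_hom, Category.assoc, Iso.hom_inv_id, Category.comp_id]

/-- If the morphism defined by z vanishes in the derived category, it factors through a functional
on L^{j+1}; the element representing this functional is, up to sign, a primitive of z. -/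
lemma dualityInjUpTo_of_bijective (i j : ℤ) (h : i + j = d) : β.DualityInjUpTo 1 i j h := by
  intro z hz
  obtain ⟨i, rfl⟩ : ∃ i', i = i' + 1 := ⟨i - 1, by omega⟩
  obtain ⟨s, hs⟩ := exists_factorization_of_Q_map_eq_zero R j hL hR (β.toSingle (i + 1) j h z) hz
  rw [toSingle_f, ← Category.assoc, cancel_mono] at hs
  obtain ⟨w, hw⟩ := (hβ i (j + 1) (by omega)).2 s.hom
  rw [one_smul]
  refine ⟨i, -(i.negOnePow • w), (hβ (i + 1) j h).1 (LinearMap.ext fun y => ?_)⟩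
  have h1 : β.comp (i + 1) j h z.1 y = s.hom ((L.d j (j + 1)).hom y) :=
    congrArg (fun g => g.hom y) hs
  rw [h1, comp_d', ← hw, map_neg, LinearMap.neg_apply, smul_neg, neg_neg, Units.smul_def,
    Units.smul_def, map_zsmul,
    LinearMap.smul_apply, ← Units.smul_def, ← Units.smul_def, smul_smul, Int.units_mul_self,
    one_smul]

end Termwise

section Retract

variable (β : ChainPairing K L N d) (β' : ChainPairing K' L' N d)
  (ιK : K' ⟶ K) (πK : K ⟶ K') (ιL : L' ⟶ L) (πL : L ⟶ L') (a : k)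

/-- If z pairs to zero with everything, then so does πz by adjunction, so πz is a coboundary; and
a·z differs from a·ιπz by a coboundary. -/
lemma DualityInjUpTo.of_retract {i j : ℤ} (h : i + j = d)
    (hK : ∀ x : K.X i, (K.d i (i + 1)).hom x = 0 →
      IsCobdry K i (a • x - a • (ιK.f i).hom ((πK.f i).hom x)))
    (h2 : ∀ x y, β.comp i j h x ((ιL.f j).hom y) = β'.comp i j h ((πK.f i).hom x) y)
    (hβ' : β'.DualityInjUpTo 1 i j h) : β.DualityInjUpTo a i j h := by
  intro z hz
  have h3 : β'.cocycleDuality i j h (mapCocycle πK z) = 0 := by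
    rw [cocycleDuality_eq_comp β' β i j h ιL (mapCocycle πK z) z (fun y => (h2 z.1 y).symm), hz,
      Limits.comp_zero]
  have h4 := ((hβ' _ h3).map ιK).smul a
  rw [one_smul] at h4
  have h5 := (hK z.1 z.2).add h4
  change IsCobdry K i (_ - _ + a • (ιK.f i).hom ((πK.f i).hom z.1)) at h5
  rwa [sub_add_cancel] at h5

/-- Represent ψ restricted along ι by a class z'. By adjunction ιz' represents ψ composed with the
projector π followed by ι, and after multiplication by a the projector is a times the identity. -/
lemma DualitySurjUpTo.of_retract {i j : ℤ} (h : i + j = d)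
    (hL : a • DerivedCategory.Q.map (πL ≫ ιL) = a • 𝟙 (DerivedCategory.Q.obj L))
    (h1 : ∀ x y, β.comp i j h ((ιK.f i).hom x) y = β'.comp i j h x ((πL.f j).hom y))
    (hβ' : β'.DualitySurjUpTo 1 i j h) : β.DualitySurjUpTo a i j h := by
  intro ψ
  obtain ⟨z', hz'⟩ := hβ' (DerivedCategory.Q.map ιL ≫ ψ)
  refine ⟨a • mapCocycle ιK z', ?_⟩
  rw [map_smul, cocycleDuality_eq_comp β β' i j h πL (mapCocycle ιK z') z' (fun y => h1 z'.1 y),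
    hz', one_smul, ← Category.assoc, ← Functor.map_comp, ← Linear.smul_comp, hL, Linear.smul_comp,
    Category.id_comp]

end Retract

end ChainPairing

end DualityCriteria

end

end PolystableDuality

namespace PolystableDuality

open CategoryTheory

noncomputable section

/-! ### From complexes in non-negative degrees to complexes of modules -/

section ToCochainComplex

variable {k : Type u} [CommRing k] {G : Type u} [Group G]

namespace GComplex

/-- The terms in all integral degrees. -/
def toCCObj (K : GComplex k G) : ℤ → ModuleCat.{u} k
  | .ofNat n => ModuleCat.of k (K.X n)
  | .negSucc _ => ModuleCat.of k PUnit.{u + 1}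

/-- The differentials in all integral degrees. -/
def toCCD (K : GComplex k G) : ∀ n : ℤ, K.toCCObj n ⟶ K.toCCObj (n + 1)
  | .ofNat n => ModuleCat.ofHom (K.d n)
  | .negSucc _ => 0

/-- The underlying complex of modules. -/
def toCC (K : GComplex k G) : CochainComplex (ModuleCat.{u} k) ℤ :=
  CochainComplex.of K.toCCObj K.toCCD (by
    rintro (n | n)
    · exact ModuleCat.hom_ext (LinearMap.ext fun f => K.d_d n f)
    · exact Limits.zero_comp)

variable (K : GComplex k G)

lemma toCC_d (n : ℤ) : K.toCC.d n (n + 1) = K.toCCD n := CochainComplex.of_d _ _ n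

lemma toCC_isZero (n : ℕ) (h : Subsingleton (K.X n)) : Limits.IsZero (K.toCC.X n) :=
  ModuleCat.isZero_of_subsingleton (ModuleCat.of k (K.X n))

lemma toCC_isZero_of_lt {b : ℕ} (h : ∀ n, b < n → Subsingleton (K.X n)) (q : ℤ) (hq : (b : ℤ) < q) :
    Limits.IsZero (K.toCC.X q) := by
  obtain ⟨n, rfl⟩ : ∃ n : ℕ, q = n := ⟨q.toNat, by omega⟩
  exact K.toCC_isZero n (h n (by omega))

lemma isCobdry_toCC (n : ℕ) (x : K.X n) : IsCobdry K.toCC (n : ℤ) x ↔ K.IsBdry n x := by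
  cases n with
  | zero =>
    refine ⟨fun ⟨i, w, hw⟩ => ?_, fun h => ⟨-1, 0, (map_zero _).trans h.symm⟩⟩
    by_cases hi : i = -1
    · subst hi
      have hw0 : w = 0 := rfl
      rw [hw0, map_zero] at hw
      exact hw.symm
    · have h0 : K.toCC.d i ((0 : ℕ) : ℤ) = 0 := K.toCC.shape _ _ (by simp; omega)
      exact hw.symm.trans (congrArg (fun g => g.hom w) h0)
  | succ n =>
    refine (isCobdry_iff (K := K.toCC) (n : ℤ) x).trans ?_
    rw [toCC_d]
    rfl

end GComplex

namespace GHom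

variable {K L : GComplex k G}

/-- The components in all integral degrees. -/
def toCCF (φ : GHom K L) : ∀ n : ℤ, K.toCCObj n ⟶ L.toCCObj n
  | .ofNat n => ModuleCat.ofHom (φ.f n)
  | .negSucc _ => 0

/-- The morphism of complexes of modules. -/
def toCC (φ : GHom K L) : K.toCC ⟶ L.toCC where
  f := φ.toCCF
  comm' := by
    rintro i _ rfl
    rw [GComplex.toCC_d, GComplex.toCC_d]
    rcases i with n | n
    · exact ModuleCat.hom_ext (LinearMap.ext fun x => (φ.comm n x).symm)
    · exact Limits.zero_comp.trans Limits.zero_comp.symm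

lemma cohInj_toCC (φ : GHom K L) (h : ∀ n, φ.InjAt n) : ∀ i, CohInj φ.toCC i
  | .ofNat n => fun x hx hx' => by
    refine (K.isCobdry_toCC n x).2 (h n x ?_ ((L.isCobdry_toCC n _).1 hx'))
    rw [K.toCC_d] at hx
    exact hx
  | .negSucc n => fun x _ _ => ⟨.negSucc n, 0, (map_zero _)⟩

lemma cohSurj_toCC (φ : GHom K L) (h : ∀ n, φ.SurjAt n) : ∀ i, CohSurj φ.toCC i
  | .ofNat n => fun z hz => by
    rw [L.toCC_d] at hz
    obtain ⟨x, hx, hx'⟩ := h n z hz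
    refine ⟨x, ?_, (L.isCobdry_toCC n _).2 hx'⟩
    rw [K.toCC_d]
    exact hx
  | .negSucc n => fun z _ => ⟨0, map_zero _, ⟨.negSucc n, 0, (map_zero _)⟩⟩

lemma quasiIso_toCC (φ : GHom K L) (h : ∀ n, φ.InjAt n ∧ φ.SurjAt n) : QuasiIso φ.toCC :=
  ⟨fun i => quasiIsoAt_of_cohInj_cohSurj _ i (φ.cohInj_toCC (fun n => (h n).1) i)
    (φ.cohSurj_toCC (fun n => (h n).2) i)⟩

/-- The existence of a null-homotopy of a family of maps. -/
def IsNullHomotopic (K L : GComplex k G) (φ : ∀ n, K.X n →ₗ[k] L.X n) : Prop :=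
  ∃ h : ∀ n, K.X (n + 1) →ₗ[k] L.X n, (∀ x, h 0 (K.d 0 x) = φ 0 x) ∧
    ∀ n x, L.d n (h n x) + h (n + 1) (K.d (n + 1) x) = φ (n + 1) x

lemma IsNullHomotopic.zero : IsNullHomotopic K L (fun _ => 0) :=
  ⟨fun _ => 0, fun _ => rfl, fun n x => by simp⟩

lemma IsNullHomotopic.add {φ ψ : ∀ n, K.X n →ₗ[k] L.X n} (h : IsNullHomotopic K L φ)
    (h' : IsNullHomotopic K L ψ) : IsNullHomotopic K L (fun n => φ n + ψ n) := by
  obtain ⟨s, hs, hs'⟩ := h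
  obtain ⟨t, ht, ht'⟩ := h'
  refine ⟨fun n => s n + t n, fun x => ?_, fun n x => ?_⟩
  · simp [hs, ht]
  · simp only [LinearMap.add_apply, map_add, ← hs', ← ht']
    abel

open CochainComplex.HomComplex in
lemma IsNullHomotopic.homotopy (φ : GHom K L) (h : IsNullHomotopic K L φ.f) :
    Nonempty (Homotopy φ.toCC 0) := by
  obtain ⟨s, hs, hs'⟩ := h
  let S : ∀ r : ℤ, K.toCC.X (r + 1) ⟶ L.toCC.X r := fun r =>
    match r with
    | .ofNat n => ModuleCat.ofHom (s n)
    | .negSucc _ => 0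
  let z : Cochain K.toCC L.toCC (-1) := Cochain.mk fun a b hab =>
    (K.toCC.XIsoOfEq (show a = b + 1 by omega)).hom ≫ S b
  have hz : ∀ b, z.v (b + 1) b (by omega) = S b := fun b => Category.id_comp _
  refine ⟨(Cochain.equivHomotopy _ _).symm ⟨z, ?_⟩⟩
  rw [Cochain.ofHom_zero, add_zero]
  refine Cochain.ext _ _ fun q q' hq => ?_
  obtain ⟨r, rfl⟩ : ∃ r, q = r + 1 := ⟨q - 1, by omega⟩
  obtain rfl : r + 1 = q' := by omega
  rw [Cochain.ofHom_v, δ_v (-1) 0 rfl z (r + 1) (r + 1) hq r (r + 1 + 1) (by omega) rfl, hz, hz,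
    Int.negOnePow_zero, one_smul, K.toCC_d, L.toCC_d]
  refine ModuleCat.hom_ext (LinearMap.ext fun x => ?_)
  rcases r with n | _ | n
  · exact (hs' n x).symm
  · exact (hs x).symm.trans (zero_add (s 0 (K.d 0 x))).symm
  · rfl

lemma IsNullHomotopic.isCobdry (φ : GHom K L) (h : IsNullHomotopic K L φ.f) :
    ∀ (i : ℤ) (x : K.toCC.X i), (K.toCC.d i (i + 1)).hom x = 0 →
      IsCobdry L.toCC i ((φ.toCC.f i).hom x)
  | .ofNat 0, x, hx => by
    obtain ⟨s, hs, hs'⟩ := h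
    rw [K.toCC_d] at hx
    have hx' : K.d 0 x = 0 := hx
    exact (L.isCobdry_toCC 0 (φ.f 0 x)).2
      ((hs x).symm.trans ((congrArg (s 0) hx').trans (map_zero _)))
  | .ofNat (n + 1), x, hx => by
    obtain ⟨s, hs, hs'⟩ := h
    rw [K.toCC_d] at hx
    have hx' : K.d (n + 1) x = 0 := hx
    refine (L.isCobdry_toCC (n + 1) (φ.f (n + 1) x)).2 ⟨s n x, ?_⟩
    exact ((add_zero _).symm.trans (congrArg (L.d n (s n x) + ·)
      ((congrArg (s (n + 1)) hx').trans (map_zero _)).symm)).trans (hs' n x)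
  | .negSucc n, x, _ => ⟨.negSucc n, 0, map_zero _⟩

end GHom

namespace GPairing

variable {K L : GComplex k G} {N : Type u} [AddCommGroup N] [Module k N] {d : ℕ}

/-- The components in all integral degrees. -/
def toChainComp (β : GPairing K L N d) : ∀ i j : ℤ,
    K.toCC.X i →ₗ[k] L.toCC.X j →ₗ[k] ModuleCat.of k N
  | .ofNat a, .ofNat b => β.comp a b
  | _, _ => 0

/-- The pairing of complexes of modules. -/
def toChain (β : GPairing K L N d) (e : ℤ) (he : (d : ℤ) = e) :
    ChainPairing K.toCC L.toCC (ModuleCat.of k N) e where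
  comp i j _ := β.toChainComp i j
  comp_d i j h x y := by
    change β.toChainComp (i + 1) j ((K.toCC.d i (i + 1)).hom x) y +
      i.negOnePow • β.toChainComp i (j + 1) x ((L.toCC.d j (j + 1)).hom y) = 0
    rcases i with a | a
    · rcases j with b | b
      · rw [K.toCC_d, L.toCC_d]
        have key := β.comp_d a b x y (by
          have : (a : ℤ) + 1 + b = e := h
          omega)
        have hs : ∀ z : N, (Int.ofNat a).negOnePow • z = (-1 : k) ^ a • z := by
          intro z
          rcases Nat.even_or_odd a with ha | ha
          · rw [ha.neg_one_pow, one_smul, Int.negOnePow_even _ (by simpa using ha), one_smul]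
          · rw [ha.neg_one_pow, neg_smul, one_smul, Int.negOnePow_odd _ (by simpa using ha),
              Units.neg_smul, one_smul]
        exact (congrArg (_ + ·) (hs _)).trans key
      · have : y = 0 := rfl
        rw [this, map_zero, map_zero, map_zero, smul_zero, add_zero]
    · have : x = 0 := rfl
      rw [this, map_zero, map_zero, map_zero, LinearMap.zero_apply, LinearMap.zero_apply, smul_zero,
        add_zero]

lemma IsTermPerfect.toChain_bijective {β : GPairing K L N d} (h : β.IsTermPerfect) (e : ℤ)
    (he : (d : ℤ) = e) (i j : ℤ) (hij : i + j = e) :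
    Function.Bijective ((β.toChain e he).comp i j hij) ∧
      Function.Bijective ((β.toChain e he).comp i j hij).flip := by
  have hbij : ∀ {M M' : Type u} [AddCommGroup M] [Module k M] [AddCommGroup M'] [Module k M']
      (b : M →ₗ[k] M' →ₗ[k] N), Subsingleton M → Subsingleton M' →
      Function.Bijective b ∧ Function.Bijective b.flip := by
    intro M M' _ _ _ _ b h1 h2
    exact ⟨⟨fun _ _ _ => Subsingleton.elim _ _, fun φ => ⟨0, LinearMap.ext fun y => by
      rw [Subsingleton.elim y 0, map_zero, map_zero]⟩⟩,
      ⟨fun _ _ _ => Subsingleton.elim _ _, fun φ => ⟨0, LinearMap.ext fun y => by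
      rw [Subsingleton.elim y 0, map_zero, map_zero]⟩⟩⟩
  rcases i with a | a
  · rcases j with b | b
    · have : a + b = d := by
        have : (a : ℤ) + b = e := hij
        omega
      exact ⟨h.left a b this, h.right a b this⟩
    -- When one degree is negative the other exceeds d, so both terms vanish.
    · have : Subsingleton (K.X a) := h.boundedL a (by
        have : (a : ℤ) + Int.negSucc b = e := hij
        omega)
      exact hbij (M := K.X a) (M' := PUnit.{u + 1}) _ this inferInstance
  · rcases j with b | b
    · have : Subsingleton (L.X b) := h.boundedR b (by
        have : Int.negSucc a + (b : ℤ) = e := hij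
        omega)
      exact hbij (M := PUnit.{u + 1}) (M' := L.X b) _ inferInstance this
    · exact hbij (M := PUnit.{u + 1}) (M' := PUnit.{u + 1}) _ inferInstance inferInstance

end GPairing

section Acyclic

variable {N : ModuleCat.{u} k} {R : InjectiveResolution N}

lemma IsAcyclicFor.of_subsingleton {M : ModuleCat.{u} k} (h : Subsingleton M) :
    IsAcyclicFor R M := fun _ _ _ => ⟨0, (ModuleCat.isZero_of_subsingleton M).eq_of_src _ _⟩

lemma IsAcyclicFor.prod {M M' : Type u} [AddCommGroup M] [Module k M] [AddCommGroup M']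
    [Module k M'] (h : IsAcyclicFor R (ModuleCat.of k M)) (h' : IsAcyclicFor R (ModuleCat.of k
      M')) :
    IsAcyclicFor R (ModuleCat.of k (M × M')) := by
  intro n f hf
  obtain ⟨g, hg⟩ := h n (ModuleCat.ofHom (LinearMap.inl k M M') ≫ f) (by
    rw [Category.assoc, hf, Limits.comp_zero])
  obtain ⟨g', hg'⟩ := h' n (ModuleCat.ofHom (LinearMap.inr k M M') ≫ f) (by
    rw [Category.assoc, hf, Limits.comp_zero])
  refine ⟨ModuleCat.ofHom (LinearMap.coprod g.hom g'.hom), ModuleCat.hom_ext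
    (LinearMap.prod_ext ?_ ?_)⟩
  · rw [ModuleCat.hom_comp, ModuleCat.hom_ofHom, LinearMap.comp_assoc, LinearMap.coprod_inl]
    exact congrArg ModuleCat.Hom.hom hg
  · rw [ModuleCat.hom_comp, ModuleCat.hom_ofHom, LinearMap.comp_assoc, LinearMap.coprod_inr]
    exact congrArg ModuleCat.Hom.hom hg'

variable {K : GComplex k G}

lemma GComplex.kos_isAcyclicFor (hK : ∀ n, IsAcyclicFor R (ModuleCat.of k (K.X n))) :
    ∀ (Γ : List G) (n : ℕ), IsAcyclicFor R (ModuleCat.of k ((K.kos Γ).X n))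
  | [], n => hK n
  | _ :: Γ, 0 => kos_isAcyclicFor hK Γ 0
  | _ :: Γ, n + 1 => IsAcyclicFor.prod (kos_isAcyclicFor hK Γ (n + 1)) (kos_isAcyclicFor hK Γ n)

lemma GComplex.toCC_isAcyclicFor (hK : ∀ n, IsAcyclicFor R (ModuleCat.of k (K.X n))) :
    ∀ q, IsAcyclicFor R (K.toCC.X q)
  | .ofNat n => hK n
  | .negSucc _ => IsAcyclicFor.of_subsingleton (inferInstanceAs (Subsingleton PUnit))

lemma GComplex.kos_subsingleton (hK : ∀ n, Subsingleton (K.X (n + 1))) :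
    ∀ (Γ : List G) (n : ℕ), Γ.length < n → Subsingleton ((K.kos Γ).X n)
  | [], n + 1, _ => hK n
  | _ :: Γ, n + 1, h => by
    have h1 := kos_subsingleton hK Γ (n + 1) (by simp at h; omega)
    have h2 := kos_subsingleton hK Γ n (by simpa using h)
    exact inferInstanceAs (Subsingleton ((K.kos Γ).X (n + 1) × (K.kos Γ).X n))

end Acyclic

section Top

variable {M : Type u} [AddCommGroup M] [Module k M] (hG : ∀ a b : G, a * b = b * a)
  (ρ : G →* Module.End k M)

/-- The top degree term of the Koszul complex of a module. -/
def kosTop : ∀ Γ : List G, ((GComplex.degZero hG ρ).kos Γ).X Γ.length →ₗ[k] M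
  | [] => LinearMap.id
  | _ :: Γ => (kosTop Γ).comp (LinearMap.snd k (((GComplex.degZero hG ρ).kos Γ).X (Γ.length + 1)) _)

lemma kosTop_bijective : ∀ Γ : List G, Function.Bijective (kosTop hG ρ Γ)
  | [] => Function.bijective_id
  | _ :: Γ => by
    have h := GComplex.kos_subsingleton (K := GComplex.degZero hG ρ)
      (fun n => inferInstanceAs (Subsingleton PUnit)) Γ (Γ.length + 1) (by omega)
    refine (kosTop_bijective Γ).comp ⟨fun x y hxy => Prod.ext (Subsingleton.elim _ _) hxy,
      fun y => ⟨(0, y), rfl⟩⟩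

lemma kosTop_toKos [TopologicalSpace G] [ContinuousMul G] : ∀ (Γ : List G)
    (f : (modComplex hG ρ).X Γ.length),
    kosTop hG ρ Γ ((toKos hG ρ Γ).f Γ.length f) = topEval k M Γ f.1
  | [], _ => rfl
  | γ :: Γ, f => kosTop_toKos Γ ((modHomotopy hG ρ γ).h Γ.length f)

lemma topEval_map {M' : Type u} [AddCommGroup M'] [Module k M'] (φ : M →ₗ[k] M') :
    ∀ (Γ : List G) (F : (Fin (Γ.length + 1) → G) → M),
    topEval k M' Γ (fun x => φ (F x)) = φ (topEval k M Γ F)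
  | [], _ => rfl
  | γ :: Γ, F => by
    have h : prism k M' γ (Γ.length + 1) (fun x => φ (F x)) =
        fun x => φ (prism k M γ (Γ.length + 1) F x) := funext fun x => prism_map γ φ _ F x
    exact (congrArg (topEval k M' Γ) h).trans (topEval_map φ Γ _)

/-- For a trivial action the operators γ - 1 are zero, and with them all differentials of the Koszul
complex; its terms then coincide with its cohomology. -/
lemma kos_d_eq_zero {K : GComplex k G} (hd : ∀ n x, K.d n x = 0) (ha : ∀ g n x, K.act g n x = x) :
    ∀ Γ : List G, (∀ n x, (K.kos Γ).d n x = 0) ∧ ∀ g n x, (K.kos Γ).act g n x = x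
  | [] => ⟨hd, ha⟩
  | γ :: Γ => by
    obtain ⟨h1, h2⟩ := kos_d_eq_zero hd ha Γ
    refine ⟨?_, ?_⟩
    · rintro (_ | n) x
      · exact Prod.ext (h1 0 x) (sub_eq_zero.2 (h2 γ 0 x))
      · obtain ⟨x, x'⟩ := x
        refine Prod.ext (h1 (n + 1) x) ?_
        change (K.kos Γ).act γ (n + 1) x - x - (K.kos Γ).d n x' = 0
        rw [h1, h2, sub_zero, sub_self]
    · rintro g (_ | n) x
      · exact h2 g 0 x
      · exact Prod.ext (h2 g (n + 1) x.1) (h2 g n x.2)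

end Top

end ToCochainComplex

end

end PolystableDuality

namespace PolystableDuality

open CategoryTheory

noncomputable section

/-! ### Algebra-valued and module-valued cochains -/

section Bridge

set_option linter.unusedSectionVars false

variable {k : Type u} [CommRing k] {G : Type u} [Group G] [TopologicalSpace G]
  {A : Type u} [CommRing A] [Algebra k A] {B : Type u} [CommRing B] [Algebra k B]
  (hG : ∀ a b : G, a * b = b * a)

/-- The underlying linear representation. -/
def toModRep (ρ : G →* (A →ₐ[k] A)) : G →* Module.End k A where
  toFun g := (ρ g).toLinearMap
  map_one' := by rw [map_one]; rfl
  map_mul' g h := by rw [map_mul]; rfl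

lemma faceD_eq_preD (n : ℕ) (f : (Fin (n + 1) → G) → A) :
    faceD k G A (n + 1) f = preD k A G n f := by
  funext x
  rw [faceD_apply]
  change _ = ∑ i : Fin (n + 2), (-1 : A) ^ (i : ℕ) * f (fun s => x (i.succAbove s))
  refine Finset.sum_congr rfl fun i _ => ?_
  rw [Algebra.smul_def, map_pow, map_neg, map_one]

/-- The components of the comparison between the two versions of the cochain complex. -/
def cochainObjIso (ρ : G →* (A →ₐ[k] A)) :
    ∀ n : ℤ, cochainObj ρ n ≅ (modComplex hG (toModRep ρ)).toCCObj n
  | .ofNat n => LinearEquiv.toModuleIso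
    { toFun := fun f : cochains ρ n => (⟨f.1, f.2⟩ : modCochains (toModRep ρ) n)
      invFun := fun f => ⟨f.1, f.2⟩
      map_add' := fun _ _ => rfl
      map_smul' := fun _ _ => rfl }
  | .negSucc _ => Iso.refl _

/-- The comparison between the two versions of the cochain complex. -/
def contComplexIso (ρ : G →* (A →ₐ[k] A)) : contComplex ρ ≅ (modComplex hG (toModRep ρ)).toCC :=
  HomologicalComplex.Hom.isoOfComponents (cochainObjIso hG ρ) (by
    rintro i _ rfl
    rw [contComplex_d, GComplex.toCC_d]
    rcases i with n | n
    · exact ModuleCat.hom_ext (LinearMap.ext fun f => Subtype.ext (faceD_eq_preD n f.1))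
    · exact Limits.comp_zero.trans Limits.zero_comp.symm)

end Bridge

/-! ### Trivial coefficients: vanishing, top cohomology and traces -/

section TrivialCoefficients

set_option linter.unusedSectionVars false

variable {k : Type u} [CommRing k] {G : Type u} [Group G] [TopologicalSpace G]
  [IsTopologicalGroup G] [CompactSpace G] (hG : ∀ a b : G, a * b = b * a) {p : ℕ} [Fact p.Prime]
  (hp : (p : k) = 0) {Γ : List G} (hΓ : IsPadicBasis p Γ)

variable (k) in
/-- The trivial action on the base ring. -/
abbrev trivRep (G : Type u) [Group G] : G →* (k →ₐ[k] k) := 1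

lemma trivRep_isSmooth : IsSmooth (toModRep (trivRep k G)) := fun m => IsLocallyConstant.const m

variable (k Γ) in
/-- The comparison with the Koszul complex for trivial coefficients. -/
def trivToKos : contComplex (trivRep k G) ⟶
    ((GComplex.degZero hG (toModRep (trivRep k G))).kos Γ).toCC :=
  (contComplexIso hG _).hom ≫ (toKos hG (toModRep (trivRep k G)) Γ).toCC

include hG hp hΓ in
lemma quasiIso_trivToKos : QuasiIso (trivToKos k hG Γ) := by
  have := (toKos hG (toModRep (trivRep k G)) Γ).quasiIso_toCC
    (fun n => toKos_bijective hG hp hΓ n trivRep_isSmooth)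
  unfold trivToKos
  infer_instance

lemma trivKos_d (n : ℕ) (x : ((GComplex.degZero hG (toModRep (trivRep k G))).kos Γ).X n) :
    ((GComplex.degZero hG (toModRep (trivRep k G))).kos Γ).d n x = 0 :=
  (kos_d_eq_zero (fun _ _ => rfl) (by rintro g (_ | n) x <;> rfl) Γ).1 n x

lemma trivKos_toCC_d (i j : ℤ) :
    ((GComplex.degZero hG (toModRep (trivRep k G))).kos Γ).toCC.d i j = 0 := by
  by_cases hij : i + 1 = j
  · subst hij
    rw [GComplex.toCC_d]
    rcases i with n | n
    · exact ModuleCat.hom_ext (LinearMap.ext fun x => trivKos_d hG n x)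
    · rfl
  · exact HomologicalComplex.shape _ _ _ hij

include hG hp hΓ in
/-- The vanishing of the cohomology above the top degree. -/
lemma contComplex_exactAt (i : ℤ) (hi : (Γ.length : ℤ) < i) :
    (contComplex (trivRep k G)).ExactAt i := by
  have := quasiIso_trivToKos hG hp hΓ
  rw [exactAt_iff_of_quasiIsoAt (trivToKos k hG Γ) i]
  exact HomologicalComplex.ExactAt.of_isZero (GComplex.toCC_isZero_of_lt _
    (fun n hn => GComplex.kos_subsingleton (fun n => inferInstanceAs (Subsingleton PUnit)) Γ n hn)
    i hi)

variable (k Γ) in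
/-- The projection of the Koszul complex to its top degree. -/
def trivTop : ((GComplex.degZero hG (toModRep (trivRep k G))).kos Γ).toCC ⟶
    (HomologicalComplex.single (ModuleCat.{u} k) (ComplexShape.up ℤ) (Γ.length : ℤ)).obj
      (ModuleCat.of k k) :=
  HomologicalComplex.mkHomToSingle (ModuleCat.ofHom (kosTop hG (toModRep (trivRep k G)) Γ))
    (fun i _ =>
      (congrArg (· ≫ _) (trivKos_toCC_d hG i _)).trans Limits.zero_comp)

lemma trivTop_f_bijective : Function.Bijective ((trivTop k hG Γ).f (Γ.length : ℤ)).hom := by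
  have h1 : Function.Bijective ((HomologicalComplex.singleObjXSelf (ComplexShape.up ℤ)
      (Γ.length : ℤ) (ModuleCat.of k k)).inv).hom :=
    (HomologicalComplex.singleObjXSelf (ComplexShape.up ℤ)
      (Γ.length : ℤ) (ModuleCat.of k k)).toLinearEquiv.symm.bijective
  have h2 : ((trivTop k hG Γ).f (Γ.length : ℤ)).hom = _ := congrArg ModuleCat.Hom.hom
    (HomologicalComplex.mkHomToSingle_f (K := ((GComplex.degZero hG _).kos Γ).toCC)
      (j := (Γ.length : ℤ)) (ModuleCat.ofHom (kosTop hG (toModRep (trivRep k G)) Γ)) _)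
  rw [h2]
  exact h1.comp (kosTop_bijective hG (toModRep (trivRep k G)) Γ)

lemma quasiIsoAt_trivTop : QuasiIsoAt (trivTop k hG Γ) (Γ.length : ℤ) := by
  have hb := trivTop_f_bijective (k := k) hG (Γ := Γ)
  refine quasiIsoAt_of_cohInj_cohSurj _ _ (fun x hx hx' => ?_) (fun z hz => ?_)
  · obtain ⟨i', w, hw⟩ := hx'
    rw [HomologicalComplex.single_obj_d] at hw
    have h0 : x = 0 := hb.1 (hw.symm.trans (map_zero _).symm)
    exact ⟨0, 0, (map_zero _).trans h0.symm⟩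
  · obtain ⟨x, rfl⟩ := hb.2 z
    exact ⟨x, by rw [trivKos_toCC_d]; rfl, 0, 0, (map_zero _).trans (sub_self _).symm⟩

include hG hp hΓ in
/-- A morphism inducing an isomorphism on top cohomology. -/
lemma exists_isIso_homologyMap : ∃ t : contComplex (trivRep k G) ⟶
    (HomologicalComplex.single (ModuleCat.{u} k) (ComplexShape.up ℤ) (Γ.length : ℤ)).obj
      (ModuleCat.of k k), IsIso (HomologicalComplex.homologyMap t (Γ.length : ℤ)) := by
  have := quasiIso_trivToKos hG hp hΓ
  have := quasiIsoAt_trivTop (k := k) hG (Γ := Γ)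
  exact ⟨trivToKos k hG Γ ≫ trivTop k hG Γ, by
    rw [← quasiIsoAt_iff_isIso_homologyMap]; infer_instance⟩

/-- The target has zero differentials, so there are no boundaries by which a class could be
corrected, and surjectivity on cohomology is already surjectivity on cochains. -/
lemma surjective_of_epi_homologyMap {K : CochainComplex (ModuleCat.{u} k) ℤ} {N : ModuleCat.{u} k}
    {d : ℤ} (f : K ⟶ (HomologicalComplex.single (ModuleCat.{u} k) (ComplexShape.up ℤ) d).obj N)
    (hf : Epi (HomologicalComplex.homologyMap f d)) : Function.Surjective (f.f d).hom := by
  rw [HomologicalComplex.epi_homologyMap_iff_up_to_refinements f (d - 1) d (d + 1) (by simp)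
    (by simp)] at hf
  obtain ⟨A', π, hπ, x, hx, y, hy⟩ := hf (𝟙 _) (by
    rw [HomologicalComplex.single_obj_d, Limits.comp_zero])
  rw [HomologicalComplex.single_obj_d, Limits.comp_zero, add_zero, Category.comp_id] at hy
  rw [hy] at hπ
  exact (ModuleCat.epi_iff_surjective _).1 (epi_of_epi x (f.f d))

variable [HasDerivedCategory.{w} (ModuleCat.{u} k)]

lemma homologyMap_eq_of_Q_map_eq {K L : CochainComplex (ModuleCat.{u} k) ℤ} {f g : K ⟶ L}
    (h : DerivedCategory.Q.map f = DerivedCategory.Q.map g) (n : ℤ) :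
    HomologicalComplex.homologyMap f n = HomologicalComplex.homologyMap g n := by
  have h1 := DerivedCategory.homologyFunctorFactors_hom_naturality f n
  have h2 := DerivedCategory.homologyFunctorFactors_hom_naturality g n
  rw [h, h2] at h1
  exact ((cancel_epi _).1 h1).symm

variable (R : InjectiveResolution (ModuleCat.of k k))

include hG hp hΓ in
/-- In the derived category, a trace on trivial coefficients is a multiple of the projection of the
Koszul complex to its top degree. -/
lemma exists_trace_eq (hR : IsAcyclicFor R (ModuleCat.of k k)) (t : contComplex (trivRep k G) ⟶
    (HomologicalComplex.single (ModuleCat.{u} k) (ComplexShape.up ℤ) (Γ.length : ℤ)).obj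
      (ModuleCat.of k k)) (ht : IsIso (HomologicalComplex.homologyMap t (Γ.length : ℤ))) :
    ∃ (t' : contComplex (trivRep k G) ⟶
      (HomologicalComplex.single (ModuleCat.{u} k) (ComplexShape.up ℤ) (Γ.length : ℤ)).obj
      (ModuleCat.of k k)) (τ : k →ₗ[k] k),
      DerivedCategory.Q.map t = DerivedCategory.Q.map t' ∧ Function.Surjective τ ∧
      ∀ f : cochains (trivRep k G) Γ.length,
        (t'.f (Γ.length : ℤ) ≫ (HomologicalComplex.singleObjXSelf (ComplexShape.up ℤ)
          (Γ.length : ℤ) (ModuleCat.of k k)).hom).hom f = τ (topEval k k Γ f.1) := by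
  have hq := quasiIso_trivToKos hG hp hΓ
  -- Transport t to the Koszul complex. Its terms are acyclic, so there t is represented by a chain
  -- map, which amounts to a functional on the top term.
  obtain ⟨g, hg⟩ := exists_Q_map_eq R (Γ.length : ℤ) (GComplex.toCC_isZero_of_lt _
    (fun n hn => GComplex.kos_subsingleton (fun n => inferInstanceAs (Subsingleton PUnit)) Γ n hn))
    (GComplex.toCC_isAcyclicFor (GComplex.kos_isAcyclicFor (by
      rintro (_ | n)
      · exact hR
      · exact IsAcyclicFor.of_subsingleton (inferInstanceAs (Subsingleton PUnit))) Γ))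
    (inv (DerivedCategory.Q.map (trivToKos k hG Γ)) ≫ DerivedCategory.Q.map t)
  have hQ : DerivedCategory.Q.map t = DerivedCategory.Q.map (trivToKos k hG Γ ≫ g) := by
    rw [Functor.map_comp, hg, IsIso.hom_inv_id_assoc]
  let G0 : ((GComplex.degZero hG (toModRep (trivRep k G))).kos Γ).X Γ.length →ₗ[k] k :=
    (g.f (Γ.length : ℤ) ≫ (HomologicalComplex.singleObjXSelf (ComplexShape.up ℤ)
          (Γ.length : ℤ) (ModuleCat.of k k)).hom).hom
  let e := LinearEquiv.ofBijective _ (kosTop_bijective hG (toModRep (trivRep k G)) Γ)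
  refine ⟨trivToKos k hG Γ ≫ g, G0.comp e.symm.toLinearMap, hQ, ?_, fun f => ?_⟩
  -- Surjectivity of τ is enough: a surjective endomorphism of the module k is multiplication by a
  -- unit.
  · have h1 : Epi (HomologicalComplex.homologyMap g (Γ.length : ℤ)) := by
      rw [homologyMap_eq_of_Q_map_eq hQ, HomologicalComplex.homologyMap_comp] at ht
      exact epi_of_epi (HomologicalComplex.homologyMap (trivToKos k hG Γ) _) _
    have h2 : Function.Surjective G0 := by
      have := (HomologicalComplex.singleObjXSelf (ComplexShape.up ℤ)
          (Γ.length : ℤ) (ModuleCat.of k k)).toLinearEquiv.surjective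
      exact this.comp (surjective_of_epi_homologyMap g h1)
    exact h2.comp e.symm.surjective
  · rw [LinearMap.comp_apply]
    have : e.symm (topEval k k Γ f.1) = (toKos hG (toModRep (trivRep k G)) Γ).f Γ.length
        (⟨f.1, f.2⟩ : modCochains (toModRep (trivRep k G)) Γ.length) := by
      rw [LinearEquiv.symm_apply_eq]
      exact (kosTop_toKos hG (toModRep (trivRep k G)) Γ
        (⟨f.1, f.2⟩ : modCochains (toModRep (trivRep k G)) Γ.length)).symm
    exact (congrArg G0 this).symm

end TrivialCoefficients

/-! ### Dependence of the duality map on the trace -/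

section AlmostDuality

set_option linter.unusedSectionVars false

variable {k : Type u} [CommRing k] {G : Type u} [Group G] [TopologicalSpace G]
  {A : Type u} [CommRing A] [Algebra k A] {N : ModuleCat.{u} k} {d : ℤ}
  [HasDerivedCategory.{w} (ModuleCat.{u} k)]

/-- The morphism `N[-(j+i)][i] ⟶ N[-j]`. -/
def singleShiftHom (N : ModuleCat.{u} k) (i j : ℤ) :
    ((HomologicalComplex.single (ModuleCat.{u} k) (ComplexShape.up ℤ) (j + i)).obj N)⟦i⟧ ⟶
      (HomologicalComplex.single (ModuleCat.{u} k) (ComplexShape.up ℤ) j).obj N :=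
  HomologicalComplex.mkHomToSingle
    (HomologicalComplex.singleObjXSelf (ComplexShape.up ℤ) (j + i) N).hom (by
      intro l hl
      have hl' : l + 1 = j := hl
      exact (HomologicalComplex.isZero_single_obj_X (ComplexShape.up ℤ) (j + i) N (l + i)
        (by omega)).eq_of_src _ _)

lemma singleShiftHom_f (N : ModuleCat.{u} k) (i j : ℤ) : (singleShiftHom N i j).f j =
    (HomologicalComplex.singleObjXSelf (ComplexShape.up ℤ) (j + i) N).hom ≫
      (HomologicalComplex.singleObjXSelf (ComplexShape.up ℤ) j N).inv :=
  HomologicalComplex.mkHomToSingle_f _ _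

/-- The morphism to a shifted module obtained by shifting a trace. -/
def shiftTrace {K : CochainComplex (ModuleCat.{u} k) ℤ} {i j : ℤ} (M : K ⟶ K⟦i⟧)
    (T : K ⟶ (HomologicalComplex.single (ModuleCat.{u} k) (ComplexShape.up ℤ) (j + i)).obj N) :
    K ⟶ (HomologicalComplex.single (ModuleCat.{u} k) (ComplexShape.up ℤ) j).obj N :=
  M ≫ T⟦i⟧' ≫ singleShiftHom N i j

lemma Q_map_shiftTrace_congr {K : CochainComplex (ModuleCat.{u} k) ℤ} {i j : ℤ} (M : K ⟶ K⟦i⟧)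
    {T T' : K ⟶ (HomologicalComplex.single (ModuleCat.{u} k) (ComplexShape.up ℤ) (j + i)).obj N}
    (hT : DerivedCategory.Q.map T = DerivedCategory.Q.map T') :
    DerivedCategory.Q.map (shiftTrace M T) = DerivedCategory.Q.map (shiftTrace M T') := by
  have h : DerivedCategory.Q.map (T⟦i⟧') = DerivedCategory.Q.map (T'⟦i⟧') := by
    have h1 := (DerivedCategory.Q.commShiftIso i).hom.naturality T
    have h2 := (DerivedCategory.Q.commShiftIso i).hom.naturality T'
    simp only [Functor.comp_map] at h1 h2
    rw [hT, ← h2] at h1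
    exact (cancel_mono _).1 h1
  unfold shiftTrace
  rw [Functor.map_comp, Functor.map_comp, h, ← Functor.map_comp, ← Functor.map_comp]

/-- The differential of the complex of continuous cochains, between arbitrary degrees. -/
def contD (ρ : G →* (A →ₐ[k] A)) (a b : ℤ) : cochainObj ρ a →ₗ[k] cochainObj ρ b :=
  ((contComplex ρ).d a b).hom

lemma contD_succ (ρ : G →* (A →ₐ[k] A)) (a b : ℤ) (h : a + 1 = b) (x : cochainObj ρ a) :
    contD ρ a b x = (show a + 1 = b from h) ▸ cochainObjD ρ a x := by
  subst h
  exact congrArg (fun g => g.hom x) (contComplex_d ρ a)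

lemma contD_cupZ (ρ : G →* (A →ₐ[k] A)) (i j n n' : ℤ) (h : i + j = n) (hn : n + 1 = n')
    (x : cochainObj ρ i) (y : cochainObj ρ j) :
    contD ρ n n' (cupZ ρ i j n h x y) =
      cupZ ρ (i + 1) j n' (by omega) (contD ρ i (i + 1) x) y +
        i.negOnePow • cupZ ρ i (j + 1) n' (by omega) x (contD ρ j (j + 1) y) := by
  subst hn
  rw [contD_succ ρ n _ rfl, contD_succ ρ i _ rfl, contD_succ ρ j _ rfl]
  exact cochainObjD_cupZ ρ i j n h x y

/-- The sign is the one in the differential of the shifted complex; with it, cup product with a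
cocycle is a morphism of complexes. -/
lemma contD_cupLeft (ρ : G →* (A →ₐ[k] A)) (i n : ℤ) (z : cochainObj ρ i)
    (hz : contD ρ i (i + 1) z = 0) (y : cochainObj ρ n) :
    i.negOnePow • contD ρ (n + i) (n + 1 + i) (cupZ ρ i n (n + i) (add_comm _ _) z y) =
      cupZ ρ i (n + 1) (n + 1 + i) (add_comm _ _) z (contD ρ n (n + 1) y) := by
  rw [contD_cupZ ρ i n (n + i) _ _ (by omega), hz, map_zero, LinearMap.zero_apply, zero_add,
    smul_smul, Int.units_mul_self, one_smul]

lemma contD_cupRight (ρ : G →* (A →ₐ[k] A)) (i n : ℤ) (z : cochainObj ρ i)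
    (hz : contD ρ i (i + 1) z = 0) (y : cochainObj ρ n) :
    i.negOnePow • contD ρ (n + i) (n + 1 + i) ((n * i).negOnePow • cupZ ρ n i (n + i) rfl y z) =
      ((n + 1) * i).negOnePow • cupZ ρ (n + 1) i (n + 1 + i) rfl (contD ρ n (n + 1) y) z := by
  rw [Units.smul_def (n * i).negOnePow, map_zsmul, ← Units.smul_def,
    contD_cupZ ρ n i (n + i) _ _ (by omega), hz, map_zero, smul_zero, add_zero, smul_smul,
    ← Int.negOnePow_add, show i + n * i = (n + 1) * i by ring]

/-- Cup product with a cocycle on the left. -/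
def cupLeft (ρ : G →* (A →ₐ[k] A)) {i : ℤ} (z : cocycles (contComplex ρ) i) :
    contComplex ρ ⟶ (contComplex ρ)⟦i⟧ where
  f n := ModuleCat.ofHom (cupZ ρ i n (n + i) (add_comm _ _) z.1)
  comm' := by
    rintro n _ rfl
    rw [CochainComplex.shiftFunctor_obj_d']
    exact ModuleCat.hom_ext (LinearMap.ext fun y => contD_cupLeft ρ i n z.1 z.2 y)

/-- Cup product with a cocycle on the right, with the sign of the interchange. -/
def cupRight (ρ : G →* (A →ₐ[k] A)) {i : ℤ} (z : cocycles (contComplex ρ) i) :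
    contComplex ρ ⟶ (contComplex ρ)⟦i⟧ where
  f n := ModuleCat.ofHom ((n * i).negOnePow • (cupZ ρ n i (n + i) rfl).flip z.1)
  comm' := by
    rintro n _ rfl
    rw [CochainComplex.shiftFunctor_obj_d']
    exact ModuleCat.hom_ext (LinearMap.ext fun y => contD_cupRight ρ i n z.1 z.2 y)

/-- The duality map depends only on the class of the trace in the derived category. -/
lemma cupPairing_cocycleDuality_congr (ρ : G →* (A →ₐ[k] A)) {T T' : contComplex ρ ⟶
    (HomologicalComplex.single (ModuleCat.{u} k) (ComplexShape.up ℤ) d).obj N}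
    (hT : DerivedCategory.Q.map T = DerivedCategory.Q.map T') (i j : ℤ) (h : i + j = d) :
    (cupPairing ρ T).cocycleDuality i j h = (cupPairing ρ T').cocycleDuality i j h ∧
    (cupPairing ρ T).flip.cocycleDuality i j h = (cupPairing ρ T').flip.cocycleDuality i j h := by
  obtain rfl : d = j + i := by omega
  -- The morphism ⟨z, -⟩ is cup product with z, from K to K[i], followed by the shifted trace. Hence
  -- it depends only on the trace as a morphism of the derived category.
  have key : ∀ (S : contComplex ρ ⟶ (HomologicalComplex.single (ModuleCat.{u} k)
      (ComplexShape.up ℤ) (j + i)).obj N) (z : cocycles (contComplex ρ) i),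
      (cupPairing ρ S).toSingle i j h z = shiftTrace (cupLeft ρ z) S ∧
      (cupPairing ρ S).flip.toSingle i j h z = shiftTrace (cupRight ρ z) S := by
    intro S z
    let F : (contComplex ρ).X (j + i) →ₗ[k] N :=
      (S.f (j + i) ≫ (HomologicalComplex.singleObjXSelf (ComplexShape.up ℤ) (j + i) N).hom).hom
    have hs : ∀ M : contComplex ρ ⟶ (contComplex ρ)⟦i⟧, (shiftTrace M S).f j =
        ModuleCat.ofHom (F.comp (M.f j).hom) ≫
          (HomologicalComplex.singleObjXSelf (ComplexShape.up ℤ) j N).inv := by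
      intro M
      have : (shiftTrace M S).f j = M.f j ≫ S.f (j + i) ≫ (singleShiftHom N i j).f j := rfl
      rw [this, singleShiftHom_f]
      rfl
    refine ⟨HomologicalComplex.to_single_hom_ext ?_, HomologicalComplex.to_single_hom_ext ?_⟩
    · rw [ChainPairing.toSingle_f, hs]
      rfl
    · rw [ChainPairing.toSingle_f, hs]
      congr 1
      refine ModuleCat.hom_ext (LinearMap.ext fun y => ?_)
      have h1 : ∀ w : (contComplex ρ).X (j + i),
          F ((j * i).negOnePow • w) = (j * i).negOnePow • F w := by
        intro w
        rw [Units.smul_def, Units.smul_def, map_zsmul]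
      exact (h1 (cupZ ρ j i (j + i) rfl y z.1)).symm
  constructor
  · refine LinearMap.ext fun z => ?_
    change DerivedCategory.Q.map _ = DerivedCategory.Q.map _
    rw [(key T z).1, (key T' z).1, Q_map_shiftTrace_congr _ hT]
  · refine LinearMap.ext fun z => ?_
    change DerivedCategory.Q.map _ = DerivedCategory.Q.map _
    rw [(key T z).2, (key T' z).2, Q_map_shiftTrace_congr _ hT]

end AlmostDuality

end

end PolystableDuality

namespace PolystableDuality

open CategoryTheory

noncomputable section

/-! ### Duality for coefficients that are almost a retract -/

section AlmostDualityTheorem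

set_option linter.unusedSectionVars false

variable {k : Type u} [CommRing k] {G : Type u} [Group G] [TopologicalSpace G]
  [IsTopologicalGroup G] [CompactSpace G] (hG : ∀ a b : G, a * b = b * a) {p : ℕ} [Fact p.Prime]
  (hp : (p : k) = 0) {Γ : List G} (hΓ : IsPadicBasis p Γ)
  {A : Type u} [CommRing A] [Algebra k A] (ρ : G →* (A →ₐ[k] A))

/-- The prism for γ composed with U_γ is a homotopy for (γ - 1)U_γ; null-homotopic maps add up. -/
lemma modHomotopy_comp_isNullHomotopic (U : G → A →ₗ[k] A)
    (hU : ∀ γ g x, U γ (ρ g x) = ρ g (U γ x)) (φ : A →ₗ[k] A) (hφ : ∀ g x, φ (ρ g x) = ρ g (φ x))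
    (hsum : ∀ x, φ x = (Γ.map fun γ => ρ γ (U γ x) - U γ x).sum) :
    GHom.IsNullHomotopic _ _
      (modComplexMap hG (ρ := toModRep ρ) (σ := toModRep ρ) φ hφ).f := by
  have h1 : ∀ γ, GHom.IsNullHomotopic (modComplex hG (toModRep ρ)) (modComplex hG (toModRep ρ))
      (fun n => ((modComplex hG (toModRep ρ)).act γ n - LinearMap.id).comp
        ((modComplexMap hG (ρ := toModRep ρ) (σ := toModRep ρ) (U γ) (hU γ)).f n)) := by
    intro γ
    refine ⟨fun n => ((modHomotopy hG (toModRep ρ) γ).h n).comp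
      ((modComplexMap hG (ρ := toModRep ρ) (σ := toModRep ρ) (U γ) (hU γ)).f (n + 1)),
      fun x => ?_, fun n x => ?_⟩
    · rw [LinearMap.comp_apply, GHom.comm, ActHomotopy.h_d_zero]
      rfl
    · rw [LinearMap.comp_apply, LinearMap.comp_apply, GHom.comm, ActHomotopy.h_d_succ]
      rfl
  have h2 : ∀ L : List G, GHom.IsNullHomotopic (modComplex hG (toModRep ρ))
      (modComplex hG (toModRep ρ)) (fun n => (L.map fun γ =>
        ((modComplex hG (toModRep ρ)).act γ n - LinearMap.id).comp
        ((modComplexMap hG (ρ := toModRep ρ) (σ := toModRep ρ) (U γ) (hU γ)).f n)).sum) := by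
    intro L
    induction L with
    | nil => exact GHom.IsNullHomotopic.zero
    | cons γ L ih =>
      simp only [List.map_cons, List.sum_cons]
      exact (h1 γ).add ih
  have h3 : (modComplexMap hG (ρ := toModRep ρ) (σ := toModRep ρ) φ hφ).f = fun n =>
      (Γ.map fun γ => ((modComplex hG (toModRep ρ)).act γ n - LinearMap.id).comp
        ((modComplexMap hG (ρ := toModRep ρ) (σ := toModRep ρ) (U γ) (hU γ)).f n)).sum := by
    funext n
    refine LinearMap.ext fun f => Subtype.ext (funext fun x => ?_)
    have h4 : ∀ L : List G, (((L.map fun γ =>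
        ((modComplex hG (toModRep ρ)).act γ n - LinearMap.id).comp
        ((modComplexMap hG (ρ := toModRep ρ) (σ := toModRep ρ) (U γ) (hU γ)).f n)).sum :
          modCochains (toModRep ρ) n →ₗ[k] modCochains (toModRep ρ) n) f).1 x =
        (L.map fun γ => ρ γ (U γ (f.1 x)) - U γ (f.1 x)).sum := by
      intro L
      induction L with
      | nil => rfl
      | cons γ L ih =>
        simp only [List.map_cons, List.sum_cons, ← ih]
        rfl
    exact (hsum (f.1 x)).trans (h4 Γ).symm
  rw [h3]
  exact h2 Γ

variable [HasDerivedCategory.{w} (ModuleCat.{u} k)] (R : InjectiveResolution (ModuleCat.of k k))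
  (hRk : IsAcyclicFor R (ModuleCat.of k k))
  (pr : A →ₗ[k] k) (hpr : ∀ g a, pr (ρ g a) = trivRep k G g (pr a))
  (t : contComplex (trivRep k G) ⟶
    (HomologicalComplex.single (ModuleCat.{u} k) (ComplexShape.up ℤ) (Γ.length : ℤ)).obj
      (ModuleCat.of k k)) (ht : IsIso (HomologicalComplex.homologyMap t (Γ.length : ℤ)))
  {B : Type u} [AddCommGroup B] [Module k B] {σ : G →* Module.End k B} (hσ : IsSmooth σ)
  (hRB : IsAcyclicFor R (ModuleCat.of k B))
  (ι : B →ₗ[k] A) (hι : ∀ g x, ι (σ g x) = ρ g (ι x))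
  (π : A →ₗ[k] B) (hπ : ∀ g x, π (ρ g x) = σ g (π x))
  (hadj : ∀ x y, pr (x * ι y) = pr (ι (π x) * ι y))
  (hperf : ∀ φ : B →ₗ[k] k, ∃! x, ∀ y, pr (ι x * ι y) = φ y)
  (a : k) (U : G → A →ₗ[k] A) (hU : ∀ γ g x, U γ (ρ g x) = ρ g (U γ x))
  (hsum : ∀ x, a • x - a • ι (π x) = (Γ.map fun γ => ρ γ (U γ x) - U γ x).sum)

include hG hp hΓ hRk hpr ht hσ hRB hι hπ hadj hperf hU hsum

/-- If the coefficients are, up to `a` and up to homotopy, a retract of an acyclic module on which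
the trace form is perfect, then cup product duality holds up to `a`. -/
theorem cupPairing_duality_upTo (i j : ℤ) (h : i + j = (Γ.length : ℤ)) :
    (cupPairing ρ (contComplexMap ρ (trivRep k G) pr hpr ≫ t)).DualityInjUpTo a i j h ∧
    (cupPairing ρ (contComplexMap ρ (trivRep k G) pr hpr ≫ t)).DualitySurjUpTo a i j h ∧
    (cupPairing ρ (contComplexMap ρ (trivRep k G) pr hpr ≫ t)).flip.DualityInjUpTo a i j h ∧
    (cupPairing ρ (contComplexMap ρ (trivRep k G) pr hpr ≫ t)).flip.DualitySurjUpTo a i j h := by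
  obtain ⟨t', τ, hQ, hτ, ht'⟩ := exists_trace_eq hG hp hΓ R hRk t ht
  have hQ' : DerivedCategory.Q.map (contComplexMap ρ (trivRep k G) pr hpr ≫ t) =
      DerivedCategory.Q.map (contComplexMap ρ (trivRep k G) pr hpr ≫ t') := by
    rw [Functor.map_comp, hQ, ← Functor.map_comp]
  unfold ChainPairing.DualityInjUpTo ChainPairing.DualitySurjUpTo
  obtain ⟨e1, e2⟩ := cupPairing_cocycleDuality_congr ρ hQ' i j h
  rw [e1, e2]
  -- the trace form
  obtain ⟨c, hc⟩ := hτ 1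
  have hτc : ∀ x, τ x = τ 1 * x := fun x => by
    rw [mul_comm, ← smul_eq_mul, ← map_smul, smul_eq_mul, mul_one]
  rw [hτc] at hc
  -- The map τ is multiplication by a unit with inverse c. Building it into the form matches the
  -- given trace and keeps the form perfect.
  let b : B →ₗ[k] B →ₗ[k] k := LinearMap.mk₂ k (fun x y => τ (pr (ι x * ι y)))
    (fun x x' y => by simp only [map_add, add_mul]) (fun r x y => by simp only [map_smul, smul_mul_assoc])
    (fun x y y' => by simp only [map_add, mul_add]) (fun r x y => by simp only [map_smul, mul_smul_comm])
  have hbflip : b.flip = b := LinearMap.ext₂ fun x y => by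
    change τ (pr (ι y * ι x)) = τ (pr (ι x * ι y))
    rw [mul_comm]
  have hb1 : Function.Bijective b := by
    constructor
    · intro x x' hxx
      obtain ⟨z, hz, hz'⟩ := hperf ((LinearMap.mulLeft k c).comp (b x))
      have : ∀ x y, pr (ι x * ι y) = c * b x y := fun x y => by
        change _ = c * τ _
        rw [hτc, ← mul_assoc, mul_comm c, hc, one_mul]
      rw [hz' x (fun y => this x y), hz' x' (fun y => by rw [this, hxx]; rfl)]
    · intro φ
      obtain ⟨z, hz, -⟩ := hperf ((LinearMap.mulLeft k c).comp φ)
      refine ⟨z, LinearMap.ext fun y => ?_⟩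
      change τ (pr (ι z * ι y)) = φ y
      rw [hz, hτc]
      change τ 1 * (c * φ y) = φ y
      rw [← mul_assoc, hc, one_mul]
  have hbσ : ∀ g x y, b (σ g x) (σ g y) = b x y := by
    intro g x y
    change τ (pr (ι (σ g x) * ι (σ g y))) = τ (pr (ι x * ι y))
    rw [hι, hι, ← map_mul, hpr]
    rfl
  let βK := (GPairing.degZero hG b hbσ).kos Γ
  have hperfK : βK.IsTermPerfect :=
    (GPairing.degZero_isTermPerfect hG b hbσ hb1 (by rw [hbflip]; exact hb1)).kos Γ
  have hlen : ((0 + Γ.length : ℕ) : ℤ) = (Γ.length : ℤ) := by rw [zero_add]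
  let β₀ := βK.toChain (Γ.length : ℤ) hlen
  let κ := (toKos hG σ Γ).toCC
  have hκ := fun n => toKos_bijective hG hp hΓ n hσ
  have : QuasiIso κ := (toKos hG σ Γ).quasiIso_toCC hκ
  have hκ1 := (toKos hG σ Γ).cohInj_toCC (fun n => (hκ n).1) i
  have hκ2 := (toKos hG σ Γ).cohSurj_toCC (fun n => (hκ n).2) i
  -- Duality for B holds degree by degree on the Koszul complex and is carried to cochains by the
  -- quasi-isomorphism κ.
  let β₁ := β₀.comap κ κ
  have hK0 : ∀ q, (Γ.length : ℤ) < q →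
      Limits.IsZero (((GComplex.degZero hG σ).kos Γ).toCC.X q) :=
    GComplex.toCC_isZero_of_lt _ (fun n hn =>
      GComplex.kos_subsingleton (fun n => inferInstanceAs (Subsingleton PUnit)) Γ n hn)
  have hKR : ∀ q, IsAcyclicFor R (((GComplex.degZero hG σ).kos Γ).toCC.X q) :=
    GComplex.toCC_isAcyclicFor (GComplex.kos_isAcyclicFor (by
      rintro (_ | n)
      · exact hRB
      · exact IsAcyclicFor.of_subsingleton (inferInstanceAs (Subsingleton PUnit))) Γ)
  have hβ₀ := fun i j hij => hperfK.toChain_bijective (Γ.length : ℤ) hlen i j hij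
  have hflip := fun i j (hij : i + j = (Γ.length : ℤ)) =>
    β₀.flip_comp_bijective i j hij (hβ₀ j i (by omega)).2
  have d1 : β₁.DualityInjUpTo 1 i j h := (β₀.dualityInjUpTo_of_bijective hK0 R hKR
    (fun i j hij => (hβ₀ i j hij).1) i j h).comap β₀ κ κ h hκ1
  have d2 : β₁.DualitySurjUpTo 1 i j h := (β₀.dualitySurjUpTo_of_bijective hK0 R hKR
    (fun i j hij => (hβ₀ i j hij).1) i j h).comap β₀ κ κ h hκ2
  have d3 : β₁.flip.DualityInjUpTo 1 i j h := (β₀.flip.dualityInjUpTo_of_bijective hK0 R hKR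
    hflip i j h).comap β₀.flip κ κ h hκ1
  have d4 : β₁.flip.DualitySurjUpTo 1 i j h := (β₀.flip.dualitySurjUpTo_of_bijective hK0 R hKR
    hflip i j h).comap β₀.flip κ κ h hκ2
  -- the retraction
  let Φ := contComplexIso hG ρ
  let ιG := (modComplexMap hG (ρ := σ) (σ := toModRep ρ) ι hι)
  let πG := (modComplexMap hG (ρ := toModRep ρ) (σ := σ) π hπ)
  let ιC := ιG.toCC ≫ Φ.inv
  let πC := Φ.hom ≫ πG.toCC
  set β := cupPairing ρ (contComplexMap ρ (trivRep k G) pr hpr ≫ t') with hβ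
  have hβcomp : ∀ (i j : ℕ) (hij : (i : ℤ) + j = (Γ.length : ℤ)) (x : cochains ρ i)
      (y : cochains ρ j), β.comp (i : ℤ) (j : ℤ) hij x y = topEval k k Γ
        (fun g => τ (pr (x.1 (fun s => g ⟨s, by omega⟩) * y.1 (fun s => g ⟨i + s, by omega⟩)))) := by
    intro i j hij x y
    have h1 := ht' (cochainsMap ρ (trivRep k G) pr hpr Γ.length
      (cup ρ i j Γ.length (by omega) x y))
    rw [← topEval_map] at h1
    exact h1
  have hβ₁comp : ∀ (i j : ℕ) (hij : (i : ℤ) + j = (Γ.length : ℤ)) (x : modCochains σ i)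
      (y : modCochains σ j), β₁.comp (i : ℤ) (j : ℤ) hij x y = topEval k k Γ
        (rawCup b i j Γ.length (by omega) x.1 y.1) :=
    fun i j hij x y => kos_comp_toKos hG b hbσ Γ i j (by omega) x y
  -- Since pr(x · ιy) = pr(ιπx · ιy), the maps induced by ι and π are adjoint for the two cup
  -- product pairings, already on cochains. Both pairings have been brought to the form `topEval` of
  -- a cup product.
  have a1 : ∀ (i j : ℤ) (h : i + j = (Γ.length : ℤ)) x y,
      β.comp i j h x ((ιC.f j).hom y) = β₁.comp i j h ((πC.f i).hom x) y := by
    rintro (i | i) (j | j) h x y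
    · refine (hβcomp i j h x _).trans (Eq.trans ?_ (hβ₁comp i j h _ y).symm)
      exact congrArg _ (funext fun g => congrArg τ (hadj _ _))
    · have h0 : y = 0 := rfl
      rw [h0, map_zero, map_zero, map_zero]
    · have h0 : x = 0 := rfl
      rw [h0, map_zero, map_zero, map_zero]
      rfl
    · have h0 : x = 0 := rfl
      rw [h0, map_zero, map_zero, map_zero]
      rfl
  have a2 : ∀ (i j : ℤ) (h : i + j = (Γ.length : ℤ)) x y,
      β.comp i j h ((ιC.f i).hom x) y = β₁.comp i j h x ((πC.f j).hom y) := by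
    rintro (i | i) (j | j) h x y
    · refine (hβcomp i j h _ y).trans (Eq.trans ?_ (hβ₁comp i j h x _).symm)
      refine congrArg _ (funext fun g => congrArg τ ?_)
      refine (congrArg pr (mul_comm _ _)).trans ((hadj _ _).trans (congrArg pr (mul_comm _ _)))
    · have h0 : y = 0 := rfl
      rw [h0, map_zero, map_zero, map_zero]
    · have h0 : x = 0 := rfl
      rw [h0, map_zero, map_zero, map_zero]
      rfl
    · have h0 : x = 0 := rfl
      rw [h0, map_zero, map_zero, map_zero]
      rfl
  let φ : A →ₗ[k] A := a • LinearMap.id - a • ι.comp π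
  have hφ : ∀ g x, φ (ρ g x) = ρ g (φ x) := by
    intro g x
    change a • ρ g x - a • ι (π (ρ g x)) = ρ g (a • x - a • ι (π x))
    rw [hπ, hι, map_sub, map_smul, map_smul]
  have hnull := modHomotopy_comp_isNullHomotopic hG ρ U hU φ hφ hsum
  let φG := modComplexMap hG (ρ := toModRep ρ) (σ := toModRep ρ) φ hφ
  -- The difference between a and a·ιπ comes from φ, which is null-homotopic. This yields the
  -- identity in the derived category and the one on cocycles, which the two retract criteria
  -- require.
  have hφC : Φ.hom ≫ φG.toCC ≫ Φ.inv = a • 𝟙 _ - a • (πC ≫ ιC) := by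
    refine HomologicalComplex.hom_ext _ _ fun i => ?_
    rcases i with n | n
    · rfl
    · rfl
  have hQφ : a • DerivedCategory.Q.map (πC ≫ ιC) = a • 𝟙 (DerivedCategory.Q.obj _) := by
    obtain ⟨H⟩ := hnull.homotopy φG
    have h1 : DerivedCategory.Q.map φG.toCC = 0 := by
      rw [DerivedCategory.Q_map_eq_of_homotopy _ H, Functor.map_zero]
    have h2 : DerivedCategory.Q.map (Φ.hom ≫ φG.toCC ≫ Φ.inv) = 0 := by
      rw [Functor.map_comp, Functor.map_comp, h1, Limits.zero_comp, Limits.comp_zero]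
    rw [hφC, Functor.map_sub, Functor.map_smul, Functor.map_smul, CategoryTheory.Functor.map_id,
      sub_eq_zero] at h2
    exact h2.symm
  have hcob : ∀ x : (contComplex ρ).X i, ((contComplex ρ).d i (i + 1)).hom x = 0 →
      IsCobdry (contComplex ρ) i (a • x - a • (ιC.f i).hom ((πC.f i).hom x)) := by
    intro x hx
    have h1 : ((modComplex hG (toModRep ρ)).toCC.d i (i + 1)).hom ((Φ.hom.f i).hom x) = 0 :=
      (ChainPairing.mapCocycle Φ.hom ⟨x, hx⟩).2
    have h2 := (hnull.isCobdry φG i _ h1).map Φ.inv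
    have h3 : (Φ.inv.f i).hom ((φG.toCC.f i).hom ((Φ.hom.f i).hom x)) =
        a • x - a • (ιC.f i).hom ((πC.f i).hom x) :=
      congrArg (fun g => (g.f i).hom x) hφC
    rwa [h3] at h2
  refine ⟨d1.of_retract β β₁ ιC πC ιC a h hcob (a1 i j h),
    d2.of_retract β β₁ ιC ιC πC a h hQφ (a2 i j h),
    d3.of_retract β.flip β₁.flip ιC πC ιC a h hcob (fun x y => ?_),
    d4.of_retract β.flip β₁.flip ιC ιC πC a h hQφ (fun x y => ?_)⟩
  · rw [ChainPairing.flip_comp, ChainPairing.flip_comp, a2]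
  · rw [ChainPairing.flip_comp, ChainPairing.flip_comp, a1]

end AlmostDualityTheorem

end

end PolystableDuality

namespace PolystableDuality

open CategoryTheory

noncomputable section

/-! ### Exact zero divisors, perfect forms and vanishing of Ext -/

section StepLemma

variable {k : Type u} [CommRing k] (R : InjectiveResolution (ModuleCat.of k k))

/-- The differential of an injective resolution, as a linear map. -/
def resD (n : ℕ) : R.cocomplex.X n →ₗ[k] R.cocomplex.X (n + 1) := (R.cocomplex.d n (n + 1)).hom

lemma isAcyclicFor_iff {M : Type u} [AddCommGroup M] [Module k M] :
    IsAcyclicFor R (ModuleCat.of k M) ↔ ∀ (n : ℕ) (f : M →ₗ[k] R.cocomplex.X (n + 1)),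
      (∀ x, resD R (n + 1) (f x) = 0) → ∃ g : M →ₗ[k] R.cocomplex.X n, ∀ x,
        resD R n (g x) = f x := by
  constructor
  · intro h n f hf
    obtain ⟨g, hg⟩ := h n (ModuleCat.ofHom f) (ModuleCat.hom_ext (LinearMap.ext hf))
    exact ⟨g.hom, fun x => congrArg (fun φ => φ.hom x) hg⟩
  · intro h n f hf
    obtain ⟨g, hg⟩ := h n f.hom (fun x => congrArg (fun φ => φ.hom x) hf)
    exact ⟨ModuleCat.ofHom g, ModuleCat.hom_ext (LinearMap.ext hg)⟩

lemma resD_exact (n : ℕ) (x : R.cocomplex.X (n + 1)) (hx : resD R (n + 1) x = 0) :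
    ∃ y, resD R n y = x := by
  have h := R.exact_succ n
  rw [ShortComplex.moduleCat_exact_iff] at h
  exact h x hx

/-- The augmentation of an injective resolution, as a linear map. -/
def resAug : k →ₗ[k] R.cocomplex.X 0 := (R.ι.f 0).hom

lemma resAug_injective : Function.Injective (resAug R) :=
  (ModuleCat.mono_iff_injective (R.ι.f 0)).1 inferInstance

lemma resAug_exact (x : R.cocomplex.X 0) (hx : resD R 0 x = 0) : ∃ y, resAug R y = x := by
  have h := R.exact₀
  rw [ShortComplex.moduleCat_exact_iff] at h
  exact h x hx

lemma resD_resAug (x : k) : resD R 0 (resAug R x) = 0 :=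
  congrArg (fun φ => φ.hom x) R.ι_f_zero_comp_complex_d

lemma resD_resD (n : ℕ) (x : R.cocomplex.X n) : resD R (n + 1) (resD R n x) = 0 :=
  congrArg (fun φ => φ.hom x) (R.cocomplex.d_comp_d n (n + 1) (n + 2))

/-- Factor through the quotient by the kernel of i, which embeds in the target, and extend by
injectivity. -/
lemma exists_extension {M M' : Type u} [AddCommGroup M] [Module k M] [AddCommGroup M']
    [Module k M'] (n : ℕ) (i : M →ₗ[k] M') (v : M →ₗ[k] R.cocomplex.X n)
    (h : ∀ x, i x = 0 → v x = 0) : ∃ u : M' →ₗ[k] R.cocomplex.X n, ∀ x, u (i x) = v x := by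
  have hle : LinearMap.ker i ≤ LinearMap.ker v := h
  let i' : (M ⧸ LinearMap.ker i) →ₗ[k] M' := (LinearMap.ker i).liftQ i le_rfl
  let v' : (M ⧸ LinearMap.ker i) →ₗ[k] R.cocomplex.X n := (LinearMap.ker i).liftQ v hle
  have hi' : Function.Injective i' :=
    LinearMap.ker_eq_bot.1 (Submodule.ker_liftQ_eq_bot _ _ _ le_rfl)
  have : Mono (ModuleCat.ofHom i') := (ModuleCat.mono_iff_injective _).2 hi'
  have := R.injective n
  refine ⟨(Injective.factorThru (J :=
    R.cocomplex.X n) (ModuleCat.ofHom v') (ModuleCat.ofHom i')).hom, fun x => ?_⟩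
  exact congrArg (fun φ => φ.hom ((LinearMap.ker i).mkQ x))
    (Injective.comp_factorThru (J := R.cocomplex.X n) (ModuleCat.ofHom v') (ModuleCat.ofHom i'))

lemma isAcyclicFor_of_basis {M : Type u} [AddCommGroup M] [Module k M] {ι : Type*}
    (b : Module.Basis ι k M) : IsAcyclicFor R (ModuleCat.of k M) := by
  rw [isAcyclicFor_iff]
  intro n f hf
  choose y hy using fun i => resD_exact R n (f (b i)) (hf _)
  refine ⟨b.constr ℕ y, fun x => ?_⟩
  have : (resD R n).comp (b.constr ℕ y) = f := b.ext fun i => by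
    rw [LinearMap.comp_apply, b.constr_basis, hy]
  exact LinearMap.congr_fun this x

lemma isAcyclicFor_self : IsAcyclicFor R (ModuleCat.of k k) :=
  isAcyclicFor_of_basis R (Module.Basis.singleton Unit k)

/-- A linear form on an algebra whose multiplication pairing is perfect. -/
def IsPerfectForm {B : Type u} [CommRing B] [Algebra k B] (lam : B →ₗ[k] k) : Prop :=
  ∀ φ : B →ₗ[k] k, ∃! b, ∀ x, φ x = lam (b * x)

variable {B : Type u} [CommRing B] [Algebra k B] {lam : B →ₗ[k] k}

lemma IsPerfectForm.eq_zero (hlam : IsPerfectForm lam) {b : B} (h : ∀ x, lam (b * x) = 0) :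
    b = 0 :=
  (hlam 0).unique (fun x => (h x).symm) (fun x => by simp)

/-- The two-periodic complex with multiplications by g and h on B stays exact under Hom into the
n-cocycles of the resolution. For n = 0 these cocycles are k, and the perfect form identifies Hom(B,
k) with B. For the step, lift w to v through the differential; by induction, with g and h exchanged,
v and some cocycle-valued e agree on hB, so v - e kills the annihilator of g and factors as a map u
after multiplication by g. Applying the differential gives w. -/
lemma exists_comp_mul_eq (hlam : IsPerfectForm lam) (hB : IsAcyclicFor R (ModuleCat.of k B))
    (n : ℕ) : ∀ {g h : B}, (∀ x, g * x = 0 → ∃ y, x = h * y) → (∀ x, h * x = 0 → ∃ y, x = g * y) →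
    g * h = 0 → ∀ w : B →ₗ[k] R.cocomplex.X n, (∀ x, resD R n (w x) = 0) → (∀ x, w (h * x) = 0) →
    ∃ e : B →ₗ[k] R.cocomplex.X n, (∀ x, resD R n (e x) = 0) ∧ ∀ x, w x = e (g * x) := by
  induction n with
  | zero =>
    intro g h hg hh hgh w hw hwh
    choose φ hφ using fun x => resAug_exact R (w x) (hw x)
    let φ' : B →ₗ[k] k :=
      { toFun := φ
        map_add' := fun x y => resAug_injective R (by simp only [map_add, hφ])
        map_smul' := fun r x => resAug_injective R (by simp only [map_smul, hφ, RingHom.id_apply]) }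
    obtain ⟨b, hb, -⟩ := hlam φ'
    have h1 : h * b = 0 := hlam.eq_zero fun x => by
      rw [show h * b * x = b * (h * x) by ring, ← hb]
      exact resAug_injective R (((hφ _).trans (hwh x)).trans (map_zero _).symm)
    obtain ⟨c, rfl⟩ := hh b h1
    refine ⟨(resAug R).comp (lam.comp (LinearMap.mulLeft k c)), fun x => resD_resAug R _,
      fun x => ?_⟩
    rw [← hφ]
    refine congrArg (resAug R) ((hb x).trans ?_)
    rw [LinearMap.comp_apply, LinearMap.mulLeft_apply]
    congr 1
    ring
  | succ n ih =>
    intro g h hg hh hgh w hw hwh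
    rw [isAcyclicFor_iff] at hB
    obtain ⟨v, hv⟩ := hB n w hw
    obtain ⟨e, he, hve⟩ := ih hh hg (by rw [mul_comm, hgh]) (v.comp (LinearMap.mulLeft k h))
      (fun x => (hv _).trans (hwh x))
      (fun x => by
        rw [LinearMap.comp_apply, LinearMap.mulLeft_apply, ← mul_assoc, mul_comm h, hgh, zero_mul,
          map_zero])
    obtain ⟨u, hu⟩ := exists_extension R n (LinearMap.mulLeft k g) (v - e) (fun x hx => by
      obtain ⟨y, rfl⟩ := hg x hx
      rw [LinearMap.sub_apply, sub_eq_zero]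
      exact hve y)
    refine ⟨(resD R n).comp u, fun x => resD_resD R n _, fun x => ?_⟩
    have h1 : u (g * x) = v x - e x := hu x
    rw [LinearMap.comp_apply, h1, map_sub, he, sub_zero, hv]

variable {B' : Type u} [CommRing B'] [Algebra k B']

/-- Passing to the quotient by `g`, where `g` and `h` are exact zero divisors. -/
lemma IsAcyclicFor.quotient (hlam : IsPerfectForm lam) (hB : IsAcyclicFor R (ModuleCat.of k B))
    {g h : B} (hg : ∀ x, g * x = 0 → ∃ y, x = h * y) (hh : ∀ x, h * x = 0 → ∃ y, x = g * y)
    (hgh : g * h = 0) (q : B →ₐ[k] B') (hq : Function.Surjective q)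
    (hker : ∀ x, q x = 0 ↔ ∃ y, x = g * y) : IsAcyclicFor R (ModuleCat.of k B') := by
  have hB' := hB
  rw [isAcyclicFor_iff] at hB ⊢
  intro n f hf
  obtain ⟨v, hv⟩ := hB n (f.comp q.toLinearMap) (fun x => hf _)
  -- A lift v of the map on B need not vanish on gB, but on gB it agrees with a map e into cocycles;
  -- then v - e descends to the quotient and has the same differential.
  obtain ⟨e, he, hve⟩ := exists_comp_mul_eq R hlam hB' n hg hh hgh (v.comp (LinearMap.mulLeft k g))
    (fun x => (hv _).trans (by
      rw [LinearMap.mulLeft_apply, LinearMap.comp_apply]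
      exact (congrArg f ((hker _).2 ⟨x, rfl⟩)).trans (map_zero _)))
    (fun x => by
      rw [LinearMap.comp_apply, LinearMap.mulLeft_apply, ← mul_assoc, hgh, zero_mul, map_zero])
  obtain ⟨u, hu⟩ := exists_extension R n q.toLinearMap (v - e) (fun x hx => by
    obtain ⟨y, rfl⟩ := (hker x).1 hx
    rw [LinearMap.sub_apply, sub_eq_zero]
    exact hve y)
  refine ⟨u, fun y => ?_⟩
  obtain ⟨x, rfl⟩ := hq y
  have h1 : u (q x) = v x - e x := hu x
  rw [h1, map_sub, he, sub_zero, hv]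
  rfl

/-- A functional on B/gB is represented on B by some b with gb = 0, that is b = hc, and c is unique
modulo the annihilator of h, which is gB. -/
lemma IsPerfectForm.quotient (hlam : IsPerfectForm lam)
    {g h : B} (hg : ∀ x, g * x = 0 → ∃ y, x = h * y) (hh : ∀ x, h * x = 0 → ∃ y, x = g * y)
    (q : B →ₐ[k] B') (hq : Function.Surjective q)
    (hker : ∀ x, q x = 0 ↔ ∃ y, x = g * y) (lam' : B' →ₗ[k] k)
    (hlam' : ∀ x, lam' (q x) = lam (h * x)) : IsPerfectForm lam' := by
  intro φ
  obtain ⟨b, hb, -⟩ := hlam (φ.comp q.toLinearMap)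
  have h1 : g * b = 0 := hlam.eq_zero fun x => by
    rw [show g * b * x = b * (g * x) by ring, ← hb]
    exact (congrArg φ ((hker _).2 ⟨x, rfl⟩)).trans (map_zero _)
  obtain ⟨c, rfl⟩ := hg b h1
  have h2 : ∀ x, φ x = lam' (q c * x) := fun y => by
    obtain ⟨x, rfl⟩ := hq y
    rw [← map_mul, hlam', ← mul_assoc, ← hb]
    rfl
  refine ⟨q c, h2, fun y hy => ?_⟩
  obtain ⟨c', rfl⟩ := hq y
  rw [← sub_eq_zero, ← map_sub, hker]
  refine hh _ (hlam.eq_zero fun x => ?_)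
  rw [mul_assoc, ← hlam', map_mul, map_sub, sub_mul, map_sub, ← h2, ← hy, sub_self]

end StepLemma

end

end PolystableDuality

namespace PolystableDuality

noncomputable section

/-! ### The rings modulo p as quotients of polynomial rings -/

section Completion

variable (p : ℕ) {A : Type u} [CommRing A]

/-- The ideal (p) is finitely generated, so it generates the kernel of evaluation at the first
stage; completion does not change the ring modulo p. -/
lemma mem_span_iff_eval_one (x : PCompletion p A) :
    x ∈ Ideal.span {(p : PCompletion p A)} ↔
      AdicCompletion.evalOneₐ (Ideal.span {(p : A)}) x = 0 := by
  have h := AdicCompletion.ker_evalOneₐ_eq_map (I := Ideal.span {(p : A)})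
    ⟨{(p : A)}, by simp⟩
  rw [Ideal.map_span, Set.image_singleton, map_natCast] at h
  rw [← h]
  rfl

lemma evalOne_algebraMap (a : A) : AdicCompletion.evalOneₐ (Ideal.span {(p : A)})
    (algebraMap A (PCompletion p A) a) = Ideal.Quotient.mk _ a := by
  exact AlgHom.commutes _ _

lemma algebraMap_mem_span_iff (a : A) :
    algebraMap A (PCompletion p A) a ∈ Ideal.span {(p : PCompletion p A)} ↔
      a ∈ Ideal.span {(p : A)} := by
  rw [mem_span_iff_eval_one, evalOne_algebraMap, Ideal.Quotient.eq_zero_iff_mem]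

lemma exists_sub_algebraMap_mem_span (x : PCompletion p A) :
    ∃ a : A, x - algebraMap A (PCompletion p A) a ∈ Ideal.span {(p : PCompletion p A)} := by
  obtain ⟨a, ha⟩ := Ideal.Quotient.mk_surjective
    (AdicCompletion.evalOneₐ (Ideal.span {(p : A)}) x)
  refine ⟨a, ?_⟩
  rw [mem_span_iff_eval_one, map_sub, evalOne_algebraMap, ha, sub_self]

end Completion

namespace ModelData

variable {p : ℕ} {C : Type u} [NormedField C] [IsUltrametricDist C] (D : ModelData p C)

/-- The ideal of the polynomial ring generated by `p` and the relations at level `m`. -/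
def polyIdeal (m : ℕ) : Ideal D.Poly :=
  Ideal.span {(p : D.Poly)} ⊔ Ideal.span (Set.range (D.rel m))

lemma natCast_mem_polyIdeal (m : ℕ) : (p : D.Poly) ∈ D.polyIdeal m :=
  Ideal.mem_sup_left (Ideal.mem_span_singleton_self _)

lemma rel_mem_polyIdeal (m : ℕ) (i : Fin D.l) : D.rel m i ∈ D.polyIdeal m :=
  Ideal.mem_sup_right (Ideal.subset_span ⟨i, rfl⟩)

lemma polyIdeal_le_iff {m : ℕ} {J : Ideal D.Poly} :
    D.polyIdeal m ≤ J ↔ (p : D.Poly) ∈ J ∧ ∀ i, D.rel m i ∈ J := by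
  rw [polyIdeal, sup_le_iff, Ideal.span_le, Ideal.span_le, Set.singleton_subset_iff,
    Set.range_subset_iff]
  rfl

/-- The map from `R_m^+` to the polynomial ring modulo `p` and the relations. -/
def toPolyQuot (m : ℕ) : D.R m →+* D.Poly ⧸ D.polyIdeal m :=
  Ideal.Quotient.lift (D.relIdeal m)
    ((Ideal.Quotient.factor (show Ideal.span {(p : D.Poly)} ≤ D.polyIdeal m from le_sup_left)).comp
      (AdicCompletion.evalOneₐ (Ideal.span {(p : D.Poly)}) : D.Tate →+* _)) (by
    suffices h : D.relIdeal m ≤ RingHom.ker ((Ideal.Quotient.factor (show Ideal.span {(p :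
      D.Poly)} ≤
        D.polyIdeal m from le_sup_left)).comp
        (AdicCompletion.evalOneₐ (Ideal.span {(p : D.Poly)}) : D.Tate →+* _)) from fun a ha => h ha
    rw [relIdeal, Ideal.span_le]
    rintro _ ⟨i, rfl⟩
    rw [SetLike.mem_coe, RingHom.mem_ker, RingHom.comp_apply, RingHom.coe_coe, evalOne_algebraMap,
      Ideal.Quotient.factor_mk, Ideal.Quotient.eq_zero_iff_mem]
    exact D.rel_mem_polyIdeal m i)

lemma toPolyQuot_ofPoly (m : ℕ) (f : D.Poly) :
    D.toPolyQuot m (D.ofPoly m f) = Ideal.Quotient.mk _ f := by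
  change Ideal.Quotient.factor (show Ideal.span {(p : D.Poly)} ≤ D.polyIdeal m from le_sup_left)
    (AdicCompletion.evalOneₐ (Ideal.span {(p : D.Poly)}) (algebraMap D.Poly D.Tate f)) = _
  rw [evalOne_algebraMap, Ideal.Quotient.factor_mk]

/-- Modulo p the completion disappears, and R_m^+/p is the polynomial ring modulo p and the
relations. All further computations take place on polynomials. -/
lemma ofPoly_mem_span_iff (m : ℕ) (f : D.Poly) :
    D.ofPoly m f ∈ Ideal.span {(p : D.R m)} ↔ f ∈ D.polyIdeal m := by
  constructor
  · intro h
    obtain ⟨c, hc⟩ := Ideal.mem_span_singleton'.1 h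
    rw [← Ideal.Quotient.eq_zero_iff_mem, ← toPolyQuot_ofPoly, ← hc, map_mul, map_natCast,
      ← map_natCast (Ideal.Quotient.mk (D.polyIdeal m)),
      Ideal.Quotient.eq_zero_iff_mem.2 (D.natCast_mem_polyIdeal m), mul_zero]
  · suffices h : D.polyIdeal m ≤ (Ideal.span {(p : D.R m)}).comap (D.ofPoly m) from fun a => h a
    rw [polyIdeal_le_iff]
    refine ⟨?_, fun i => ?_⟩
    · rw [Ideal.mem_comap, map_natCast]
      exact Ideal.mem_span_singleton_self _
    · rw [Ideal.mem_comap]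
      have : D.ofPoly m (D.rel m i) = 0 :=
        Ideal.Quotient.eq_zero_iff_mem.2 (Ideal.subset_span ⟨i, rfl⟩)
      rw [this]
      exact zero_mem _

lemma exists_sub_ofPoly_mem_span (m : ℕ) (x : D.R m) :
    ∃ f, x - D.ofPoly m f ∈ Ideal.span {(p : D.R m)} := by
  obtain ⟨x, rfl⟩ := Ideal.Quotient.mk_surjective x
  obtain ⟨f, hf⟩ := exists_sub_algebraMap_mem_span p x
  refine ⟨f, ?_⟩
  have := Ideal.mem_map_of_mem (Ideal.Quotient.mk (D.relIdeal m)) hf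
  rw [Ideal.map_span, Set.image_singleton, map_natCast, map_sub] at this
  exact this

/-- The map from polynomials to `R^+/p`. -/
def polyToModP : D.Poly →+* D.RModP := (Ideal.Quotient.mk _).comp (D.ofPoly 0)

lemma polyToModP_surjective : Function.Surjective D.polyToModP := by
  intro x
  obtain ⟨x, rfl⟩ := Ideal.Quotient.mk_surjective x
  obtain ⟨f, hf⟩ := D.exists_sub_ofPoly_mem_span 0 x
  refine ⟨f, ?_⟩
  rw [← neg_mem_iff, neg_sub] at hf
  exact (Ideal.Quotient.eq (I := Ideal.span {(p : D.R 0)})).2 hf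

lemma polyToModP_eq_zero_iff (f : D.Poly) : D.polyToModP f = 0 ↔ f ∈ D.polyIdeal 0 := by
  rw [← ofPoly_mem_span_iff]
  exact Ideal.Quotient.eq_zero_iff_mem

lemma natCast_RModP : (p : D.RModP) = 0 := by
  have : D.polyToModP (p : D.Poly) = 0 := (D.polyToModP_eq_zero_iff _).2 (D.natCast_mem_polyIdeal 0)
  rwa [map_natCast] at this

/-- The map from polynomials in the `t_{i,j}^{1/p^m}` to `R_∞^+/p`. -/
def polyToInf (m : ℕ) : D.Poly →+* D.RInfModP := (D.toRInfModP m).comp (D.ofPoly m)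

/-- The substitution of `q`-th powers of the variables, as a ring map. -/
def expandHom (q : ℕ) : D.Poly →+* D.Poly :=
  (MvPolynomial.expand q : D.Poly →ₐ[OC C] D.Poly).toRingHom

lemma trans_ofPoly {m m' : ℕ} (h : m ≤ m') (f : D.Poly) :
    D.trans m m' h (D.ofPoly m f) = D.ofPoly m' (D.expandHom (p ^ (m' - m)) f) := by
  change Ideal.Quotient.mk _ (pCompletionMap p _ _) = Ideal.Quotient.mk _ _
  rw [pCompletionMap_algebraMap]
  rfl

lemma toRInf_trans {m m' : ℕ} (h : m ≤ m') (x : D.R m) :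
    D.toRInf m' (D.trans m m' h x) = D.toRInf m x := by
  exact congrArg (algebraMap D.RColim D.RInf) (Ring.DirectLimit.of_f (f :=
    fun m m' h => D.trans m m' h) h x)

lemma polyToInf_expandHom (m r : ℕ) (f : D.Poly) :
    D.polyToInf (m + r) (D.expandHom (p ^ r) f) = D.polyToInf m f := by
  have h := D.trans_ofPoly (Nat.le_add_right m r) f
  rw [Nat.add_sub_cancel_left] at h
  change Ideal.Quotient.mk _ (D.toRInf _ _) = Ideal.Quotient.mk _ (D.toRInf _ _)
  rw [← h, toRInf_trans]

lemma exists_polyToInf (x : D.RInfModP) : ∃ m f, D.polyToInf m f = x := by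
  obtain ⟨x, rfl⟩ := Ideal.Quotient.mk_surjective x
  obtain ⟨a, ha⟩ := exists_sub_algebraMap_mem_span p x
  obtain ⟨m, y, rfl⟩ := Ring.DirectLimit.exists_of a
  obtain ⟨f, hf⟩ := D.exists_sub_ofPoly_mem_span m y
  refine ⟨m, f, ((Ideal.Quotient.eq (I := Ideal.span {(p : D.RInf)})).2 ?_).symm⟩
  have h := Ideal.mem_map_of_mem (D.toRInf m) hf
  rw [Ideal.map_span, Set.image_singleton, map_natCast, map_sub] at h
  have h2 := Ideal.add_mem _ ha h
  rw [toRInf, RingHom.comp_apply, RingHom.comp_apply, sub_add_sub_cancel] at h2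
  exact h2

lemma exists_polyToInf_add (m : ℕ) (x : D.RInfModP) : ∃ r f, D.polyToInf (m + r) f = x := by
  obtain ⟨m', f, rfl⟩ := D.exists_polyToInf x
  refine ⟨m', D.expandHom (p ^ m) f, ?_⟩
  rw [add_comm, polyToInf_expandHom]

lemma expandHom_expandHom (a b : ℕ) (f : D.Poly) :
    D.expandHom a (D.expandHom b f) = D.expandHom (a * b) f :=
  (MvPolynomial.expand_mul a b f).symm

lemma expandHom_one (f : D.Poly) : D.expandHom 1 f = f := by
  simp [expandHom]

lemma trans_self (m : ℕ) : D.trans m m le_rfl = RingHom.id _ := by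
  have h' : ∀ i, D.rel m i ∣ (RingHom.id D.Poly) (D.rel m i) := fun i => dvd_rfl
  have h : D.expandHom (p ^ (m - m)) = RingHom.id _ := by
    rw [Nat.sub_self, pow_zero]
    exact RingHom.ext D.expandHom_one
  exact (D.mapR_congr (D.rel_dvd_expand le_rfl) h' h).trans (D.mapR_id h')

lemma trans_comp_trans {m₁ m₂ m₃ : ℕ} (h12 : m₁ ≤ m₂) (h23 : m₂ ≤ m₃) :
    (D.trans m₂ m₃ h23).comp (D.trans m₁ m₂ h12) = D.trans m₁ m₃ (h12.trans h23) := by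
  have h : (D.expandHom (p ^ (m₃ - m₂))).comp (D.expandHom (p ^ (m₂ - m₁))) =
      D.expandHom (p ^ (m₃ - m₁)) := by
    refine RingHom.ext fun f => ?_
    rw [RingHom.comp_apply, expandHom_expandHom, ← pow_add,
      show m₃ - m₂ + (m₂ - m₁) = m₃ - m₁ by omega]
  have h' : ∀ i, D.rel m₃ i ∣ D.expandHom (p ^ (m₃ - m₁)) (D.rel m₁ i) :=
    D.rel_dvd_expand (h12.trans h23)
  have h'' : ∀ i, D.rel m₃ i ∣
      ((D.expandHom (p ^ (m₃ - m₂))).comp (D.expandHom (p ^ (m₂ - m₁)))) (D.rel m₁ i) := by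
    rw [h]; exact h'
  exact (D.mapR_comp _ _ _ _ h'').trans (D.mapR_congr h'' h' h)

instance directedSystem_trans : DirectedSystem D.R (fun m m' h => D.trans m m' h) where
  map_self m x := by
    rw [D.trans_self]
    rfl
  map_map _ _ _ h12 h23 x := by
    rw [← D.trans_comp_trans h12 h23]
    rfl

/-- Divisibility by p can be tested before completing, and in the colimit both the quotient by p and
the resulting equation are witnessed at some finite level. -/
lemma exists_mem_of_polyToInf_eq_zero (m : ℕ) (f : D.Poly) (hf : D.polyToInf m f = 0) :
    ∃ r, D.expandHom (p ^ r) f ∈ D.polyIdeal (m + r) := by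
  have h1 : algebraMap D.RColim D.RInf
      (Ring.DirectLimit.of D.R (fun m m' h => D.trans m m' h) m (D.ofPoly m f)) ∈
      Ideal.span {(p : D.RInf)} := Ideal.Quotient.eq_zero_iff_mem.1 hf
  rw [algebraMap_mem_span_iff] at h1
  obtain ⟨z, hz⟩ := Ideal.mem_span_singleton'.1 h1
  obtain ⟨m', y, rfl⟩ := Ring.DirectLimit.exists_of z
  have h2 : Ring.DirectLimit.of D.R (fun m m' h => D.trans m m' h) (m + m')
      (D.trans m (m + m') (by omega) (D.ofPoly m f) - D.trans m' (m + m') (by omega) y * p) = 0 :=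
        by
    rw [map_sub, map_mul, Ring.DirectLimit.of_f, Ring.DirectLimit.of_f, map_natCast, hz, sub_self]
  obtain ⟨m'', h, h3⟩ := Ring.DirectLimit.of.zero_exact h2
  refine ⟨m'' - m, ?_⟩
  have e : m + (m'' - m) = m'' := by omega
  rw [e, ← ofPoly_mem_span_iff, ← D.trans_ofPoly (by omega)]
  rw [map_sub, map_mul, map_natCast, sub_eq_zero, ← RingHom.comp_apply, trans_comp_trans] at h3
  rw [h3]
  exact Ideal.mul_mem_left _ _ (Ideal.mem_span_singleton_self _)

lemma algebraMap_polyToModP (f : D.Poly) :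
    algebraMap D.RModP D.RInfModP (D.polyToModP f) = D.polyToInf 0 f := rfl

end ModelData

end

end PolystableDuality

namespace PolystableDuality

noncomputable section

/-! ### Contraction of monomials along p-power roots -/

namespace ModelData

variable {p : ℕ} {C : Type u} [NormedField C] [IsUltrametricDist C] (D : ModelData p C)

/-- The exponent of the product of the variables in the block `i`. -/
def block (i : Fin D.l) : D.Idx →₀ ℕ :=
  Finsupp.equivFunOnFinite.symm fun s => if s.1 = i then 1 else 0

lemma block_apply (i : Fin D.l) (s : D.Idx) : D.block i s = if s.1 = i then 1 else 0 := rfl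

lemma prod_X_block (i : Fin D.l) :
    (∏ j, MvPolynomial.X ⟨i, j⟩ : D.Poly) = MvPolynomial.monomial (D.block i) 1 := by
  rw [MvPolynomial.monomial_eq, map_one, one_mul, Finsupp.prod_fintype _ _ (fun _ => pow_zero _),
    Fintype.prod_sigma, Finset.prod_eq_single i]
  · simp [block_apply]
  · intro i' _ hi
    simp [block_apply, hi]
  · simp

lemma rel_eq_monomial (m : ℕ) (i : Fin D.l) :
    D.rel m i = MvPolynomial.monomial (D.block i) 1 - MvPolynomial.C (D.root i m) := by
  rw [rel, prod_X_block]

/-- The exponents divided by `q`, rounded down. -/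
def expDiv (q : ℕ) (e : D.Idx →₀ ℕ) : D.Idx →₀ ℕ := e.mapRange (· / q) (Nat.zero_div q)

lemma expDiv_apply (q : ℕ) (e : D.Idx →₀ ℕ) (s : D.Idx) : D.expDiv q e s = e s / q := by
  simp [expDiv]

/-- The exponents that are constant modulo `q` on the blocks in `J`, and congruent to `-1`
modulo `q` on the others. -/
def IsContractible (q : ℕ) (J : Finset (Fin D.l)) (e : D.Idx →₀ ℕ) : Prop :=
  (∀ i ∈ J, ∀ j, e ⟨i, j⟩ % q = e ⟨i, 0⟩ % q) ∧ ∀ i ∉ J, ∀ j, e ⟨i, j⟩ % q = q - 1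

/-- The coefficient picked up by a monomial under contraction. -/
def contractCoeff (M q : ℕ) (J : Finset (Fin D.l)) (e : D.Idx →₀ ℕ) : OC C :=
  ∏ i ∈ J, D.root i M ^ (e ⟨i, 0⟩ % q)

open Classical in
/-- The contraction of polynomials along the substitution of `q`-th powers: on the blocks in `J`, it
writes a monomial with constant exponents modulo `q` as a power of the product of the variables,
which is replaced by `ϖ^{1/p^M}`, times a monomial in the `q`-th powers; on the other blocks it
takes
the coefficient of the top monomial. -/
def contract (M q : ℕ) (J : Finset (Fin D.l)) : D.Poly →ₗ[OC C] D.Poly :=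
  (MvPolynomial.basisMonomials D.Idx (OC C)).constr (OC C) fun e =>
    if D.IsContractible q J e then MvPolynomial.monomial (D.expDiv q e) (D.contractCoeff M q J e)
    else 0

open Classical in
lemma contract_monomial (M q : ℕ) (J : Finset (Fin D.l)) (e : D.Idx →₀ ℕ) (a : OC C) :
    D.contract M q J (MvPolynomial.monomial e a) =
      if D.IsContractible q J e then
        MvPolynomial.monomial (D.expDiv q e) (a * D.contractCoeff M q J e) else 0 := by
  have h : MvPolynomial.monomial e a = a • MvPolynomial.basisMonomials D.Idx (OC C) e := by
    rw [MvPolynomial.coe_basisMonomials, MvPolynomial.smul_monomial, smul_eq_mul, mul_one]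
  rw [h, map_smul, contract, Module.Basis.constr_basis]
  split_ifs
  · rw [MvPolynomial.smul_monomial, smul_eq_mul]
  · rw [smul_zero]

lemma contract_monomial_of (M q : ℕ) (J : Finset (Fin D.l)) {e : D.Idx →₀ ℕ} (a : OC C)
    (h : D.IsContractible q J e) : D.contract M q J (MvPolynomial.monomial e a) =
      MvPolynomial.monomial (D.expDiv q e) (a * D.contractCoeff M q J e) := by
  rw [contract_monomial, if_pos h]

lemma contract_monomial_of_not (M q : ℕ) (J : Finset (Fin D.l)) {e : D.Idx →₀ ℕ} (a : OC C)
    (h : ¬ D.IsContractible q J e) : D.contract M q J (MvPolynomial.monomial e a) = 0 := by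
  rw [contract_monomial, if_neg h]

/-- Two additive maps on polynomials agree if they agree on monomials. -/
lemma addHom_ext {S : Type*} [AddCommMonoid S] {f g : D.Poly → S}
    (hf : ∀ x y, f (x + y) = f x + f y) (hg : ∀ x y, g (x + y) = g x + g y)
    (h : ∀ e a, f (MvPolynomial.monomial e a) = g (MvPolynomial.monomial e a)) (x : D.Poly) :
    f x = g x :=
  MvPolynomial.induction_on' x h fun x y hx hy => by rw [hf, hg, hx, hy]

lemma expandHom_monomial (q : ℕ) (e : D.Idx →₀ ℕ) (a : OC C) :
    D.expandHom q (MvPolynomial.monomial e a) = MvPolynomial.monomial (q • e) a :=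
  MvPolynomial.expand_monomial _ _ _

/-- Adding q·d to the exponents leaves the residues modulo q alone and raises the quotients by d; so
contraction is linear over q-th powers. -/
lemma contract_expandHom_mul (M : ℕ) {q : ℕ} (hq : 0 < q) (J : Finset (Fin D.l)) (x y : D.Poly) :
    D.contract M q J (D.expandHom q x * y) = x * D.contract M q J y := by
  refine D.addHom_ext (f := fun x => D.contract M q J (D.expandHom q x * y))
    (g := fun x => x * D.contract M q J y) (fun x x' => by simp only [map_add, add_mul])
    (fun x x' => by simp only [add_mul]) (fun d b => ?_) x
  refine D.addHom_ext (f := fun y => D.contract M q J (D.expandHom q _ * y))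
    (g := fun y => _ * D.contract M q J y) (fun x x' => by simp only [map_add, mul_add])
    (fun x x' => by simp only [map_add, mul_add]) (fun e a => ?_) y
  have h1 : ∀ s, (q • d + e) s % q = e s % q := fun s => by simp
  have h2 : D.IsContractible q J (q • d + e) ↔ D.IsContractible q J e := by
    simp only [IsContractible, h1]
  rw [expandHom_monomial, MvPolynomial.monomial_mul]
  by_cases h : D.IsContractible q J e
  · rw [contract_monomial_of _ _ _ _ _ h, contract_monomial_of _ _ _ _ _ (h2.2 h),
      MvPolynomial.monomial_mul]
    have h3 : D.expDiv q (q • d + e) = d + D.expDiv q e := Finsupp.ext fun s => by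
      simp [expDiv_apply, Nat.mul_add_div hq]
    have h4 : D.contractCoeff M q J (q • d + e) = D.contractCoeff M q J e := by
      simp only [contractCoeff, h1]
    rw [h3, h4, mul_assoc]
  · rw [contract_monomial_of_not _ _ _ _ _ h, contract_monomial_of_not _ _ _ _ _ (h2.not.2 h),
      mul_zero]

/-- Multiplication by the product of the variables of block i raises the residue on that block by
one. As long as the residue does not wrap around, both terms of the relation contract to the same
monomial; when it passes from q - 1 to 0, the difference is a multiple of the relation at the lower
level. -/
lemma contract_rel_mul_mem {m M q : ℕ} (hq : 0 < q) (J : Finset (Fin D.l)) {i : Fin D.l}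
    (hi : i ∈ J) (hroot : D.root i M ^ q = D.root i m) (y : D.Poly) :
    D.contract M q J (D.rel M i * y) ∈ Ideal.span {D.rel m i} := by
  induction y using MvPolynomial.induction_on' with
  | add x y hx hy => rw [mul_add, map_add]; exact add_mem hx hy
  | monomial e a =>
  have h0 : ∀ i' ≠ i, ∀ j, (D.block i + e) ⟨i', j⟩ = e ⟨i', j⟩ := fun i' h j => by
    simp [block_apply, h]
  have h1 : ∀ j, (D.block i + e) ⟨i, j⟩ = 1 + e ⟨i, j⟩ := fun j => by simp [block_apply]
  have h2 : D.IsContractible q J (D.block i + e) ↔ D.IsContractible q J e := by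
    refine and_congr (forall_congr' fun i' => forall_congr' fun hi' => forall_congr' fun j => ?_)
      (forall_congr' fun i' => forall_congr' fun hi' => forall_congr' fun j => ?_)
    · by_cases h : i' = i
      · subst h
        rw [h1, h1]
        exact ⟨fun h => Nat.ModEq.add_left_cancel' 1 h, fun h => Nat.ModEq.add_left 1 h⟩
      · rw [h0 _ h, h0 _ h]
    · rw [h0 _ (ne_of_mem_of_not_mem hi hi').symm]
  rw [D.rel_eq_monomial M, sub_mul, map_sub, MvPolynomial.monomial_mul, one_mul,
    MvPolynomial.C_mul_monomial]
  by_cases h : D.IsContractible q J e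
  swap
  · rw [contract_monomial_of_not _ _ _ _ _ h, contract_monomial_of_not _ _ _ _ _ (h2.not.2 h),
      sub_zero]
    exact zero_mem _
  rw [contract_monomial_of _ _ _ _ _ h, contract_monomial_of _ _ _ _ _ (h2.2 h)]
  have h3 : ∀ e, D.contractCoeff M q J e = D.root i M ^ (e ⟨i, 0⟩ % q) *
      ∏ i' ∈ J.erase i, D.root i' M ^ (e ⟨i', 0⟩ % q) := fun e => by
    rw [contractCoeff, ← Finset.mul_prod_erase J _ hi]
  have h4 : ∏ i' ∈ J.erase i, D.root i' M ^ ((D.block i + e) ⟨i', 0⟩ % q) =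
      ∏ i' ∈ J.erase i, D.root i' M ^ (e ⟨i', 0⟩ % q) :=
    Finset.prod_congr rfl fun i' hi' => by rw [h0 _ (Finset.ne_of_mem_erase hi')]
  rw [h3, h3, h4, h1]
  set c := ∏ i' ∈ J.erase i, D.root i' M ^ (e ⟨i', 0⟩ % q)
  have hlt := Nat.mod_lt (e ⟨i, 0⟩) hq
  -- This separates the wrap-around from the generic case.
  by_cases hs : e ⟨i, 0⟩ % q + 1 = q
  · have h5 : ∀ j, (1 + e ⟨i, j⟩) / q = 1 + e ⟨i, j⟩ / q := fun j => by
      have := Nat.div_add_mod (e ⟨i, j⟩) q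
      rw [h.1 i hi j] at this
      rw [show 1 + e ⟨i, j⟩ = q * (e ⟨i, j⟩ / q) + q by omega, Nat.mul_add_div hq, Nat.div_self hq,
        add_comm]
    have h6 : D.expDiv q (D.block i + e) = D.block i + D.expDiv q e := Finsupp.ext fun s => by
      obtain ⟨i', j⟩ := s
      rw [expDiv_apply, Finsupp.add_apply (D.block i) (D.expDiv q e), expDiv_apply]
      by_cases hi' : i' = i
      · subst hi'
        rw [h1, h5, block_apply, if_pos rfl]
      · rw [h0 _ hi', block_apply, if_neg hi', zero_add]
    have h7 : (1 + e ⟨i, 0⟩) % q = 0 := by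
      have := Nat.div_add_mod (e ⟨i, 0⟩) q
      rw [show 1 + e ⟨i, 0⟩ = q * (e ⟨i, 0⟩ / q) + q by omega]
      simp
    have h8 : D.root i M * a * (D.root i M ^ (e ⟨i, 0⟩ % q) * c) = D.root i m * (a * c) := by
      rw [← hroot, ← hs, pow_succ]
      simp only [hs]
      ring
    rw [h6, h7, h8, pow_zero, one_mul, Ideal.mem_span_singleton']
    refine ⟨MvPolynomial.monomial (D.expDiv q e) (a * c), ?_⟩
    rw [rel_eq_monomial, mul_sub, MvPolynomial.monomial_mul, mul_one, mul_comm _ (MvPolynomial.C _),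
      MvPolynomial.C_mul_monomial, add_comm]
  · have h5 : ∀ j, (1 + e ⟨i, j⟩) / q = e ⟨i, j⟩ / q := fun j => by
      have h6 := Nat.div_add_mod (e ⟨i, j⟩) q
      rw [h.1 i hi j] at h6
      rw [show 1 + e ⟨i, j⟩ = q * (e ⟨i, j⟩ / q) + (e ⟨i, 0⟩ % q + 1) by omega, Nat.mul_add_div hq,
        Nat.div_eq_of_lt (a := e ⟨i, 0⟩ % q + 1) (by omega), add_zero]
    have h6 : D.expDiv q (D.block i + e) = D.expDiv q e := Finsupp.ext fun s => by
      obtain ⟨i', j⟩ := s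
      rw [expDiv_apply, expDiv_apply]
      by_cases hi' : i' = i
      · subst hi'
        rw [h1, h5]
      · rw [h0 _ hi']
    have h7 : (1 + e ⟨i, 0⟩) % q = e ⟨i, 0⟩ % q + 1 := by
      have := Nat.div_add_mod (e ⟨i, 0⟩) q
      rw [show 1 + e ⟨i, 0⟩ = q * (e ⟨i, 0⟩ / q) + (e ⟨i, 0⟩ % q + 1) by omega, Nat.mul_add_mod,
        Nat.mod_eq_of_lt (a := e ⟨i, 0⟩ % q + 1) (by omega)]
    rw [h6, h7, show a * (D.root i M ^ (e ⟨i, 0⟩ % q + 1) * c) =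
      D.root i M * a * (D.root i M ^ (e ⟨i, 0⟩ % q) * c) by ring, sub_self]
    exact zero_mem _

/-- The cofactor of `∏ X - ϖ^{1/p^M}` in the difference of `q`-th powers. -/
def cofactor (M q : ℕ) (i : Fin D.l) : D.Poly :=
  ∑ s ∈ Finset.range q, (∏ j, MvPolynomial.X ⟨i, j⟩) ^ s * MvPolynomial.C (D.root i M) ^ (q - 1 - s)

lemma cofactor_mul_rel {m M q : ℕ} (i : Fin D.l) (hroot : D.root i M ^ q = D.root i m) :
    D.cofactor M q i * D.rel M i = D.expandHom q (D.rel m i) := by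
  rw [cofactor, rel, (Commute.all _ _).geom_sum₂_mul, expandHom, rel, ← map_pow, hroot]
  simp [Finset.prod_pow]

/-- The cofactor is Σ (∏X)^s ϖ^{q-1-s}, with ϖ standing for the root at level M. On a monomial with
constant residue r on block i, only s = q - 1 - r produces the residue q - 1 that the contraction
without i selects, and its coefficient is ϖ^r, as prescribed with i. This is the compatibility that
lets the form pass to the quotient by the relation of block i. -/
lemma contract_insert (M : ℕ) {q : ℕ} (hq : 0 < q) {J : Finset (Fin D.l)} {i : Fin D.l}
    (hi : i ∉ J) (x : D.Poly) :
    D.contract M q (insert i J) x = D.contract M q J (D.cofactor M q i * x) := by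
  refine D.addHom_ext (f := fun x => D.contract M q (insert i J) x)
    (g := fun x => D.contract M q J (D.cofactor M q i * x)) (fun x y => map_add _ _ _)
    (fun x y => by simp only [mul_add, map_add]) (fun e a => ?_) x
  have h0 : ∀ s : ℕ, ∀ i' ≠ i, ∀ j, (s • D.block i + e) ⟨i', j⟩ = e ⟨i', j⟩ := fun s i' h j => by
    simp [block_apply, h]
  have h1 : ∀ s : ℕ, ∀ j, (s • D.block i + e) ⟨i, j⟩ = s + e ⟨i, j⟩ :=
      fun s j => by simp [block_apply]
  have h2 : D.contract M q J (D.cofactor M q i * MvPolynomial.monomial e a) =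
      ∑ s ∈ Finset.range q, D.contract M q J (MvPolynomial.monomial (s • D.block i + e)
        (D.root i M ^ (q - 1 - s) * a)) := by
    rw [cofactor, Finset.sum_mul, map_sum]
    refine Finset.sum_congr rfl fun s _ => ?_
    rw [prod_X_block, MvPolynomial.monomial_pow, one_pow, ← map_pow, mul_assoc,
      MvPolynomial.C_mul_monomial, MvPolynomial.monomial_mul, one_mul]
  rw [h2]
  have h3 : ∀ s, D.IsContractible q J (s • D.block i + e) →
      (∀ j, (s + e ⟨i, j⟩) % q = q - 1) ∧ D.IsContractible q (insert i J) e := by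
    intro s h
    have h4 : ∀ j, (s + e ⟨i, j⟩) % q = q - 1 := fun j => by rw [← h1]; exact h.2 i hi j
    refine ⟨h4, fun i' hi' j => ?_, fun i' hi' j => ?_⟩
    · rcases Finset.mem_insert.1 hi' with rfl | hi'
      · exact Nat.ModEq.add_left_cancel' s ((h4 j).trans (h4 0).symm)
      · have hne : i' ≠ i := fun h => hi (h ▸ hi')
        have := h.1 i' hi' j
        rwa [h0 _ _ hne, h0 _ _ hne] at this
    · rw [Finset.mem_insert, not_or] at hi'
      have := h.2 i' hi'.2 j
      rwa [h0 _ _ hi'.1] at this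
  by_cases h : D.IsContractible q (insert i J) e
  swap
  · rw [contract_monomial_of_not _ _ _ _ _ h]
    exact (Finset.sum_eq_zero fun s _ => D.contract_monomial_of_not _ _ _ _ fun h' => h (h3 s
      h').2).symm
  have hlt := Nat.mod_lt (e ⟨i, 0⟩) hq
  have hdm : ∀ j, q * (e ⟨i, j⟩ / q) + e ⟨i, 0⟩ % q = e ⟨i, j⟩ := fun j => by
    rw [← h.1 i (Finset.mem_insert_self _ _) j]
    exact Nat.div_add_mod _ _
  have hs : ∀ j, q - 1 - e ⟨i, 0⟩ % q + e ⟨i, j⟩ = q * (e ⟨i, j⟩ / q) + (q - 1) := fun j => by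
    have := hdm j
    omega
  rw [Finset.sum_eq_single (q - 1 - e ⟨i, 0⟩ % q)]
  · have hc : D.IsContractible q J ((q - 1 - e ⟨i, 0⟩ % q) • D.block i + e) := by
      refine ⟨fun i' hi' j => ?_, fun i' hi' j => ?_⟩
      · have hne : i' ≠ i := fun h => hi (h ▸ hi')
        rw [h0 _ _ hne, h0 _ _ hne]
        exact h.1 i' (Finset.mem_insert_of_mem hi') j
      · by_cases hne : i' = i
        · subst hne
          rw [h1, hs, Nat.mul_add_mod, Nat.mod_eq_of_lt (by omega)]
        · rw [h0 _ _ hne]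
          exact h.2 i' (by simp [hne, hi']) j
    rw [contract_monomial_of _ _ _ _ _ h, contract_monomial_of _ _ _ _ _ hc]
    have h5 : D.expDiv q ((q - 1 - e ⟨i, 0⟩ % q) • D.block i + e) = D.expDiv q e :=
      Finsupp.ext fun s => by
        obtain ⟨i', j⟩ := s
        rw [expDiv_apply, expDiv_apply]
        by_cases hne : i' = i
        · subst hne
          rw [h1, hs, Nat.mul_add_div hq, Nat.div_eq_of_lt (a := q - 1) (by omega), add_zero]
        · rw [h0 _ _ hne]
    have h6 : D.contractCoeff M q J ((q - 1 - e ⟨i, 0⟩ % q) • D.block i + e) =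
        D.contractCoeff M q J e := Finset.prod_congr rfl fun i' hi' => by
      rw [h0 _ _ (fun h => hi (h ▸ hi'))]
    have h7 : D.contractCoeff M q (insert i J) e =
        D.root i M ^ (e ⟨i, 0⟩ % q) * D.contractCoeff M q J e := Finset.prod_insert hi
    rw [h5, h6, h7, show q - 1 - (q - 1 - e ⟨i, 0⟩ % q) = e ⟨i, 0⟩ % q by omega]
    congr 1
    ring
  · intro s hsq hne
    refine D.contract_monomial_of_not _ _ _ _ fun h' => hne ?_
    have h4 := (h3 s h').1 0
    have h5 : (s + e ⟨i, 0⟩) % q = (q - 1 - e ⟨i, 0⟩ % q + e ⟨i, 0⟩) % q := by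
      rw [h4, hs, Nat.mul_add_mod, Nat.mod_eq_of_lt (by omega)]
    have h6 : s % q = (q - 1 - e ⟨i, 0⟩ % q) % q := Nat.ModEq.add_right_cancel' _ h5
    rwa [Nat.mod_eq_of_lt (Finset.mem_range.1 hsq), Nat.mod_eq_of_lt (by omega)] at h6
  · intro hn
    exact absurd (Finset.mem_range.2 (by omega)) hn

/-- Digit expansion: the residue modulo q₂q₁ consists of the residue modulo q₂ and the residue
modulo q₁ of the quotient. The coefficients match because ϖ^{1/p^m} is a q₂-th power. -/
lemma contract_contract {m M q₁ q₂ : ℕ} (hroot : ∀ i, D.root i M ^ q₂ = D.root i m) (x : D.Poly) :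
    D.contract m q₁ Finset.univ (D.contract M q₂ Finset.univ x) =
      D.contract M (q₂ * q₁) Finset.univ x := by
  refine D.addHom_ext (f := fun x => D.contract m q₁ Finset.univ (D.contract M q₂ Finset.univ x))
    (g := fun x => D.contract M (q₂ * q₁) Finset.univ x) (fun x y => by simp only [map_add])
    (fun x y => map_add _ _ _) (fun e a => ?_) x
  have hmod : ∀ s, e s % (q₂ * q₁) = e s % q₂ + q₂ * (e s / q₂ % q₁) := fun s => Nat.mod_mul
  have hiff : D.IsContractible (q₂ * q₁) Finset.univ e ↔
      D.IsContractible q₂ Finset.univ e ∧ D.IsContractible q₁ Finset.univ (D.expDiv q₂ e) := by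
    simp only [IsContractible, Finset.mem_univ, true_imp_iff, not_true_eq_false, false_imp_iff,
      implies_true, and_true, expDiv_apply]
    constructor
    · intro h
      have h1 : ∀ i j, e ⟨i, j⟩ % q₂ = e ⟨i, 0⟩ % q₂ := fun i j => by
        have := congrArg (· % q₂) (h i j)
        simpa only [Nat.mod_mul_right_mod] using this
      refine ⟨h1, fun i j => ?_⟩
      rcases Nat.eq_zero_or_pos q₂ with rfl | hq
      · simp
      · have h2 := h i j
        rw [hmod, hmod, h1] at h2
        exact Nat.eq_of_mul_eq_mul_left hq (Nat.add_left_cancel h2)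
    · rintro ⟨h1, h2⟩ i j
      rw [hmod, hmod, h1, h2]
  by_cases h : D.IsContractible q₂ Finset.univ e
  · rw [contract_monomial_of _ _ _ _ _ h]
    by_cases h' : D.IsContractible q₁ Finset.univ (D.expDiv q₂ e)
    · rw [contract_monomial_of _ _ _ _ _ h', contract_monomial_of _ _ _ _ _ (hiff.2 ⟨h, h'⟩)]
      have h1 : D.expDiv q₁ (D.expDiv q₂ e) = D.expDiv (q₂ * q₁) e := Finsupp.ext fun s => by
        simp only [expDiv_apply, Nat.div_div_eq_div_mul]
      have h2 : D.contractCoeff M q₂ Finset.univ e *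
          D.contractCoeff m q₁ Finset.univ (D.expDiv q₂ e) =
          D.contractCoeff M (q₂ * q₁) Finset.univ e := by
        rw [contractCoeff, contractCoeff, contractCoeff, ← Finset.prod_mul_distrib]
        refine Finset.prod_congr rfl fun i _ => ?_
        rw [expDiv_apply, hmod, pow_add, pow_mul, hroot]
      rw [h1, mul_assoc, h2]
    · rw [contract_monomial_of_not _ _ _ _ _ h',
        contract_monomial_of_not _ _ _ _ _ fun h'' => h' (hiff.1 h'').2]
  · rw [contract_monomial_of_not _ _ _ _ _ h, map_zero,
      contract_monomial_of_not _ _ _ _ _ fun h'' => h (hiff.1 h'').1]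

lemma contract_one (M q : ℕ) : D.contract M q Finset.univ 1 = 1 := by
  rw [show (1 : D.Poly) = MvPolynomial.monomial 0 1 from rfl, contract_monomial_of]
  · have h1 : D.expDiv q 0 = 0 := Finsupp.ext fun s => by simp [expDiv_apply]
    rw [h1, contractCoeff]
    simp
  · exact ⟨fun _ _ _ => by simp, by simp⟩

lemma contract_expandHom (M : ℕ) {q : ℕ} (hq : 0 < q) (x : D.Poly) :
    D.contract M q Finset.univ (D.expandHom q x) = x := by
  have := D.contract_expandHom_mul M hq Finset.univ x 1
  rwa [mul_one, contract_one, mul_one] at this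

end ModelData

end

end PolystableDuality

namespace PolystableDuality

noncomputable section

/-! ### Injectivity of the transition maps and equivariance of contraction -/

namespace ModelData

variable {p : ℕ} {C : Type u} [NormedField C] [IsUltrametricDist C] (D : ModelData p C)

lemma contract_mem_polyIdeal [hp : Fact p.Prime] (m r : ℕ) {x : D.Poly} (hx : x ∈ D.polyIdeal (m
    + r)) :
    D.contract (m + r) (p ^ r) Finset.univ x ∈ D.polyIdeal m := by
  have hq : 0 < p ^ r := pow_pos hp.out.pos r
  rw [polyIdeal, Submodule.mem_sup] at hx
  obtain ⟨y, hy, z, hz, rfl⟩ := hx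
  rw [map_add]
  refine add_mem ?_ ?_
  · obtain ⟨y, rfl⟩ := Ideal.mem_span_singleton'.1 hy
    rw [mul_comm, ← nsmul_eq_mul, map_nsmul, nsmul_eq_mul]
    exact Ideal.mul_mem_right _ _ (D.natCast_mem_polyIdeal m)
  · suffices h : ∀ y : D.Poly, D.contract (m + r) (p ^ r) Finset.univ (z * y) ∈ D.polyIdeal m by
      have := h 1
      rwa [mul_one] at this
    refine Submodule.span_induction (p := fun z _ => ∀ y : D.Poly,
      D.contract (m + r) (p ^ r) Finset.univ (z * y) ∈ D.polyIdeal m) ?_ ?_ ?_ ?_ hz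
    · rintro _ ⟨i, rfl⟩ y
      refine Ideal.span_le.2 ?_ (D.contract_rel_mul_mem hq Finset.univ (Finset.mem_univ i)
        (D.root_pow_pow i m r) y)
      rw [Set.singleton_subset_iff]
      exact D.rel_mem_polyIdeal m i
    · intro y
      rw [zero_mul, map_zero]
      exact zero_mem _
    · intro x x' _ _ h h' y
      rw [add_mul, map_add]
      exact add_mem (h y) (h' y)
    · intro a x _ h y
      rw [smul_eq_mul, mul_comm a, mul_assoc]
      exact h _

/-- The transition maps modulo p are injective since contraction is a retraction: it undoes the
substitution of powers and respects the ideals. So an element that dies at a later level was already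
zero. -/
lemma polyToInf_eq_zero_iff [Fact p.Prime] (m : ℕ) (f : D.Poly) :
    D.polyToInf m f = 0 ↔ f ∈ D.polyIdeal m := by
  constructor
  · intro h
    obtain ⟨r, hr⟩ := D.exists_mem_of_polyToInf_eq_zero m f h
    have := D.contract_mem_polyIdeal m r hr
    rwa [contract_expandHom] at this
    exact pow_pos (Fact.out : p.Prime).pos r
  · intro h
    have h1 := (D.ofPoly_mem_span_iff m f).2 h
    have h2 := Ideal.mem_map_of_mem (D.toRInf m) h1
    rw [Ideal.map_span, Set.image_singleton, map_natCast] at h2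
    exact Ideal.Quotient.eq_zero_iff_mem.2 h2

/-- As R_∞^+/p is the union of its finite levels, a map out of it amounts to a compatible family on
polynomials; starting at level m allows targets that make sense only from there on. -/
lemma exists_lift [Fact p.Prime] {S : Type*} [AddCommGroup S] (m : ℕ) (φ : ∀ _ : ℕ, D.Poly →+ S)
    (hφ : ∀ r, ∀ f ∈ D.polyIdeal (m + r), φ r f = 0)
    (hc : ∀ r r' f, φ (r + r') (D.expandHom (p ^ r') f) = φ r f) :
    ∃ Φ : D.RInfModP →+ S, ∀ r f, Φ (D.polyToInf (m + r) f) = φ r f := by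
  have key : ∀ r r' f f', D.polyToInf (m + r) f = D.polyToInf (m + r') f' → φ r f = φ r' f' := by
    intro r r' f f' h
    rw [← D.polyToInf_expandHom _ r', ← D.polyToInf_expandHom (m + r') r, add_right_comm,
      ← sub_eq_zero,
      ← map_sub, polyToInf_eq_zero_iff, add_right_comm, add_assoc] at h
    have := hφ _ _ h
    rwa [map_sub, hc, add_comm r, hc, sub_eq_zero] at this
  choose r f hf using D.exists_polyToInf_add m
  have key' : ∀ s x, φ (r (D.polyToInf (m + s) x)) (f (D.polyToInf (m + s) x)) = φ s x :=
    fun s x => key _ _ _ _ (hf _)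
  refine ⟨⟨⟨fun x => φ (r x) (f x), ?_⟩, ?_⟩, key'⟩
  · have := key' 0 0
    rwa [map_zero, map_zero] at this
  · intro x y
    change φ (r (x + y)) (f (x + y)) = φ (r x) (f x) + φ (r y) (f y)
    have h1 : x + y = D.polyToInf (m + (r x + r y))
        (D.expandHom (p ^ r y) (f x) + D.expandHom (p ^ r x) (f y)) := by
      rw [map_add, ← add_assoc, polyToInf_expandHom, add_right_comm, polyToInf_expandHom, hf, hf]
    rw [h1, key', map_add, hc, add_comm (r x), hc]

lemma polyToModP_smul_polyToInf (m : ℕ) (f g : D.Poly) :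
    D.polyToModP f • D.polyToInf m g = D.polyToInf m (D.expandHom (p ^ m) f * g) := by
  rw [Algebra.smul_def, algebraMap_polyToModP, map_mul]
  congr 1
  have := D.polyToInf_expandHom 0 m f
  rw [zero_add] at this
  exact this.symm

lemma actR_ofPoly (ε : D.Delta) (m : ℕ) (f : D.Poly) :
    D.actR ε m (D.ofPoly m f) = D.ofPoly m (D.actPoly ε m f) := by
  change Ideal.Quotient.mk _ (pCompletionMap p _ _) = Ideal.Quotient.mk _ _
  rw [pCompletionMap_algebraMap]

lemma actRInf_toRInf (ε : D.Delta) (m : ℕ) (x : D.R m) :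
    D.actRInf ε (D.toRInf m x) = D.toRInf m (D.actR ε m x) := by
  rw [actRInf, toRInf, RingHom.comp_apply, pCompletionMap_algebraMap, actColim,
    Ring.DirectLimit.map_apply_of]
  rfl

lemma rho_polyToInf (ε : D.Delta) (m : ℕ) (f : D.Poly) :
    D.rho ε (D.polyToInf m f) = D.polyToInf m (D.actPoly ε m f) := by
  change Ideal.Quotient.mk _ (D.actRInf ε (D.toRInf m (D.ofPoly m f))) = _
  rw [actRInf_toRInf, actR_ofPoly]
  rfl

lemma actPoly_monomial (ε : D.Delta) (m : ℕ) (e : D.Idx →₀ ℕ) (a : OC C) :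
    D.actPoly ε m (MvPolynomial.monomial e a) =
      MvPolynomial.monomial e (a * ∏ s, (ε.level m s : OC C) ^ e s) := by
  have h : ∀ b : OC C, (MvPolynomial.monomial e b : D.Poly) =
      MvPolynomial.C b * ∏ s, MvPolynomial.X s ^ e s := fun b => by
    rw [MvPolynomial.monomial_eq, Finsupp.prod_fintype _ _ (fun _ => pow_zero _)]
  rw [h, h, map_mul, actPoly_C, map_prod, map_mul, map_prod, mul_assoc, ← Finset.prod_mul_distrib]
  congr 1
  refine Finset.prod_congr rfl fun s _ => ?_
  rw [map_pow, actPoly_X, mul_pow, map_pow]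

/-- Split each exponent into quotient and residue modulo p^r. The quotients see the p^r-th power of
ε at level m + r, which is ε at level m; the residues are constant on blocks and contribute nothing.
-/
lemma contract_actPoly (ε : D.Delta) (m r : ℕ) (x : D.Poly) :
    D.contract (m + r) (p ^ r) Finset.univ (D.actPoly ε (m + r) x) =
      D.actPoly ε m (D.contract (m + r) (p ^ r) Finset.univ x) := by
  refine D.addHom_ext
    (f := fun x => D.contract (m + r) (p ^ r) Finset.univ (D.actPoly ε (m + r) x))
    (g := fun x => D.actPoly ε m (D.contract (m + r) (p ^ r) Finset.univ x))
    (fun x y => by simp only [map_add]) (fun x y => by simp only [map_add]) (fun e a => ?_) x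
  rw [actPoly_monomial]
  by_cases h : D.IsContractible (p ^ r) Finset.univ e
  · rw [contract_monomial_of _ _ _ _ _ h, contract_monomial_of _ _ _ _ _ h, actPoly_monomial]
    have h1 : ∏ s, (ε.level (m + r) s : OC C) ^ e s =
        ∏ s, (ε.level m s : OC C) ^ D.expDiv (p ^ r) e s := by
      have h2 : ∀ s, (ε.level (m + r) s : OC C) ^ e s =
          (ε.level m s : OC C) ^ D.expDiv (p ^ r) e s * (ε.level (m + r) s : OC C) ^ (e s % p ^
            r) := by
        intro s
        rw [expDiv_apply, ← D.level_pow ε m r s, Units.val_pow_eq_pow_val, ← pow_mul, ← pow_add,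
          Nat.div_add_mod]
      simp only [h2, Finset.prod_mul_distrib]
      -- On each block the residue is constant, and the product of the components of ε over the
      -- block is one.
      have h3 : ∏ s, (ε.level (m + r) s : OC C) ^ (e s % p ^ r) = 1 := by
        rw [Fintype.prod_sigma]
        refine Finset.prod_eq_one fun i _ => ?_
        have h5 : ∏ j, ε.level (m + r) ⟨i, j⟩ = 1 := ε.2.2.2 (m + r) i
        rw [Finset.prod_congr rfl fun j _ => by rw [h.1 i (Finset.mem_univ _) j], Finset.prod_pow,
          ← Units.coe_prod, h5, Units.val_one, one_pow]
      rw [h3, mul_one]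
    rw [h1]
    congr 1
    ring
  · rw [contract_monomial_of_not _ _ _ _ _ h, contract_monomial_of_not _ _ _ _ _ h, map_zero]

end ModelData

end

end PolystableDuality

namespace PolystableDuality

noncomputable section

/-! ### Quotients between the free extension and the ring of level m -/

namespace ModelData

variable {p : ℕ} {C : Type u} [NormedField C] [IsUltrametricDist C] (D : ModelData p C)

/-- Extension of a ring map from polynomials to `R^+/p`. -/
def modPLift {S : Type*} [CommRing S] (φ : D.Poly →+* S) (h : D.polyIdeal 0 ≤ RingHom.ker φ) :
    D.RModP →+* S :=
  RingHom.liftOfSurjective D.polyToModP D.polyToModP_surjective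
    ⟨φ, fun f hf => h ((D.polyToModP_eq_zero_iff f).1 hf)⟩

lemma modPLift_polyToModP {S : Type*} [CommRing S] (φ : D.Poly →+* S)
    (h : D.polyIdeal 0 ≤ RingHom.ker φ) (f : D.Poly) : D.modPLift φ h (D.polyToModP f) = φ f :=
  RingHom.liftOfRightInverse_comp_apply _ _ _ _ _

/-- An additive map between `R^+/p`-modules is linear if it commutes with the classes of
polynomials. -/
def linearMapOfPoly {M M' : Type*} [AddCommGroup M] [Module D.RModP M] [AddCommGroup M']
    [Module D.RModP M'] (φ : M →+ M')
    (h : ∀ f x, φ (D.polyToModP f • x) = D.polyToModP f • φ x) : M →ₗ[D.RModP] M' where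
  toFun := φ
  map_add' := map_add φ
  map_smul' r x := by
    obtain ⟨f, rfl⟩ := D.polyToModP_surjective r
    exact h f x

/-- The generators of the ideal `frobIdeal`. -/
def frobGens (m : ℕ) (J : Finset (Fin D.l)) : Set D.Poly :=
  {(p : D.Poly)} ∪ (Set.range fun i => D.expandHom (p ^ m) (D.rel 0 i)) ∪ D.rel m '' J

/-- The ideal generated by `p`, by the relations at level `m` for the blocks in `J`, and by the
`p^m`-th powers of the relations for all blocks. -/
def frobIdeal (m : ℕ) (J : Finset (Fin D.l)) : Ideal D.Poly := Ideal.span (D.frobGens m J)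

lemma natCast_mem_frobIdeal (m : ℕ) (J : Finset (Fin D.l)) : (p : D.Poly) ∈ D.frobIdeal m J :=
  Ideal.subset_span (.inl (.inl rfl))

lemma expandHom_rel_mem_frobIdeal (m : ℕ) (J : Finset (Fin D.l)) (i : Fin D.l) :
    D.expandHom (p ^ m) (D.rel 0 i) ∈ D.frobIdeal m J :=
  Ideal.subset_span (.inl (.inr ⟨i, rfl⟩))

lemma rel_mem_frobIdeal (m : ℕ) {J : Finset (Fin D.l)} {i : Fin D.l} (hi : i ∈ J) :
    D.rel m i ∈ D.frobIdeal m J :=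
  Ideal.subset_span (.inr ⟨i, hi, rfl⟩)

lemma frobIdeal_le_iff {m : ℕ} {J : Finset (Fin D.l)} {K : Ideal D.Poly} :
    D.frobIdeal m J ≤ K ↔ (p : D.Poly) ∈ K ∧ (∀ i, D.expandHom (p ^ m) (D.rel 0 i) ∈ K) ∧
      ∀ i ∈ J, D.rel m i ∈ K := by
  rw [frobIdeal, Ideal.span_le, frobGens, Set.union_subset_iff, Set.union_subset_iff,
    Set.singleton_subset_iff, Set.range_subset_iff, Set.image_subset_iff, and_assoc]
  rfl

lemma frobIdeal_insert (m : ℕ) (J : Finset (Fin D.l)) (i : Fin D.l) :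
    D.frobIdeal m (insert i J) = D.frobIdeal m J ⊔ Ideal.span {D.rel m i} := by
  rw [frobIdeal, frobIdeal, ← Ideal.span_union, frobGens, frobGens, Finset.coe_insert,
    Set.image_insert_eq]
  congr 1
  ext x
  simp only [Set.mem_union, Set.mem_insert_iff, Set.mem_singleton_iff]
  tauto

lemma rel_dvd_expandHom (m : ℕ) (i : Fin D.l) :
    D.rel m i ∣ D.expandHom (p ^ m) (D.rel 0 i) :=
  D.rel_dvd_expand (Nat.zero_le m) i

/-- The relation at level zero, written in p^m-th powers, is a multiple of the relation at level m,
so once all blocks are in J the former are redundant. -/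
lemma frobIdeal_univ (m : ℕ) : D.frobIdeal m Finset.univ = D.polyIdeal m := by
  refine le_antisymm (D.frobIdeal_le_iff.2 ⟨D.natCast_mem_polyIdeal m, fun i => ?_,
    fun i _ => D.rel_mem_polyIdeal m i⟩) (D.polyIdeal_le_iff.2 ⟨D.natCast_mem_frobIdeal m _,
    fun i => D.rel_mem_frobIdeal m (Finset.mem_univ i)⟩)
  obtain ⟨c, hc⟩ := D.rel_dvd_expandHom m i
  rw [hc]
  exact Ideal.mul_mem_right _ _ (D.rel_mem_polyIdeal m i)

/-- The quotient of the polynomial ring by `frobIdeal`. -/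
def FrobQuot (m : ℕ) (J : Finset (Fin D.l)) : Type u := D.Poly ⧸ D.frobIdeal m J

instance (m : ℕ) (J : Finset (Fin D.l)) : CommRing (D.FrobQuot m J) :=
  inferInstanceAs (CommRing (D.Poly ⧸ D.frobIdeal m J))

/-- The quotient map from the polynomial ring. -/
def frobMk (m : ℕ) (J : Finset (Fin D.l)) : D.Poly →+* D.FrobQuot m J :=
  Ideal.Quotient.mk (D.frobIdeal m J)

lemma frobMk_surjective (m : ℕ) (J : Finset (Fin D.l)) : Function.Surjective (D.frobMk m J) :=
  Ideal.Quotient.mk_surjective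

lemma frobMk_eq_zero_iff {m : ℕ} {J : Finset (Fin D.l)} {f : D.Poly} :
    D.frobMk m J f = 0 ↔ f ∈ D.frobIdeal m J := Ideal.Quotient.eq_zero_iff_mem

lemma polyIdeal_zero_le_ker (m : ℕ) (J : Finset (Fin D.l)) :
    D.polyIdeal 0 ≤ RingHom.ker ((D.frobMk m J).comp (D.expandHom (p ^ m))) := by
  rw [polyIdeal_le_iff]
  refine ⟨?_, fun i => ?_⟩
  · rw [RingHom.mem_ker, RingHom.comp_apply, map_natCast, frobMk_eq_zero_iff]
    exact D.natCast_mem_frobIdeal m J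
  · rw [RingHom.mem_ker, RingHom.comp_apply, frobMk_eq_zero_iff]
    exact D.expandHom_rel_mem_frobIdeal m J i

/-- The structure of `R^+/p`-algebra, where the variables of `R^+` act through `p^m`-th powers. -/
instance (m : ℕ) (J : Finset (Fin D.l)) : Algebra D.RModP (D.FrobQuot m J) :=
  (D.modPLift ((D.frobMk m J).comp (D.expandHom (p ^ m))) (D.polyIdeal_zero_le_ker m J)).toAlgebra

lemma polyToModP_smul_frobMk (m : ℕ) (J : Finset (Fin D.l)) (f g : D.Poly) :
    D.polyToModP f • D.frobMk m J g = D.frobMk m J (D.expandHom (p ^ m) f * g) := by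
  rw [Algebra.smul_def, map_mul]
  congr 1
  exact D.modPLift_polyToModP _ (D.polyIdeal_zero_le_ker m J) f

set_option linter.unusedSectionVars false

variable [hp : Fact p.Prime]

/-- Contraction is linear over p^m-th powers, and the blocks in J are exactly those on which it
respects the relations at level m; so it induces a form on the quotient. -/
lemma contract_mem_polyIdeal_zero (m : ℕ) (J : Finset (Fin D.l)) {x : D.Poly}
    (hx : x ∈ D.frobIdeal m J) : D.contract m (p ^ m) J x ∈ D.polyIdeal 0 := by
  have hq : 0 < p ^ m := pow_pos hp.out.pos m
  suffices h : ∀ y : D.Poly, D.contract m (p ^ m) J (x * y) ∈ D.polyIdeal 0 by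
    have := h 1
    rwa [mul_one] at this
  refine Submodule.span_induction (p := fun z _ => ∀ y : D.Poly,
    D.contract m (p ^ m) J (z * y) ∈ D.polyIdeal 0) ?_ ?_ ?_ ?_ hx
  · rintro _ ((rfl | ⟨i, rfl⟩) | ⟨i, hi, rfl⟩) y
    · rw [← nsmul_eq_mul, map_nsmul, nsmul_eq_mul]
      exact Ideal.mul_mem_right _ _ (D.natCast_mem_polyIdeal 0)
    · rw [contract_expandHom_mul _ _ hq]
      exact Ideal.mul_mem_right _ _ (D.rel_mem_polyIdeal 0 i)
    · have hr := D.root_pow_pow i 0 m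
      rw [zero_add] at hr
      refine Ideal.span_le.2 ?_ (D.contract_rel_mul_mem hq J hi hr y)
      rw [Set.singleton_subset_iff]
      exact D.rel_mem_polyIdeal 0 i
  · intro y
    rw [zero_mul, map_zero]
    exact zero_mem _
  · intro x x' _ _ h h' y
    rw [add_mul, map_add]
    exact add_mem (h y) (h' y)
  · intro a x _ h y
    rw [smul_eq_mul, mul_comm a, mul_assoc]
    exact h _

/-- The linear form on `FrobQuot` induced by contraction. -/
def frobForm (m : ℕ) (J : Finset (Fin D.l)) : D.FrobQuot m J →ₗ[D.RModP] D.RModP :=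
  D.linearMapOfPoly (QuotientAddGroup.lift (D.frobIdeal m J).toAddSubgroup
    (D.polyToModP.toAddMonoidHom.comp (D.contract m (p ^ m) J).toAddMonoidHom) (fun x hx =>
      (D.polyToModP_eq_zero_iff _).2 (D.contract_mem_polyIdeal_zero m J hx))) (fun f x => by
    obtain ⟨x, rfl⟩ := D.frobMk_surjective m J x
    rw [polyToModP_smul_frobMk]
    change D.polyToModP (D.contract _ _ _ _) = _ * D.polyToModP (D.contract _ _ _ _)
    rw [contract_expandHom_mul _ _ (pow_pos hp.out.pos m), map_mul])

lemma frobForm_frobMk (m : ℕ) (J : Finset (Fin D.l)) (x : D.Poly) :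
    D.frobForm m J (D.frobMk m J x) = D.polyToModP (D.contract m (p ^ m) J x) := rfl

lemma isContractible_empty_iff (q : ℕ) (e : D.Idx →₀ ℕ) :
    D.IsContractible q ∅ e ↔ ∀ s, e s % q = q - 1 := by
  simp [IsContractible, Sigma.forall]

/-- A bounded exponent, seen as a finitely supported function. -/
def boundedExp {q : ℕ} (a : D.Idx → Fin q) : D.Idx →₀ ℕ :=
  Finsupp.equivFunOnFinite.symm fun s => a s

/-- The complementary exponents q - 1 - a raise the residues to the top value exactly when they
equal a, so contraction against the complementary monomial reads off the coefficient at a. -/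
lemma contract_empty_monomial {M q : ℕ} (a : D.Idx → Fin q) (e : D.Idx →₀ ℕ) (c : OC C) :
    D.contract M q ∅ (MvPolynomial.monomial (D.boundedExp fun s => (a s).rev) 1 *
      MvPolynomial.monomial e c) =
      if (∀ s, e s % q = a s) then MvPolynomial.monomial (D.expDiv q e) c else 0 := by
  rw [MvPolynomial.monomial_mul, one_mul]
  have h0 : ∀ s, (D.boundedExp (fun s => (a s).rev) + e) s = (q - (a s + 1)) + e s := fun s => by
    simp [boundedExp, Fin.val_rev]
  have h1 : ∀ s, (q - (a s + 1) + e s) % q = q - 1 ↔ e s % q = a s := fun s => by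
    have h2 := (a s).2
    rw [show q - 1 = (q - (a s + 1) + a s) % q by
      rw [show q - (a s + 1 : ℕ) + a s = q - 1 by omega, Nat.mod_eq_of_lt (by omega)]]
    conv_rhs => rw [← Nat.mod_eq_of_lt h2]
    exact ⟨fun h => Nat.ModEq.add_left_cancel' _ h, fun h => Nat.ModEq.add_left _ h⟩
  split_ifs with h
  · rw [contract_monomial_of]
    · have h3 : D.expDiv q (D.boundedExp (fun s => (a s).rev) + e) = D.expDiv q e :=
        Finsupp.ext fun s => by
          have := (a s).2
          rw [expDiv_apply, expDiv_apply, h0]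
          conv_lhs => rw [← Nat.div_add_mod (e s) q, h s]
          rw [show q - (a s + 1 : ℕ) + (q * (e s / q) + a s) = q * (e s / q) + (q - 1) by omega,
            Nat.mul_add_div (by omega), Nat.div_eq_of_lt (a := q - 1) (by omega), add_zero]
      rw [h3, contractCoeff, Finset.prod_empty, mul_one]
    · rw [isContractible_empty_iff]
      intro s
      rw [h0, h1]
      exact h s
  · rw [contract_monomial_of_not]
    rw [isContractible_empty_iff]
    intro h'
    exact h fun s => by rw [← h1, ← h0]; exact h' s

lemma sum_expandHom_contract {M q : ℕ} (hq : 0 < q) (x : D.Poly) :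
    ∑ a : D.Idx → Fin q, D.expandHom q (D.contract M q ∅
      (MvPolynomial.monomial (D.boundedExp fun s => (a s).rev) 1 * x)) *
      MvPolynomial.monomial (D.boundedExp a) 1 = x := by
  refine D.addHom_ext (f := fun x => ∑ a : D.Idx → Fin q, D.expandHom q (D.contract M q ∅
      (MvPolynomial.monomial (D.boundedExp fun s => (a s).rev) 1 * x)) *
      MvPolynomial.monomial (D.boundedExp a) 1) (g := fun x => x)
    (fun x y => by simp only [mul_add, map_add, add_mul, Finset.sum_add_distrib])
    (fun _ _ => rfl) (fun e c => ?_) x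
  let a₀ : D.Idx → Fin q := fun s => ⟨e s % q, Nat.mod_lt _ hq⟩
  rw [Finset.sum_eq_single a₀]
  · rw [contract_empty_monomial, if_pos (fun s => rfl), expandHom_monomial,
      MvPolynomial.monomial_mul,
      mul_one]
    congr 1
    refine congrArg _ (Finsupp.ext fun s => ?_)
    rw [Finsupp.add_apply, Finsupp.smul_apply, expDiv_apply, smul_eq_mul]
    exact Nat.div_add_mod _ _
  · intro a _ ha
    rw [contract_empty_monomial, if_neg (fun h => ha (funext fun s => Fin.ext (h s).symm)),
      map_zero,
      zero_mul]
  · exact fun h => absurd (Finset.mem_univ _) h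

/-- The monomial basis of `FrobQuot m ∅`. -/
def frobBasis (m : ℕ) : Module.Basis (D.Idx → Fin (p ^ m)) D.RModP (D.FrobQuot m ∅) :=
  Module.Basis.ofEquivFun
    { toFun := fun x a => D.frobForm m ∅ (D.frobMk m ∅
        (MvPolynomial.monomial (D.boundedExp fun s => (a s).rev) 1) * x)
      map_add' := fun x y => funext fun a => by simp only [mul_add, map_add, Pi.add_apply]
      map_smul' := fun r x => funext fun a => by
        simp only [mul_smul_comm, map_smul, Pi.smul_apply, RingHom.id_apply]
      invFun := fun v => ∑ a, v a • D.frobMk m ∅ (MvPolynomial.monomial (D.boundedExp a) 1)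
      left_inv := fun x => by
        obtain ⟨x, rfl⟩ := D.frobMk_surjective m ∅ x
        simp only [← map_mul, frobForm_frobMk, polyToModP_smul_frobMk]
        rw [← map_sum, D.sum_expandHom_contract (pow_pos hp.out.pos m)]
      right_inv := fun v => funext fun a => by
        beta_reduce
        rw [Finset.mul_sum, map_sum, Finset.sum_eq_single a]
        · rw [mul_smul_comm, map_smul, ← map_mul, frobForm_frobMk, contract_empty_monomial,
            if_pos (show ∀ s, D.boundedExp a s % p ^ m = a s from fun s => Nat.mod_eq_of_lt (a
              s).2)]
          have : D.expDiv (p ^ m) (D.boundedExp a) = 0 := Finsupp.ext fun s => by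
            rw [expDiv_apply]
            exact Nat.div_eq_of_lt (a s).2
          rw [this, smul_eq_mul]
          exact (congrArg (v a * ·) (map_one D.polyToModP)).trans (mul_one _)
        · intro b _ hb
          rw [mul_smul_comm, map_smul, ← map_mul, frobForm_frobMk, contract_empty_monomial,
            if_neg, map_zero, smul_zero]
          exact fun h => hb (funext fun s => Fin.ext
            ((Nat.mod_eq_of_lt (b s).2).symm.trans (h s)))
        · exact fun h => absurd (Finset.mem_univ _) h }

lemma frobBasis_repr (m : ℕ) (x : D.FrobQuot m ∅) (a : D.Idx → Fin (p ^ m)) :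
    (D.frobBasis m).repr x a = D.frobForm m ∅ (D.frobMk m ∅
      (MvPolynomial.monomial (D.boundedExp fun s => (a s).rev) 1) * x) := rfl

/-- Monomials with complementary exponents are dual bases for the form, so a functional is
represented by the combination of dual monomials with its values as coefficients. -/
lemma frobForm_empty_isPerfectForm (m : ℕ) : IsPerfectForm (D.frobForm m ∅) := by
  have h0 : ∀ b : D.FrobQuot m ∅, (∀ x, D.frobForm m ∅ (b * x) = 0) → b = 0 := by
    intro b hb
    refine (D.frobBasis m).repr.injective (Finsupp.ext fun a => ?_)
    rw [frobBasis_repr, mul_comm, hb, map_zero, Finsupp.zero_apply]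
  intro φ
  have h1 : ∀ x, φ x = D.frobForm m ∅ ((∑ a, φ (D.frobBasis m a) • D.frobMk m ∅
      (MvPolynomial.monomial (D.boundedExp fun s => (a s).rev) 1)) * x) := by
    intro x
    conv_lhs => rw [← (D.frobBasis m).sum_repr x]
    rw [map_sum, Finset.sum_mul, map_sum]
    refine Finset.sum_congr rfl fun a _ => ?_
    rw [map_smul, smul_mul_assoc, map_smul, frobBasis_repr, smul_eq_mul, smul_eq_mul, mul_comm]
  refine ⟨_, h1, fun b hb => ?_⟩
  rw [← sub_eq_zero]
  refine h0 _ fun x => ?_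
  rw [sub_mul, map_sub, ← h1, ← hb, sub_self]

end ModelData

end

end PolystableDuality

namespace PolystableDuality

noncomputable section

/-! ### Regularity of the relations and induction over the blocks -/

section Regularity

variable {σ k : Type*} [CommRing k]

open MvPolynomial

lemma divMonomial_monomial_mul_of_disjoint (d e : σ →₀ ℕ) (he : ∀ s, d s ≠ 0 → e s = 0) (a : k)
    (x : MvPolynomial σ k) : (monomial e a * x).divMonomial d = monomial e a * x.divMonomial d := by
  induction x using MvPolynomial.induction_on' with
  | add x y hx hy => rw [mul_add, add_divMonomial, hx, hy, add_divMonomial, mul_add]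
  | monomial f b =>
    classical
    ext g
    rw [coeff_divMonomial, coeff_monomial_mul', coeff_monomial_mul', coeff_divMonomial]
    have h1 : e ≤ d + g ↔ e ≤ g := by
      refine ⟨fun h s => ?_, fun h => h.trans le_add_self⟩
      by_cases hs : d s = 0
      · simpa [hs] using h s
      · rw [he s hs]; exact Nat.zero_le _
    by_cases h : e ≤ g
    · rw [if_pos h, if_pos (h1.2 h), add_tsub_assoc_of_le h]
    · rw [if_neg h, if_neg (h1.not.2 h)]

lemma exists_iterate_divMonomial_eq_zero (d : σ →₀ ℕ) (hd : d ≠ 0) (x : MvPolynomial σ k) :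
    ∃ n, (fun y : MvPolynomial σ k => y.divMonomial d)^[n] x = 0 := by
  obtain ⟨s, hs⟩ := Finsupp.ne_iff.1 hd
  rw [Finsupp.zero_apply] at hs
  have h : ∀ n, (fun y : MvPolynomial σ k => y.divMonomial d)^[n] x = x.divMonomial (n • d) := by
    intro n
    induction n with
    | zero => rw [zero_smul, divMonomial_zero]; rfl
    | succ n ih => rw [Function.iterate_succ_apply', ih, succ_nsmul, divMonomial_add]
  refine ⟨x.degreeOf s + 1, ?_⟩
  rw [h]
  ext g
  rw [coeff_divMonomial, coeff_zero]
  by_contra hne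
  have h1 := MvPolynomial.le_degreeOf_of_mem_support s (mem_support_iff.2 hne)
  simp only [Finsupp.add_apply, Finsupp.smul_apply, smul_eq_mul] at h1
  have : (x.degreeOf s + 1) * 1 ≤ (x.degreeOf s + 1) * d s := Nat.mul_le_mul_left _ (by omega)
  omega

/-- A monomial minus a constant is a nonzerodivisor modulo an ideal generated by
polynomials that do not involve the variables of the monomial. -/
lemma mem_of_monomial_sub_C_mul_mem (d : σ →₀ ℕ) (hd : d ≠ 0) (c : k) (S : Set (MvPolynomial σ k))
    (hS : ∀ w ∈ S, ∀ y : MvPolynomial σ k, (w * y).divMonomial d = w * y.divMonomial d)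
    (x : MvPolynomial σ k) (hx : (monomial d 1 - C c) * x ∈ Ideal.span S) : x ∈ Ideal.span S := by
  have hT : ∀ z ∈ Ideal.span S, z.divMonomial d ∈ Ideal.span S := by
    intro z hz
    suffices h : ∀ y, (z * y).divMonomial d ∈ Ideal.span S by
      have := h 1
      rwa [mul_one] at this
    refine Submodule.span_induction (p := fun z _ => ∀ y : MvPolynomial σ k,
      (z * y).divMonomial d ∈ Ideal.span S) ?_ ?_ ?_ ?_ hz
    · intro w hw y
      rw [hS w hw]
      exact Ideal.mul_mem_right _ _ (Ideal.subset_span hw)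
    · intro y
      rw [zero_mul, zero_divMonomial]
      exact zero_mem _
    · intro x x' _ _ h h' y
      rw [add_mul, add_divMonomial]
      exact add_mem (h y) (h' y)
    · intro a x _ h y
      rw [smul_eq_mul, mul_comm a, mul_assoc]
      exact h _
  have hCT : ∀ y : MvPolynomial σ k, (C c * y).divMonomial d = C c * y.divMonomial d := fun y =>
    divMonomial_monomial_mul_of_disjoint d 0 (fun _ _ => rfl) c y
  let T : MvPolynomial σ k →+ MvPolynomial σ k :=
    ⟨⟨fun y => y.divMonomial d, zero_divMonomial d⟩, fun x y => add_divMonomial x y d⟩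
  -- Let T be division by the monomial; it preserves the ideal. Applying T to the hypothesis gives x
  -- ≡ cTx modulo the ideal, and T is nilpotent on each polynomial, so x is in the ideal.
  have h1 : ∀ n, ∀ x, x - C c * T x ∈ Ideal.span S → T^[n] x = 0 → x ∈ Ideal.span S := by
    intro n
    induction n with
    | zero =>
      intro x _ h0
      rw [show x = 0 from h0]
      exact zero_mem _
    | succ n ih =>
      intro x h h0
      have h2 : T x - C c * T (T x) ∈ Ideal.span S := by
        have := hT _ h
        change T (x - C c * T x) ∈ _ at this
        rw [map_sub] at this
        rwa [show T (C c * T x) = C c * T (T x) from hCT (T x)] at this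
      have h3 := add_mem h (Ideal.mul_mem_left _ (C c) (ih _ h2 h0))
      rwa [sub_add_cancel] at h3
  obtain ⟨n, hn⟩ := exists_iterate_divMonomial_eq_zero d hd x
  refine h1 n x ?_ hn
  have h2 := hT _ hx
  change T _ ∈ _ at h2
  rw [sub_mul, map_sub] at h2
  rwa [show T (monomial d 1 * x) = x from divMonomial_monomial_mul d x,
    show T (C c * x) = _ from hCT x] at h2

end Regularity

namespace ModelData

variable {p : ℕ} {C : Type u} [NormedField C] [IsUltrametricDist C] (D : ModelData p C)

lemma expandHom_rel (q m : ℕ) (i : Fin D.l) : D.expandHom q (D.rel m i) =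
    MvPolynomial.monomial (q • D.block i) 1 - MvPolynomial.C (D.root i m) := by
  rw [rel_eq_monomial, map_sub, expandHom_monomial]
  congr 1
  exact MvPolynomial.expand_C _ _

/-- As i is not in J, the only generator involving the variables of block i is the relation in
p^m-th powers. It is a monomial minus a constant, hence regular modulo the ideal I spanned by the
others. -/
lemma mem_frobIdeal_of_expandHom_rel_mul_mem [hp : Fact p.Prime] (m : ℕ) (J : Finset (Fin D.l))
    {i : Fin D.l} (hi : i ∉ J) :
    ∃ I : Ideal D.Poly, D.frobIdeal m J = I ⊔ Ideal.span {D.expandHom (p ^ m) (D.rel 0 i)} ∧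
      ∀ x, D.expandHom (p ^ m) (D.rel 0 i) * x ∈ I → x ∈ I := by
  have hq : 0 < p ^ m := pow_pos hp.out.pos m
  let S : Set D.Poly := {(p : D.Poly)} ∪ (fun i' => D.expandHom (p ^ m) (D.rel 0 i')) '' {i' | i'
      ≠ i} ∪
    D.rel m '' J
  have hS : ∀ w ∈ S, ∀ y : D.Poly, (w * y).divMonomial (p ^ m • D.block i) =
      w * y.divMonomial (p ^ m • D.block i) := by
    have h1 : ∀ N : ℕ, ∀ i' ≠ i, ∀ c (y : D.Poly), ((MvPolynomial.monomial (N • D.block i') 1 -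
        MvPolynomial.C c) * y).divMonomial (p ^ m • D.block i) =
        (MvPolynomial.monomial (N • D.block i') 1 - MvPolynomial.C c) *
          y.divMonomial (p ^ m • D.block i) := by
      intro N i' hi' c y
      have h2 : MvPolynomial.monomial (N • D.block i') 1 - MvPolynomial.C c =
          MvPolynomial.monomial (N • D.block i') 1 + MvPolynomial.monomial 0 (-c) := by
        rw [sub_eq_add_neg, ← map_neg]
        rfl
      rw [h2, add_mul, add_mul, MvPolynomial.add_divMonomial, divMonomial_monomial_mul_of_disjoint,
        divMonomial_monomial_mul_of_disjoint]
      · intro s _; rfl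
      · intro s hs
        simp only [Finsupp.smul_apply, block_apply, smul_eq_mul] at hs ⊢
        by_cases h : s.1 = i
        · rw [if_neg (fun h' : s.1 = i' => hi' (h'.symm.trans h)), mul_zero]
        · simp [h] at hs
    rintro w ((rfl | ⟨i', hi', rfl⟩) | ⟨i', hi', rfl⟩) y
    · have : (p : D.Poly) = MvPolynomial.monomial 0 (p : OC C) :=
        (map_natCast MvPolynomial.C p).symm
      rw [this, divMonomial_monomial_mul_of_disjoint]
      intro s _; rfl
    · dsimp only
      rw [expandHom_rel]
      exact h1 _ _ hi' _ _
    · rw [rel_eq_monomial, ← one_smul ℕ (D.block i')]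
      exact h1 _ _ (fun h => hi (h ▸ hi')) _ _
  refine ⟨Ideal.span S, ?_, fun x hx => ?_⟩
  · rw [frobIdeal, ← Ideal.span_union]
    congr 1
    ext x
    simp only [S, frobGens, Set.mem_union, Set.mem_image, Set.mem_range, Set.mem_singleton_iff]
    constructor
    · rintro ((h | ⟨i', rfl⟩) | h)
      · exact .inl (.inl (.inl h))
      · by_cases hi' : i' = i
        · subst hi'; exact .inr rfl
        · exact .inl (.inl (.inr ⟨i', hi', rfl⟩))
      · exact .inl (.inr h)
    · rintro (((h | ⟨i', _, rfl⟩) | h) | rfl)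
      · exact .inl (.inl h)
      · exact .inl (.inr ⟨i', rfl⟩)
      · exact .inr h
      · exact .inl (.inr ⟨i, rfl⟩)
  · rw [expandHom_rel] at hx
    refine mem_of_monomial_sub_C_mul_mem _ ?_ _ S hS x hx
    intro h
    have := DFunLike.congr_fun h ⟨i, 0⟩
    simp [block_apply] at this
    exact hp.out.ne_zero this.1

/-- If `g h = f` with `f` regular modulo `I`, then `g` and `h` are exact zero divisors
modulo `I + (f)`. -/
lemma exists_mul_of_mul_mem {A : Type*} [CommRing A] {I : Ideal A} {f g h : A} (hf : g * h = f)
    (hI : ∀ x, f * x ∈ I → x ∈ I) (x : A) (hx : g * x ∈ I ⊔ Ideal.span {f}) :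
    ∃ y, x - h * y ∈ I ⊔ Ideal.span {f} := by
  obtain ⟨a, ha, b, hb, hab⟩ := Submodule.mem_sup.1 hx
  obtain ⟨c, rfl⟩ := Ideal.mem_span_singleton'.1 hb
  refine ⟨c, Ideal.mem_sup_left (hI _ ?_)⟩
  have : f * (x - h * c) = h * a := by
    have : a = g * x - c * f := by rw [← hab]; ring
    rw [this, ← hf]
    ring
  rw [this]
  exact Ideal.mul_mem_left _ _ ha

-- Induction on J. For J empty the algebra is free with dual monomial bases. Adding a block kills
-- its relation g at level m; g times its cofactor h is the relation in p^m-th powers, which is zero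
-- in the current quotient and regular modulo the other generators. Therefore g and h are exact zero
-- divisors, and both properties pass to the quotient; the forms agree by `contract_insert`.
open CategoryTheory in
lemma frobForm_isPerfectForm_and_isAcyclicFor [hp : Fact p.Prime]
    (R : InjectiveResolution (ModuleCat.of D.RModP D.RModP)) (m : ℕ) (J : Finset (Fin D.l)) :
    IsPerfectForm (D.frobForm m J) ∧ IsAcyclicFor R (ModuleCat.of D.RModP (D.FrobQuot m J)) := by
  induction J using Finset.induction_on with
  | empty => exact ⟨D.frobForm_empty_isPerfectForm m, isAcyclicFor_of_basis R (D.frobBasis m)⟩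
  | insert i J hi ih =>
    have hq : 0 < p ^ m := pow_pos hp.out.pos m
    have hle : D.frobIdeal m J ≤ D.frobIdeal m (insert i J) := by
      rw [frobIdeal_insert]
      exact le_sup_left
    have hr := D.root_pow_pow i 0 m
    rw [zero_add] at hr
    have hfac := D.cofactor_mul_rel i hr
    have hfac' : D.rel m i * D.cofactor m (p ^ m) i = _ := (mul_comm _ _).trans hfac
    obtain ⟨I, hI, hreg⟩ := D.mem_frobIdeal_of_expandHom_rel_mul_mem m J hi
    let g := D.frobMk m J (D.rel m i)
    let h := D.frobMk m J (D.cofactor m (p ^ m) i)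
    have hg : ∀ x, g * x = 0 → ∃ y, x = h * y := by
      intro x hx
      obtain ⟨x, rfl⟩ := D.frobMk_surjective m J x
      rw [← map_mul, frobMk_eq_zero_iff, hI] at hx
      obtain ⟨y, hy⟩ := exists_mul_of_mul_mem hfac' hreg x hx
      refine ⟨D.frobMk m J y, ?_⟩
      rw [← hI, ← frobMk_eq_zero_iff, map_sub, sub_eq_zero, map_mul] at hy
      exact hy
    have hh : ∀ x, h * x = 0 → ∃ y, x = g * y := by
      intro x hx
      obtain ⟨x, rfl⟩ := D.frobMk_surjective m J x
      rw [← map_mul, frobMk_eq_zero_iff, hI] at hx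
      obtain ⟨y, hy⟩ := exists_mul_of_mul_mem hfac hreg x hx
      refine ⟨D.frobMk m J y, ?_⟩
      rw [← hI, ← frobMk_eq_zero_iff, map_sub, sub_eq_zero, map_mul] at hy
      exact hy
    have hgh : g * h = 0 := by
      rw [← map_mul, hfac', frobMk_eq_zero_iff]
      exact D.expandHom_rel_mem_frobIdeal m J i
    let q' : D.FrobQuot m J →+* D.FrobQuot m (insert i J) := Ideal.Quotient.factor hle
    have hq' : ∀ f, q' (D.frobMk m J f) = D.frobMk m (insert i J) f := fun f => rfl
    let q : D.FrobQuot m J →ₐ[D.RModP] D.FrobQuot m (insert i J) :=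
      { q' with
        commutes' := fun r => by
          obtain ⟨f, rfl⟩ := D.polyToModP_surjective r
          have h1 := D.polyToModP_smul_frobMk m J f 1
          have h2 := D.polyToModP_smul_frobMk m (insert i J) f 1
          rw [map_one, Algebra.smul_def, mul_one] at h1 h2
          rw [h1, h2]
          exact hq' _ }
    have hqs : Function.Surjective q := fun y => by
      obtain ⟨f, rfl⟩ := D.frobMk_surjective m _ y
      exact ⟨D.frobMk m J f, rfl⟩
    have hker : ∀ x, q x = 0 ↔ ∃ y, x = g * y := by
      intro x
      obtain ⟨x, rfl⟩ := D.frobMk_surjective m J x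
      change D.frobMk m (insert i J) x = 0 ↔ _
      rw [frobMk_eq_zero_iff, frobIdeal_insert]
      constructor
      · intro hx
        obtain ⟨a, ha, b, hb, rfl⟩ := Submodule.mem_sup.1 hx
        obtain ⟨c, rfl⟩ := Ideal.mem_span_singleton'.1 hb
        refine ⟨D.frobMk m J c, ?_⟩
        rw [map_add, D.frobMk_eq_zero_iff.2 ha, zero_add, mul_comm, map_mul]
      · rintro ⟨y, hy⟩
        obtain ⟨y, rfl⟩ := D.frobMk_surjective m J y
        rw [← map_mul, ← sub_eq_zero, ← map_sub, frobMk_eq_zero_iff] at hy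
        have := add_mem (Ideal.mem_sup_left hy : _ ∈ D.frobIdeal m J ⊔ Ideal.span {D.rel m i})
          (Ideal.mem_sup_right (Ideal.mul_mem_right y _ (Ideal.mem_span_singleton_self (D.rel m
            i))))
        rwa [sub_add_cancel] at this
    refine ⟨ih.1.quotient hg hh q hqs hker _ fun x => ?_,
      ih.2.quotient R ih.1 hg hh hgh q hqs hker⟩
    obtain ⟨x, rfl⟩ := D.frobMk_surjective m J x
    change D.frobForm m (insert i J) (D.frobMk m _ x) = D.frobForm m J (D.frobMk m J _ * D.frobMk
      m J x)
    rw [← map_mul, frobForm_frobMk, frobForm_frobMk, D.contract_insert m hq hi]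

end ModelData

end

end PolystableDuality

namespace PolystableDuality

noncomputable section

/-! ### The rings of finite level and the weight projection -/

namespace ModelData

variable {p : ℕ} {C : Type u} [NormedField C] [IsUltrametricDist C] (D : ModelData p C)

lemma polyToInf_C (m : ℕ) (a : OC C) : D.polyToInf m (MvPolynomial.C a) =
    algebraMap D.RModP D.RInfModP (D.polyToModP (MvPolynomial.C a)) := by
  rw [algebraMap_polyToModP]
  have := D.polyToInf_expandHom 0 m (MvPolynomial.C a)
  rw [zero_add] at this
  rw [← this]
  congr 1
  exact (MvPolynomial.expand_C _ _).symm

lemma polyToInf_monomial (m : ℕ) (e : D.Idx →₀ ℕ) (a : OC C) :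
    D.polyToInf m (MvPolynomial.monomial e a) =
      D.polyToModP (MvPolynomial.C a) • D.monomial m e := by
  rw [Algebra.smul_def, ← D.polyToInf_C m, monomial, MvPolynomial.monomial_eq,
    Finsupp.prod_fintype _ _ (fun _ => pow_zero _), map_mul]
  rfl

set_option linter.unusedSectionVars false

variable [hp : Fact p.Prime]

lemma polyToInf_rel (m : ℕ) (i : Fin D.l) : D.polyToInf m (MvPolynomial.monomial (D.block i) 1) =
    D.polyToInf m (MvPolynomial.C (D.root i m)) := by
  rw [← sub_eq_zero, ← map_sub, ← rel_eq_monomial, polyToInf_eq_zero_iff]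
  exact D.rel_mem_polyIdeal m i

/-- Pull the constant residue out of each block as a power of the product of its variables, which
equals a power of ϖ^{1/p^(m+r)}; the remaining exponents are multiples of p^r, so the monomial comes
from level m. -/
lemma polyToInf_monomial_of_isContractible (m r : ℕ) {e : D.Idx →₀ ℕ} (a : OC C)
    (h : D.IsContractible (p ^ r) Finset.univ e) :
    D.polyToInf (m + r) (MvPolynomial.monomial e a) =
      D.polyToInf m (D.contract (m + r) (p ^ r) Finset.univ (MvPolynomial.monomial e a)) := by
  rw [contract_monomial_of _ _ _ _ _ h, ← D.polyToInf_expandHom m r, expandHom_monomial,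
    contractCoeff]
  have h1 : e = ∑ i, (e ⟨i, 0⟩ % p ^ r) • D.block i + p ^ r • D.expDiv (p ^ r) e :=
    Finsupp.ext fun s => by
      obtain ⟨i, j⟩ := s
      rw [Finsupp.add_apply, Finsupp.finsetSum_apply, Finset.sum_eq_single i]
      · rw [Finsupp.smul_apply, Finsupp.smul_apply, block_apply, if_pos rfl, expDiv_apply,
          smul_eq_mul,
          mul_one, smul_eq_mul, ← h.1 i (Finset.mem_univ i) j, Nat.mod_add_div]
      · intro i' _ hi'
        rw [Finsupp.smul_apply, block_apply, if_neg hi'.symm, smul_zero]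
      · exact fun h => absurd (Finset.mem_univ _) h
  have h2 : ∀ b : D.Idx →₀ ℕ, D.polyToInf (m + r)
      (MvPolynomial.monomial (∑ i, (e ⟨i, 0⟩ % p ^ r) • D.block i + b) a) =
      D.polyToInf (m + r) (MvPolynomial.monomial b
        (a * ∏ i, D.root i (m + r) ^ (e ⟨i, 0⟩ % p ^ r))) := by
    intro b
    have h3 : (MvPolynomial.monomial (∑ i, (e ⟨i, 0⟩ % p ^ r) • D.block i + b) a : D.Poly) =
        (∏ i, MvPolynomial.monomial (D.block i) 1 ^ (e ⟨i, 0⟩ % p ^ r)) *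
          MvPolynomial.monomial b a := by
      simp only [MvPolynomial.monomial_pow, one_pow]
      rw [← MvPolynomial.monomial_sum_one, MvPolynomial.monomial_mul, one_mul]
    have h4 : (MvPolynomial.monomial b (a * ∏ i, D.root i (m + r) ^ (e ⟨i, 0⟩ % p ^ r)) : D.Poly) =
        (∏ i, MvPolynomial.C (D.root i (m + r)) ^ (e ⟨i, 0⟩ % p ^ r)) *
          MvPolynomial.monomial b a := by
      simp only [← map_pow, ← map_prod]
      rw [MvPolynomial.C_mul_monomial, mul_comm]
    rw [h3, h4, map_mul, map_mul, map_prod, map_prod]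
    simp only [map_pow, polyToInf_rel]
  conv_lhs => rw [h1]
  exact h2 _

-- The axioms leave no choice: a contractible monomial comes from R^+/p, where linearity and pr(1) =
-- 1 apply, and every other monomial has non-trivial weight and is killed.
variable {D} in
lemma IsWeightProjection.apply_polyToInf {pr : D.RInfModP →ₗ[D.RModP] D.RModP}
    (hpr : D.IsWeightProjection pr) (m : ℕ) (f : D.Poly) :
    pr (D.polyToInf m f) = D.polyToModP (D.contract m (p ^ m) Finset.univ f) := by
  refine D.addHom_ext (f := fun f => pr (D.polyToInf m f))
    (g := fun f => D.polyToModP (D.contract m (p ^ m) Finset.univ f))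
    (fun x y => by simp only [map_add]) (fun x y => by simp only [map_add]) (fun e a => ?_) f
  by_cases h : D.IsContractible (p ^ m) Finset.univ e
  · have := D.polyToInf_monomial_of_isContractible 0 m a h
    rw [zero_add] at this
    rw [this, ← algebraMap_polyToModP, Algebra.algebraMap_eq_smul_one, map_smul, hpr.map_one,
      smul_eq_mul, mul_one]
  · rw [contract_monomial_of_not _ _ _ _ _ h, polyToInf_monomial, map_smul, map_zero,
      hpr.map_monomial, smul_zero]
    intro h'
    exact h ⟨fun i _ j => h' i j 0, fun i hi => absurd (Finset.mem_univ i) hi⟩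

lemma contract_expandHom_contract (m r r' : ℕ) (f : D.Poly) :
    D.contract (m + (r + r')) (p ^ (r + r')) Finset.univ (D.expandHom (p ^ r') f) =
      D.contract (m + r) (p ^ r) Finset.univ f := by
  rw [add_comm r r', pow_add p r' r,
    ← D.contract_contract (m := m + r) (M := m + (r' + r)) (fun i => by
      rw [add_comm r' r, ← add_assoc]; exact D.root_pow_pow i (m + r) r'),
    contract_expandHom _ _ (pow_pos hp.out.pos r')]

/-- The subring of `R_∞^+/p` generated by the elements of level `m`. -/
abbrev LevelRing (m : ℕ) : Type u := D.FrobQuot m Finset.univ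

/-- The quotient map onto the ring of level `m`. -/
abbrev levelMk (m : ℕ) : D.Poly →+* D.LevelRing m := D.frobMk m Finset.univ

lemma levelMk_eq_zero_iff {m : ℕ} {f : D.Poly} : D.levelMk m f = 0 ↔ f ∈ D.polyIdeal m := by
  rw [frobMk_eq_zero_iff, frobIdeal_univ]

/-- Contraction to level m is compatible with raising the level and respects the relations, so it
defines a projection of R_∞^+/p; it is linear over R^+/p because contraction is linear over p^r-th
powers. -/
lemma exists_levelProj (m : ℕ) : ∃ π : D.RInfModP →ₗ[D.RModP] D.LevelRing m,
    ∀ r f, π (D.polyToInf (m + r) f) =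
      D.levelMk m (D.contract (m + r) (p ^ r) Finset.univ f) := by
  obtain ⟨Φ, hΦ⟩ := D.exists_lift m (fun r => (D.levelMk m).toAddMonoidHom.comp
    (D.contract (m + r) (p ^ r) Finset.univ).toAddMonoidHom)
    (fun r f hf => D.levelMk_eq_zero_iff.2 (D.contract_mem_polyIdeal m r hf))
    (fun r r' f => congrArg (D.levelMk m) (D.contract_expandHom_contract m r r' f))
  refine ⟨D.linearMapOfPoly Φ fun f x => ?_, hΦ⟩
  obtain ⟨r, g, rfl⟩ := D.exists_polyToInf_add m x
  rw [polyToModP_smul_polyToInf, hΦ, hΦ]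
  change D.levelMk m (D.contract _ _ _ _) = D.polyToModP f • D.levelMk m (D.contract _ _ _ _)
  rw [polyToModP_smul_frobMk, add_comm m r, pow_add, ← expandHom_expandHom,
    contract_expandHom_mul _ _ (pow_pos hp.out.pos r)]

/-- The projection of `R_∞^+/p` onto the part of level `m`. -/
def levelProj (m : ℕ) : D.RInfModP →ₗ[D.RModP] D.LevelRing m := (D.exists_levelProj m).choose

lemma levelProj_polyToInf (m r : ℕ) (f : D.Poly) : D.levelProj m (D.polyToInf (m + r) f) =
    D.levelMk m (D.contract (m + r) (p ^ r) Finset.univ f) :=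
  (D.exists_levelProj m).choose_spec r f

/-- The inclusion of the part of level `m` in `R_∞^+/p`. -/
def levelIncl (m : ℕ) : D.LevelRing m →ₐ[D.RModP] D.RInfModP :=
  { Ideal.Quotient.lift (D.frobIdeal m Finset.univ) (D.polyToInf m) (fun f hf => by
      rw [frobIdeal_univ] at hf
      exact (D.polyToInf_eq_zero_iff m f).2 hf) with
    commutes' := fun r => by
      obtain ⟨f, rfl⟩ := D.polyToModP_surjective r
      have h1 := D.polyToModP_smul_frobMk m Finset.univ f 1
      have h2 := D.polyToModP_smul_polyToInf m f 1
      rw [map_one, Algebra.smul_def, mul_one] at h1 h2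
      rw [h1, h2]
      rfl }

lemma levelIncl_levelMk (m : ℕ) (f : D.Poly) : D.levelIncl m (D.levelMk m f) = D.polyToInf m f :=
    rfl

variable {D} in
lemma IsWeightProjection.levelIncl_mul {pr : D.RInfModP →ₗ[D.RModP] D.RModP}
    (hpr : D.IsWeightProjection pr) (m : ℕ) (x y : D.LevelRing m) :
    pr (D.levelIncl m x * D.levelIncl m y) = D.frobForm m Finset.univ (x * y) := by
  obtain ⟨x, rfl⟩ := D.frobMk_surjective m _ x
  obtain ⟨y, rfl⟩ := D.frobMk_surjective m _ y
  rw [levelIncl_levelMk, levelIncl_levelMk, ← map_mul, ← map_mul, hpr.apply_polyToInf,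
    frobForm_frobMk]

-- Contract to level zero in two stages, through level m: the first stage is linear over level m, so
-- it replaces x by its projection. This is the adjunction between inclusion and projection needed
-- for the retract argument.
variable {D} in
lemma IsWeightProjection.mul_levelIncl {pr : D.RInfModP →ₗ[D.RModP] D.RModP}
    (hpr : D.IsWeightProjection pr) (m : ℕ) (x : D.RInfModP) (y : D.LevelRing m) :
    pr (x * D.levelIncl m y) = pr (D.levelIncl m (D.levelProj m x) * D.levelIncl m y) := by
  obtain ⟨r, x, rfl⟩ := D.exists_polyToInf_add m x
  obtain ⟨y, rfl⟩ := D.frobMk_surjective m _ y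
  rw [levelProj_polyToInf, levelIncl_levelMk, levelIncl_levelMk, ← map_mul, hpr.apply_polyToInf,
    ← D.polyToInf_expandHom m r y, ← map_mul, hpr.apply_polyToInf, add_comm m r, pow_add p r m,
    ← D.contract_contract (m := m) (M := r + m) (fun i => by
      rw [add_comm]; exact D.root_pow_pow i m r), mul_comm x,
    contract_expandHom_mul _ _ (pow_pos hp.out.pos r), mul_comm y]

variable {D} in
open CategoryTheory in
lemma IsWeightProjection.existsUnique {pr : D.RInfModP →ₗ[D.RModP] D.RModP}
    (hpr : D.IsWeightProjection pr) (m : ℕ) (φ : D.LevelRing m →ₗ[D.RModP] D.RModP) :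
    ∃! x, ∀ y, pr (D.levelIncl m x * D.levelIncl m y) = φ y := by
  obtain ⟨x, hx, hx'⟩ := (D.frobForm_isPerfectForm_and_isAcyclicFor
    (injectiveResolution _) m Finset.univ).1 φ
  exact ⟨x, fun y => (hpr.levelIncl_mul m x y).trans (hx y).symm,
    fun z hz => hx' z fun y => (hz y).symm.trans (hpr.levelIncl_mul m z y)⟩

/-- Existence: contraction to level zero is compatible with the levels, and it is invariant because
Δ acts trivially at level zero. Uniqueness: the axioms force the formula on polynomials of every
level. -/
theorem existsUnique_isWeightProjection :
    ∃! pr : D.RInfModP →ₗ[D.RModP] D.RModP, D.IsWeightProjection pr := by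
  obtain ⟨Φ, hΦ⟩ := D.exists_lift 0 (fun r => D.polyToModP.toAddMonoidHom.comp
    (D.contract (0 + r) (p ^ r) Finset.univ).toAddMonoidHom)
    (fun r f hf => (D.polyToModP_eq_zero_iff _).2 (D.contract_mem_polyIdeal 0 r hf))
    (fun r r' f => congrArg D.polyToModP (D.contract_expandHom_contract 0 r r' f))
  have hΦ' : ∀ m f, Φ (D.polyToInf m f) = D.polyToModP (D.contract m (p ^ m) Finset.univ f) := by
    intro m f
    have := hΦ m f
    rw [zero_add] at this
    exact this
  refine ⟨D.linearMapOfPoly Φ fun f x => ?_, ⟨?_, fun m e he => ?_, fun ε x => ?_⟩,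
    fun pr hpr => ?_⟩
  · obtain ⟨m, g, rfl⟩ := D.exists_polyToInf x
    rw [polyToModP_smul_polyToInf, hΦ', hΦ', contract_expandHom_mul _ _ (pow_pos hp.out.pos m),
      map_mul, smul_eq_mul]
  · change Φ 1 = 1
    rw [← map_one (D.polyToInf 0), hΦ', contract_one, map_one]
  · have h1 := D.polyToInf_monomial m (Finsupp.equivFunOnFinite.symm e) 1
    rw [MvPolynomial.C_1, map_one D.polyToModP, one_smul] at h1
    change Φ (D.monomial m e) = 0
    rw [show D.monomial m e = _ from h1.symm, hΦ', contract_monomial_of_not, map_zero]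
    intro h
    exact he fun i j j' => (h.1 i (Finset.mem_univ i) j).trans (h.1 i (Finset.mem_univ i) j').symm
  · obtain ⟨m, g, rfl⟩ := D.exists_polyToInf x
    change Φ _ = Φ _
    have h1 := D.contract_actPoly ε 0 m g
    rw [zero_add, actPoly_zero, RingHom.id_apply] at h1
    rw [rho_polyToInf, hΦ', hΦ', h1]
  · refine LinearMap.ext fun x => ?_
    obtain ⟨m, g, rfl⟩ := D.exists_polyToInf x
    rw [hpr.apply_polyToInf]
    exact (hΦ' m g).symm

/-- The action of `Δ` on the ring of level `m`. -/
def levelRho (m : ℕ) : D.Delta →* Module.End D.RModP (D.LevelRing m) where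
  toFun ε := D.linearMapOfPoly (Ideal.quotientMap (D.frobIdeal m Finset.univ) (D.actPoly ε m) (by
      rw [frobIdeal_univ, polyIdeal_le_iff]
      refine ⟨?_, fun i => ?_⟩
      · rw [Ideal.mem_comap, map_natCast]
        exact D.natCast_mem_polyIdeal m
      · rw [Ideal.mem_comap, actPoly_rel]
        exact D.rel_mem_polyIdeal m i) : D.LevelRing m →+* D.LevelRing m).toAddMonoidHom (fun f x
          => by
    obtain ⟨x, rfl⟩ := D.frobMk_surjective m _ x
    have h := RingHom.congr_fun (D.actPoly_expand ε (Nat.zero_le m)) f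
    rw [actPoly_zero] at h
    rw [polyToModP_smul_frobMk]
    change D.levelMk m (D.actPoly ε m _) = D.polyToModP f • D.levelMk m (D.actPoly ε m x)
    rw [polyToModP_smul_frobMk, map_mul]
    exact congrArg (fun z => D.levelMk m (z * _)) h)
  map_one' := LinearMap.ext fun x => by
    obtain ⟨x, rfl⟩ := D.frobMk_surjective m _ x
    change D.levelMk m (D.actPoly 1 m x) = _
    rw [actPoly_one]
    rfl
  map_mul' ε δ := LinearMap.ext fun x => by
    obtain ⟨x, rfl⟩ := D.frobMk_surjective m _ x
    change D.levelMk m (D.actPoly (ε * δ) m x) = _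
    rw [actPoly_mul]
    rfl

lemma levelRho_levelMk (m : ℕ) (ε : D.Delta) (f : D.Poly) :
    D.levelRho m ε (D.levelMk m f) = D.levelMk m (D.actPoly ε m f) := rfl

lemma levelIncl_levelRho (m : ℕ) (ε : D.Delta) (x : D.LevelRing m) :
    D.levelIncl m (D.levelRho m ε x) = D.rho ε (D.levelIncl m x) := by
  obtain ⟨x, rfl⟩ := D.frobMk_surjective m _ x
  rw [levelRho_levelMk, levelIncl_levelMk, levelIncl_levelMk, rho_polyToInf]

lemma levelProj_rho (m : ℕ) (ε : D.Delta) (x : D.RInfModP) :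
    D.levelProj m (D.rho ε x) = D.levelRho m ε (D.levelProj m x) := by
  obtain ⟨r, x, rfl⟩ := D.exists_polyToInf_add m x
  rw [rho_polyToInf, levelProj_polyToInf, levelProj_polyToInf, contract_actPoly, levelRho_levelMk]

lemma isLocallyConstant_level (m : ℕ) : IsLocallyConstant fun ε : D.Delta => ε.level m := by
  intro s
  exact iInf_le (fun m : ℕ => TopologicalSpace.induced (fun ε : D.Delta => ε.level m) ⊥) m _
    ⟨s, trivial, rfl⟩

lemma levelRho_isSmooth (m : ℕ) : IsSmooth (D.levelRho m) := by
  intro x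
  obtain ⟨x, rfl⟩ := D.frobMk_surjective m _ x
  have h := (D.isLocallyConstant_level m).comp fun v : D.Idx → (OC C)ˣ =>
    D.levelMk m ((MvPolynomial.aeval (R := OC C) fun s =>
      MvPolynomial.C ((v s : (OC C)ˣ) : OC C) * MvPolynomial.X s) x)
  exact h

end ModelData

end

end PolystableDuality

namespace PolystableDuality

noncomputable section

/-! ### Distances of roots of unity to 1 in the valuation ring -/

section Norms

variable {C : Type u} [NormedField C] [IsUltrametricDist C]

lemma mem_OC_iff (x : C) : x ∈ OC C ↔ ‖x‖ ≤ 1 := Iff.rfl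

lemma norm_coe_le_one (x : OC C) : ‖(x : C)‖ ≤ 1 := (mem_OC_iff _).1 x.2

lemma dvd_of_norm_le {a b : OC C} (h : ‖(a : C)‖ ≤ ‖(b : C)‖) : b ∣ a := by
  by_cases hb : (b : C) = 0
  · rw [hb, norm_zero, norm_le_zero_iff] at h
    rw [show a = 0 from Subtype.ext h]
    exact dvd_zero b
  · refine ⟨⟨(a : C) / b, (mem_OC_iff _).2 ?_⟩, Subtype.ext ?_⟩
    · rw [norm_div]
      exact div_le_one_of_le₀ h (norm_nonneg _)
    · change (a : C) = b * (a / b)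
      rw [mul_div_cancel₀ _ hb]

lemma norm_lt_one_of_mem_maximalIdeal {a : OC C} (h : a ∈ IsLocalRing.maximalIdeal (OC C)) :
    ‖(a : C)‖ < 1 := by
  refine lt_of_le_of_ne (norm_coe_le_one a) fun h1 => ?_
  refine (IsLocalRing.mem_maximalIdeal a).1 h ?_
  rw [isUnit_iff_dvd_one]
  exact dvd_of_norm_le (by rw [h1]; simp)

lemma mem_maximalIdeal_of_norm_lt_one {a : OC C} (h : ‖(a : C)‖ < 1) :
    a ∈ IsLocalRing.maximalIdeal (OC C) := by
  rw [IsLocalRing.mem_maximalIdeal]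
  intro hu
  obtain ⟨b, hb⟩ := isUnit_iff_dvd_one.1 hu
  have h1 : (1 : C) = a * b := congrArg Subtype.val hb
  have h2 := norm_mul (a : C) b
  rw [← h1, norm_one] at h2
  nlinarith [norm_coe_le_one b, norm_nonneg (a : C)]

lemma norm_unit (u : (OC C)ˣ) : ‖((u : OC C) : C)‖ = 1 := by
  refine le_antisymm (norm_coe_le_one _) ?_
  have h1 : ((u : OC C) : C) * ((u⁻¹ : (OC C)ˣ) : OC C) = 1 :=
    congrArg Subtype.val u.mul_inv
  have h2 := norm_mul ((u : OC C) : C) ((u⁻¹ : (OC C)ˣ) : OC C)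
  rw [h1, norm_one] at h2
  nlinarith [norm_coe_le_one ((u⁻¹ : (OC C)ˣ) : OC C), norm_nonneg ((u : OC C) : C)]

/-- The distance to `1` of roots of unity of `p`-power order. -/
lemma norm_natCast_le_norm_sub_one_pow {p k : ℕ} [Fact p.Prime] {w : OC C}
    (hw : IsPrimitiveRoot w (p ^ (k + 1))) :
    ‖(p : C)‖ ≤ ‖((w - 1 : OC C) : C)‖ ^ Nat.totient (p ^ (k + 1)) := by
  -- This is the value at 1 of the cyclotomic polynomial; each factor is 1 - w^i and so divisible by
  -- 1 - w.
  have h1 : (p : OC C) = ∏ μ ∈ primitiveRoots (p ^ (k + 1)) (OC C), (1 - μ) := by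
    rw [← Polynomial.eval_one_cyclotomic_prime_pow (R := OC C) (p := p) k,
      Polynomial.cyclotomic_eq_prod_X_sub_primitiveRoots hw, Polynomial.eval_prod]
    simp
  have h3 : (w - 1) ^ Nat.totient (p ^ (k + 1)) ∣ (p : OC C) := by
    rw [h1, ← hw.card_primitiveRoots, ← Finset.prod_const]
    refine Finset.prod_dvd_prod_of_dvd _ _ fun μ hμ => ?_
    have hpos : 0 < p ^ (k + 1) := pow_pos (Fact.out : p.Prime).pos _
    obtain ⟨i, -, rfl⟩ := hw.eq_pow_of_pow_eq_one ((mem_primitiveRoots hpos).1 hμ).pow_eq_one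
    rw [← neg_sub (w ^ i), dvd_neg]
    simpa using sub_dvd_pow_sub_pow w 1 i
  obtain ⟨c, hc⟩ := h3
  have h4 : (p : C) = ((w - 1 : OC C) : C) ^ Nat.totient (p ^ (k + 1)) * c := by
    have := congrArg (fun x : OC C => (x : C)) hc
    simpa using this
  rw [h4, norm_mul, norm_pow]
  exact mul_le_of_le_one_right (by positivity) (norm_coe_le_one c)

/-- Roots of unity of large `p`-power order are far from `1`. -/
lemma exists_norm_le_norm_sub_one {p : ℕ} [hp : Fact p.Prime] [CharZero C] {a : OC C}
    (ha : ‖(a : C)‖ < 1) : ∃ m : ℕ, ∀ (M : ℕ) (w : OC C), w ^ p ^ M = 1 → w ^ p ^ m ≠ 1 →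
      ‖(a : C)‖ ≤ ‖((w - 1 : OC C) : C)‖ := by
  have hpos : 0 < ‖(p : C)‖ := norm_pos_iff.2 (Nat.cast_ne_zero.2 hp.out.ne_zero)
  -- Here |a|^N < |p|. If w has order p^(k+1) with k ≥ N, then φ(p^(k+1)) ≥ N, so |w - 1| < |a|
  -- would give |p| ≤ |a|^N.
  obtain ⟨N, hN⟩ := exists_pow_lt_of_lt_one hpos ha
  refine ⟨N, fun M w hM hN' => ?_⟩
  obtain ⟨k, hk, hk'⟩ := (Nat.dvd_prime_pow hp.out).1 (orderOf_dvd_of_pow_eq_one hM)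
  have hlt : N < k := by
    by_contra hle
    refine hN' (orderOf_dvd_iff_pow_eq_one.1 ?_)
    rw [hk']
    exact pow_dvd_pow p (not_lt.1 hle)
  obtain ⟨k, rfl⟩ : ∃ k', k = k' + 1 := ⟨k - 1, by omega⟩
  have hw : IsPrimitiveRoot w (p ^ (k + 1)) := hk' ▸ IsPrimitiveRoot.orderOf w
  have h1 := norm_natCast_le_norm_sub_one_pow hw
  by_contra hlt'
  rw [not_le] at hlt'
  have h2 : N ≤ Nat.totient (p ^ (k + 1)) := by
    rw [Nat.totient_prime_pow_succ hp.out]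
    calc N ≤ k := by omega
      _ ≤ p ^ k := (Nat.lt_pow_self hp.out.one_lt).le
      _ = p ^ k * 1 := (mul_one _).symm
      _ ≤ _ := Nat.mul_le_mul_left _ (by have := hp.out.two_le; omega)
  have h3 : ‖((w - 1 : OC C) : C)‖ ^ Nat.totient (p ^ (k + 1)) ≤ ‖(a : C)‖ ^ N :=
    (pow_le_pow_of_le_one (norm_nonneg _) (norm_coe_le_one _) h2).trans
      (pow_le_pow_left₀ (norm_nonneg _) hlt'.le N)
  linarith

variable [IsAlgClosed C]

lemma exists_unit_pow_eq {n : ℕ} (hn : 0 < n) (u : (OC C)ˣ) : ∃ v : (OC C)ˣ, v ^ n = u := by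
  obtain ⟨x, hx⟩ := IsAlgClosed.exists_pow_nat_eq ((u : OC C) : C) hn
  have h1 : ‖x‖ ^ n = 1 := by rw [← norm_pow, hx, norm_unit]
  have h2 : ‖x‖ = 1 := (pow_eq_one_iff_of_nonneg (norm_nonneg _) hn.ne').1 h1
  let y : OC C := ⟨x, (mem_OC_iff _).2 h2.le⟩
  have hy : y ^ n = u := Subtype.ext hx
  have hu : IsUnit y := (isUnit_pow_iff hn.ne').1 (hy ▸ u.isUnit)
  exact ⟨hu.unit, Units.ext hy⟩

variable (C) in
/-- There is a compatible system of primitive `p`-power roots of unity. -/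
lemma exists_primitive_system (p : ℕ) [hp : Fact p.Prime] [CharZero C] :
    ∃ ζ : ℕ → (OC C)ˣ, (∀ m, ζ (m + 1) ^ p = ζ m) ∧ ∀ m, IsPrimitiveRoot (ζ m) (p ^ m) := by
  have : NeZero (p : C) := ⟨Nat.cast_ne_zero.2 hp.out.ne_zero⟩
  obtain ⟨z, hz⟩ := HasEnoughRootsOfUnity.exists_primitiveRoot C p
  have hz1 : ‖z‖ = 1 := (pow_eq_one_iff_of_nonneg (norm_nonneg _) hp.out.ne_zero).1
    (by rw [← norm_pow, hz.pow_eq_one, norm_one])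
  let y : OC C := ⟨z, (mem_OC_iff _).2 hz1.le⟩
  have hy : y ^ p = 1 := Subtype.ext hz.pow_eq_one
  have hy1 : y ≠ 1 := fun h => hz.ne_one hp.out.one_lt (congrArg Subtype.val h)
  let z₁ : (OC C)ˣ := Units.ofPowEqOne y p hy hp.out.ne_zero
  choose r hr using exists_unit_pow_eq (C := C) hp.out.pos
  -- Extract p-th roots repeatedly, starting from a primitive p-th root of unity; the exact orders
  -- then follow from the first root being different from 1.
  let ζ : ℕ → (OC C)ˣ := fun m => Nat.casesOn m 1 fun m => r^[m] z₁
  have h1 : ∀ m, ζ (m + 1) ^ p = ζ m := by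
    rintro (_ | m)
    · exact Units.ext hy
    · change (r^[m + 1] z₁) ^ p = r^[m] z₁
      rw [Function.iterate_succ_apply', hr]
  have h2 : ∀ m k, ζ (m + k) ^ p ^ k = ζ m := by
    intro m k
    induction k with
    | zero => simp
    | succ k ih => rw [pow_succ', pow_mul, ← add_assoc, h1, ih]
  refine ⟨ζ, h1, fun m => ?_⟩
  rcases m with _ | m
  · rw [pow_zero]
    exact IsPrimitiveRoot.one
  · rw [← orderOf_eq_prime_pow (x := ζ (m + 1)) (p := p) (n := m)]
    · exact IsPrimitiveRoot.orderOf _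
    · have := h2 1 m
      rw [add_comm] at this
      rw [this]
      exact fun h => hy1 (congrArg Units.val h)
    · have := h2 0 (m + 1)
      rwa [zero_add] at this

end Norms

end

end PolystableDuality

namespace PolystableDuality

/-! ### The group Δ: topology and topological generators -/

noncomputable section

lemma nhds_induced_bot {X Y : Type*} (f : X → Y) (a : X) :
    @nhds X (TopologicalSpace.induced f ⊥) a = Filter.principal {x | f x = f a} := by
  let _ : TopologicalSpace Y := ⊥
  have : DiscreteTopology Y := ⟨rfl⟩
  rw [nhds_induced, nhds_discrete, Filter.comap_pure]
  rfl

/-- A compatible system of primitive `p`-power roots of unity in `O_C`. -/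
structure PrimitiveSystem (p : ℕ) (C : Type u) [NormedField C] [IsUltrametricDist C] where
  /-- The root of unity of order `p^m`. -/
  root : ℕ → (OC C)ˣ
  pow : ∀ m, root (m + 1) ^ p = root m
  prim : ∀ m, IsPrimitiveRoot (root m) (p ^ m)

namespace ModelData

variable {p : ℕ} {C : Type u} [NormedField C] [IsUltrametricDist C] (D : ModelData p C)

lemma delta_mul_comm (x y : D.Delta) : x * y = y * x := Subtype.ext (mul_comm _ _)

instance : CommGroup D.Delta := { (inferInstance : Group D.Delta) with mul_comm :=
    D.delta_mul_comm }

/-- The projection of `Δ` to its components at level `m`. -/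
def levelHom (m : ℕ) : D.Delta →* (D.Idx → (OC C)ˣ) where
  toFun x := x.level m
  map_one' := rfl
  map_mul' _ _ := rfl

lemma level_eq_of_le {m m' : ℕ} (h : m ≤ m') {x y : D.Delta} (hxy : x.level m' = y.level m') :
    x.level m = y.level m := by
  obtain ⟨r, rfl⟩ := Nat.exists_eq_add_of_le h
  funext s
  rw [← D.level_pow x m r, ← D.level_pow y m r, hxy]

lemma delta_nhds (a : D.Delta) : nhds a = ⨅ m : ℕ, Filter.principal {x | x.level m = a.level m} :=
    by
  rw [nhds_iInf]
  refine iInf_congr fun m => ?_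
  exact nhds_induced_bot (fun ε : D.Delta => ε.level m) a

lemma mem_delta_nhds_iff {a : D.Delta} {U : Set D.Delta} :
    U ∈ nhds a ↔ ∃ m, ∀ x : D.Delta, x.level m = a.level m → x ∈ U := by
  rw [delta_nhds, Filter.mem_iInf_of_directed]
  · rfl
  · intro m m'
    refine ⟨max m m', ?_, ?_⟩
    · exact Filter.principal_mono.2 fun x hx => D.level_eq_of_le (le_max_left m m') hx
    · exact Filter.principal_mono.2 fun x hx => D.level_eq_of_le (le_max_right m m') hx

instance : IsTopologicalGroup D.Delta where
  continuous_mul := by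
    refine continuous_iff_continuousAt.2 fun ⟨a, b⟩ U hU => ?_
    obtain ⟨m, hm⟩ := D.mem_delta_nhds_iff.1 hU
    rw [Filter.mem_map, nhds_prod_eq]
    refine Filter.mem_of_superset (Filter.prod_mem_prod
      (D.mem_delta_nhds_iff.2 ⟨m, fun x hx => hx⟩) (D.mem_delta_nhds_iff.2 ⟨m, fun x hx => hx⟩))
      (fun ⟨x, y⟩ hxy => hm _ ?_)
    change x.level m * y.level m = a.level m * b.level m
    rw [show x.level m = a.level m from hxy.1, show y.level m = b.level m from hxy.2]
  continuous_inv := by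
    refine continuous_iff_continuousAt.2 fun a U hU => ?_
    obtain ⟨m, hm⟩ := D.mem_delta_nhds_iff.1 hU
    refine Filter.mem_map.2 (D.mem_delta_nhds_iff.2 ⟨m, fun x hx => hm _ ?_⟩)
    change (x.level m)⁻¹ = (a.level m)⁻¹
    rw [hx]

/-- At each level there are finitely many tuples of roots of unity, so an ultrafilter is eventually
constant at every level. The constants inherit the compatibilities and form the limit point. -/
instance [hp : Fact p.Prime] : CompactSpace D.Delta where
  isCompact_univ := by
    refine isCompact_iff_ultrafilter_le_nhds.2 fun F _ => ?_
    have h1 : ∀ m, ∃ v, {x : D.Delta | x.level m = v} ∈ F := by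
      intro m
      have hpos : 0 < p ^ m := pow_pos hp.out.pos m
      have hfin : (Set.range fun x : D.Delta => x.level m).Finite := by
        have : NeZero (p ^ m) := ⟨hpos.ne'⟩
        have h2 : (Set.univ.pi fun _ : D.Idx => {u : (OC C)ˣ | u ^ p ^ m = 1}).Finite :=
          Set.Finite.pi fun _ => by
            have h3 : {u : (OC C)ˣ | u ^ p ^ m = 1} = (rootsOfUnity (p ^ m) (OC C) : Set (OC C)ˣ)
                := by
              ext u
              simp
            rw [h3]
            exact Set.finite_coe_iff.1 (inferInstanceAs (Finite (rootsOfUnity (p ^ m) (OC C))))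
        refine h2.subset ?_
        rintro _ ⟨x, rfl⟩ s -
        exact x.2.1 m s
      obtain ⟨v, -, hv⟩ := Ultrafilter.eq_pure_of_finite_mem (f :=
          F.map fun x : D.Delta => x.level m)
        hfin (Ultrafilter.mem_map.2 (Filter.mem_of_superset Filter.univ_mem fun x _ => ⟨x, rfl⟩))
      refine ⟨v, ?_⟩
      have : {v} ∈ F.map fun x : D.Delta => x.level m := by
        rw [hv]
        exact Ultrafilter.mem_pure.2 rfl
      exact this
    choose v hv using h1
    let a : D.Delta := ⟨v, fun m s => by
        obtain ⟨x, hx⟩ := F.nonempty_of_mem (hv m)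
        rw [← show x.level m = v m from hx]
        exact x.2.1 m s, fun m s => by
        obtain ⟨x, hx, hx'⟩ := F.nonempty_of_mem (Filter.inter_mem (hv m) (hv (m + 1)))
        rw [← show x.level m = v m from hx, ← show x.level (m + 1) = v (m + 1) from hx']
        exact x.2.2.1 m s, fun m i => by
        obtain ⟨x, hx⟩ := F.nonempty_of_mem (hv m)
        rw [← show x.level m = v m from hx]
        exact x.2.2.2 m i⟩
    refine ⟨a, trivial, ?_⟩
    rw [delta_nhds]
    exact le_iInf fun m => Filter.le_principal_iff.2 (hv m)

/-- The index set of the topological generators. -/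
abbrev GenIdx : Type := Σ i : Fin D.l, Fin (D.n i)

/-- The variable corresponding to a generator. -/
def genVar (s : D.GenIdx) : D.Idx := ⟨s.1, s.2.succ⟩

lemma card_genIdx : Fintype.card D.GenIdx = D.dim := by
  simp [dim]

section Generators

variable (Z : PrimitiveSystem p C)

/-- The generator acting by `ζ` on the variable `s` and by `ζ⁻¹` on the variable `(i, 0)` of the
same
block. -/
def genFun (m : ℕ) (s : D.GenIdx) (x : D.Idx) : (OC C)ˣ :=
  if x = D.genVar s then Z.root m else if x = ⟨s.1, 0⟩ then (Z.root m)⁻¹ else 1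

lemma genVar_ne (s : D.GenIdx) (i : Fin D.l) : D.genVar s ≠ ⟨i, 0⟩ := by
  rintro h
  obtain ⟨i', j⟩ := s
  simp only [genVar, Sigma.mk.injEq] at h
  obtain ⟨rfl, h⟩ := h
  exact Fin.succ_ne_zero _ (eq_of_heq h)

lemma genVar_injective : Function.Injective D.genVar := by
  rintro ⟨i, j⟩ ⟨i', j'⟩ h
  simp only [genVar, Sigma.mk.injEq] at h
  obtain ⟨rfl, h⟩ := h
  rw [Fin.succ_injective _ (eq_of_heq h)]

lemma prod_genFun_mul (m : ℕ) (s : D.GenIdx) (i : Fin D.l) : ∏ j, D.genFun Z m s ⟨i, j⟩ = 1 := by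
  obtain ⟨i', j'⟩ := s
  by_cases h : i = i'
  · subst h
    rw [Fin.prod_univ_succ, Finset.prod_eq_single j']
    · simp [genFun, genVar, (Fin.succ_ne_zero j').symm]
    · intro j _ hj
      simp [genFun, genVar, hj]
    · exact fun h => absurd (Finset.mem_univ _) h
  · refine Finset.prod_eq_one fun j _ => ?_
    simp [genFun, genVar, h]

/-- The topological generators of `Δ`. -/
def gen (s : D.GenIdx) : D.Delta := ⟨fun m => D.genFun Z m s,
  fun m x => by
    dsimp only [genFun]
    split_ifs <;> simp [(Z.prim m).pow_eq_one],
  fun m x => by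
    dsimp only [genFun]
    split_ifs <;> simp [Z.pow],
  fun m i => D.prod_genFun_mul Z m s i⟩

lemma level_gen (s : D.GenIdx) (m : ℕ) : (D.gen Z s).level m = D.genFun Z m s := rfl

lemma level_gen_genVar_self (s : D.GenIdx) (m : ℕ) :
    (D.gen Z s).level m (D.genVar s) = Z.root m := by
  rw [level_gen, genFun, if_pos rfl]

lemma level_gen_genVar_of_ne {s s' : D.GenIdx} (h : s' ≠ s) (m : ℕ) :
    (D.gen Z s).level m (D.genVar s') = 1 := by
  rw [level_gen, genFun, if_neg fun h' => h (D.genVar_injective h'), if_neg (D.genVar_ne _ _)]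

/-- The product over a block is one, so the component at the zeroth variable is determined by the
others. -/
lemma level_ext {x y : D.Delta} {m : ℕ} (h : ∀ s, x.level m (D.genVar s) = y.level m (D.genVar s)) :
    x.level m = y.level m := by
  have h3 : ∀ i (j : Fin (D.n i)), x.level m ⟨i, j.succ⟩ = y.level m ⟨i, j.succ⟩ :=
    fun i j => h ⟨i, j⟩
  funext ⟨i, j⟩
  have hx : ∏ j, x.level m ⟨i, j⟩ = 1 := x.2.2.2 m i
  have hy : ∏ j, y.level m ⟨i, j⟩ = 1 := y.2.2.2 m i
  refine Fin.cases ?_ (h3 i) j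
  rw [Fin.prod_univ_succ] at hx hy
  rw [eq_inv_of_mul_eq_one_left hx, eq_inv_of_mul_eq_one_left hy]
  simp only [h3]

variable [hp : Fact p.Prime]

/-- The coordinate is the discrete logarithm of the component at s with respect to the primitive
root of order p^N. -/
lemma exists_coord (s : D.GenIdx) (N : ℕ) : ∃ c : D.Delta → ZMod (p ^ N),
    (∀ x y : D.Delta, x.level N = y.level N → c x = c y) ∧ (∀ x y, c (x * y) = c x + c y) ∧
    ∀ x : D.Delta, x.level N (D.genVar s) = Z.root N ^ (c x).val := by
  have : NeZero (p ^ N) := ⟨(pow_pos hp.out.pos N).ne'⟩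
  have h3 : ∀ u : (OC C)ˣ, u ^ p ^ N = 1 → ∃ k : ZMod (p ^ N), u = Z.root N ^ k.val := by
    intro u hu
    obtain ⟨i, hi, hi'⟩ := (IsPrimitiveRoot.coe_units_iff.2 (Z.prim N)).eq_pow_of_pow_eq_one
      (show (u : OC C) ^ p ^ N = 1 by rw [← Units.val_pow_eq_pow_val, hu, Units.val_one])
    refine ⟨(i : ZMod (p ^ N)), ?_⟩
    rw [ZMod.val_natCast, Nat.mod_eq_of_lt hi]
    exact Units.ext (by rw [Units.val_pow_eq_pow_val, hi'])
  have h4 : ∀ u : (OC C)ˣ, ∃ k : ZMod (p ^ N), u ^ p ^ N = 1 → u = Z.root N ^ k.val := by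
    intro u
    by_cases hu : u ^ p ^ N = 1
    · obtain ⟨k, hk⟩ := h3 u hu
      exact ⟨k, fun _ => hk⟩
    · exact ⟨0, fun h => absurd h hu⟩
  choose k hk using h4
  have hk' : ∀ x : D.Delta, x.level N (D.genVar s) = Z.root N ^ (k (x.level N (D.genVar s))).val :=
    fun x => hk _ (x.2.1 N _)
  refine ⟨fun x => k (x.level N (D.genVar s)),
    fun x y h => congrArg (fun v => k (v (D.genVar s))) h, fun x y => ?_, hk'⟩
  refine ZMod.val_injective _ ((Z.prim N).pow_inj (ZMod.val_lt _) (ZMod.val_lt _) ?_)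
  have hmod : ∀ n, Z.root N ^ (n % p ^ N) = Z.root N ^ n := fun n => by
    conv_rhs => rw [← Nat.div_add_mod n (p ^ N), pow_add, pow_mul, (Z.prim N).pow_eq_one, one_pow,
      one_mul]
  rw [← hk', ZMod.val_add, hmod, pow_add, ← hk', ← hk']
  rfl

/-- The list of topological generators. -/
def genList : List D.Delta := Finset.univ.toList.map (D.gen Z)

set_option linter.unusedSectionVars false in
lemma genList_length : (D.genList Z).length = D.dim := by
  rw [genList, List.length_map, Finset.length_toList, Finset.card_univ, card_genIdx]

lemma genList_isPadicBasis : IsPadicBasis p (D.genList Z) where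
  dense U hU hΓ := by
    rw [eq_top_iff]
    intro x _
    obtain ⟨N, hN⟩ := D.mem_delta_nhds_iff.1 (hU.mem_nhds (show (1 : D.Delta) ∈ (U : Set _) from
        U.one_mem))
    choose c hc using fun s => D.exists_coord Z s N
    have hmem : ∏ s, D.gen Z s ^ (c s x).val ∈ U := by
      refine Subgroup.prod_mem U fun s _ => U.pow_mem (hΓ _ ?_) _
      exact List.mem_map.2 ⟨s, Finset.mem_toList.2 (Finset.mem_univ s), rfl⟩
    -- The product of generators with the coordinates of x as exponents agrees with x at level N,
    -- and U contains everything that is trivial at level N.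
    have hx : x * (∏ s, D.gen Z s ^ (c s x).val)⁻¹ ∈ U := by
      refine hN _ (D.level_ext fun s => ?_)
      have h3 : (∏ s, D.gen Z s ^ (c s x).val).level N (D.genVar s) = Z.root N ^ (c s x).val := by
        change D.levelHom N _ _ = _
        rw [map_prod, Finset.prod_apply, Finset.prod_eq_single s]
        · rw [map_pow, Pi.pow_apply]
          exact congrArg (· ^ _) (D.level_gen_genVar_self Z s N)
        · intro s' _ hs'
          rw [map_pow, Pi.pow_apply]
          exact (congrArg (· ^ _) (D.level_gen_genVar_of_ne Z hs'.symm N)).trans (one_pow _)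
        · exact fun h => absurd (Finset.mem_univ _) h
      change x.level N (D.genVar s) * ((∏ s, D.gen Z s ^ (c s x).val).level N (D.genVar s))⁻¹ = 1
      rw [h3, (hc s).2.2 x, mul_inv_cancel]
    have := U.mul_mem hx hmem
    rwa [inv_mul_cancel_right] at this
  coord γ Γ' hΓ N := by
    -- No index is repeated, so the generators behind γ have other indices and their coordinate in
    -- the direction of γ vanishes.
    have hnd : (Finset.univ : Finset D.GenIdx).toList.Nodup := Finset.nodup_toList _
    obtain ⟨t, ht⟩ := hΓ
    have h3 : ∃ s L, γ = D.gen Z s ∧ Γ' = List.map (D.gen Z) L ∧ s ∉ L := by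
      obtain ⟨l₁, l₂, hl, -, h4⟩ := List.map_eq_append_iff.1 ht.symm
      obtain ⟨s, L, rfl, h5, h6⟩ := List.map_eq_cons_iff.1 h4
      refine ⟨s, L, h5.symm, h6.symm, ?_⟩
      rw [hl] at hnd
      exact (List.nodup_cons.1 (List.nodup_append.1 hnd).2.1).1
    obtain ⟨s, L, rfl, rfl, hs⟩ := h3
    obtain ⟨c, hc, hadd, hc'⟩ := D.exists_coord Z s N
    have hlt : ∀ y z : ZMod (p ^ N), Z.root N ^ y.val = Z.root N ^ z.val → y = z := fun y z h => by
      have : NeZero (p ^ N) := ⟨(pow_pos hp.out.pos N).ne'⟩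
      exact ZMod.val_injective _ ((Z.prim N).pow_inj (ZMod.val_lt _) (ZMod.val_lt _) h)
    refine ⟨c, ?_, fun x => ?_, ?_⟩
    · rw [IsLocallyConstant.iff_eventually_eq]
      exact fun x => D.mem_delta_nhds_iff.2 ⟨N, fun y hy => hc y x hy⟩
    · rw [hadd]
      congr 1
      refine hlt _ _ ?_
      rw [← hc', level_gen_genVar_self]
      -- For N = 0 the residue 1 has value 0, but the root of unity is then 1 as well.
      rcases Nat.eq_zero_or_pos N with rfl | hN
      · have := (Z.prim 0).pow_eq_one
        rw [pow_zero, pow_one] at this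
        rw [this, one_pow]
      · have : Fact (1 < p ^ N) := ⟨Nat.one_lt_pow hN.ne' hp.out.one_lt⟩
        rw [ZMod.val_one, pow_one]
    · rintro γ' hγ' x
      obtain ⟨s', hs', rfl⟩ := List.mem_map.1 hγ'
      rw [hadd]
      have : c (D.gen Z s') = 0 := by
        refine hlt _ _ ?_
        rw [← hc', D.level_gen_genVar_of_ne Z (ne_of_mem_of_not_mem hs' hs).symm, ZMod.val_zero,
          pow_zero]
      rw [this, add_zero]
  tendsto γ _ U hU := by
    obtain ⟨N, hN⟩ := D.mem_delta_nhds_iff.1 hU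
    exact ⟨N, hN _ (funext fun s => γ.2.1 N s)⟩

end Generators

end ModelData

end

end PolystableDuality

namespace PolystableDuality

/-! ### Weights and the contracting operators outside a finite level -/

noncomputable section

namespace ModelData

variable {p : ℕ} {C : Type u} [NormedField C] [IsUltrametricDist C] (D : ModelData p C)

section Weights

set_option linter.unusedSectionVars false

variable (Z : PrimitiveSystem p C)

/-- The weight of the monomial with exponents `e` at level `M`. -/
def weight (M : ℕ) (e : D.Idx →₀ ℕ) (s : D.GenIdx) : (OC C)ˣ :=
  Z.root M ^ ((e (D.genVar s) : ℤ) - e ⟨s.1, 0⟩)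

lemma weight_add (M : ℕ) (d e : D.Idx →₀ ℕ) :
    D.weight Z M (d + e) = D.weight Z M d * D.weight Z M e := by
  funext s
  rw [Pi.mul_apply, weight, weight, weight, ← zpow_add, Finsupp.add_apply, Finsupp.add_apply]
  congr 1
  push_cast
  ring

lemma weight_block (M : ℕ) (i : Fin D.l) : D.weight Z M (D.block i) = 1 := by
  funext s
  change Z.root M ^ (((if s.1 = i then 1 else 0 : ℕ) : ℤ) - (if s.1 = i then 1 else 0 : ℕ)) = 1
  rw [sub_self, zpow_zero]

lemma weight_smul (M q : ℕ) (e : D.Idx →₀ ℕ) : D.weight Z M (q • e) = D.weight Z M e ^ q := by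
  induction q with
  | zero => funext s; simp [weight]
  | succ q ih => rw [succ_nsmul, weight_add, ih, pow_succ]

lemma root_pow_pow' (m r : ℕ) : Z.root (m + r) ^ p ^ r = Z.root m := by
  induction r with
  | zero => simp
  | succ r ih => rw [pow_succ', pow_mul, ← add_assoc, Z.pow, ih]

lemma weight_pow_pow (m r : ℕ) (e : D.Idx →₀ ℕ) :
    D.weight Z (m + r) e ^ p ^ r = D.weight Z m e := by
  funext s
  rw [Pi.pow_apply, weight, weight, ← root_pow_pow' Z m r, ← zpow_natCast, ← zpow_natCast,
    ← zpow_mul, ← zpow_mul, mul_comm]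

lemma weight_pow (M : ℕ) (e : D.Idx →₀ ℕ) : D.weight Z M e ^ p ^ M = 1 := by
  funext s
  rw [Pi.pow_apply, weight, ← zpow_natCast, ← zpow_mul, mul_comm, zpow_mul, zpow_natCast,
    (Z.prim M).pow_eq_one, one_zpow]
  rfl

/-- Multiplication of the monomials by a function of their weight, on polynomials. -/
def diagPoly (M : ℕ) (F : (D.GenIdx → (OC C)ˣ) → OC C) : D.Poly →ₗ[OC C] D.Poly :=
  (MvPolynomial.basisMonomials D.Idx (OC C)).constr (OC C) fun e =>
    MvPolynomial.monomial e (F (D.weight Z M e))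

lemma diagPoly_monomial (M : ℕ) (F : (D.GenIdx → (OC C)ˣ) → OC C) (e : D.Idx →₀ ℕ) (a : OC C) :
    D.diagPoly Z M F (MvPolynomial.monomial e a) =
      MvPolynomial.monomial e (F (D.weight Z M e) * a) := by
  have h : MvPolynomial.monomial e a = a • MvPolynomial.basisMonomials D.Idx (OC C) e := by
    rw [MvPolynomial.coe_basisMonomials, MvPolynomial.smul_monomial, smul_eq_mul, mul_one]
  rw [h, map_smul, diagPoly, Module.Basis.constr_basis, MvPolynomial.smul_monomial, smul_eq_mul,
    mul_comm]

lemma diagPoly_monomial_mul (M : ℕ) (F : (D.GenIdx → (OC C)ˣ) → OC C) {d : D.Idx →₀ ℕ}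
    (hd : D.weight Z M d = 1) (b : OC C) (x : D.Poly) :
    D.diagPoly Z M F (MvPolynomial.monomial d b * x) =
      MvPolynomial.monomial d b * D.diagPoly Z M F x := by
  refine D.addHom_ext (f := fun x => D.diagPoly Z M F (MvPolynomial.monomial d b * x))
    (g := fun x => MvPolynomial.monomial d b * D.diagPoly Z M F x)
    (fun x y => by simp only [mul_add, map_add]) (fun x y => by simp only [mul_add, map_add])
    (fun e a => ?_) x
  rw [diagPoly_monomial, MvPolynomial.monomial_mul, MvPolynomial.monomial_mul, diagPoly_monomial,
    weight_add, hd, one_mul]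
  congr 1
  ring

lemma diagPoly_expandHom_mul (M : ℕ) (F : (D.GenIdx → (OC C)ˣ) → OC C) (f x : D.Poly) :
    D.diagPoly Z M F (D.expandHom (p ^ M) f * x) = D.expandHom (p ^ M) f * D.diagPoly Z M F x := by
  refine D.addHom_ext (f := fun f => D.diagPoly Z M F (D.expandHom (p ^ M) f * x))
    (g := fun f => D.expandHom (p ^ M) f * D.diagPoly Z M F x)
    (fun x y => by simp only [add_mul, map_add]) (fun x y => by simp only [add_mul, map_add])
    (fun e a => ?_) f
  rw [expandHom_monomial, diagPoly_monomial_mul]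
  rw [weight_smul, weight_pow]

lemma diagPoly_expandHom (m r : ℕ) (F : (D.GenIdx → (OC C)ˣ) → OC C) (x : D.Poly) :
    D.diagPoly Z (m + r) F (D.expandHom (p ^ r) x) = D.expandHom (p ^ r) (D.diagPoly Z m F x) := by
  refine D.addHom_ext (f := fun x => D.diagPoly Z (m + r) F (D.expandHom (p ^ r) x))
    (g := fun x => D.expandHom (p ^ r) (D.diagPoly Z m F x))
    (fun x y => by simp only [map_add]) (fun x y => by simp only [map_add]) (fun e a => ?_) x
  rw [expandHom_monomial, diagPoly_monomial, diagPoly_monomial, expandHom_monomial, weight_smul,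
    weight_pow_pow]

/-- Both terms of a relation have trivial weight, so operators that are diagonal in the weights
commute with multiplication by it. -/
lemma diagPoly_mem (M : ℕ) (F : (D.GenIdx → (OC C)ˣ) → OC C) {x : D.Poly} (hx : x ∈ D.polyIdeal M) :
    D.diagPoly Z M F x ∈ D.polyIdeal M := by
  rw [polyIdeal, ← Ideal.span_union] at hx
  suffices h : ∀ y : D.Poly, D.diagPoly Z M F (x * y) ∈ D.polyIdeal M by
    have := h 1
    rwa [mul_one] at this
  refine Submodule.span_induction (p := fun z _ => ∀ y : D.Poly,
    D.diagPoly Z M F (z * y) ∈ D.polyIdeal M) ?_ ?_ ?_ ?_ hx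
  · rintro _ (rfl | ⟨i, rfl⟩) y
    · rw [← nsmul_eq_mul, map_nsmul, nsmul_eq_mul]
      exact Ideal.mul_mem_right _ _ (D.natCast_mem_polyIdeal M)
    · have : D.diagPoly Z M F (D.rel M i * y) = D.rel M i * D.diagPoly Z M F y := by
        rw [rel_eq_monomial, sub_mul, map_sub, D.diagPoly_monomial_mul Z M F (D.weight_block Z M i),
          sub_mul]
        congr 1
        exact D.diagPoly_monomial_mul Z M F (funext fun s => by simp [weight]) _ y
      rw [this]
      exact Ideal.mul_mem_right _ _ (D.rel_mem_polyIdeal M i)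
  · intro y
    rw [zero_mul, map_zero]
    exact zero_mem _
  · intro x x' _ _ h h' y
    rw [add_mul, map_add]
    exact add_mem (h y) (h' y)
  · intro a x _ h y
    rw [smul_eq_mul, mul_comm a, mul_assoc]
    exact h _

variable [hp : Fact p.Prime]

lemma exists_diag (F : (D.GenIdx → (OC C)ˣ) → OC C) : ∃ φ : D.RInfModP →ₗ[D.RModP] D.RInfModP,
    ∀ M f, φ (D.polyToInf M f) = D.polyToInf M (D.diagPoly Z M F f) := by
  obtain ⟨Φ, hΦ⟩ := D.exists_lift 0 (fun r => (D.polyToInf (0 + r)).toAddMonoidHom.comp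
    (D.diagPoly Z (0 + r) F).toAddMonoidHom)
    (fun r f hf => (D.polyToInf_eq_zero_iff _ _).2 (D.diagPoly_mem Z _ F hf))
    (fun r r' f => by
      change D.polyToInf (0 + (r + r')) (D.diagPoly Z (0 + (r + r')) F (D.expandHom (p ^ r') f)) =
        D.polyToInf (0 + r) (D.diagPoly Z (0 + r) F f)
      rw [← add_assoc, diagPoly_expandHom, polyToInf_expandHom])
  have hΦ' : ∀ M f, Φ (D.polyToInf M f) = D.polyToInf M (D.diagPoly Z M F f) := by
    intro M f
    have := hΦ M f
    rw [zero_add] at this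
    exact this
  refine ⟨D.linearMapOfPoly Φ fun f x => ?_, hΦ'⟩
  obtain ⟨M, g, rfl⟩ := D.exists_polyToInf x
  rw [polyToModP_smul_polyToInf, hΦ', hΦ', polyToModP_smul_polyToInf, diagPoly_expandHom_mul]

/-- Multiplication of the monomials by a function of their weight. -/
def diag (F : (D.GenIdx → (OC C)ˣ) → OC C) : D.RInfModP →ₗ[D.RModP] D.RInfModP :=
  (D.exists_diag Z F).choose

lemma diag_monomial (F : (D.GenIdx → (OC C)ˣ) → OC C) (M : ℕ) (e : D.Idx →₀ ℕ) (a : OC C) :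
    D.diag Z F (D.polyToInf M (MvPolynomial.monomial e a)) =
      D.polyToInf M (MvPolynomial.monomial e (F (D.weight Z M e) * a)) := by
  rw [diag, (D.exists_diag Z F).choose_spec, diagPoly_monomial]

lemma inf_ext (m : ℕ) {S : Type*} [AddCommMonoid S] {f g : D.RInfModP → S}
    (hf : ∀ x y, f (x + y) = f x + f y) (hg : ∀ x y, g (x + y) = g x + g y)
    (h : ∀ r e a, f (D.polyToInf (m + r) (MvPolynomial.monomial e a)) =
      g (D.polyToInf (m + r) (MvPolynomial.monomial e a))) (x : D.RInfModP) : f x = g x := by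
  obtain ⟨r, x, rfl⟩ := D.exists_polyToInf_add m x
  exact D.addHom_ext (f := fun x => f (D.polyToInf (m + r) x))
    (g := fun x => g (D.polyToInf (m + r) x)) (fun x y => by simp only [map_add, hf])
    (fun x y => by simp only [map_add, hg]) (h r) x

lemma diag_rho (F : (D.GenIdx → (OC C)ˣ) → OC C) (ε : D.Delta) (x : D.RInfModP) :
    D.diag Z F (D.rho ε x) = D.rho ε (D.diag Z F x) := by
  refine D.inf_ext 0 (f := fun x => D.diag Z F (D.rho ε x)) (g := fun x => D.rho ε (D.diag Z F x))
    (fun x y => by simp only [map_add]) (fun x y => by simp only [map_add]) (fun r e a => ?_) x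
  rw [rho_polyToInf, actPoly_monomial, diag_monomial, diag_monomial, rho_polyToInf,
    actPoly_monomial,
    mul_assoc]

lemma prod_genFun_pow (M : ℕ) (s : D.GenIdx) (e : D.Idx →₀ ℕ) :
    ∏ x, D.genFun Z M s x ^ e x = D.weight Z M e s := by
  rw [weight, zpow_sub, zpow_natCast, zpow_natCast,
    ← Finset.mul_prod_erase _ _ (Finset.mem_univ (D.genVar s)),
    ← Finset.mul_prod_erase _ _ (Finset.mem_erase.2 ⟨(D.genVar_ne s s.1).symm, Finset.mem_univ _⟩),
    Finset.prod_eq_one, mul_one]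
  · rw [genFun, if_pos rfl, genFun, if_neg (D.genVar_ne s s.1).symm, if_pos rfl, inv_pow]
  · intro x hx
    rw [Finset.mem_erase, Finset.mem_erase] at hx
    rw [genFun, if_neg hx.2.1, if_neg hx.1, one_pow]

lemma rho_gen (s : D.GenIdx) (x : D.RInfModP) :
    D.rho (D.gen Z s) x = D.diag Z (fun w => w s) x := by
  refine D.inf_ext 0 (f := fun x => D.rho (D.gen Z s) x) (g := fun x => D.diag Z (fun w => w s) x)
    (fun x y => by simp only [map_add]) (fun x y => by simp only [map_add]) (fun r e a => ?_) x
  rw [rho_polyToInf, actPoly_monomial, diag_monomial, mul_comm]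
  congr 3
  rw [level_gen, ← D.prod_genFun_pow, Units.coe_prod]
  simp only [Units.val_pow_eq_pow_val]

/-- The weights killed by p^m are those of level m: the exponent difference times p^m is divisible
by p^(m+r) exactly when the exponents of the block agree modulo p^r. -/
lemma weight_pow_eq_one_iff (m r : ℕ) (e : D.Idx →₀ ℕ) :
    (∀ s, D.weight Z (m + r) e s ^ p ^ m = 1) ↔ D.IsContractible (p ^ r) Finset.univ e := by
  have h1 : ∀ s, D.weight Z (m + r) e s ^ p ^ m = 1 ↔ e (D.genVar s) % p ^ r = e ⟨s.1,
      0⟩ % p ^ r := by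
    intro s
    have hpm : ((p ^ m : ℕ) : ℤ) ≠ 0 := by exact_mod_cast (pow_pos hp.out.pos m).ne'
    rw [weight, ← zpow_natCast, ← zpow_mul, (Z.prim (m + r)).zpow_eq_one_iff_dvd, pow_add,
      mul_comm (p ^ m), Nat.cast_mul, mul_dvd_mul_iff_right hpm, eq_comm]
    exact (Nat.modEq_iff_dvd (n := p ^ r) (a := e ⟨s.1, 0⟩) (b := e (D.genVar s))).symm
  constructor
  · intro h
    refine ⟨fun i _ j => ?_, fun i hi => absurd (Finset.mem_univ i) hi⟩
    refine Fin.cases rfl (fun j => ?_) j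
    exact (h1 ⟨i, j⟩).1 (h _)
  · exact fun h s => (h1 s).2 (h.1 s.1 (Finset.mem_univ _) _)

-- Contraction either reproduces a monomial or kills it, according to its weight. So the projector
-- to level m is diagonal, as are the generators, and a homotopy can be found weight by weight.
open Classical in
lemma levelIncl_levelProj (m : ℕ) (x : D.RInfModP) : D.levelIncl m (D.levelProj m x) =
    D.diag Z (fun w => if ∀ s, w s ^ p ^ m = 1 then 1 else 0) x := by
  refine D.inf_ext m (f := fun x => D.levelIncl m (D.levelProj m x))
    (g := fun x => D.diag Z (fun w => if ∀ s, w s ^ p ^ m = 1 then 1 else 0) x)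
    (fun x y => by simp only [map_add]) (fun x y => by simp only [map_add]) (fun r e a => ?_) x
  rw [levelProj_polyToInf, levelIncl_levelMk, diag_monomial]
  by_cases h : D.IsContractible (p ^ r) Finset.univ e
  · rw [if_pos ((D.weight_pow_eq_one_iff Z m r e).2 h), one_mul,
      D.polyToInf_monomial_of_isContractible m r a h]
  · rw [if_neg ((D.weight_pow_eq_one_iff Z m r e).not.2 h), zero_mul, map_zero, map_zero,
      contract_monomial_of_not _ _ _ _ _ h, map_zero]

lemma gen_injective : Function.Injective (D.gen Z) := by
  intro s s' h
  by_contra hne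
  have h1 := D.level_gen_genVar_self Z s 1
  rw [h, D.level_gen_genVar_of_ne Z hne] at h1
  have h2 := (Z.prim 1).pow_eq_one_iff_dvd 1
  rw [← h1, one_pow, pow_one] at h2
  exact hp.out.one_lt.ne' (Nat.dvd_one.1 (h2.1 rfl))

/-- The operators `U_γ` with `∑_γ (γ - 1) U_γ = a (1 - e)`, where `e` is the projection to level
`m` and
`a` is divisible by `ζ - 1` for all roots of unity `ζ` of order larger than `p^m`. -/
lemma exists_homotopy_operators (m : ℕ) (a : OC C)
    (ha : ∀ (M : ℕ) (w : OC C), w ^ p ^ M = 1 → w ^ p ^ m ≠ 1 → w - 1 ∣ a) :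
    ∃ U : D.Delta → D.RInfModP →ₗ[D.RModP] D.RInfModP,
      (∀ γ g x, U γ (D.rho g x) = D.rho g (U γ x)) ∧
      ∀ x, D.polyToModP (MvPolynomial.C a) • x -
        D.polyToModP (MvPolynomial.C a) • D.levelIncl m (D.levelProj m x) =
        ((D.genList Z).map fun γ => D.rho γ (U γ x) - U γ x).sum := by
  classical
  -- For a weight w outside level m choose one coordinate with w_s^{p^m} ≠ 1, put a/(w_s - 1) there
  -- and zero elsewhere. The choice depends only on w, so the operators commute with Δ. Tuples that
  -- are not p-power torsion do not occur as weights.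
  have hF : ∃ F : D.GenIdx → (D.GenIdx → (OC C)ˣ) → OC C, ∀ w : D.GenIdx → (OC C)ˣ,
      (∃ M, w ^ p ^ M = 1) →
      ∑ s, ((w s : OC C) - 1) * F s w = if ∀ s, w s ^ p ^ m = 1 then 0 else a := by
    have : ∀ w : D.GenIdx → (OC C)ˣ, ∃ F : D.GenIdx → OC C, (∃ M, w ^ p ^ M = 1) →
        ∑ s, ((w s : OC C) - 1) * F s = if ∀ s, w s ^ p ^ m = 1 then 0 else a := by
      intro w
      by_cases hM : ∃ M, w ^ p ^ M = 1
      swap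
      · exact ⟨0, fun h => absurd h hM⟩
      by_cases h : ∀ s, w s ^ p ^ m = 1
      · refine ⟨0, fun _ => ?_⟩
        rw [if_pos h]
        simp
      · obtain ⟨M, hM⟩ := hM
        obtain ⟨s, hs⟩ := not_forall.1 h
        obtain ⟨c, hc⟩ := ha M (w s)
          (by rw [← Units.val_pow_eq_pow_val, ← Pi.pow_apply, hM]; rfl)
          (fun h => hs (Units.ext (by rw [Units.val_pow_eq_pow_val, h, Units.val_one])))
        refine ⟨Pi.single s c, fun _ => ?_⟩
        rw [if_neg h, Finset.sum_eq_single s, Pi.single_eq_same, hc]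
        · intro s' _ hs'
          rw [Pi.single_eq_of_ne hs', mul_zero]
        · exact fun h => absurd (Finset.mem_univ _) h
    choose F hF using this
    exact ⟨fun s w => F w s, hF⟩
  obtain ⟨F, hF⟩ := hF
  -- The operators are indexed by group elements; as distinct indices give distinct generators, the
  -- sum picks out F s when γ is the generator of index s.
  refine ⟨fun γ => D.diag Z (fun w => ∑ s, if D.gen Z s = γ then F s w else 0),
    fun γ g x => D.diag_rho Z _ g x, fun x => ?_⟩
  have hU : ∀ s x, D.diag Z (fun w => ∑ s', if D.gen Z s' = D.gen Z s then F s' w else 0) x =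
      D.diag Z (F s) x := by
    intro s x
    congr 2
    funext w
    rw [Finset.sum_eq_single s, if_pos rfl]
    · intro s' _ hs'
      rw [if_neg fun h => hs' (D.gen_injective Z h)]
    · exact fun h => absurd (Finset.mem_univ _) h
  rw [genList, List.map_map, Finset.sum_map_toList]
  simp only [Function.comp_apply, hU, rho_gen, D.levelIncl_levelProj Z]
  refine D.inf_ext 0 (f := fun x => D.polyToModP (MvPolynomial.C a) • x -
      D.polyToModP (MvPolynomial.C a) • D.diag Z (fun w => if ∀ s, w s ^ p ^ m = 1 then 1 else 0) x)
    (g := fun x => ∑ s, (D.diag Z (fun w => w s) (D.diag Z (F s) x) - D.diag Z (F s) x))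
    (fun x y => by simp only [map_add, smul_add]; abel)
    (fun x y => by
      simp only [map_add, ← Finset.sum_add_distrib]
      refine Finset.sum_congr rfl fun s _ => by abel) (fun r e b => ?_) x
  simp only [diag_monomial, polyToModP_smul_polyToInf, expandHom, AlgHom.toRingHom_eq_coe,
    RingHom.coe_coe, MvPolynomial.expand_C, MvPolynomial.C_mul_monomial, ← map_sub, ← map_sum]
  congr 2
  have h1 := hF (D.weight Z (0 + r) e) ⟨0 + r, D.weight_pow Z _ e⟩
  have h2 : ∑ s, ((D.weight Z (0 + r) e s : OC C) * (F s (D.weight Z (0 + r) e) * b) -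
      F s (D.weight Z (0 + r) e) * b) =
      (∑ s, ((D.weight Z (0 + r) e s : OC C) - 1) * F s (D.weight Z (0 + r) e)) * b := by
    rw [Finset.sum_mul]
    exact Finset.sum_congr rfl fun s _ => by ring
  rw [h2, h1]
  split_ifs <;> ring

end Weights

end ModelData

end

end PolystableDuality

/-! ### Almost perfectness -/

namespace PolystableDuality

open CategoryTheory

noncomputable section

namespace ModelData

set_option linter.unusedSectionVars false

variable {p : ℕ} [hp : Fact p.Prime] {C : Type u} [NormedField C] [IsUltrametricDist C]
  (D : ModelData p C)

/-- Divisibility in a valuation ring is total, so of two elements of the maximal ideal the one of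
smaller norm is a multiple of the other. It thus suffices to treat multiples of a single a. -/
lemma exists_eq_mul_of_mem_almostIdeal {b : D.RModP} (hb : b ∈ D.almostIdeal) :
    ∃ r, ∃ a ∈ IsLocalRing.maximalIdeal (OC C), b = r * D.polyToModP (MvPolynomial.C a) := by
  have halg : ∀ a, algebraMap (OC C) D.RModP a = D.polyToModP (MvPolynomial.C a) := fun a => rfl
  refine Submodule.span_induction (p := fun b _ => ∃ r, ∃ a ∈ IsLocalRing.maximalIdeal (OC C),
    b = r * D.polyToModP (MvPolynomial.C a)) ?_ ?_ ?_ ?_ hb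
  · rintro _ ⟨a, ha, rfl⟩
    exact ⟨1, a, ha, by rw [one_mul, halg]⟩
  · exact ⟨0, 0, zero_mem _, by rw [zero_mul]⟩
  · rintro _ _ _ _ ⟨r, a, ha, rfl⟩ ⟨r', a', ha', rfl⟩
    rcases le_total ‖(a : C)‖ ‖(a' : C)‖ with h | h
    · obtain ⟨c, rfl⟩ := dvd_of_norm_le h
      refine ⟨r * D.polyToModP (MvPolynomial.C c) + r', a', ha', ?_⟩
      simp only [map_mul]
      ring
    · obtain ⟨c, rfl⟩ := dvd_of_norm_le h
      refine ⟨r + r' * D.polyToModP (MvPolynomial.C c), a, ha, ?_⟩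
      simp only [map_mul]
      ring
  · rintro c _ _ ⟨r, a, ha, rfl⟩
    exact ⟨c * r, a, ha, by rw [smul_eq_mul, mul_assoc]⟩

variable [CharZero C] [HasDerivedCategory.{w} (ModuleCat.{u} D.RModP)]

/-- Given a, choose m such that ζ - 1 divides a for all p-power roots of unity ζ not killed by p^m.
Then the ring of level m is a retract of R_∞^+/p up to a and up to homotopy, and the general
criterion applies with its inclusion, its projection and its perfect form. -/
lemma cupPairing_duality_upTo_of_mem (Z : PrimitiveSystem p C) {pr : D.RInfModP →ₗ[D.RModP] D.RModP}
    (hpr : D.IsWeightProjection pr) {d : ℤ} (hd : ((D.genList Z).length : ℤ) = d)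
    (t : D.cohR ⟶ (HomologicalComplex.single (ModuleCat.{u} D.RModP) (ComplexShape.up ℤ) d).obj
      (ModuleCat.of D.RModP D.RModP))
    (ht : IsIso (HomologicalComplex.homologyMap t d)) {b : D.RModP} (hb : b ∈ D.almostIdeal)
    (i j : ℤ) (h : i + j = d) :
    (cupPairing D.rho (contComplexMap D.rho 1 pr hpr.map_rho ≫ t)).DualityInjUpTo b i j h ∧
    (cupPairing D.rho (contComplexMap D.rho 1 pr hpr.map_rho ≫ t)).DualitySurjUpTo b i j h ∧
    (cupPairing D.rho (contComplexMap D.rho 1 pr hpr.map_rho ≫ t)).flip.DualityInjUpTo b i j h ∧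
    (cupPairing D.rho (contComplexMap D.rho 1 pr hpr.map_rho ≫ t)).flip.DualitySurjUpTo b i j h :=
      by
  subst hd
  obtain ⟨r, a, ha, rfl⟩ := D.exists_eq_mul_of_mem_almostIdeal hb
  obtain ⟨m, hm⟩ := exists_norm_le_norm_sub_one (p := p) (norm_lt_one_of_mem_maximalIdeal ha)
  obtain ⟨U, hU, hsum⟩ := D.exists_homotopy_operators Z m a
    fun M w h1 h2 => dvd_of_norm_le (hm M w h1 h2)
  let R := injectiveResolution (ModuleCat.of D.RModP D.RModP)
  refine cupPairing_duality_upTo D.delta_mul_comm D.natCast_RModP (D.genList_isPadicBasis Z) D.rho R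
    (isAcyclicFor_self R) pr hpr.map_rho t ht (D.levelRho_isSmooth m)
    (D.frobForm_isPerfectForm_and_isAcyclicFor R m Finset.univ).2 (D.levelIncl m).toLinearMap
    (D.levelIncl_levelRho m) (D.levelProj m) (D.levelProj_rho m) (hpr.mul_levelIncl m)
    (hpr.existsUnique m) _ (fun γ => r • U γ) (fun γ g x => ?_) (fun x => ?_) i j h
  · rw [LinearMap.smul_apply, hU, LinearMap.smul_apply, map_smul]
  · have h1 := congrArg (r • ·) (hsum x)
    rw [mul_smul, mul_smul, ← smul_sub]
    refine h1.trans ?_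
    rw [List.smul_sum, List.map_map]
    congr 2
    funext γ
    rw [Function.comp_apply, smul_sub, ← map_smul]
    rfl

theorem pairing_isAlmostPerfect (Z : PrimitiveSystem p C) (pr : D.RInfModP →ₗ[D.RModP] D.RModP)
    (hpr : D.IsWeightProjection pr) (t : D.cohR ⟶ D.shiftedRModP)
    (ht : IsIso (HomologicalComplex.homologyMap t (D.dim : ℤ))) :
    (D.pairing pr hpr t).IsAlmostPerfect D.almostIdeal := by
  intro i j h
  have key := fun b (hb : b ∈ D.almostIdeal) => D.cupPairing_duality_upTo_of_mem Z hpr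
    (by rw [genList_length]) t ht hb i j h
  exact ⟨ChainPairing.isAlmostIso_duality _ _ i j h (fun b hb => (key b hb).1)
    (fun b hb => (key b hb).2.1), ChainPairing.isAlmostIso_duality _ _ i j h
    (fun b hb => (key b hb).2.2.1) (fun b hb => (key b hb).2.2.2)⟩

theorem cohR_exactAt (Z : PrimitiveSystem p C) (i : ℤ) (hi : (D.dim : ℤ) < i) : D.cohR.ExactAt i :=
  contComplex_exactAt D.delta_mul_comm D.natCast_RModP (D.genList_isPadicBasis Z) i
    (by rwa [genList_length])

theorem exists_trace (Z : PrimitiveSystem p C) : ∃ t : D.cohR ⟶ D.shiftedRModP,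
    IsIso (HomologicalComplex.homologyMap t (D.dim : ℤ)) := by
  have h := exists_isIso_homologyMap D.delta_mul_comm D.natCast_RModP (D.genList_isPadicBasis Z)
  rw [genList_length] at h
  exact h

end ModelData

end

end PolystableDuality

/-! ### Failure of perfectness: surjectivity implies finiteness -/

namespace PolystableDuality

open CategoryTheory

noncomputable section

section DerivedMaps

set_option linter.unusedSectionVars false

variable {k : Type u} [CommRing k] [HasDerivedCategory.{w} (ModuleCat.{u} k)]
  {K : CochainComplex (ModuleCat.{u} k) ℤ} {N : ModuleCat.{u} k} {j : ℤ}

/-- Morphisms to a complex concentrated in one degree that agree in the derived category agree on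
cocycles. -/
lemma apply_eq_of_Q_map_eq {f g : K ⟶
      (HomologicalComplex.single (ModuleCat.{u} k) (ComplexShape.up ℤ) j).obj N}
    (h : DerivedCategory.Q.map f = DerivedCategory.Q.map g) (y : K.X j)
    (hy : (K.d j (j + 1)).hom y = 0) : (f.f j).hom y = (g.f j).hom y := by
  -- The cocycle y is a morphism from k[-j] to K. Morphisms between modules placed in the same
  -- degree are not changed by passing to the derived category, so the two composites agree as
  -- morphisms of complexes.
  let s : (HomologicalComplex.single (ModuleCat.{u} k) (ComplexShape.up ℤ) j).obj
      (ModuleCat.of k k) ⟶ K :=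
    HomologicalComplex.mkHomFromSingle (ModuleCat.ofHom (LinearMap.toSpanSingleton k _ y)) (by
      rintro _ rfl
      refine ModuleCat.hom_ext (LinearMap.ext_ring ?_)
      change (K.d j (j + 1)).hom ((1 : k) • y) = 0
      rw [one_smul, hy])
  let F := HomologicalComplex.single (ModuleCat.{u} k) (ComplexShape.up ℤ) j
  have h1 : DerivedCategory.Q.map (s ≫ f) = DerivedCategory.Q.map (s ≫ g) := by
    rw [Functor.map_comp, Functor.map_comp, h]
  have h2 : F.preimage (s ≫ f) = F.preimage (s ≫ g) := by
    apply (DerivedCategory.singleFunctor (ModuleCat.{u} k) j).map_injective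
    change DerivedCategory.Q.map (F.map _) = DerivedCategory.Q.map (F.map _)
    rw [F.map_preimage, F.map_preimage, h1]
  have h3 : s ≫ f = s ≫ g := by rw [← F.map_preimage (s ≫ f), h2, F.map_preimage]
  have h4 : (s.f j).hom ((HomologicalComplex.singleObjXSelf (ComplexShape.up ℤ) j
      (ModuleCat.of k k)).inv.hom 1) = y := by
    rw [HomologicalComplex.mkHomFromSingle_f]
    have := congrArg (fun φ => φ.hom (1 : k)) (HomologicalComplex.singleObjXSelf (ComplexShape.up
        ℤ) j
      (ModuleCat.of k k)).inv_hom_id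
    change (LinearMap.toSpanSingleton k _ y) ((HomologicalComplex.singleObjXSelf (ComplexShape.up
      ℤ) j
      (ModuleCat.of k k)).hom.hom ((HomologicalComplex.singleObjXSelf (ComplexShape.up ℤ) j
      (ModuleCat.of k k)).inv.hom 1)) = y
    rw [show (HomologicalComplex.singleObjXSelf (ComplexShape.up ℤ) j (ModuleCat.of k k)).hom.hom
      ((HomologicalComplex.singleObjXSelf (ComplexShape.up ℤ) j (ModuleCat.of k k)).inv.hom 1) =
        1 from this]
    exact one_smul k y
  have h5 := congrArg (fun φ => (φ.f j).hom ((HomologicalComplex.singleObjXSelf (ComplexShape.up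
      ℤ) j
    (ModuleCat.of k k)).inv.hom 1)) h3
  have h6 : ∀ f' : K ⟶ F.obj N, ((s ≫ f').f j).hom ((HomologicalComplex.singleObjXSelf
      (ComplexShape.up ℤ) j (ModuleCat.of k k)).inv.hom 1) = (f'.f j).hom y := fun f' => by
    conv_rhs => rw [← h4]
    rfl
  rw [← h6 f, ← h6 g]
  exact h5

variable {G : Type u} [Group G] [TopologicalSpace G] {A : Type u} [CommRing A] [Algebra k A]

/-- The `0`-cocycle of an invariant. -/
def invCochain (ρ : G →* (A →ₐ[k] A)) (y : A) (hy : ∀ g, ρ g y = y) : cochains ρ 0 :=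
  ⟨fun _ => y, IsLocallyConstant.const y, fun g _ => (hy g).symm⟩

lemma cochainD_invCochain (ρ : G →* (A →ₐ[k] A)) (y : A) (hy : ∀ g, ρ g y = y) :
    cochainD ρ 0 (invCochain ρ y hy) = 0 := by
  refine Subtype.ext (funext fun x => ?_)
  rw [cochainD_apply]
  simp [Fin.sum_univ_two, invCochain]

/-- The values of a cochain on a compact group span a finite set. -/
lemma cochain_range_finite [IsTopologicalGroup G] [CompactSpace G] (ρ : G →* (A →ₐ[k] A)) {n : ℕ}
    (f : cochains ρ n) : (Set.range f.1).Finite := f.2.1.range_finite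

/-- If top cohomology detects all functionals in degree `0`, then functionals on the coefficients
are
given on invariants by finitely many pairings. -/
lemma exists_finite_of_surjective [IsTopologicalGroup G] [CompactSpace G] (ρ : G →* (A →ₐ[k] A))
    (pr : A →ₗ[k] k) (hpr : ∀ g a, pr (ρ g a) = trivRep k G g (pr a)) {n : ℕ}
    (t : contComplex (trivRep k G) ⟶ (HomologicalComplex.single (ModuleCat.{u} k)
      (ComplexShape.up ℤ)
      (n : ℤ)).obj (ModuleCat.of k k))
    (hsurj : Function.Surjective ((cupPairing ρ (contComplexMap ρ (trivRep k G) pr hpr ≫ t)).duality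
      (n : ℤ) 0 (add_zero _))) (ψ : A →ₗ[k] k) :
    ∃ S : Set A, S.Finite ∧ ∀ y, (∀ g, ρ g y = y) → (∀ x ∈ S, pr (x * y) = 0) → ψ y = 0 := by
  -- Evaluation at 1 followed by ψ is a morphism of complexes to k in degree zero, since there is
  -- nothing in negative degrees.
  let ev : cochains ρ 0 →ₗ[k] k := ψ.comp
    ({ toFun := fun f => f.1 1, map_add' := fun _ _ => rfl, map_smul' := fun _ _ => rfl } :
      cochains ρ 0 →ₗ[k] A)
  let Ψ : contComplex ρ ⟶ (HomologicalComplex.single (ModuleCat.{u} k) (ComplexShape.up ℤ) 0).obj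
      (ModuleCat.of k k) :=
    HomologicalComplex.mkHomToSingle (ModuleCat.ofHom ev : (contComplex ρ).X 0 ⟶ _) (by
      rintro i hi
      obtain rfl : i = Int.negSucc 0 := by
        have : i + 1 = 0 := hi
        omega
      exact ModuleCat.hom_ext (LinearMap.ext fun x => by
        rw [show x = 0 from rfl, map_zero, map_zero]))
  obtain ⟨c, hc⟩ := hsurj (DerivedCategory.Q.map Ψ)
  obtain ⟨z, rfl⟩ := Submodule.mkQ_surjective _ c
  let z' : cochains ρ n := z.1
  -- The set consists of the values of a cochain z representing ψ. If they all pair to zero with y,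
  -- then the cup product of z with the constant cocycle y is already killed by pr on cochains.
  refine ⟨Set.range z'.1, cochain_range_finite ρ z', fun y hy hS => ?_⟩
  let y' : (contComplex ρ).X 0 := invCochain ρ y hy
  have hy' : ((contComplex ρ).d 0 (0 + 1)).hom y' = 0 := by
    rw [contComplex_d]
    exact cochainD_invCochain ρ y hy
  have h1 := apply_eq_of_Q_map_eq (show DerivedCategory.Q.map (ChainPairing.toSingle _ _ _ _ z) =
    DerivedCategory.Q.map Ψ from hc) y' hy'
  have h2 : (Ψ.f 0).hom y' = (HomologicalComplex.singleObjXSelf (ComplexShape.up ℤ) 0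
      (ModuleCat.of k k)).inv.hom (ψ y) := by
    have h : Ψ.f 0 = ModuleCat.ofHom ev ≫ (HomologicalComplex.singleObjXSelf (ComplexShape.up ℤ) 0
        (ModuleCat.of k k)).inv := HomologicalComplex.mkHomToSingle_f _ _
    rw [h]
    rfl
  rw [h2, ChainPairing.toSingle_f] at h1
  have h3 : (cupPairing ρ (contComplexMap ρ (trivRep k G) pr hpr ≫ t)).comp n 0 (add_zero _) z.1
      y' =
      0 := by
    have h4 : (contComplexMap ρ (trivRep k G) pr hpr).f (n : ℤ) (cupZ ρ n 0 n (add_zero _) z.1 y') =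
        0 := by
      refine Subtype.ext (funext fun g => ?_)
      exact hS _ ⟨_, rfl⟩
    change (HomologicalComplex.singleObjXSelf (ComplexShape.up ℤ) (n : ℤ)
      (ModuleCat.of k k)).hom.hom
      ((t.f (n : ℤ)).hom ((contComplexMap ρ (trivRep k G) pr hpr).f (n : ℤ)
        (cupZ ρ n 0 n (add_zero _) z.1 y'))) = 0
    rw [h4, map_zero, map_zero]
  have h5 : (HomologicalComplex.singleObjXSelf (ComplexShape.up ℤ) 0
      (ModuleCat.of k k)).inv.hom (ψ y) = 0 := by
    rw [← h1]
    change (HomologicalComplex.singleObjXSelf (ComplexShape.up ℤ) 0 (ModuleCat.of k k)).inv.hom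
      ((cupPairing ρ (contComplexMap ρ (trivRep k G) pr hpr ≫ t)).comp n 0 (add_zero _) z.1 y') = 0
    rw [h3, map_zero]
  have h6 := congrArg (fun φ => φ.hom (ψ y)) (HomologicalComplex.singleObjXSelf (ComplexShape.up
      ℤ) 0
    (ModuleCat.of k k)).inv_hom_id
  have h7 : (HomologicalComplex.singleObjXSelf (ComplexShape.up ℤ) 0 (ModuleCat.of k k)).hom.hom
      ((HomologicalComplex.singleObjXSelf (ComplexShape.up ℤ) 0 (ModuleCat.of k k)).inv.hom (ψ y)) =
      ψ y := h6
  rw [← h7, h5, map_zero]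

end DerivedMaps

end

end PolystableDuality

/-! ### Failure of perfectness: invariants of unbounded level -/

namespace PolystableDuality

open CategoryTheory

noncomputable section

/-- The sum of a family of functionals of which almost all vanish at each vector. -/
lemma exists_functional_of_finite_support {k A : Type*} [CommRing k] [AddCommGroup A] [Module k A]
    (φ : ℕ → A →ₗ[k] k) (hφ : ∀ x, (Function.support fun r => φ r x).Finite) :
    ∃ ψ : A →ₗ[k] k, ∀ x r, (∀ r', r' ≠ r → φ r' x = 0) → ψ x = φ r x := by
  refine ⟨{ toFun := fun x => ∑ᶠ r, φ r x, map_add' := fun x y => ?_, map_smul' := fun c x => ?_ },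
    fun x r h => finsum_eq_single _ r h⟩
  · simp only [map_add]
    exact finsum_add_distrib (hφ x) (hφ y)
  · simp only [map_smul, smul_eq_mul, RingHom.id_apply]
    exact (mul_finsum' (fun r => φ r x) c (hφ x)).symm

section PrimitiveSystems

variable {p : ℕ} [hp : Fact p.Prime] {C : Type u} [NormedField C] [IsUltrametricDist C]
  (Z : PrimitiveSystem p C)

lemma PrimitiveSystem.sub_one_dvd (m : ℕ) :
    ((Z.root (m + 1) : OC C) - 1) ∣ (p : OC C) := by
  refine dvd_of_norm_le ((norm_natCast_le_norm_sub_one_pow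
    (IsPrimitiveRoot.coe_units_iff.2 (Z.prim (m + 1)))).trans ?_)
  exact pow_le_of_le_one (norm_nonneg _) (norm_coe_le_one _)
    (Nat.totient_pos.2 (pow_pos hp.out.pos _)).ne'

/-- Modulo p one has (ζ - 1)^{p^m} ≡ ζ^{p^m} - 1 = 0, so ζ - 1 lies in the maximal ideal. -/
lemma PrimitiveSystem.not_isUnit_sub_one (h : ‖(p : C)‖ < 1) (m : ℕ) :
    ¬ IsUnit ((Z.root m : OC C) - 1) := by
  have hmem : (p : OC C) ∈ IsLocalRing.maximalIdeal (OC C) :=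
    mem_maximalIdeal_of_norm_lt_one (by simpa using h)
  obtain ⟨r, hr⟩ := exists_add_pow_prime_pow_eq hp.out ((Z.root m : OC C) - 1) 1 m
  rw [sub_add_cancel, ← Units.val_pow_eq_pow_val, (Z.prim m).pow_eq_one, Units.val_one,
    one_pow] at hr
  have h1 : ((Z.root m : OC C) - 1) ^ p ^ m = p * (-(((Z.root m : OC C) - 1) * 1 * r)) := by
    linear_combination -hr
  have h2 : ((Z.root m : OC C) - 1) ^ p ^ m ∈ IsLocalRing.maximalIdeal (OC C) := by
    rw [h1]
    exact Ideal.mul_mem_right _ _ hmem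
  exact (IsLocalRing.mem_maximalIdeal _).1
    ((IsLocalRing.maximalIdeal.isMaximal _).isPrime.mem_of_pow_mem _ h2)

end PrimitiveSystems

namespace ModelData

set_option linter.unusedSectionVars false

variable {p : ℕ} [hp : Fact p.Prime] {C : Type u} [NormedField C] [IsUltrametricDist C]
  (D : ModelData p C)

lemma exists_polyToInf_of_le {m M : ℕ} (h : m ≤ M) (f : D.Poly) :
    ∃ g, D.polyToInf M g = D.polyToInf m f := by
  obtain ⟨r, rfl⟩ := Nat.exists_eq_add_of_le h
  exact ⟨_, D.polyToInf_expandHom m r f⟩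

lemma exists_level_of_finite {S : Set D.RInfModP} (hS : S.Finite) :
    ∃ m, ∀ M, m ≤ M → ∀ x ∈ S, ∃ f, D.polyToInf M f = x := by
  choose μ f hf using D.exists_polyToInf
  obtain ⟨m, hm⟩ := (hS.image μ).bddAbove
  refine ⟨m, fun M hM x hx => ?_⟩
  obtain ⟨g, hg⟩ := D.exists_polyToInf_of_le ((hm ⟨x, hx, rfl⟩).trans hM) (f x)
  exact ⟨g, hg.trans (hf x)⟩

/-- The exponents N and 0 within one block are not congruent modulo the positive power of p
separating the two levels. -/
lemma levelProj_monomial_eq_zero {m M : ℕ} (h : m < M) (s : D.GenIdx) {N : ℕ} (hN : ¬ p ∣ N)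
    (a : OC C) : D.levelProj m (D.polyToInf M
      (MvPolynomial.monomial (Finsupp.single (D.genVar s) N) a)) = 0 := by
  obtain ⟨r, rfl⟩ := Nat.exists_eq_add_of_lt h
  rw [add_assoc, levelProj_polyToInf, contract_monomial_of_not, map_zero]
  intro hc
  have h1 := hc.1 s.1 (Finset.mem_univ _) s.2.succ
  rw [show (⟨s.1, s.2.succ⟩ : D.Idx) = D.genVar s from rfl, Finsupp.single_eq_same,
    Finsupp.single_eq_of_ne (D.genVar_ne s s.1).symm, Nat.zero_mod] at h1
  exact hN ((dvd_pow_self p r.succ_ne_zero).trans (Nat.dvd_of_mod_eq_zero h1))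

variable {D} in
lemma IsWeightProjection.mul_polyToInf_eq_zero {pr : D.RInfModP →ₗ[D.RModP] D.RModP}
    (hpr : D.IsWeightProjection pr) {m : ℕ} {x : D.RInfModP} (hx : D.levelProj m x = 0) (f :
      D.Poly) :
    pr (x * D.polyToInf m f) = 0 := by
  rw [← levelIncl_levelMk, hpr.mul_levelIncl, hx, map_zero, zero_mul, map_zero]

lemma polyToInf_monomial_congr (m : ℕ) (e : D.Idx →₀ ℕ) {a b : OC C} (h : (p : OC C) ∣ a - b) :
    D.polyToInf m (MvPolynomial.monomial e a) = D.polyToInf m (MvPolynomial.monomial e b) := by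
  obtain ⟨c, hc⟩ := h
  have h1 : (MvPolynomial.monomial e a : D.Poly) =
      MvPolynomial.monomial e b + (p : D.Poly) * MvPolynomial.monomial e c := by
    rw [← map_natCast (MvPolynomial.C (R := OC C) (σ := D.Idx)), MvPolynomial.C_mul_monomial, ← hc,
      ← map_add, add_sub_cancel]
  rw [h1, map_add, map_mul, (D.polyToInf_eq_zero_iff m _).2 (D.natCast_mem_polyIdeal m), zero_mul,
    add_zero]

/-- Specialise the zeroth variable of each block to ϖ and the others to 1: this respects the
relations, gives a map to O_C/p, and sends the monomial to its coefficient. -/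
lemma dvd_of_polyToModP_monomial_eq_zero (s : D.GenIdx) {a : OC C}
    (h : D.polyToModP (MvPolynomial.monomial (Finsupp.single (D.genVar s) 1) a) = 0) :
    (p : OC C) ∣ a := by
  let φ : D.Poly →ₐ[OC C] OC C :=
    MvPolynomial.aeval fun x : D.Idx => if x.2 = 0 then D.root x.1 0 else 1
  have h1 : D.polyIdeal 0 ≤ (Ideal.span {(p : OC C)}).comap φ := by
    rw [polyIdeal_le_iff]
    refine ⟨?_, fun i => ?_⟩
    · rw [Ideal.mem_comap, map_natCast]
      exact Ideal.mem_span_singleton_self _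
    · have : φ (D.rel 0 i) = 0 := by
        simp [φ, rel, Fin.prod_univ_succ]
      rw [Ideal.mem_comap, this]
      exact zero_mem _
  have h2 := Ideal.mem_span_singleton.1 (h1 ((D.polyToModP_eq_zero_iff _).1 h))
  simpa [φ, genVar, MvPolynomial.aeval_monomial] using h2

lemma root_sub_one_dvd_level_sub_one (Z : PrimitiveSystem p C) (ε : D.Delta) (m : ℕ) (v : D.Idx) :
    ((Z.root m : OC C) - 1) ∣ (ε.level m v : OC C) - 1 := by
  have : NeZero (p ^ m) := ⟨(pow_pos hp.out.pos m).ne'⟩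
  obtain ⟨i, -, hi⟩ := (IsPrimitiveRoot.coe_units_iff.2 (Z.prim m)).eq_pow_of_pow_eq_one
    (show (ε.level m v : OC C) ^ p ^ m = 1 by
      rw [← Units.val_pow_eq_pow_val, show ε.level m v ^ p ^ m = 1 from ε.2.1 m v, Units.val_one])
  rw [← hi]
  simpa using sub_dvd_pow_sub_pow (Z.root m : OC C) 1 i

/-- If `R_∞^+/p` is not `R^+/p`, it has invariants of arbitrarily large level that are not
determined
by finitely many pairings. -/
lemma exists_functional (Z : PrimitiveSystem p C) (hp1 : ‖(p : C)‖ < 1) [CharZero C] (hd : 0 <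
    D.dim)
    {pr : D.RInfModP →ₗ[D.RModP] D.RModP} (hpr : D.IsWeightProjection pr) :
    ∃ ψ : D.RInfModP →ₗ[D.RModP] D.RModP, ∀ S : Set D.RInfModP, S.Finite →
      ∃ y, (∀ ε, D.rho ε y = y) ∧ (∀ x ∈ S, pr (x * y) = 0) ∧ ψ y ≠ 0 := by
  rw [← card_genIdx, Fintype.card_pos_iff] at hd
  obtain ⟨s⟩ := hd
  -- The constant c_m is p/(ζ - 1) with ζ of order p^(m+1).
  choose c hc using fun m => Z.sub_one_dvd m
  let y : ℕ → D.RInfModP := fun r =>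
    D.polyToInf (r + 1) (MvPolynomial.monomial (Finsupp.single (D.genVar s) 1) (c r))
  -- The exponent is complementary to that of y r: their product c_r·t comes from R^+/p, so it
  -- survives pr. Neither factor has a component of level at most r.
  let y' : ℕ → D.RInfModP := fun r =>
    D.polyToInf (r + 1) (MvPolynomial.monomial (Finsupp.single (D.genVar s) (p ^ (r + 1) - 1)) 1)
  have hy : ∀ m r, m < r + 1 → D.levelProj m (y r) = 0 := fun m r h =>
    D.levelProj_monomial_eq_zero h s (fun h => hp.out.one_lt.ne' (Nat.dvd_one.1 h)) _
  have hy' : ∀ m r, m < r + 1 → D.levelProj m (y' r) = 0 := fun m r h =>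
    D.levelProj_monomial_eq_zero h s (fun h => by
      have h1 := (Nat.dvd_sub_iff_right (Nat.one_le_pow _ _ hp.out.pos)
        (dvd_pow_self p r.succ_ne_zero)).1 h
      exact hp.out.one_lt.ne' (Nat.dvd_one.1 h1)) _
  -- An element of level m is orthogonal to y' r for all r ≥ m, so the infinite sum of the
  -- functionals pr(y' r · -) makes sense.
  obtain ⟨ψ, hψ⟩ := exists_functional_of_finite_support
    (fun r => pr.comp (LinearMap.mulLeft D.RModP (y' r))) (fun x => by
      obtain ⟨m, f, rfl⟩ := D.exists_polyToInf x
      refine (Set.finite_lt_nat m).subset fun r hr => ?_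
      by_contra hlt
      exact hr (hpr.mul_polyToInf_eq_zero (hy' m r (lt_of_not_ge fun h => hlt h)) f))
  refine ⟨ψ, fun S hS => ?_⟩
  obtain ⟨m, hm⟩ := D.exists_level_of_finite hS
  -- All of S has level m, while y m has no component there. It is invariant because ε moves it by a
  -- multiple of (ζ - 1)·c_m = p.
  refine ⟨y m, fun ε => ?_, fun x hx => ?_, ?_⟩
  · rw [rho_polyToInf, actPoly_monomial]
    refine D.polyToInf_monomial_congr _ _ ?_
    rw [Finset.prod_eq_single (D.genVar s) (fun b _ hb => by
      rw [Finsupp.single_eq_of_ne hb, pow_zero]) (fun h => absurd (Finset.mem_univ _) h),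
      Finsupp.single_eq_same, pow_one]
    obtain ⟨b, hb⟩ := D.root_sub_one_dvd_level_sub_one Z ε (m + 1) (D.genVar s)
    refine ⟨b, ?_⟩
    conv_rhs => rw [hc m]
    linear_combination c m * hb
  · obtain ⟨f, rfl⟩ := hm m le_rfl x hx
    rw [mul_comm]
    exact hpr.mul_polyToInf_eq_zero (hy m m m.lt_succ_self) f
  · rw [hψ (y m) m fun r hr => ?_]
    · have h1 : y' m * y m = algebraMap D.RModP D.RInfModP (D.polyToModP
          (MvPolynomial.monomial (Finsupp.single (D.genVar s) 1) (c m))) := by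
        have h2 := D.polyToInf_expandHom 0 (m + 1)
          (MvPolynomial.monomial (Finsupp.single (D.genVar s) 1) (c m))
        rw [zero_add, expandHom_monomial, Finsupp.smul_single, smul_eq_mul, mul_one] at h2
        rw [algebraMap_polyToModP, ← h2, ← map_mul, MvPolynomial.monomial_mul, ← Finsupp.single_add,
          one_mul, Nat.sub_add_cancel (Nat.one_le_pow _ _ hp.out.pos)]
      change pr (y' m * y m) ≠ 0
      rw [h1, Algebra.algebraMap_eq_smul_one, map_smul, hpr.map_one, smul_eq_mul, mul_one]
      -- If c_m were divisible by p, then dividing (ζ - 1)·c_m = p by p would make ζ - 1 a unit.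
      intro h0
      obtain ⟨b, hb⟩ := D.dvd_of_polyToModP_monomial_eq_zero s h0
      refine Z.not_isUnit_sub_one hp1 (m + 1) (IsUnit.of_mul_eq_one b ?_)
      have hpc : (p : OC C) ≠ 0 := fun h => by
        have h3 : (p : C) = 0 := by simpa using congrArg (fun x : OC C => (x : C)) h
        exact hp.out.ne_zero (Nat.cast_eq_zero.1 h3)
      refine mul_left_cancel₀ hpc ?_
      linear_combination -hc m - ((Z.root (m + 1) : OC C) - 1) * hb
    · change pr (y' r * y m) = 0
      -- For r ≠ m one factor has smaller level than the other, which has no component in that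
      -- level, so only the term r = m contributes to ψ.
      rcases lt_or_gt_of_ne hr with h | h
      · rw [mul_comm]
        exact hpr.mul_polyToInf_eq_zero (hy (r + 1) m (by omega)) _
      · exact hpr.mul_polyToInf_eq_zero (hy' (m + 1) r (by omega)) _

theorem pairing_not_isPerfect (Z : PrimitiveSystem p C) (hp1 : ‖(p : C)‖ < 1) [CharZero C]
    (hd : 0 < D.dim) [HasDerivedCategory.{w} (ModuleCat.{u} D.RModP)]
    (pr : D.RInfModP →ₗ[D.RModP] D.RModP) (hpr : D.IsWeightProjection pr)
    (t : D.cohR ⟶ D.shiftedRModP) : ¬ (D.pairing pr hpr t).IsPerfect := by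
  intro h
  obtain ⟨ψ, hψ⟩ := D.exists_functional Z hp1 hd hpr
  obtain ⟨S, hS, hS'⟩ := exists_finite_of_surjective D.rho pr hpr.map_rho t
    (h (D.dim : ℤ) 0 (add_zero _)).1.2 ψ
  obtain ⟨y, hy, hy1, hy2⟩ := hψ S hS
  exact hy2 (hS' y hy hy1)

end ModelData

end

end PolystableDuality

/-- Let `Spf R^+` be a model polystable formal `O_C`-scheme of relative dimension `d`. The projection
`R_∞^+/p → R^+/p` onto the summand of trivial weight exists and is unique; `H^i_cont(Δ, R^+/p)`
vanishes for `i > d`, and there are morphisms `RΓ_cont(Δ, R^+/p) → R^+/p[-d]` inducing an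
isomorphism `H^d_cont(Δ, R^+/p) ≅ R^+/p`. For every such morphism, the cup product on
`RΓ_cont(Δ, R_∞^+/p)` followed by the resulting trace is an almost perfect pairing, and it is not
perfect if `d > 0`. -/
theorem theorem3p20 {p : ℕ} [Fact p.Prime] {C : Type u} [NormedField C] [IsUltrametricDist C]
    [CompleteSpace C] [IsAlgClosed C] [CharZero C] (hp : ‖(p : C)‖ < 1)
    (D : PolystableDuality.ModelData p C)
    [HasDerivedCategory.{w} (ModuleCat.{u} D.RModP)] :
    (∃! pr : D.RInfModP →ₗ[D.RModP] D.RModP, D.IsWeightProjection pr) ∧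
    (∀ i : ℤ, (D.dim : ℤ) < i → D.cohR.ExactAt i) ∧
    (∃ t : D.cohR ⟶ D.shiftedRModP,
      CategoryTheory.IsIso (HomologicalComplex.homologyMap t (D.dim : ℤ))) ∧
    ∀ (pr : D.RInfModP →ₗ[D.RModP] D.RModP) (hpr : D.IsWeightProjection pr)
      (t : D.cohR ⟶ D.shiftedRModP),
      CategoryTheory.IsIso (HomologicalComplex.homologyMap t (D.dim : ℤ)) →
        (D.pairing pr hpr t).IsAlmostPerfect D.almostIdeal ∧
          (0 < D.dim → ¬ (D.pairing pr hpr t).IsPerfect) := by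
  obtain ⟨ζ, h1, h2⟩ := PolystableDuality.exists_primitive_system C p
  let Z : PolystableDuality.PrimitiveSystem p C := ⟨ζ, h1, h2⟩
  exact ⟨D.existsUnique_isWeightProjection, D.cohR_exactAt Z, D.exists_trace Z,
    fun pr hpr t ht => ⟨D.pairing_isAlmostPerfect Z pr hpr t ht,
      fun hd => D.pairing_not_isPerfect Z hp hd pr hpr t⟩⟩
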